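/- Let $\Gamma=\mathbb R\times\mathbb R_*$ be the transformation groupoid with product $(z,c_1)(z/c_1,c_2)=(z,c_1c_2)$, left projection $(z,c)\mapsto z$ and right projection $(z,c)\mapsto z/c$. The space $\mathcal D(\Gamma)=C_c^\infty(\Gamma)$ with $(f*g)(z,c)=\int_{\mathbb R_*}f(z,h)\,g(z/h,c/h)\,\frac{dh}{|h|}$ and $f^*(z,c)=\overline{f(z/c,1/c)}$ acts by left convolution on $L^2(\Gamma)=L^2(\frac{dz\,dc}{c^2})$, and $C_r^*(\Gamma)$ is the norm closure of the resulting operator algebra; $C_r^*(\Gamma\times\Gamma)=C_r^*(\Gamma)\otimes C_r^*(\Gamma)$ is defined in the same way on $L^2(\Gamma\times\Gamma)$. On $L^2(\Gamma)$ let $(\hat B_tf)(z,c)=f(e^{-t}z,e^{-t}c)=(e^{it\hat X}f)(z,c)$ (this defines the selfadjoint generator $\hat X$, so $\hat X f=i(z\partial_z+c\partial_c)f$ on $\mathcal D(\Gamma)$), let $(\hat Jf)(z,c)=f(-z,-c)$, and let $\hat Y$ be the closure of $f(z,c)\mapsto zf(z,c)$ on $\mathcal D(\Gamma)$. Put $U=\{(z,c)\in\Gamma: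 z+1\neq0\}$ and $T=\{((z_1,\tfrac1{1+z_2}),(z_2,1)):1+z_2\ne0\}\subset\Gamma\times\Gamma$. Left multiplication by $T$ in the groupoid $\Gamma\times\Gamma$ induces by push-forward of functions a bijection $F\mapsto TF$ of $\mathcal A(\Gamma\times U)$, the space of elements of $\mathcal D(\Gamma\times\Gamma)$ supported in $\Gamma\times U$. Let $Ch:\{\pm1\}^2\to\{\pm1\}$ be $-1$ at $(-1,-1)$ and $1$ otherwise. **Lemma 5.6.** (a) The function $\chi(x,\varepsilon_1,y,\varepsilon_2)=e^{-ixy}\,Ch(\varepsilon_1,\varepsilon_2)$ is a bicharacter of $\mathbb R\times\mathbb Z_2$, and $$\hat T=V:=\exp\bigl(-i\,\hat X\otimes\log|\hat Y+I|\bigr)\;Ch\bigl(I\otimes\operatorname{sgn}(\hat Y+I),\,\hat J\otimes I\bigr),$$ that is: $V$ is the one and only unitary multiplier $\hat T$ of $C_r^*(\Gamma)\otimes C_r^*(\Gamma)$ that extends the map $F\mapsto TF$ of $\mathcal A(\Gamma\times U)$. (b) There is exactly one $*$-homomorphism $\Delta_0$ of $C_r^*(\Gamma)$ into the multipliers of $C_r^*(\Gamma)\otimes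 C_r^*(\Gamma)$ with $\Delta_0(f)F=\hat\delta_0(f)F$ for $f\in\mathcal D(\Gamma)$, $F\in\mathcal D(\Gamma\times\Gamma)$, where $(\hat\delta_0(f)F)(z_1,c_1,z_2,c_2)=\int_{\mathbb R_*}f(z_1+z_2,h)\,F(\tfrac{z_1}h,\tfrac{c_1}h,\tfrac{z_2}h,\tfrac{c_2}h)\frac{dh}{|h|}$. Put $\Delta(a)=\hat T\Delta_0(a)\hat T^{-1}$, extended to affiliated elements. Then, on $\mathcal A(\Gamma\times U)$, $$\Delta(\hat X)=\hat X\otimes(\hat Y+I)^{-1}+I\otimes\hat X,\qquad \Delta(\hat Y)=\hat Y\otimes\hat Y+\hat Y\otimes I+I\otimes\hat Y .$$ -/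

import Mathlib

open MeasureTheory Set Filter Topology
open scoped ContDiff ENNReal InnerProductSpace

noncomputable section

namespace AxB

/-! ## Unbounded operators, exponentials and functional calculus on a Hilbert space -/

section Operators

variable {H : Type*} [NormedAddCommGroup H] [InnerProductSpace ℂ H]

/-- The closed operator whose graph is the closed linear span of the set `G` of pairs
(vector, image); meaningful whenever that span is the graph of a function. -/
def closedOp (G : Set (H × H)) : H →ₗ.[ℂ] H :=
  (Submodule.span ℂ G).topologicalClosure.toLinearPMap

/-- A bounded operator regarded as an everywhere defined partial operator. -/
def ofBdd (a : H →L[ℂ] H) : H →ₗ.[ℂ] H := (a : H →ₗ[ℂ] H).toPMap ⊤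

open Classical in
/-- The bounded operator that coincides with an everywhere defined bounded partial operator. -/
def asBdd (A : H →ₗ.[ℂ] H) : H →L[ℂ] H :=
  if h : ∃ a : H →L[ℂ] H, ofBdd a = A then h.choose else 0

/-- Strongly continuous one parameter groups of unitaries. -/
structure IsUnitaryGroup [CompleteSpace H] (U : ℝ → H →L[ℂ] H) : Prop where
  unitary : ∀ t, U t ∈ unitary (H →L[ℂ] H)
  zero : U 0 = 1
  add : ∀ s t, U (s + t) = U s * U t
  continuous : ∀ ψ, Continuous fun t => U t ψ

/-- The generator `A` of `U t = exp (i t A)`: its domain consists of the `ψ` for which `t ↦ U t ψ`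
is differentiable at `0`, and `A ψ = -i d/dt U t ψ` at `t = 0`. -/
def generator (U : ℝ → H →L[ℂ] H) : H →ₗ.[ℂ] H where
  domain :=
    { carrier := {ψ | DifferentiableAt ℝ (fun t => U t ψ) 0}
      add_mem' := fun {a b} ha hb => by
        have h : DifferentiableAt ℝ (fun t => U t a + U t b) 0 :=
          DifferentiableAt.fun_add ha hb
        simpa using h
      zero_mem' := by simp
      smul_mem' := fun c a ha => by
        have h : DifferentiableAt ℝ (fun t => c • U t a) 0 :=
          DifferentiableAt.fun_const_smul ha c
        simpa using h }
  toFun :=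
    { toFun := fun ψ => -Complex.I • deriv (fun t => U t (ψ : H)) 0
      map_add' := fun a b => by
        have h : deriv (fun t => U t (a : H) + U t (b : H)) 0 = _ := deriv_fun_add a.2 b.2
        simp only [Submodule.coe_add, map_add]
        rw [h, smul_add]
      map_smul' := fun c a => by
        have h : deriv (fun t => c • U t (a : H)) 0 = _ := deriv_fun_const_smul c a.2
        simp only [Submodule.coe_smul, map_smul, RingHom.id_apply]
        rw [h, smul_comm] }

open Classical in
/-- `exp (i S)` for a selfadjoint `S`: the value at `1` of the strongly continuous one parameter
group of unitaries generated by `S`. -/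
def expI [CompleteSpace H] (S : H →ₗ.[ℂ] H) : H →L[ℂ] H :=
  if h : ∃ U : ℝ → H →L[ℂ] H, IsUnitaryGroup U ∧ generator U = S then h.choose 1 else 0

variable (H) in
/-- Projection valued measures on the Borel sets of the real line. -/
structure PVM [CompleteSpace H] where
  proj : Set ℝ → H →L[ℂ] H
  isStarProjection : ∀ s, MeasurableSet s → IsStarProjection (proj s)
  univ : proj Set.univ = 1
  empty : proj ∅ = 0
  iUnion : ∀ s : ℕ → Set ℝ, (∀ n, MeasurableSet (s n)) → Pairwise (Function.onFun Disjoint s) →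
    ∀ ψ, HasSum (fun n => proj (s n) ψ) (proj (⋃ n, s n) ψ)

namespace PVM

variable [CompleteSpace H] (E : PVM H)

lemma inner_proj (s : Set ℝ) (hs : MeasurableSet s) (ψ : H) :
    (⟪ψ, E.proj s ψ⟫_ℂ).re = ‖E.proj s ψ‖ ^ 2 := by
  have h := E.isStarProjection s hs
  have h1 : E.proj s (E.proj s ψ) = E.proj s ψ := by
    have := congrArg (fun a : H →L[ℂ] H => a ψ) h.isIdempotentElem.eq
    simpa using this
  have h2 : ⟪ψ, E.proj s (E.proj s ψ)⟫_ℂ = ⟪E.proj s ψ, E.proj s ψ⟫_ℂ := by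
    rw [← ContinuousLinearMap.adjoint_inner_left]
    congr 2
    rw [← ContinuousLinearMap.star_eq_adjoint, h.isSelfAdjoint.star_eq]
  rw [← h1, h2, h1, inner_self_eq_norm_sq_to_K]
  norm_cast

/-- The finite measure `s ↦ ⟨ψ, E(s) ψ⟩ = ‖E(s) ψ‖ ^ 2`. -/
def scalar (ψ : H) : Measure ℝ :=
  Measure.ofMeasurable (fun s _ => ENNReal.ofReal (‖E.proj s ψ‖ ^ 2))
    (by simp [E.empty])
    (by
      intro s hs hd
      have h := E.iUnion s hs hd ψ
      have h2 : HasSum (fun n => ‖E.proj (s n) ψ‖ ^ 2) (‖E.proj (⋃ n, s n) ψ‖ ^ 2) := by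
        have h3 := Complex.hasSum_re ((innerSL ℂ ψ).hasSum h)
        simp only [innerSL_apply_apply] at h3
        rw [E.inner_proj _ (MeasurableSet.iUnion hs)] at h3
        convert h3 using 2 with n
        exact (E.inner_proj _ (hs n) ψ).symm
      rw [← h2.tsum_eq, ENNReal.ofReal_tsum_of_nonneg (fun n => by positivity) h2.summable])

/-- `B = ∫ f(x) dE(x)`: the domain of `B` is the set of `ψ` for which `f` is square integrable with
respect to `⟨ψ, E(·) ψ⟩`, and `⟨ψ, B ψ⟩ = ∫ f(x) d⟨ψ, E(x) ψ⟩` there. -/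
def IsIntegral (f : ℝ → ℝ) (B : H →ₗ.[ℂ] H) : Prop :=
  (∀ ψ, ψ ∈ B.domain ↔ ∫⁻ x, ENNReal.ofReal (f x ^ 2) ∂(E.scalar ψ) < ⊤) ∧
  ∀ ψ : B.domain, ⟪(ψ : H), B ψ⟫_ℂ = ((∫ x, f x ∂(E.scalar (ψ : H)) : ℝ) : ℂ)

/-- `E` is the spectral measure of the selfadjoint operator `A`, i.e. `A = ∫ x dE(x)`. By the
spectral theorem a selfadjoint operator has exactly one spectral measure. -/
def IsSpectralMeasure (A : H →ₗ.[ℂ] H) : Prop := E.IsIntegral id A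

open Classical in
/-- The Borel functional calculus: `f(A) = ∫ f(x) dE(x)`, for `E` the spectral measure of `A`. -/
def fn (f : ℝ → ℝ) : H →ₗ.[ℂ] H :=
  if h : ∃ B, E.IsIntegral f B then h.choose else 0

end PVM

/-- The bicharacter of `ℤ₂ × ℤ₂` that is `-1` exactly at `(-1, -1)`. -/
def Ch (ε₁ ε₂ : ℤˣ) : ℝ := if ε₁ = -1 ∧ ε₂ = -1 then -1 else 1

/-- The spectral projection of `a` on the eigenvalue `ε = ±1`. -/
def eigProj [CompleteSpace H] (a : H →L[ℂ] H) (ε : ℤˣ) : H →L[ℂ] H :=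
  (a - ((ε : ℤ) : ℂ) • (1 : H →L[ℂ] H)).ker.starProjection

/-- `Ch(a, b)` for commuting selfadjoint `a`, `b` with spectra contained in `{-1, 1}`. -/
def chOp [CompleteSpace H] (a b : H →L[ℂ] H) : H →L[ℂ] H :=
  ∑ ε₁ : ℤˣ, ∑ ε₂ : ℤˣ, (Ch ε₁ ε₂ : ℂ) • (eigProj a ε₁ * eigProj b ε₂)

end Operators

/-- The function `χ(x, ε₁, y, ε₂) = exp (-i x y) Ch(ε₁, ε₂)` on `(ℝ × ℤ₂) × (ℝ × ℤ₂)`. -/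
def chi (x : ℝ) (ε₁ : ℤˣ) (y : ℝ) (ε₂ : ℤˣ) : ℂ := Complex.exp (-(Complex.I * x * y)) * Ch ε₁ ε₂

/-- `c` is a bicharacter on `ℝ × ℤ₂` with values in the unit circle. -/
def IsBicharacter (c : ℝ → ℤˣ → ℝ → ℤˣ → ℂ) : Prop :=
  (∀ x ε y δ, ‖c x ε y δ‖ = 1) ∧
  (∀ x x' ε ε' y δ, c (x + x') (ε * ε') y δ = c x ε y δ * c x' ε' y δ) ∧
  ∀ x ε y y' δ δ', c x ε (y + y') (δ * δ') = c x ε y δ * c x ε y' δ'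

/-- The unique bounded operator on `L²(μ)` that acts on the (classes of) functions of a dense
space `D` by the map `K`. -/
def opOn {X : Type*} [MeasurableSpace X] (μ : Measure X) (D : (X → ℂ) → Prop)
    (K : (X → ℂ) → X → ℂ) : Lp ℂ 2 μ →L[ℂ] Lp ℂ 2 μ :=
  open Classical in
  if h : ∃ m : Lp ℂ 2 μ →L[ℂ] Lp ℂ 2 μ,
      ∀ f, D f → ∀ ψ : Lp ℂ 2 μ, ψ =ᵐ[μ] f → m ψ =ᵐ[μ] K f
  then h.choose else 0

/-! ## The groupoid `Γ = ℝ × ℝ_*` and the groupoid `Γ × Γ` -/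

/-- Points `(z, c)`; the groupoid `Γ` is the open subset `c ≠ 0`, with units `c = 1`, left
projection `(z, c) ↦ z` and right projection `(z, c) ↦ z / c`. -/
abbrev P := ℝ × ℝ

/-- Points of the product; `Γ × Γ` is the open set where both second coordinates do not vanish. -/
abbrev Q := P × P

/-- `x` is the product `t g` in `Γ`, i.e. `(z, c₁) (z / c₁, c₂) = (z, c₁ c₂)`. -/
def IsMul (x t g : P) : Prop :=
  t.2 ≠ 0 ∧ g.2 ≠ 0 ∧ g.1 = t.1 / t.2 ∧ x.1 = t.1 ∧ x.2 = t.2 * g.2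

/-- `x` is the product `t g` in `Γ × Γ`. -/
def IsMul₂ (x t g : Q) : Prop := IsMul x.1 t.1 g.1 ∧ IsMul x.2 t.2 g.2

/-- Push-forward of a function by the left multiplication by a set `S` of groupoid elements
(a section of both projections): `(S f)(t g) = f g` for `t ∈ S`, and `S f` vanishes at the points
that are not of the form `t g`. -/
def push {X : Type*} (mul : X → X → X → Prop) (S : Set X) (f : X → ℂ) (x : X) : ℂ :=
  ∑ᶠ g ∈ {g | ∃ t ∈ S, mul x t g}, f g

/-- `𝒟(Γ)`: smooth functions with compact support in `Γ`. -/
def IsTest (f : P → ℂ) : Prop :=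
  ContDiff ℝ ∞ f ∧ HasCompactSupport f ∧ tsupport f ⊆ {p | p.2 ≠ 0}

/-- `𝒟(Γ × Γ)`. -/
def IsTest₂ (F : Q → ℂ) : Prop :=
  ContDiff ℝ ∞ F ∧ HasCompactSupport F ∧ tsupport F ⊆ {q | q.1.2 ≠ 0 ∧ q.2.2 ≠ 0}

/-- `𝒟(Γ × U)`, where `U = {(z, c) ∈ Γ : z + 1 ≠ 0}`. -/
def IsTestU (F : Q → ℂ) : Prop :=
  IsTest₂ F ∧ tsupport F ⊆ {q | q.2.1 + 1 ≠ 0}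

/-- The measure `dz dc / c²` on `Γ`; it is the square of the half density `ψ₀`. -/
def mu : Measure P := volume.withDensity fun p => ENNReal.ofReal (1 / p.2 ^ 2)

/-- `L²(Γ)`. -/
abbrev H := Lp ℂ 2 mu

/-- `L²(Γ × Γ)`. -/
abbrev H₂ := Lp ℂ 2 (mu.prod mu)

/-- The multiplication of the groupoid algebra of `Γ`. -/
def conv (f g : P → ℂ) (p : P) : ℂ :=
  ∫ h : ℝ, f (p.1, h) * g (p.1 / h, p.2 / h) / |h|

/-- The multiplication of the groupoid algebra of `Γ × Γ`. -/
def conv₂ (F G : Q → ℂ) (q : Q) : ℂ :=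
  ∫ h : ℝ × ℝ, F ((q.1.1, h.1), (q.2.1, h.2)) *
    G ((q.1.1 / h.1, q.1.2 / h.1), (q.2.1 / h.2, q.2.2 / h.2)) / (|h.1| * |h.2|)

/-- The representation `π_id` of the groupoid algebra of `Γ` on `L²(Γ)`. -/
def rep (f : P → ℂ) : H →L[ℂ] H := opOn mu IsTest (conv f)

/-- The representation `π_id` of the groupoid algebra of `Γ × Γ` on `L²(Γ × Γ)`. -/
def rep₂ (F : Q → ℂ) : H₂ →L[ℂ] H₂ := opOn (mu.prod mu) IsTest₂ (conv₂ F)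

/-- The reduced C*-algebra of `Γ`. -/
def Cr : NonUnitalStarSubalgebra ℂ (H →L[ℂ] H) :=
  (NonUnitalStarAlgebra.adjoin ℂ {a | ∃ f, IsTest f ∧ a = rep f}).topologicalClosure

/-- The reduced C*-algebra of `Γ × Γ`, which is the (spatial) tensor square of that of `Γ`. -/
def Cr₂ : NonUnitalStarSubalgebra ℂ (H₂ →L[ℂ] H₂) :=
  (NonUnitalStarAlgebra.adjoin ℂ {a | ∃ F, IsTest₂ F ∧ a = rep₂ F}).topologicalClosure

/-- The multipliers of the reduced C*-algebra of `Γ × Γ`. -/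
def IsMultiplier₂ (m : H₂ →L[ℂ] H₂) : Prop := ∀ a ∈ Cr₂, m * a ∈ Cr₂ ∧ a * m ∈ Cr₂

/-! ## The generators -/

/-- The unitaries `B̂_t` given by the bisections `B_t = {(z, e ^ t)}`;
`(B̂_t f)(z, c) = f (e ^ (-t) z, e ^ (-t) c)`. -/
def Bhat (t : ℝ) : H →L[ℂ] H := opOn mu IsTest (push IsMul {p | p.2 = Real.exp t})

/-- `X̂`, the generator of `B̂_t = exp (i t X̂)`. -/
def Xhat : H →ₗ.[ℂ] H := generator Bhat

/-- `Ĵ`, given by the bisection `J = {(z, -1)}`; `(Ĵ f)(z, c) = f (-z, -c)`. -/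
def Jhat : H →L[ℂ] H := opOn mu IsTest (push IsMul {p | p.2 = -1})

/-- `Ŷ`, the closure of the operator `f(z, c) ↦ z f(z, c)` on `𝒟(Γ)`. -/
def Yhat : H →ₗ.[ℂ] H :=
  closedOp {p | ∃ f, IsTest f ∧ p.1 =ᵐ[mu] f ∧ p.2 =ᵐ[mu] fun x => (x.1 : ℂ) * f x}

/-- `(Ŷ + I)⁻¹`. -/
def Yinv : H →ₗ.[ℂ] H := (Yhat + ofBdd 1).inverse

/-- `Ψ = ψ ⊗ φ` in `L²(Γ × Γ) = L²(Γ) ⊗ L²(Γ)`. -/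
def IsTensor (Ψ : H₂) (ψ φ : H) : Prop := Ψ =ᵐ[mu.prod mu] fun q => ψ q.1 * φ q.2

/-- The tensor product `A ⊗ B` of closable operators: the closure of the algebraic one. -/
def tensor (A B : H →ₗ.[ℂ] H) : H₂ →ₗ.[ℂ] H₂ :=
  closedOp {p | ∃ (ψ : A.domain) (φ : B.domain), IsTensor p.1 ψ φ ∧ IsTensor p.2 (A ψ) (B φ)}

/-! ## The twist and the comultiplication -/

/-- The set `T ⊂ Γ × Γ` defining the twist. -/
def T : Set Q := {q | ∃ z₁ z₂ : ℝ, 1 + z₂ ≠ 0 ∧ q = ((z₁, 1 / (1 + z₂)), (z₂, 1))}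

/-- `m` is the unitary multiplier of the C*-algebra of `Γ × Γ` that extends the map
`T : 𝒜(Γ × U) → 𝒜(Γ × U)` given by the left multiplication by the set `T`. -/
structure IsTwist (m : H₂ →L[ℂ] H₂) : Prop where
  unitary : m ∈ unitary (H₂ →L[ℂ] H₂)
  multiplier : IsMultiplier₂ m
  extend : ∀ F, IsTestU F → IsTestU (push IsMul₂ T F) ∧ m * rep₂ F = rep₂ (push IsMul₂ T F)

/-- `exp (-i X̂ ⊗ log|Ŷ + I|) Ch(I ⊗ sgn(Ŷ + I), Ĵ ⊗ I)`, where `E` is the spectral measure of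
`Ŷ`. -/
def V (E : PVM H) : H₂ →L[ℂ] H₂ :=
  expI (-(tensor Xhat (E.fn fun x => Real.log |x + 1|))) *
    chOp (asBdd (tensor (ofBdd 1) (E.fn fun x => Real.sign (x + 1))))
      (asBdd (tensor (ofBdd Jhat) (ofBdd 1)))

/-- The map `δ̂₀(f)` of `𝒜(Γ × Γ)` defined by the morphism
`δ₀ = {((z₁, c), (z₂, c); (z₁ + z₂, c))} : Γ → Γ × Γ`. -/
def delta₀ (f : P → ℂ) (F : Q → ℂ) (q : Q) : ℂ :=
  ∫ h : ℝ, f (q.1.1 + q.2.1, h) *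
    F ((q.1.1 / h, q.1.2 / h), (q.2.1 / h, q.2.2 / h)) / |h|

/-- `Δ₀` is the *-homomorphism of the C*-algebra of `Γ` into the multipliers of that of `Γ × Γ`
which extends `δ̂₀`. -/
def IsComult₀ (Δ₀ : Cr →⋆ₙₐ[ℂ] (H₂ →L[ℂ] H₂)) : Prop :=
  (∀ a, IsMultiplier₂ (Δ₀ a)) ∧
  ∀ f, IsTest f → ∀ a : Cr, (a : H →L[ℂ] H) = rep f →
    ∀ F, IsTest₂ F → IsTest₂ (delta₀ f F) ∧ Δ₀ a * rep₂ F = rep₂ (delta₀ f F)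

/-- The twisted comultiplication `Δ(a) = T̂ Δ₀(a) T̂⁻¹`. -/
def comult (That : H₂ →L[ℂ] H₂) (Δ₀ : Cr →⋆ₙₐ[ℂ] (H₂ →L[ℂ] H₂)) (a : Cr) : H₂ →L[ℂ] H₂ :=
  That * Δ₀ a * star That

/-- The action `Φ(A)` of a morphism `Φ` on an element `A` affiliated with the C*-algebra of `Γ`:
`Φ(A) Φ(a) Ψ = Φ(A a) Ψ` for `a` in the domain of `A` (that is, `a` maps into the domain of the
operator `A` and `A a` is again in the C*-algebra), and the span of these `Φ(a) Ψ` is a core. -/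
def image (Φ : Cr → H₂ →L[ℂ] H₂) (A : H →ₗ.[ℂ] H) : H₂ →ₗ.[ℂ] H₂ :=
  closedOp {p | ∃ a b : Cr,
    (∀ ψ : H, ∃ h : (a : H →L[ℂ] H) ψ ∈ A.domain, A ⟨_, h⟩ = (b : H →L[ℂ] H) ψ) ∧
    ∃ Ψ : H₂, p.1 = Φ a Ψ ∧ p.2 = Φ b Ψ}

/-- `A` and `B` are both defined on `𝒜(Γ × U)` and coincide there. The elements of `𝒜(Γ × U)` are
taken both as vectors of `L²(Γ × Γ)` and as elements of the C*-algebra (a closed operator acts on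
an element `a` of the C*-algebra by acting on all vectors `a Φ`). -/
def EqOnU (A B : H₂ →ₗ.[ℂ] H₂) : Prop :=
  ∀ F, IsTestU F → ∀ Ψ : H₂, (Ψ =ᵐ[mu.prod mu] F ∨ ∃ Φ : H₂, Ψ = rep₂ F Φ) →
    ∃ (hA : Ψ ∈ A.domain) (hB : Ψ ∈ B.domain), A ⟨Ψ, hA⟩ = B ⟨Ψ, hB⟩

end AxB

end

noncomputable section

namespace AxB

/-! Write x₁ = (z₁, c₁) and x₂ = (z₂, c₂). Solving t g = x for t ∈ T shows that left multiplication
by T is F ↦ F((1 + z₂) x₁, x₂) (`push_T`). Dilations of ℝ² preserve dz dc / c², so the same formula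
defines a unitary `twist` of L²(Γ × Γ). Left multiplication commutes with convolution from the
right, whence `twist * rep₂ F = rep₂ (TF)` on 𝒜(Γ × U). A function cut off near z₂ = -1 changes
little in operator norm, by Schur's test (`IsTest₂.exists_isTestU`). Hence `twist` is a multiplier.
The ranges of `rep₂ F`, F ∈ 𝒜(Γ × U), are total, hence it is the only candidate (`isTwist_iff`).

Unbounded operators are handled as generators of explicit unitary groups. A set of pairs in the
graph of a generator S is a core once its image under S - i is dense (`closedOp_eq`), and this holds
if the vectors form an invariant total set (`closedOp_eq_of_invariant`). In this way Ŷ is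
multiplication by z, and X̂ ⊗ b(Ŷ) generates ψ ↦ ψ(exp(-t b(z₂)) x₁, x₂) (`tensor_Xhat_mulMax`).
With b = log|z + 1| and t = -1 this is ψ(|1 + z₂| x₁, x₂). The factor Ch reflects x₁ exactly where 1
+ z₂ < 0 and so restores the missing sign: V = `twist` (`V_mulPVM`).

The operator δ̂₀(f) convolves along simultaneous dilations of x₁ and x₂. In the coordinates (x₁ /
c₂, (z₁ + z₂, c₂)) only the second variable moves, so δ̂₀(f) is unitarily equivalent to I ⊗ f
(`diagHom_rep`). This extends to the C*-algebra, and uniqueness follows from totality and automatic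
continuity.

A morphism carries the generator of a group of multipliers to the generator of the image group
(`closedOp_image_generator`). For X̂ the image group under Δ₀ dilates both variables by exp(-t), for
Ŷ it multiplies by exp(it(z₁ + z₂)). Conjugation by the twist turns z₁ + z₂ into (1 + z₂) z₁ + z₂,
which is the formula for Δ(Ŷ). For X̂ the chain rule gives the rate -1 + z₂ / (1 + z₂) = -1 / (1 +
z₂) in x₁, which is the factor (Ŷ + I)⁻¹ (`scaleDeriv_untwist`). -/

lemma _root_.HasDerivAt.of_norm_sub_le {E F : Type*} [NormedAddCommGroup E] [NormedSpace ℝ E]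
    [NormedAddCommGroup F] [NormedSpace ℝ F] {f : ℝ → E} {f' : E} (hf : HasDerivAt f f' 0)
    {g : ℝ → F} {g' : F} {C : ℝ} (h : ∀ t, ‖g t - g 0 - t • g'‖ ≤ C * ‖f t - f 0 - t • f'‖) :
    HasDerivAt g g' 0 := by
  rw [hasDerivAt_iff_isLittleO] at hf ⊢
  refine Asymptotics.IsBigO.trans_isLittleO ?_ hf
  refine Asymptotics.IsBigO.of_bound C (Eventually.of_forall fun t => ?_)
  simpa using h t

/-! ### Unitary groups, their generators, and cores -/

section AbstractOperators

variable {H : Type*} [NormedAddCommGroup H] [InnerProductSpace ℂ H]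

lemma inner_apply_of_mem_unitary [CompleteSpace H] {u : H →L[ℂ] H} (hu : u ∈ unitary (H →L[ℂ] H))
    (φ ψ : H) : ⟪u φ, u ψ⟫_ℂ = ⟪φ, ψ⟫_ℂ := by
  rw [← ContinuousLinearMap.adjoint_inner_right, ← ContinuousLinearMap.star_eq_adjoint]
  have := congrArg (fun a : H →L[ℂ] H => a ψ) (Unitary.star_mul_self_of_mem hu)
  simp only [mul_apply_eq_comp, one_apply_eq_self] at this
  rw [this]

lemma norm_apply_of_mem_unitary [CompleteSpace H] {u : H →L[ℂ] H} (hu : u ∈ unitary (H →L[ℂ] H))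
    (ψ : H) : ‖u ψ‖ = ‖ψ‖ := by
  have h := inner_apply_of_mem_unitary hu ψ ψ
  rw [inner_self_eq_norm_sq_to_K, inner_self_eq_norm_sq_to_K] at h
  have h2 : ‖u ψ‖ ^ 2 = ‖ψ‖ ^ 2 := by exact_mod_cast h
  exact (sq_eq_sq₀ (norm_nonneg _) (norm_nonneg _)).1 h2

/-- Totality of a set is expressed here and below by saying that only 0 is orthogonal to it. For
sets of test functions this is the form in which it is proved. -/
lemma ext_of_inner_dense [CompleteSpace H] {K : Type*} [NormedAddCommGroup K]
    [NormedSpace ℂ K] {D : Set H}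
    (hD : ∀ Φ : H, (∀ ψ ∈ D, ⟪Φ, ψ⟫_ℂ = 0) → Φ = 0) {a b : H →L[ℂ] K}
    (h : ∀ ψ ∈ D, a ψ = b ψ) : a = b := by
  have hd : (Submodule.span ℂ D).topologicalClosure = ⊤ := by
    rw [Submodule.topologicalClosure_eq_top_iff, Submodule.eq_bot_iff]
    intro Φ hΦ
    refine hD Φ fun ψ hψ => ?_
    exact (Submodule.mem_orthogonal' _ _).1 hΦ ψ (Submodule.subset_span hψ)
  refine ContinuousLinearMap.ext_on (s := D) ?_ h
  exact Submodule.dense_iff_topologicalClosure_eq_top.2 hd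

lemma mem_graph_generator {U : ℝ → H →L[ℂ] H} {ψ η : H} :
    (ψ, η) ∈ (generator U).graph ↔ HasDerivAt (fun t => U t ψ) (Complex.I • η) 0 := by
  rw [LinearPMap.mem_graph_iff]
  constructor
  · rintro ⟨y, hy, h⟩
    have hy' : (y : H) = ψ := hy
    have hd : DifferentiableAt ℝ (fun t => U t (y : H)) 0 := y.2
    have h' : -Complex.I • deriv (fun t => U t (y : H)) 0 = η := h
    rw [hy'] at hd h'
    have := hd.hasDerivAt
    rwa [show Complex.I • η = deriv (fun t => U t ψ) 0 by
      rw [← h', smul_smul]; simp]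
  · intro h
    refine ⟨⟨ψ, h.differentiableAt⟩, rfl, ?_⟩
    change -Complex.I • deriv (fun t => U t ψ) 0 = η
    rw [h.deriv, smul_smul]; simp

namespace IsUnitaryGroup

variable [CompleteSpace H] {U : ℝ → H →L[ℂ] H}

lemma apply_add (hU : IsUnitaryGroup U) (s t : ℝ) (ψ : H) : U (s + t) ψ = U s (U t ψ) := by
  rw [hU.add]; rfl

lemma apply_zero (hU : IsUnitaryGroup U) (ψ : H) : U 0 ψ = ψ := by
  rw [hU.zero]; rfl

lemma inner_apply (hU : IsUnitaryGroup U) (t : ℝ) (φ ψ : H) : ⟪U t φ, U t ψ⟫_ℂ = ⟪φ, ψ⟫_ℂ :=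
  inner_apply_of_mem_unitary (hU.unitary t) φ ψ

lemma norm_apply (hU : IsUnitaryGroup U) (t : ℝ) (ψ : H) : ‖U t ψ‖ = ‖ψ‖ :=
  norm_apply_of_mem_unitary (hU.unitary t) ψ

lemma hasDerivAt (hU : IsUnitaryGroup U) {ψ η : H}
    (h : HasDerivAt (fun t => U t ψ) η 0) (t : ℝ) :
    HasDerivAt (fun t => U t ψ) (U t η) t := by
  have h1 : HasDerivAt (fun s : ℝ => U (s - t) ψ) η t := by
    have h0 : HasDerivAt (fun t => U t ψ) η (t - t) := by simpa using h
    simpa using h0.comp_sub_const t t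
  have h2 := ((U t).restrictScalars ℝ).hasFDerivAt.comp_hasDerivAt t h1
  refine h2.congr_of_eventuallyEq (Filter.Eventually.of_forall fun s => ?_)
  change U s ψ = U t (U (s - t) ψ)
  rw [← hU.apply_add]; congr 2; ring

lemma apply_mem_graph (hU : IsUnitaryGroup U) {ψ η : H} (h : (ψ, η) ∈ (generator U).graph)
    (t : ℝ) : (U t ψ, U t η) ∈ (generator U).graph := by
  rw [mem_graph_generator] at h ⊢
  have h2 := ((U t).restrictScalars ℝ).hasFDerivAt.comp_hasDerivAt 0 h
  refine (h2.congr_of_eventuallyEq (Filter.Eventually.of_forall fun s => ?_)).congr_deriv ?_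
  · change U s (U t ψ) = U t (U s ψ)
    rw [← hU.apply_add, ← hU.apply_add, add_comm]
  · change U t (Complex.I • η) = _
    rw [map_smul]

/-- The integrated form of the differential equation involves no limit in ψ and η, so it survives
passage to limits and shows that the graph is closed. -/
lemma mem_graph_iff_integral (hU : IsUnitaryGroup U) {ψ η : H} :
    (ψ, η) ∈ (generator U).graph ↔ ∀ t : ℝ, U t ψ - ψ = ∫ s in (0 : ℝ)..t, U s (Complex.I • η) := by
  rw [mem_graph_generator]
  constructor
  · intro h t
    have := intervalIntegral.integral_eq_sub_of_hasDerivAt (a := 0) (b := t)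
      (fun s _ => hU.hasDerivAt h s) ((hU.continuous _).intervalIntegrable _ _)
    rw [this, hU.apply_zero]
  · intro h
    have h1 := intervalIntegral.integral_hasDerivAt_right (a := 0) (b := 0)
      ((hU.continuous (Complex.I • η)).intervalIntegrable _ _)
      ((hU.continuous _).stronglyMeasurableAtFilter _ _) (hU.continuous (Complex.I • η)).continuousAt
    rw [hU.apply_zero] at h1
    refine (h1.add_const ψ).congr_of_eventuallyEq (Filter.Eventually.of_forall fun t => ?_)
    change U t ψ = (∫ s in (0 : ℝ)..t, U s (Complex.I • η)) + ψ
    rw [← h t]; abel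

lemma isClosed_graph (hU : IsUnitaryGroup U) : IsClosed ((generator U).graph : Set (H × H)) := by
  have : ((generator U).graph : Set (H × H)) =
      ⋂ t : ℝ, {p | U t p.1 - p.1 = ∫ s in (0 : ℝ)..t, U s (Complex.I • p.2)} := by
    ext ⟨ψ, η⟩
    simp only [SetLike.mem_coe, hU.mem_graph_iff_integral, mem_iInter, mem_ofPred_eq]
  rw [this]
  refine isClosed_iInter fun t => isClosed_eq (by fun_prop) ?_
  have hL : LipschitzWith (Real.toNNReal |t|) (fun η : H => ∫ s in (0 : ℝ)..t, U s η) := by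
    refine LipschitzWith.of_dist_le_mul fun η η' => ?_
    rw [dist_eq_norm, ← intervalIntegral.integral_sub ((hU.continuous _).intervalIntegrable _ _)
      ((hU.continuous _).intervalIntegrable _ _)]
    refine (intervalIntegral.norm_integral_le_of_norm_le_const (C := ‖η - η'‖) fun s _ => ?_).trans ?_
    · rw [← map_sub, hU.norm_apply]
    · rw [dist_eq_norm, Real.coe_toNNReal _ (abs_nonneg t), sub_zero, mul_comm]
  exact hL.continuous.comp (by fun_prop)

/-- Differentiate the constant function t ↦ ⟨U t ψ₁, U t ψ₂⟩ at 0. -/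
lemma symmetric (hU : IsUnitaryGroup U) {ψ₁ η₁ ψ₂ η₂ : H} (h₁ : (ψ₁, η₁) ∈ (generator U).graph)
    (h₂ : (ψ₂, η₂) ∈ (generator U).graph) : ⟪η₁, ψ₂⟫_ℂ = ⟪ψ₁, η₂⟫_ℂ := by
  rw [mem_graph_generator] at h₁ h₂
  have h := h₁.inner ℂ h₂
  have hc : (fun t => ⟪U t ψ₁, U t ψ₂⟫_ℂ) = fun _ => ⟪ψ₁, ψ₂⟫_ℂ := funext fun t => hU.inner_apply t _ _
  rw [hc] at h
  have h0 := h.unique (hasDerivAt_const _ _)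
  simp only [hU.apply_zero, inner_smul_left, inner_smul_right, Complex.conj_I] at h0
  have h2 : Complex.I * (⟪ψ₁, η₂⟫_ℂ - ⟪η₁, ψ₂⟫_ℂ) = 0 := by linear_combination h0
  have h3 := (mul_eq_zero.1 h2).resolve_left Complex.I_ne_zero
  exact (sub_eq_zero.1 h3).symm

/-- The cross term vanishes because ⟨η, ψ⟩ is real by symmetry. The identity makes S - i injective
with bounded inverse on its range. -/
lemma norm_sub_I_smul_sq (hU : IsUnitaryGroup U) {ψ η : H} (h : (ψ, η) ∈ (generator U).graph) :
    ‖η - Complex.I • ψ‖ ^ 2 = ‖η‖ ^ 2 + ‖ψ‖ ^ 2 := by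
  have hs := hU.symmetric h h
  have := @norm_sub_sq ℂ H _ _ _ η (Complex.I • ψ)
  rw [this, norm_smul, Complex.norm_I, one_mul, inner_smul_right]
  have hr : RCLike.re (Complex.I * ⟪η, ψ⟫_ℂ) = 0 := by
    have h1 : (starRingEnd ℂ) ⟪η, ψ⟫_ℂ = ⟪η, ψ⟫_ℂ := by rw [inner_conj_symm, hs]
    have h2 := congrArg Complex.im h1
    simp only [Complex.conj_im] at h2
    have h3 : (⟪η, ψ⟫_ℂ).im = 0 := by linarith
    simp [h3]
  rw [hr]; ring

/-- S - i is bounded below on the graph, so it maps the closed span K of `G` onto a closed subspace.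
This image is dense by `hd`, hence everything, and injectivity on the graph leaves no room outside
K. -/
lemma closure_eq_graph (hU : IsUnitaryGroup U) {G : Set (H × H)}
    (hG : G ⊆ (generator U).graph)
    (hd : ∀ Φ : H, (∀ p ∈ G, ⟪Φ, p.2 - Complex.I • p.1⟫_ℂ = 0) → Φ = 0) :
    (Submodule.span ℂ G).topologicalClosure = (generator U).graph := by
  have hle : (Submodule.span ℂ G).topologicalClosure ≤ (generator U).graph :=
    Submodule.topologicalClosure_minimal _ (Submodule.span_le.2 hG) hU.isClosed_graph
  refine le_antisymm hle ?_
  set K := (Submodule.span ℂ G).topologicalClosure with hK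
  have hKc : IsClosed (K : Set (H × H)) := Submodule.isClosed_topologicalClosure _
  let L : (H × H) →L[ℂ] H :=
    ContinuousLinearMap.snd ℂ H H - Complex.I • ContinuousLinearMap.fst ℂ H H
  have hL : ∀ p, L p = p.2 - Complex.I • p.1 := fun p => rfl
  have hbd : ∀ p ∈ (generator U).graph, ‖p‖ ≤ ‖L p‖ := by
    rintro ⟨ψ, η⟩ hp
    have := hU.norm_sub_I_smul_sq hp
    rw [hL, Prod.norm_def]
    refine max_le ?_ ?_
    · refine abs_le_of_sq_le_sq' ?_ (norm_nonneg _) |>.2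
      rw [this]; nlinarith [sq_nonneg ‖η‖]
    · refine abs_le_of_sq_le_sq' ?_ (norm_nonneg _) |>.2
      rw [this]; nlinarith [sq_nonneg ‖ψ‖]
  have hanti : AntilipschitzWith 1 (L.comp K.subtypeL) := by
    refine AddMonoidHomClass.antilipschitz_of_bound _ fun x => ?_
    simpa using hbd x (hle x.2)
  have : CompleteSpace K := hKc.completeSpace_coe
  have hcl : IsClosed (Set.range (L.comp K.subtypeL)) :=
    hanti.isClosed_range (L.comp K.subtypeL).uniformContinuous
  have htop : LinearMap.range (L.comp K.subtypeL : K →ₗ[ℂ] H) = ⊤ := by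
    have hc' : IsClosed ((LinearMap.range (L.comp K.subtypeL : K →ₗ[ℂ] H) : Submodule ℂ H) : Set H) := by
      convert hcl using 1
      ext x; simp
    rw [← hc'.submodule_topologicalClosure_eq, Submodule.topologicalClosure_eq_top_iff,
      Submodule.eq_bot_iff]
    intro Φ hΦ
    refine hd Φ fun p hp => ?_
    refine (Submodule.mem_orthogonal' _ _).1 hΦ _ ⟨⟨p, ?_⟩, rfl⟩
    exact Submodule.le_topologicalClosure _ (Submodule.subset_span hp)
  intro p hp
  obtain ⟨q, hq⟩ : L p ∈ LinearMap.range (L.comp K.subtypeL : K →ₗ[ℂ] H) := by rw [htop]; trivial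
  have hq' : L q = L p := hq
  have h0 : ‖p - q‖ ≤ ‖L (p - q)‖ := hbd _ (Submodule.sub_mem _ hp (hle q.2))
  rw [map_sub, hq', sub_self, norm_zero] at h0
  have : p = q := sub_eq_zero.1 (norm_le_zero_iff.1 h0)
  rw [this]; exact q.2

/-- A set of pairs in the graph of the generator is a core if the image of its span under
`S - i` is dense. -/
lemma closedOp_eq (hU : IsUnitaryGroup U) {G : Set (H × H)}
    (hG : G ⊆ (generator U).graph)
    (hd : ∀ Φ : H, (∀ p ∈ G, ⟪Φ, p.2 - Complex.I • p.1⟫_ℂ = 0) → Φ = 0) :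
    closedOp G = generator U := by
  rw [closedOp, hU.closure_eq_graph hG hd]
  apply LinearPMap.eq_of_eq_graph
  rw [Submodule.toLinearPMap_graph_eq]
  intro x hx hx0
  exact LinearPMap.graph_fst_eq_zero_snd _ hx hx0

/-- If Φ is orthogonal to the range of S - i, then f(t) = ⟨Φ, U t ψ⟩ satisfies f' = -f, so exp(t)
f(t) is constant. Since f is bounded, letting t → -∞ shows that the constant f(0) is 0. -/
lemma dense_range_of_invariant (hU : IsUnitaryGroup U) {G : Set (H × H)}
    (hG : G ⊆ (generator U).graph) {D : Set H} (hD : ∀ ψ ∈ D, ∃ η, (ψ, η) ∈ G)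
    (hinv : ∀ t, ∀ ψ ∈ D, U t ψ ∈ D) (hd : ∀ Φ : H, (∀ ψ ∈ D, ⟪Φ, ψ⟫_ℂ = 0) → Φ = 0) (Φ : H)
    (hΦ : ∀ p ∈ G, ⟪Φ, p.2 - Complex.I • p.1⟫_ℂ = 0) : Φ = 0 := by
  refine hd Φ fun ψ hψ => ?_
  obtain ⟨η, hη⟩ := hD ψ hψ
  have h1 := hU.hasDerivAt (mem_graph_generator.1 (hG hη))
  have h2 : ∀ t, HasDerivAt (fun t => ⟪Φ, U t ψ⟫_ℂ) (-⟪Φ, U t ψ⟫_ℂ) t := by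
    intro t
    have h3 : HasDerivAt (fun t => ⟪Φ, U t ψ⟫_ℂ) (⟪Φ, U t (Complex.I • η)⟫_ℂ) t := by
      simpa [inner_smul_right] using (hasDerivAt_const t Φ).inner ℂ (h1 t)
    obtain ⟨η', hη'⟩ := hD _ (hinv t ψ hψ)
    have h4 := hΦ _ hη'
    -- `G` supplies some image η' of U t ψ. It can only be U t η, because the graph is single
    -- valued.
    have h5 : η' = U t η :=
      LinearPMap.mem_graph_snd_inj' _ (hG hη') (hU.apply_mem_graph (hG hη) t) rfl
    simp only [inner_sub_right, inner_smul_right, h5] at h4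
    convert h3 using 1
    rw [map_smul, inner_smul_right, sub_eq_zero.1 h4, ← mul_assoc, Complex.I_mul_I]; ring
  have h3 : ∀ t : ℝ, Complex.exp t * ⟪Φ, U t ψ⟫_ℂ = ⟪Φ, ψ⟫_ℂ := by
    have hder : ∀ t : ℝ, HasDerivAt (fun t : ℝ => Complex.exp t * ⟪Φ, U t ψ⟫_ℂ) 0 t := by
      intro t
      have he : HasDerivAt (fun t : ℝ => Complex.exp t) (Complex.exp t) t :=
        (Complex.hasDerivAt_exp (t : ℂ)).comp_ofReal
      refine (he.mul (h2 t)).congr_deriv ?_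
      ring
    intro t
    have := is_const_of_deriv_eq_zero (fun t => (hder t).differentiableAt)
      (fun t => (hder t).deriv) t 0
    simpa [hU.apply_zero] using this
  have h4 : ∀ t : ℝ, ‖⟪Φ, ψ⟫_ℂ‖ ≤ Real.exp t * (‖Φ‖ * ‖ψ‖) := by
    intro t
    rw [← h3 t, norm_mul, Complex.norm_exp, Complex.ofReal_re]
    gcongr
    exact (norm_inner_le_norm _ _).trans (by rw [hU.norm_apply])
  have h5 : Tendsto (fun t => Real.exp t * (‖Φ‖ * ‖ψ‖)) atBot (𝓝 0) := by
    simpa using Real.tendsto_exp_atBot.mul_const (‖Φ‖ * ‖ψ‖)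
  have := ge_of_tendsto' h5 h4
  exact norm_le_zero_iff.1 this

/-- An invariant dense set of vectors in the domain of the generator is a core. -/
lemma closedOp_eq_of_invariant (hU : IsUnitaryGroup U) {G : Set (H × H)}
    (hG : G ⊆ (generator U).graph) {D : Set H} (hD : ∀ ψ ∈ D, ∃ η, (ψ, η) ∈ G)
    (hinv : ∀ t, ∀ ψ ∈ D, U t ψ ∈ D) (hd : ∀ Φ : H, (∀ ψ ∈ D, ⟪Φ, ψ⟫_ℂ = 0) → Φ = 0) :
    closedOp G = generator U :=
  hU.closedOp_eq hG (hU.dense_range_of_invariant hG hD hinv hd)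

/-- By symmetry of the common generator ⟨W t φ, U t ψ⟩ does not depend on t, so W(-t) U t fixes ψ.
-/
lemma eq_of_generator_eq {W : ℝ → H →L[ℂ] H} (hU : IsUnitaryGroup U) (hW : IsUnitaryGroup W)
    (h : generator U = generator W) {D : Set H} (hD : ∀ ψ ∈ D, ∃ η, (ψ, η) ∈ (generator U).graph)
    (hd : ∀ Φ : H, (∀ ψ ∈ D, ⟪Φ, ψ⟫_ℂ = 0) → Φ = 0) : U = W := by
  funext t
  have key : ∀ φ ∈ D, ∀ ψ ∈ D, ⟪W t φ, U t ψ⟫_ℂ = ⟪φ, ψ⟫_ℂ := by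
    intro φ hφ ψ hψ
    obtain ⟨φ', hφ'⟩ := hD φ hφ
    obtain ⟨ψ', hψ'⟩ := hD ψ hψ
    have hder : ∀ s, HasDerivAt (fun s => ⟪W s φ, U s ψ⟫_ℂ) 0 s := by
      intro s
      have h1 := hW.hasDerivAt (mem_graph_generator.1 (h ▸ hφ')) s
      have h2 := hU.hasDerivAt (mem_graph_generator.1 hψ') s
      refine (h1.inner ℂ h2).congr_deriv ?_
      have h3 := hW.symmetric (hW.apply_mem_graph (h ▸ hφ') s) (h ▸ hU.apply_mem_graph hψ' s)
      rw [map_smul, map_smul, inner_smul_left, inner_smul_right, h3, Complex.conj_I]; ring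
    have := is_const_of_deriv_eq_zero (fun t => (hder t).differentiableAt)
      (fun t => (hder t).deriv) t 0
    simpa [hU.apply_zero, hW.apply_zero] using this
  refine ext_of_inner_dense hd fun ψ hψ => ?_
  have h1 : W (-t) (U t ψ) - ψ = 0 := by
    refine hd _ fun φ hφ => ?_
    have h2 := key φ hφ ψ hψ
    rw [inner_sub_left, sub_eq_zero, ← hW.inner_apply t, ← hW.apply_add, add_neg_cancel,
      hW.apply_zero, ← inner_conj_symm, h2, inner_conj_symm]
  have h2 := congrArg (W t) (sub_eq_zero.1 h1)
  rwa [← hW.apply_add, add_neg_cancel, hW.apply_zero] at h2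

lemma neg (hU : IsUnitaryGroup U) : IsUnitaryGroup fun t => U (-t) where
  unitary t := hU.unitary _
  zero := by simp [hU.zero]
  add s t := by rw [neg_add, hU.add]
  continuous ψ := (hU.continuous ψ).comp continuous_neg

lemma conj (hU : IsUnitaryGroup U) {v : H →L[ℂ] H} (hv : v ∈ _root_.unitary (H →L[ℂ] H)) :
    IsUnitaryGroup fun t => v * U t * star v where
  unitary t := mul_mem (mul_mem hv (hU.unitary t)) (Unitary.star_mem hv)
  zero := by simp [hU.zero, Unitary.mul_star_self_of_mem hv]
  add s t := by
    rw [hU.add]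
    calc v * (U s * U t) * star v = v * U s * 1 * (U t * star v) := by simp only [mul_assoc, one_mul]
      _ = _ := by rw [← Unitary.star_mul_self_of_mem hv]; simp only [mul_assoc]
  continuous ψ := v.continuous.comp (hU.continuous (star v ψ))

end IsUnitaryGroup

lemma generator_neg (U : ℝ → H →L[ℂ] H) : generator (fun t => U (-t)) = -generator U := by
  apply LinearPMap.eq_of_eq_graph
  ext ⟨ψ, η⟩
  have h1 : (ψ, η) ∈ (-generator U).graph ↔ (ψ, -η) ∈ (generator U).graph := by
    rw [LinearPMap.mem_graph_iff, LinearPMap.mem_graph_iff]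
    constructor
    · rintro ⟨y, hy, h⟩
      refine ⟨y, hy, ?_⟩
      have h' : -(generator U y) = η := h
      rw [← h']; simp
    · rintro ⟨y, hy, h⟩
      refine ⟨y, hy, ?_⟩
      change -(generator U y) = η
      rw [h]; simp
  rw [h1, mem_graph_generator, mem_graph_generator]
  constructor
  · intro h
    have h0 : HasDerivAt (fun t => U (-t) ψ) (Complex.I • η) (-0) := by simpa using h
    simpa [Function.comp_def] using HasDerivAt.scomp (0 : ℝ) h0 (hasDerivAt_neg (0 : ℝ))
  · intro h
    have h0 : HasDerivAt (fun t => U t ψ) (Complex.I • -η) (-0) := by simpa using h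
    simpa [Function.comp_def] using HasDerivAt.scomp (0 : ℝ) h0 (hasDerivAt_neg (0 : ℝ))

/-- A group with dense domain of the generator is determined by the generator, so the choice made in
`expI` is immaterial. -/
lemma expI_generator [CompleteSpace H] {U : ℝ → H →L[ℂ] H} (hU : IsUnitaryGroup U) {D : Set H}
    (hD : ∀ ψ ∈ D, ∃ η, (ψ, η) ∈ (generator U).graph)
    (hd : ∀ Φ : H, (∀ ψ ∈ D, ⟪Φ, ψ⟫_ℂ = 0) → Φ = 0) : expI (generator U) = U 1 := by
  have h : ∃ W : ℝ → H →L[ℂ] H, IsUnitaryGroup W ∧ generator W = generator U := ⟨U, hU, rfl⟩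
  rw [expI, dif_pos h]
  rw [← hU.eq_of_generator_eq h.choose_spec.1 h.choose_spec.2.symm hD hd]

lemma ofBdd_injective : Function.Injective (ofBdd : (H →L[ℂ] H) → H →ₗ.[ℂ] H) := by
  intro a b h
  ext ψ
  have h1 : (ψ, a ψ) ∈ (ofBdd a).graph := (LinearPMap.mem_graph_iff _).2 ⟨⟨ψ, trivial⟩, rfl, rfl⟩
  rw [h, LinearPMap.mem_graph_iff] at h1
  obtain ⟨y, hy, h1⟩ := h1
  simp only at hy
  subst hy
  exact h1.symm

lemma mem_graph_ofBdd {a : H →L[ℂ] H} {ψ η : H} : (ψ, η) ∈ (ofBdd a).graph ↔ η = a ψ := by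
  rw [LinearPMap.mem_graph_iff]
  constructor
  · rintro ⟨y, hy, h1⟩
    simp only at hy
    subst hy
    exact h1.symm
  · rintro rfl
    exact ⟨⟨ψ, trivial⟩, rfl, rfl⟩

lemma asBdd_ofBdd (a : H →L[ℂ] H) : asBdd (ofBdd a) = a := by
  have h : ∃ b : H →L[ℂ] H, ofBdd b = ofBdd a := ⟨a, rfl⟩
  rw [asBdd, dif_pos h]
  exact ofBdd_injective h.choose_spec

/-- The graph of `a` is the image of the space under the continuous map ψ ↦ (ψ, a ψ), which sends a
dense subspace into the span of `G`. -/
lemma closedOp_eq_ofBdd [CompleteSpace H] {G : Set (H × H)} {a : H →L[ℂ] H}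
    (hG : ∀ p ∈ G, p.2 = a p.1)
    (hd : ∀ Φ : H, (∀ p ∈ G, ⟪Φ, p.1⟫_ℂ = 0) → Φ = 0) : closedOp G = ofBdd a := by
  have hgr : ((ofBdd a).graph : Set (H × H)) = {p | p.2 = a p.1} := by
    ext ⟨ψ, η⟩
    exact mem_graph_ofBdd
  have hcl : IsClosed ((ofBdd a).graph : Set (H × H)) := by
    rw [hgr]; exact isClosed_eq (by fun_prop) (by fun_prop)
  have h1 : (Submodule.span ℂ G).topologicalClosure = (ofBdd a).graph := by
    refine le_antisymm (Submodule.topologicalClosure_minimal _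
      (Submodule.span_le.2 fun p hp => ?_) hcl) ?_
    · rw [hgr]; exact hG p hp
    · let L : H →L[ℂ] H × H := (ContinuousLinearMap.id ℂ H).prod a
      have hdn : Dense (Submodule.span ℂ (Prod.fst '' G) : Set H) := by
        rw [Submodule.dense_iff_topologicalClosure_eq_top,
          Submodule.topologicalClosure_eq_top_iff, Submodule.eq_bot_iff]
        intro Φ hΦ
        refine hd Φ fun p hp => ?_
        exact (Submodule.mem_orthogonal' _ _).1 hΦ p.1 (Submodule.subset_span ⟨p, hp, rfl⟩)
      rintro ⟨ψ, η⟩ hp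
      rw [mem_graph_ofBdd] at hp
      subst hp
      have h2 : MapsTo L (Submodule.span ℂ (Prod.fst '' G) : Set H)
          (Submodule.span ℂ G : Set (H × H)) := by
        intro x hx
        have h3 : Submodule.span ℂ (Prod.fst '' G) ≤ (Submodule.span ℂ G).comap (L : H →ₗ[ℂ] H × H) := by
          rw [Submodule.span_le]
          rintro _ ⟨p, hp, rfl⟩
          have : L p.1 = p := Prod.ext rfl (hG p hp).symm
          simp only [Submodule.comap_coe, mem_preimage, ContinuousLinearMap.coe_coe, this]
          exact Submodule.subset_span hp
        exact h3 hx
      exact h2.closure L.continuous (hdn ψ)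
  rw [closedOp, h1]
  apply LinearPMap.eq_of_eq_graph
  rw [Submodule.toLinearPMap_graph_eq]
  intro x hx hx0
  exact LinearPMap.graph_fst_eq_zero_snd _ hx hx0

/-- For a selfadjoint involution, (1 + ε a) / 2 maps into the ε-eigenspace and the complement (1 - ε
a) / 2 is orthogonal to it; this characterizes the orthogonal projection. -/
lemma eigProj_eq [CompleteSpace H] {a : H →L[ℂ] H} (ha : IsSelfAdjoint a) (h1 : a * a = 1)
    (ε : ℤˣ) : eigProj a ε = (2⁻¹ : ℂ) • (1 + ((ε : ℤ) : ℂ) • a) := by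
  have hε : ((ε : ℤ) : ℂ) * ((ε : ℤ) : ℂ) = 1 := by
    rcases Int.units_eq_one_or ε with rfl | rfl <;> simp
  have haa : ∀ ψ, a (a ψ) = ψ := fun ψ => congrArg (fun b : H →L[ℂ] H => b ψ) h1
  ext ψ
  rw [eigProj]
  refine (Submodule.eq_starProjection_of_mem_of_inner_eq_zero
    (K := (a - ((ε : ℤ) : ℂ) • (1 : H →L[ℂ] H)).ker) (u := ψ)
    (v := ((2⁻¹ : ℂ) • (1 + ((ε : ℤ) : ℂ) • a)) ψ) ?_ ?_)
  · simp only [LinearMap.mem_ker, ContinuousLinearMap.coe_coe, sub_apply,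
      smul_apply, add_apply,
      one_apply_eq_self, map_smul, map_add, haa]
    simp only [smul_sub, smul_smul]
    rw [hε, one_smul, sub_add_sub_cancel, sub_self, smul_zero]
  · intro w hw
    have hw' : a w = ((ε : ℤ) : ℂ) • w := by
      have : a w - ((ε : ℤ) : ℂ) • w = 0 := hw
      exact sub_eq_zero.1 this
    have h2 : ⟪a ψ, w⟫_ℂ = ((ε : ℤ) : ℂ) * ⟪ψ, w⟫_ℂ := by
      have : ⟪a ψ, w⟫_ℂ = ⟪ψ, a w⟫_ℂ := by
        rw [← ContinuousLinearMap.adjoint_inner_right, ← ContinuousLinearMap.star_eq_adjoint,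
          ha.star_eq]
      rw [this, hw', inner_smul_right]
    simp only [smul_apply, add_apply,
      one_apply_eq_self, inner_sub_left, inner_smul_left, inner_add_left, h2, map_inv₀,
      Complex.conj_ofNat, map_intCast]
    linear_combination (-(2⁻¹ : ℂ)) * hε * ⟪ψ, w⟫_ℂ

/-- `Ch(a, b)` acts as `1` where `a = 1` and as `b` where `a = -1`. -/
lemma chOp_eq [CompleteSpace H] {a b : H →L[ℂ] H} (ha : IsSelfAdjoint a) (ha1 : a * a = 1)
    (hb : IsSelfAdjoint b) (hb1 : b * b = 1) :
    chOp a b = (2⁻¹ : ℂ) • ((1 + a) + (1 - a) * b) := by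
  have huniv : (Finset.univ : Finset ℤˣ) = {1, -1} := rfl
  have hne : (1 : ℤˣ) ≠ -1 := by decide
  simp only [chOp, eigProj_eq ha ha1, eigProj_eq hb hb1, huniv, Finset.sum_pair hne, Ch, hne]
  simp only [false_and, and_false, and_self, ↓reduceIte, Units.val_one, Int.cast_one, one_smul,
    Units.val_neg, Int.cast_neg, neg_smul, Complex.ofReal_one, Complex.ofReal_neg, smul_mul_smul_comm]
  simp only [mul_add, add_mul, one_mul, mul_one, mul_neg, neg_mul, sub_mul]
  module

end AbstractOperators

/-! ### Generators under morphisms of operator algebras -/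

section Image

lemma isClosed_Cr : IsClosed (Cr : Set (H →L[ℂ] H)) :=
  NonUnitalStarSubalgebra.isClosed_topologicalClosure _

lemma mem_graph_iff_exists {E : Type*} [NormedAddCommGroup E] [InnerProductSpace ℂ E]
    {A : E →ₗ.[ℂ] E} {ψ η : E} : (ψ, η) ∈ A.graph ↔ ∃ h : ψ ∈ A.domain, A ⟨ψ, h⟩ = η := by
  rw [LinearPMap.mem_graph_iff]
  constructor
  · rintro ⟨⟨y, hy⟩, rfl, h⟩
    exact ⟨hy, h⟩
  · rintro ⟨h, h'⟩
    exact ⟨⟨ψ, h⟩, rfl, h'⟩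

/-- If `U t a` is norm continuous, weak differentiability of it implies norm differentiability. -/
lemma IsUnitaryGroup.hasDerivAt_mul {E : Type*} [NormedAddCommGroup E] [InnerProductSpace ℂ E]
    [CompleteSpace E] {U : ℝ → E →L[ℂ] E} (hU : IsUnitaryGroup U) {a b : E →L[ℂ] E}
    (hb : Continuous fun t => U t * b) (h : ∀ ψ, (a ψ, b ψ) ∈ (generator U).graph) :
    HasDerivAt (fun t => U t * a) (Complex.I • b) 0 := by
  -- Norm continuity of this integrand lets the integrated equation hold for operators, not only
  -- vector by vector.
  have hF : Continuous fun s => Complex.I • (U s * b) := hb.const_smul Complex.I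
  have h1 : ∀ t, U t * a = (∫ s in (0 : ℝ)..t, Complex.I • (U s * b)) + a := by
    intro t
    ext1 ψ
    have h2 := (ContinuousLinearMap.apply ℂ E ψ).intervalIntegral_comp_comm
      (hF.intervalIntegrable (μ := volume) 0 t)
    change U t (a ψ) = ContinuousLinearMap.apply ℂ E ψ (∫ s in (0 : ℝ)..t, Complex.I • (U s * b)) + a ψ
    rw [← h2, ← sub_eq_iff_eq_add, (hU.mem_graph_iff_integral).1 (h ψ) t]
    refine intervalIntegral.integral_congr fun s _ => ?_
    change U s (Complex.I • b ψ) = Complex.I • U s (b ψ)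
    rw [map_smul]
  have h3 := intervalIntegral.integral_hasDerivAt_right (a := 0) (b := 0)
    (hF.intervalIntegrable _ _) (hF.stronglyMeasurableAtFilter _ _) hF.continuousAt
  rw [hU.zero, one_mul] at h3
  exact (h3.add_const a).congr_of_eventuallyEq (Eventually.of_forall h1)

/-- The image of the generator of a one parameter group of multipliers under a morphism is the
generator of the image group. -/
lemma closedOp_image_generator {E E₂ : Type*} [NormedAddCommGroup E] [InnerProductSpace ℂ E]
    [CompleteSpace E] [NormedAddCommGroup E₂] [InnerProductSpace ℂ E₂] [CompleteSpace E₂]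
    {𝒞 : NonUnitalStarSubalgebra ℂ (E →L[ℂ] E)}
    {U : ℝ → E →L[ℂ] E} (hU : IsUnitaryGroup U) {U' : ℝ → E₂ →L[ℂ] E₂}
    (hU' : IsUnitaryGroup U') (Φ : 𝒞 →ₗ[ℂ] (E₂ →L[ℂ] E₂))
    (hΦn : ∀ a : 𝒞, ‖Φ a‖ ≤ ‖(a : E →L[ℂ] E)‖)
    (hmem : ∀ t, ∀ a : 𝒞, U t * a ∈ 𝒞)
    (hΦ : ∀ t (a : 𝒞), Φ ⟨U t * a, hmem t a⟩ = U' t * Φ a)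
    (hc : ∀ a : 𝒞, Continuous fun t => U t * (a : E →L[ℂ] E)) {D : Set 𝒞}
    (hD : ∀ a ∈ D, ∃ b : 𝒞, ∀ ψ, ((a : E →L[ℂ] E) ψ, (b : E →L[ℂ] E) ψ) ∈ (generator U).graph)
    (hd : ∀ X : E₂, (∀ a ∈ D, ∀ Ψ, ⟪X, Φ a Ψ⟫_ℂ = 0) → X = 0) :
    closedOp {p : E₂ × E₂ | ∃ a b : 𝒞,
      (∀ ψ : E, ∃ h : (a : E →L[ℂ] E) ψ ∈ (generator U).domain,
        generator U ⟨_, h⟩ = (b : E →L[ℂ] E) ψ) ∧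
      ∃ Ψ : E₂, p.1 = Φ a Ψ ∧ p.2 = Φ b Ψ} = generator U' := by
  -- The invariant set consists of all Φ(a)Ψ with `a` in the domain. `D` need not be invariant; it
  -- serves only to show that this set is total.
  refine hU'.closedOp_eq_of_invariant (D := {X | ∃ a b : 𝒞,
    (∀ ψ, ((a : E →L[ℂ] E) ψ, (b : E →L[ℂ] E) ψ) ∈ (generator U).graph) ∧ ∃ Ψ, X = Φ a Ψ}) ?_ ?_ ?_ ?_
  · rintro ⟨X, Y⟩ ⟨a, b, hab, Ψ, hX, hY⟩
    simp only at hX hY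
    subst hX hY
    have hab' : ∀ ψ, ((a : E →L[ℂ] E) ψ, (b : E →L[ℂ] E) ψ) ∈ (generator U).graph :=
      fun ψ => mem_graph_iff_exists.2 (hab ψ)
    rw [SetLike.mem_coe, mem_graph_generator]
    -- The Taylor remainder of U' t (Φ a) Ψ is the image under Φ of that of U t a, applied to Ψ. As
    -- Φ does not increase norms, the factor ‖Ψ‖ suffices.
    refine (hU.hasDerivAt_mul (hc b) hab').of_norm_sub_le (C := ‖Ψ‖) fun t => ?_
    have h2 : U' t (Φ a Ψ) - U' 0 (Φ a Ψ) - t • Complex.I • Φ b Ψ =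
        Φ (⟨U t * a, hmem t a⟩ - ⟨U 0 * a, hmem 0 a⟩ - (t : ℂ) • Complex.I • b) Ψ := by
      rw [map_sub, map_sub, map_smul, map_smul, hΦ, hΦ]
      rfl
    rw [h2, mul_comm]
    exact ((Φ _).le_opNorm Ψ).trans (mul_le_mul_of_nonneg_right (hΦn _) (norm_nonneg _))
  · rintro _ ⟨a, b, hab, Ψ, rfl⟩
    exact ⟨Φ b Ψ, a, b, fun ψ => mem_graph_iff_exists.1 (hab ψ), Ψ, rfl, rfl⟩
  · rintro t _ ⟨a, b, hab, Ψ, rfl⟩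
    refine ⟨⟨U t * a, hmem t a⟩, ⟨U t * b, hmem t b⟩, fun ψ => hU.apply_mem_graph (hab ψ) t, Ψ, ?_⟩
    rw [hΦ]; rfl
  · intro X hX
    refine hd X fun a ha Ψ => ?_
    obtain ⟨b, hb⟩ := hD a ha
    exact hX _ ⟨a, b, hb, Ψ, rfl⟩

end Image

lemma hasDerivAt_of_tendsto_slope {E : Type*} [NormedAddCommGroup E] [NormedSpace ℂ E]
    {f : ℝ → E} {f' : E} (h : Tendsto (fun t : ℝ => (t : ℂ)⁻¹ • (f t - f 0)) (𝓝[≠] 0) (𝓝 f')) :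
    HasDerivAt f f' 0 := by
  rw [hasDerivAt_iff_tendsto_slope]
  refine h.congr fun t => ?_
  rw [slope_def_module, sub_zero, ← Complex.ofReal_inv]
  rfl

/-- A unitary one parameter group is strongly continuous if it is so at `0` on a dense set. -/
lemma isUnitaryGroup_of_dense {E : Type*} [NormedAddCommGroup E] [InnerProductSpace ℂ E]
    [CompleteSpace E] {U : ℝ → E →L[ℂ] E} (h1 : ∀ t, U t ∈ unitary (E →L[ℂ] E)) (h2 : U 0 = 1)
    (h3 : ∀ s t, U (s + t) = U s * U t) {D : Set E}
    (hd : ∀ Φ : E, (∀ ψ ∈ D, ⟪Φ, ψ⟫_ℂ = 0) → Φ = 0)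
    (hc : ∀ ψ ∈ D, ContinuousAt (fun t => U t ψ) 0) : IsUnitaryGroup U := by
  refine ⟨h1, h2, h3, ?_⟩
  have hd' : Dense (Submodule.span ℂ D : Set E) := by
    rw [Submodule.dense_iff_topologicalClosure_eq_top,
      Submodule.topologicalClosure_eq_top_iff, Submodule.eq_bot_iff]
    intro Φ hΦ
    exact hd Φ fun ψ hψ => (Submodule.mem_orthogonal' _ _).1 hΦ ψ (Submodule.subset_span hψ)
  have hspan : ∀ ψ ∈ Submodule.span ℂ D, ContinuousAt (fun t => U t ψ) 0 := by
    intro ψ hψ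
    induction hψ using Submodule.span_induction with
    | mem x hx => exact hc x hx
    | zero => simpa using continuousAt_const
    | add x y _ _ hx hy =>
      simp only [map_add]
      exact hx.add hy
    | smul c x _ hx =>
      simp only [map_smul]
      exact hx.const_smul c
  have hall : ∀ ψ, ContinuousAt (fun t => U t ψ) 0 := by
    intro ψ
    rw [Metric.continuousAt_iff]
    intro ε hε
    obtain ⟨φ, hφ, hφd⟩ := Metric.dense_iff.1 hd' ψ (ε / 3) (by positivity)
    obtain ⟨δ, hδ, h⟩ := Metric.continuousAt_iff.1 (hspan φ hφd) (ε / 3) (by positivity)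
    refine ⟨δ, hδ, fun t ht => ?_⟩
    have h4 := h ht
    have hiso : ∀ s, dist (U s ψ) (U s φ) = dist ψ φ := fun s => by
      rw [dist_eq_norm, ← map_sub, norm_apply_of_mem_unitary (h1 s), dist_eq_norm]
    have h5 := hiso t
    have h6 := hiso 0
    rw [Metric.mem_ball, dist_comm] at hφ
    calc dist (U t ψ) (U 0 ψ) ≤ dist (U t ψ) (U t φ) + dist (U t φ) (U 0 φ) + dist (U 0 φ) (U 0 ψ) :=
          dist_triangle4 _ _ _ _
      _ < ε := by rw [dist_comm (U 0 φ)]; linarith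
  intro ψ
  rw [continuous_iff_continuousAt]
  intro t
  have h4 : (fun s => U s ψ) = fun s => U t (U (s - t) ψ) := by
    funext s
    rw [← mul_apply_eq_comp, ← h3]; congr 2; ring
  rw [h4]
  refine (U t).continuous.continuousAt.comp ?_
  refine ContinuousAt.comp (g := fun t => U t ψ) (f := fun s => s - t) ?_ (by fun_prop)
  simpa using hall ψ

/-! ### Multiplication and composition operators on L² -/

section SquareIntegrable

variable {X : Type*} [MeasurableSpace X] {m : Measure X}

lemma norm_sq_eq_integral (ψ : Lp ℂ 2 m) : ‖ψ‖ ^ 2 = ∫ x, ‖ψ x‖ ^ 2 ∂m := by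
  have h := @inner_self_eq_norm_sq_to_K ℂ _ _ _ _ ψ
  rw [L2.inner_def] at h
  simp only [inner_self_eq_norm_sq_to_K] at h
  have h2 : ∫ x, ((‖ψ x‖ : ℂ) ^ 2) ∂m = ((∫ x, ‖ψ x‖ ^ 2 ∂m : ℝ) : ℂ) := by
    rw [← integral_complex_ofReal]; congr 1; ext x; push_cast; rfl
  have h3 : ((∫ x, ‖ψ x‖ ^ 2 ∂m : ℝ) : ℂ) = (‖ψ‖ : ℂ) ^ 2 := by rw [← h2]; exact h
  exact_mod_cast h3.symm

lemma integrable_norm_sq (ψ : Lp ℂ 2 m) : Integrable (fun x => ‖ψ x‖ ^ 2) m :=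
  (memLp_two_iff_integrable_sq_norm (Lp.memLp ψ).1).1 (Lp.memLp ψ)

/-- Dominated convergence applied to |f i - g|². The bound is imposed on the difference and may hold
only eventually, as difference quotients require. -/
lemma tendsto_of_dominated {ι : Type*} {l : Filter ι} [l.IsCountablyGenerated]
    {F : ι → Lp ℂ 2 m} {G : Lp ℂ 2 m} {f : ι → X → ℂ} {g : X → ℂ} (hF : ∀ i, F i =ᵐ[m] f i)
    (hG : G =ᵐ[m] g) {bd : X → ℝ} (hbd : MemLp bd 2 m)
    (h1 : ∀ᶠ i in l, ∀ᵐ x ∂m, ‖f i x - g x‖ ≤ bd x)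
    (h2 : ∀ᵐ x ∂m, Tendsto (fun i => f i x) l (𝓝 (g x))) : Tendsto F l (𝓝 G) := by
  have hI : Integrable (fun x => bd x ^ 2) m := hbd.integrable_sq
  have key : Tendsto (fun i => ∫ x, ‖f i x - g x‖ ^ 2 ∂m) l (𝓝 (∫ _ : X, (0 : ℝ) ∂m)) := by
    refine tendsto_integral_filter_of_dominated_convergence (fun x => bd x ^ 2) ?_ ?_ hI ?_
    · refine Eventually.of_forall fun i => ?_
      exact ((((Lp.memLp (F i)).1.congr (hF i)).sub ((Lp.memLp G).1.congr hG)).norm).pow 2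
    · filter_upwards [h1] with i hi
      filter_upwards [hi] with x hx
      rw [Real.norm_of_nonneg (by positivity)]
      gcongr
    · filter_upwards [h2] with x hx
      have := ((hx.sub_const (g x)).norm).pow 2
      simpa using this
  simp only [integral_zero] at key
  rw [tendsto_iff_norm_sub_tendsto_zero]
  have h3 : ∀ i, ∫ x, ‖f i x - g x‖ ^ 2 ∂m = ‖F i - G‖ ^ 2 := by
    intro i
    rw [norm_sq_eq_integral]
    refine integral_congr_ae ?_
    filter_upwards [Lp.coeFn_sub (F i) G, hF i, hG] with x hx h4 h5
    rw [hx, Pi.sub_apply, h4, h5]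
  simp only [h3] at key
  have := (Real.continuous_sqrt.tendsto 0).comp key
  simpa [Function.comp_def, Real.sqrt_sq] using this

/-- A bounded measurable function. -/
structure IsBddMeas (b : X → ℂ) : Prop where
  measurable : Measurable b
  bdd : ∃ C, ∀ x, ‖b x‖ ≤ C

lemma IsBddMeas.memLp {b : X → ℂ} (hb : IsBddMeas b) {f : X → ℂ} (hf : MemLp f 2 m) :
    MemLp (fun x => b x * f x) 2 m := by
  obtain ⟨C, hC⟩ := hb.bdd
  exact hf.of_le_mul (c := C) (hb.measurable.aestronglyMeasurable.mul hf.1)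
    (Eventually.of_forall fun x => by rw [norm_mul]; gcongr; exact hC x)

lemma norm_le_mul_of_ae {ψ φ : Lp ℂ 2 m} {C : ℝ} (h : ∀ᵐ x ∂m, ‖ψ x‖ ≤ C * ‖φ x‖) :
    ‖ψ‖ ≤ C * ‖φ‖ := Lp.norm_le_mul_norm_of_ae_le_mul h

variable (m) in
/-- Multiplication by a bounded measurable function. -/
def mulOp {b : X → ℂ} (hb : IsBddMeas b) : Lp ℂ 2 m →L[ℂ] Lp ℂ 2 m :=
  LinearMap.mkContinuous
    { toFun := fun ψ => (hb.memLp (Lp.memLp ψ)).toLp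
      map_add' := fun ψ φ => by
        apply Lp.ext
        filter_upwards [(hb.memLp (Lp.memLp (ψ + φ))).coeFn_toLp, (hb.memLp (Lp.memLp ψ)).coeFn_toLp,
          (hb.memLp (Lp.memLp φ)).coeFn_toLp, Lp.coeFn_add ψ φ,
          Lp.coeFn_add (hb.memLp (Lp.memLp ψ)).toLp (hb.memLp (Lp.memLp φ)).toLp] with x h1 h2 h3 h4 h5
        rw [h1, h5, Pi.add_apply, h2, h3, h4, Pi.add_apply]; ring
      map_smul' := fun c ψ => by
        apply Lp.ext
        filter_upwards [(hb.memLp (Lp.memLp (c • ψ))).coeFn_toLp, (hb.memLp (Lp.memLp ψ)).coeFn_toLp,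
          Lp.coeFn_smul c ψ, Lp.coeFn_smul c (hb.memLp (Lp.memLp ψ)).toLp] with x h1 h2 h3 h4
        simp only [RingHom.id_apply]
        rw [h1, h4, Pi.smul_apply, h2, h3, Pi.smul_apply, smul_eq_mul, smul_eq_mul]; ring }
    hb.bdd.choose fun ψ => by
      refine norm_le_mul_of_ae ?_
      filter_upwards [(hb.memLp (Lp.memLp ψ)).coeFn_toLp] with x h1
      simp only [LinearMap.coe_mk, AddHom.coe_mk]
      rw [h1, norm_mul]
      gcongr
      exact hb.bdd.choose_spec x

lemma mulOp_ae {b : X → ℂ} (hb : IsBddMeas b) (ψ : Lp ℂ 2 m) :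
    mulOp m hb ψ =ᵐ[m] fun x => b x * ψ x := (hb.memLp (Lp.memLp ψ)).coeFn_toLp

lemma inner_mulOp {b : X → ℂ} (hb : IsBddMeas b) {b' : X → ℂ} (hb' : IsBddMeas b')
    (h : ∀ x, b' x = (starRingEnd ℂ) (b x)) (φ ψ : Lp ℂ 2 m) :
    ⟪mulOp m hb' φ, ψ⟫_ℂ = ⟪φ, mulOp m hb ψ⟫_ℂ := by
  rw [L2.inner_def, L2.inner_def]
  refine integral_congr_ae ?_
  filter_upwards [mulOp_ae hb ψ, mulOp_ae hb' φ] with x h1 h2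
  rw [h1, h2, h]
  simp only [RCLike.inner_apply, map_mul, Complex.conj_conj]
  ring

lemma star_mulOp {b : X → ℂ} (hb : IsBddMeas b) {b' : X → ℂ} (hb' : IsBddMeas b')
    (h : ∀ x, b' x = (starRingEnd ℂ) (b x)) : star (mulOp m hb) = mulOp m hb' := by
  rw [ContinuousLinearMap.star_eq_adjoint]
  refine ((ContinuousLinearMap.eq_adjoint_iff _ _).2 fun φ ψ => ?_).symm
  exact inner_mulOp hb hb' h φ ψ

lemma mulOp_mul {a b c : X → ℂ} (ha : IsBddMeas a) (hb : IsBddMeas b) (hc : IsBddMeas c)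
    (h : ∀ᵐ x ∂m, a x * b x = c x) : mulOp m ha * mulOp m hb = mulOp m hc := by
  ext1 ψ
  apply Lp.ext
  filter_upwards [mulOp_ae ha (mulOp m hb ψ), mulOp_ae hb ψ, mulOp_ae hc ψ, h] with x h1 h2 h3 h4
  rw [mul_apply_eq_comp, h1, h2, h3, ← h4]; ring

lemma mulOp_one {b : X → ℂ} (hb : IsBddMeas b) (h : ∀ᵐ x ∂m, b x = 1) : mulOp m hb = 1 := by
  ext1 ψ
  apply Lp.ext
  filter_upwards [mulOp_ae hb ψ, h] with x h1 h2
  rw [h1, h2, one_mul]; rfl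

/-- Composition with a measure preserving map. -/
def compOp {θ : X → X} (hθ : MeasurePreserving θ m m) : Lp ℂ 2 m →L[ℂ] Lp ℂ 2 m :=
  (Lp.compMeasurePreservingₗᵢ ℂ θ hθ).toContinuousLinearMap

lemma compOp_ae {θ : X → X} (hθ : MeasurePreserving θ m m) (ψ : Lp ℂ 2 m) :
    compOp hθ ψ =ᵐ[m] fun x => ψ (θ x) := Lp.coeFn_compMeasurePreserving ψ hθ

lemma compOp_toLp_ae {θ : X → X} (hθ : MeasurePreserving θ m m) {ψ : Lp ℂ 2 m} {f : X → ℂ}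
    (h : ψ =ᵐ[m] f) : compOp hθ ψ =ᵐ[m] fun x => f (θ x) :=
  (compOp_ae hθ ψ).trans (hθ.quasiMeasurePreserving.ae_eq_comp h)

lemma norm_compOp {θ : X → X} (hθ : MeasurePreserving θ m m) (ψ : Lp ℂ 2 m) :
    ‖compOp hθ ψ‖ = ‖ψ‖ := Lp.norm_compMeasurePreserving ψ hθ

lemma compOp_mul {θ θ' θ'' : X → X} (hθ : MeasurePreserving θ m m)
    (hθ' : MeasurePreserving θ' m m) (hθ'' : MeasurePreserving θ'' m m)
    (h : ∀ᵐ x ∂m, θ' (θ x) = θ'' x) : compOp hθ * compOp hθ' = compOp hθ'' := by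
  ext1 ψ
  apply Lp.ext
  filter_upwards [compOp_toLp_ae hθ (compOp_ae hθ' ψ), compOp_ae hθ'' ψ, h] with x h1 h2 h3
  rw [mul_apply_eq_comp, h1, h2, ← h3]

lemma compOp_one {θ : X → X} (hθ : MeasurePreserving θ m m) (h : ∀ᵐ x ∂m, θ x = x) :
    compOp hθ = 1 := by
  ext1 ψ
  apply Lp.ext
  filter_upwards [compOp_ae hθ ψ, h] with x h1 h2
  rw [h1, h2]; rfl

/-- An isometry A satisfies A* A = 1, so a right inverse of A equals A*. An inverse point map is
needed only almost everywhere. -/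
lemma star_compOp {θ θ' : X → X} (hθ : MeasurePreserving θ m m)
    (hθ' : MeasurePreserving θ' m m) (h : ∀ᵐ x ∂m, θ' (θ x) = x) :
    star (compOp hθ) = compOp hθ' := by
  have hi : star (compOp hθ) * compOp hθ = 1 := by
    have := (Lp.compMeasurePreservingₗᵢ ℂ θ hθ : Lp ℂ 2 m →ₗᵢ[ℂ] Lp ℂ 2 m)
    rw [ContinuousLinearMap.star_eq_adjoint]
    exact ((compOp hθ).norm_map_iff_adjoint_comp_self).1 (norm_compOp hθ)
  have h1 : compOp hθ * compOp hθ' = 1 := by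
    rw [compOp_mul hθ hθ' (MeasurePreserving.id m) (by simpa using h)]
    exact compOp_one _ (by simp)
  calc star (compOp hθ) = star (compOp hθ) * (compOp hθ * compOp hθ') := by rw [h1, mul_one]
    _ = _ := by rw [← mul_assoc, hi, one_mul]

lemma compOp_mem_unitary {θ θ' : X → X} (hθ : MeasurePreserving θ m m)
    (hθ' : MeasurePreserving θ' m m) (h : ∀ᵐ x ∂m, θ' (θ x) = x) (h' : ∀ᵐ x ∂m, θ (θ' x) = x) :
    compOp hθ ∈ unitary (Lp ℂ 2 m →L[ℂ] Lp ℂ 2 m) := by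
  rw [Unitary.mem_iff, star_compOp hθ hθ' h]
  constructor
  · rw [compOp_mul hθ' hθ (MeasurePreserving.id m) (by simpa using h')]
    exact compOp_one _ (by simp)
  · rw [compOp_mul hθ hθ' (MeasurePreserving.id m) (by simpa using h)]
    exact compOp_one _ (by simp)

variable (m) in
/-- Multiplication by a real function with its maximal domain. -/
def mulMax (b : X → ℝ) : Lp ℂ 2 m →ₗ.[ℂ] Lp ℂ 2 m where
  domain :=
    { carrier := {ψ | MemLp (fun x => (b x : ℂ) * ψ x) 2 m}
      add_mem' := fun {ψ φ} hψ hφ => by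
        refine (hψ.add hφ).ae_eq ?_
        filter_upwards [Lp.coeFn_add ψ φ] with x h
        rw [h, Pi.add_apply, Pi.add_apply]; ring
      zero_mem' := by
        refine (MemLp.zero (ε := ℂ)).ae_eq ?_
        filter_upwards [Lp.coeFn_zero ℂ 2 m] with x h
        rw [h]; simp
      smul_mem' := fun c ψ hψ => by
        refine (hψ.const_smul c).ae_eq ?_
        filter_upwards [Lp.coeFn_smul c ψ] with x h
        rw [h, Pi.smul_apply, Pi.smul_apply, smul_eq_mul, smul_eq_mul]; ring }
  toFun :=
    { toFun := fun ψ => MemLp.toLp _ ψ.2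
      map_add' := fun ψ φ => by
        apply Lp.ext
        filter_upwards [MemLp.coeFn_toLp (ψ + φ).2, MemLp.coeFn_toLp ψ.2, MemLp.coeFn_toLp φ.2,
          Lp.coeFn_add (MemLp.toLp _ ψ.2) (MemLp.toLp _ φ.2), Lp.coeFn_add (ψ : Lp ℂ 2 m) φ]
          with x h1 h2 h3 h4 h5
        rw [h1, h4, Pi.add_apply, h2, h3, Submodule.coe_add, h5, Pi.add_apply]; ring
      map_smul' := fun c ψ => by
        apply Lp.ext
        filter_upwards [MemLp.coeFn_toLp (c • ψ).2, MemLp.coeFn_toLp ψ.2,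
          Lp.coeFn_smul c (MemLp.toLp _ ψ.2), Lp.coeFn_smul c (ψ : Lp ℂ 2 m)] with x h1 h2 h3 h4
        simp only [RingHom.id_apply]
        rw [h1, h3, Pi.smul_apply, h2, Submodule.coe_smul, h4, Pi.smul_apply, smul_eq_mul,
          smul_eq_mul]; ring }

lemma mem_graph_mulMax {b : X → ℝ} {ψ η : Lp ℂ 2 m} :
    (ψ, η) ∈ (mulMax m b).graph ↔ η =ᵐ[m] fun x => (b x : ℂ) * ψ x := by
  rw [LinearPMap.mem_graph_iff]
  constructor
  · rintro ⟨y, hy, h⟩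
    simp only at hy h
    subst hy
    rw [← h]
    exact MemLp.coeFn_toLp y.2
  · intro h
    have hm : MemLp (fun x => (b x : ℂ) * ψ x) 2 m := (Lp.memLp η).ae_eq h
    refine ⟨⟨ψ, hm⟩, rfl, ?_⟩
    apply Lp.ext
    exact (MemLp.coeFn_toLp hm).trans h.symm

lemma mulMax_eq_ofBdd {b : X → ℝ} (hb : IsBddMeas fun x => (b x : ℂ)) :
    mulMax m b = ofBdd (mulOp m hb) := by
  apply LinearPMap.eq_of_eq_graph
  ext ⟨ψ, η⟩
  rw [mem_graph_mulMax, mem_graph_ofBdd]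
  constructor
  · intro h
    exact Lp.ext (h.trans (mulOp_ae hb ψ).symm)
  · rintro rfl
    exact mulOp_ae hb ψ

/-- The phase function `exp (i t b)`. -/
lemma isBddMeas_phase {b : X → ℝ} (hb : Measurable b) (t : ℝ) :
    IsBddMeas fun x => Complex.exp (Complex.I * t * b x) where
  measurable := by fun_prop
  bdd := ⟨1, fun x => by
    rw [show Complex.I * t * b x = ((t * b x : ℝ) : ℂ) * Complex.I by push_cast; ring,
      Complex.norm_exp_ofReal_mul_I]⟩

variable (m) in
/-- The unitary group of multiplications by `exp (i t b)`. -/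
def phase {b : X → ℝ} (hb : Measurable b) (t : ℝ) : Lp ℂ 2 m →L[ℂ] Lp ℂ 2 m :=
  mulOp m (isBddMeas_phase hb t)

lemma phase_ae {b : X → ℝ} (hb : Measurable b) (t : ℝ) (ψ : Lp ℂ 2 m) :
    phase m hb t ψ =ᵐ[m] fun x => Complex.exp (Complex.I * t * b x) * ψ x := mulOp_ae _ ψ

lemma norm_phase (t y : ℝ) : ‖Complex.exp (Complex.I * t * y)‖ = 1 := by
  rw [show Complex.I * t * y = ((t * y : ℝ) : ℂ) * Complex.I by push_cast; ring,
    Complex.norm_exp_ofReal_mul_I]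

lemma isUnitaryGroup_phase {b : X → ℝ} (hb : Measurable b) : IsUnitaryGroup (phase m hb) := by
  have hz : phase m hb 0 = 1 := mulOp_one _ (by simp)
  have ha : ∀ s t, phase m hb (s + t) = phase m hb s * phase m hb t := by
    intro s t
    refine (mulOp_mul _ _ _ (Eventually.of_forall fun x => ?_)).symm
    rw [← Complex.exp_add]; congr 1; push_cast; ring
  have hs : ∀ t, star (phase m hb t) = phase m hb (-t) := by
    intro t
    refine star_mulOp _ _ fun x => ?_
    rw [← Complex.exp_conj]
    simp
  refine ⟨fun t => ?_, hz, ha, fun ψ => ?_⟩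
  · rw [Unitary.mem_iff, hs, ← ha, ← ha]
    simp [hz]
  · rw [continuous_iff_continuousAt]
    intro t
    refine tendsto_of_dominated (fun s => phase_ae hb s ψ) (phase_ae hb t ψ)
      (bd := fun x => 2 * ‖ψ x‖) ((Lp.memLp ψ).norm.const_mul 2) ?_ ?_
    · refine Eventually.of_forall fun s => Eventually.of_forall fun x => ?_
      rw [← sub_mul, norm_mul]
      gcongr
      refine (norm_sub_le _ _).trans ?_
      rw [norm_phase, norm_phase]; norm_num
    · refine Eventually.of_forall fun x => ?_
      have : Continuous fun s : ℝ => Complex.exp (Complex.I * s * b x) * ψ x := by fun_prop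
      exact this.tendsto t

lemma hasDerivAt_phase {b : X → ℝ} (hb : Measurable b) {ψ η : Lp ℂ 2 m}
    (h : η =ᵐ[m] fun x => (b x : ℂ) * ψ x) :
    HasDerivAt (fun t => phase m hb t ψ) (Complex.I • η) 0 := by
  refine hasDerivAt_of_tendsto_slope ?_
  refine tendsto_of_dominated (f := fun t x => (t : ℂ)⁻¹ *
      (Complex.exp (Complex.I * t * b x) * ψ x - ψ x)) (g := fun x => Complex.I * (b x * ψ x))
      (bd := fun x => 2 * ‖(b x : ℂ) * ψ x‖) ?_ ?_ ?_ ?_ ?_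
  · intro t
    filter_upwards [Lp.coeFn_smul ((t : ℂ)⁻¹) (phase m hb t ψ - phase m hb 0 ψ),
      Lp.coeFn_sub (phase m hb t ψ) (phase m hb 0 ψ), phase_ae hb t ψ, phase_ae hb 0 ψ]
      with x h1 h2 h3 h4
    rw [h1, Pi.smul_apply, h2, Pi.sub_apply, h3, h4]
    simp
  · filter_upwards [Lp.coeFn_smul Complex.I η, h] with x h1 h2
    rw [h1, Pi.smul_apply, h2, smul_eq_mul]
  · exact (((Lp.memLp η).ae_eq h).norm).const_mul 2
  · filter_upwards [self_mem_nhdsWithin] with t ht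
    refine Eventually.of_forall fun x => ?_
    -- From |exp(iy) - 1| ≤ |y| the difference quotient is at most |b ψ|; its limit accounts for the
    -- other half of the bound 2 |b ψ|.
    have h1 : ‖Complex.exp (Complex.I * t * b x) - 1‖ ≤ ‖t * b x‖ := by
      have := Real.norm_exp_I_mul_ofReal_sub_one_le (x := t * b x)
      rwa [show Complex.I * ((t * b x : ℝ) : ℂ) = Complex.I * t * b x by push_cast; ring] at this
    have h2 : ‖(t : ℂ)⁻¹ * (Complex.exp (Complex.I * t * b x) * ψ x - ψ x)‖ ≤ ‖(b x : ℂ) * ψ x‖ := by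
      have ht' : 0 < |t| := abs_pos.2 ht
      rw [show Complex.exp (Complex.I * t * b x) * ψ x - ψ x =
        (Complex.exp (Complex.I * t * b x) - 1) * ψ x by ring, norm_mul, norm_mul, norm_mul, norm_inv,
        Complex.norm_real, Complex.norm_real, Real.norm_eq_abs, ← mul_assoc]
      gcongr
      rw [inv_mul_le_iff₀ ht']
      simpa [abs_mul] using h1
    refine (norm_sub_le _ _).trans ?_
    rw [norm_mul Complex.I, Complex.norm_I, one_mul, two_mul]
    gcongr
  · refine Eventually.of_forall fun x => ?_
    have h1 : HasDerivAt (fun t : ℝ => Complex.exp (Complex.I * t * b x) * ψ x)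
        (Complex.I * (b x * ψ x)) 0 := by
      have h0 : HasDerivAt (fun t : ℝ => Complex.I * (t : ℂ) * b x) (Complex.I * b x) 0 := by
        have := ((hasDerivAt_id (0 : ℂ)).const_mul Complex.I).mul_const (b x : ℂ)
        simpa using this.comp_ofReal (z := 0)
      have h2 := (h0.cexp).mul_const (ψ x)
      refine h2.congr_deriv ?_
      simp; ring
    have h2 := (hasDerivAt_iff_tendsto_slope.1 h1)
    refine h2.congr fun t => ?_
    simp [slope_def_module]

lemma isBddMeas_resolvent {b : X → ℝ} (hb : Measurable b) :
    IsBddMeas fun x => ((b x : ℂ) - Complex.I)⁻¹ where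
  measurable := by fun_prop
  bdd := ⟨1, fun x => by
    rw [norm_inv]
    refine inv_le_one_of_one_le₀ ?_
    have := Complex.abs_im_le_norm ((b x : ℂ) - Complex.I)
    simpa using this⟩

lemma isBddMeas_mul_resolvent {b : X → ℝ} (hb : Measurable b) :
    IsBddMeas fun x => (b x : ℂ) * ((b x : ℂ) - Complex.I)⁻¹ where
  measurable := by fun_prop
  bdd := ⟨1, fun x => by
    rw [norm_mul, norm_inv]
    have h := Complex.abs_re_le_norm ((b x : ℂ) - Complex.I)
    have h1 := Complex.abs_im_le_norm ((b x : ℂ) - Complex.I)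
    simp only [Complex.sub_re, Complex.ofReal_re, Complex.I_re, sub_zero, Complex.sub_im,
      Complex.ofReal_im, Complex.I_im, zero_sub, abs_neg, abs_one] at h h1
    rw [mul_inv_le_iff₀ (by linarith), one_mul, Complex.norm_real, Real.norm_eq_abs]
    exact h⟩

lemma sub_I_ne_zero (y : ℝ) : (y : ℂ) - Complex.I ≠ 0 := fun h => by
  have := congrArg Complex.im h
  simp at this

/-- The generator of the multiplications by `exp (i t b)` is the multiplication by `b`. -/
lemma generator_phase {b : X → ℝ} (hb : Measurable b) : generator (phase m hb) = mulMax m b := by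
  apply LinearPMap.eq_of_eq_graph
  have hle : (mulMax m b).graph ≤ (generator (phase m hb)).graph := by
    rintro ⟨ψ, η⟩ h
    rw [mem_graph_mulMax] at h
    exact mem_graph_generator.2 (hasDerivAt_phase hb h)
  refine le_antisymm ?_ hle
  rintro ⟨ψ, η⟩ h
  set ξ := η - Complex.I • ψ with hξ
  -- The pair (ψ₀, η₀) solves (b - i) ψ₀ = ξ inside the maximal domain of multiplication. Since
  -- generator - i is injective, (ψ, η) must be this pair.
  let ψ₀ := mulOp m (isBddMeas_resolvent hb) ξ
  let η₀ := mulOp m (isBddMeas_mul_resolvent hb) ξ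
  have h0 : (ψ₀, η₀) ∈ (mulMax m b).graph := by
    rw [mem_graph_mulMax]
    filter_upwards [mulOp_ae (isBddMeas_resolvent hb) ξ, mulOp_ae (isBddMeas_mul_resolvent hb) ξ]
      with x h1 h2
    rw [h1, h2]; ring
  have h1 : η₀ - Complex.I • ψ₀ = ξ := by
    apply Lp.ext
    filter_upwards [mulOp_ae (isBddMeas_resolvent hb) ξ, mulOp_ae (isBddMeas_mul_resolvent hb) ξ,
      Lp.coeFn_sub η₀ (Complex.I • ψ₀), Lp.coeFn_smul Complex.I ψ₀] with x h1 h2 h3 h4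
    rw [h3, Pi.sub_apply, h4, Pi.smul_apply, h1, h2, smul_eq_mul]
    field_simp [sub_I_ne_zero (b x)]
  have h2 := (isUnitaryGroup_phase hb).norm_sub_I_smul_sq (Submodule.sub_mem _ h (hle h0))
  simp only at h2
  have h3 : η - η₀ - Complex.I • (ψ - ψ₀) = 0 := by
    rw [smul_sub, sub_sub_sub_comm, ← hξ, h1, sub_self]
  rw [h3, norm_zero] at h2
  have h4 : ‖η - η₀‖ = 0 := by nlinarith [sq_nonneg ‖η - η₀‖, sq_nonneg ‖ψ - ψ₀‖, norm_nonneg (η - η₀)]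
  have h5 : ‖ψ - ψ₀‖ = 0 := by nlinarith [sq_nonneg ‖η - η₀‖, sq_nonneg ‖ψ - ψ₀‖, norm_nonneg (ψ - ψ₀)]
  rw [sub_eq_zero.1 (norm_eq_zero.1 h4), sub_eq_zero.1 (norm_eq_zero.1 h5)]
  exact h0

lemma isBddMeas_exp {c : X → ℝ} (hc : Measurable c) {C : ℝ} (hC : ∀ x, |c x| ≤ C) (s : ℝ) :
    IsBddMeas fun x => (Real.exp (s * c x) : ℂ) where
  measurable := by fun_prop
  bdd := ⟨Real.exp (|s| * C), fun x => by
    rw [Complex.norm_real, Real.norm_of_nonneg (Real.exp_pos _).le, Real.exp_le_exp]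
    refine (le_abs_self _).trans ?_
    rw [abs_mul]
    gcongr
    exact hC x⟩

lemma isBddMeas_ofReal {c : X → ℝ} (hc : Measurable c) {C : ℝ} (hC : ∀ x, |c x| ≤ C) :
    IsBddMeas fun x => (c x : ℂ) where
  measurable := by fun_prop
  bdd := ⟨C, fun x => by rw [Complex.norm_real]; exact hC x⟩

/-- Real exponents are needed later: with c a truncation of 1/b, the non-unitary group exp(s c) in
one tensor factor compensates a unitary group in the other. -/
lemma hasDerivAt_mulOp_exp {c : X → ℝ} (hc : Measurable c) {C : ℝ} (hC : ∀ x, |c x| ≤ C)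
    (ψ : Lp ℂ 2 m) : HasDerivAt (fun s => mulOp m (isBddMeas_exp hc hC s) ψ)
      (mulOp m (isBddMeas_ofReal hc hC) ψ) 0 := by
  refine hasDerivAt_of_tendsto_slope ?_
  refine tendsto_of_dominated (f := fun t x => (t : ℂ)⁻¹ *
      ((Real.exp (t * c x) : ℂ) * ψ x - ψ x)) (g := fun x => c x * ψ x)
      (bd := fun x => 3 * C * ‖ψ x‖) ?_ ?_ ?_ ?_ ?_
  · intro t
    filter_upwards [Lp.coeFn_smul ((t : ℂ)⁻¹) (mulOp m (isBddMeas_exp hc hC t) ψ -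
        mulOp m (isBddMeas_exp hc hC 0) ψ),
      Lp.coeFn_sub (mulOp m (isBddMeas_exp hc hC t) ψ) (mulOp m (isBddMeas_exp hc hC 0) ψ),
      mulOp_ae (isBddMeas_exp hc hC t) ψ, mulOp_ae (isBddMeas_exp hc hC 0) ψ]
      with x h1 h2 h3 h4
    rw [h1, Pi.smul_apply, h2, Pi.sub_apply, h3, h4]
    simp
  · exact mulOp_ae _ ψ
  · exact (Lp.memLp ψ).norm.const_mul _
  -- The bound 3C is 2C from |exp(w) - 1| ≤ 2|w| for |w| ≤ 1, which needs |t| |C| < 1, plus C from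
  -- the limit.
  · have hsm : ∀ᶠ t in 𝓝[≠] (0 : ℝ), |t| * |C| < 1 := by
      have : Tendsto (fun t : ℝ => |t| * |C|) (𝓝 0) (𝓝 (|0| * |C|)) :=
        ((continuous_abs).mul continuous_const).tendsto 0
      rw [abs_zero, zero_mul] at this
      exact (this.mono_left nhdsWithin_le_nhds).eventually_lt_const one_pos
    filter_upwards [self_mem_nhdsWithin, hsm] with t ht hts
    refine Eventually.of_forall fun x => ?_
    have ht' : 0 < |t| := abs_pos.2 ht
    have h1 : ‖Complex.exp (t * c x : ℝ) - 1‖ ≤ 2 * ‖((t * c x : ℝ) : ℂ)‖ := by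
      refine Complex.norm_exp_sub_one_le ?_
      rw [Complex.norm_real, Real.norm_eq_abs, abs_mul]
      exact (mul_le_mul_of_nonneg_left ((hC x).trans (le_abs_self C)) (abs_nonneg t)).trans hts.le
    rw [Complex.norm_real, Real.norm_eq_abs, abs_mul] at h1
    have h2 : ‖(t : ℂ)⁻¹ * ((Real.exp (t * c x) : ℂ) * ψ x - ψ x)‖ ≤ 2 * |c x| * ‖ψ x‖ := by
      rw [show (Real.exp (t * c x) : ℂ) * ψ x - ψ x =
        ((Real.exp (t * c x) : ℂ) - 1) * ψ x by ring, norm_mul, norm_mul, norm_inv,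
        Complex.norm_real, Real.norm_eq_abs, ← mul_assoc]
      refine mul_le_mul_of_nonneg_right ?_ (norm_nonneg _)
      rw [inv_mul_le_iff₀ ht', Complex.ofReal_exp]
      linarith
    refine (norm_sub_le _ _).trans ?_
    rw [norm_mul (c x : ℂ), Complex.norm_real, Real.norm_eq_abs]
    nlinarith [norm_nonneg (ψ x), mul_le_mul_of_nonneg_right (hC x) (norm_nonneg (ψ x))]
  · refine Eventually.of_forall fun x => ?_
    have h1 : HasDerivAt (fun t : ℝ => (Real.exp (t * c x) : ℂ) * ψ x) (c x * ψ x) 0 := by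
      have h0 : HasDerivAt (fun t : ℝ => Real.exp (t * c x)) (c x) 0 := by
        simpa using (((hasDerivAt_id (0 : ℝ)).mul_const (c x)).exp)
      exact h0.ofReal_comp.mul_const (ψ x)
    have h2 := (hasDerivAt_iff_tendsto_slope.1 h1)
    refine h2.congr fun t => ?_
    simp [slope_def_module]

end SquareIntegrable

/-! ### Invariance of the measures under dilations -/

section Measures

/-- The factor k by which θ changes μ is cancelled by the factor k' by which it changes the density.
-/
lemma measurePreserving_withDensity {X : Type*} [MeasurableSpace X] {μ : Measure X} {θ : X → X}
    (hθ : Measurable θ) {k k' : ℝ≥0∞} (hk : k' * k = 1) (hmap : μ.map θ = k • μ) {w : X → ℝ≥0∞}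
    (hw : Measurable w) (h : ∀ x, w x = k' * w (θ x)) :
    MeasurePreserving θ (μ.withDensity w) (μ.withDensity w) := by
  refine ⟨hθ, ?_⟩
  ext s hs
  rw [Measure.map_apply hθ hs, withDensity_apply _ (hθ hs), withDensity_apply _ hs,
    ← lintegral_indicator hs, ← lintegral_indicator (hθ hs)]
  have h1 : ∀ x, (θ ⁻¹' s).indicator w x = k' * (s.indicator w) (θ x) := by
    intro x
    by_cases hx : θ x ∈ s
    · rw [indicator_of_mem (show x ∈ θ ⁻¹' s from hx), indicator_of_mem hx, h]
    · rw [indicator_of_notMem (show x ∉ θ ⁻¹' s from hx), indicator_of_notMem hx, mul_zero]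
  simp_rw [h1]
  rw [lintegral_const_mul _ (show Measurable fun x => s.indicator w (θ x) from
    (hw.indicator hs).comp hθ), ← lintegral_map (hw.indicator hs) hθ, hmap,
    lintegral_smul_measure, smul_eq_mul, ← mul_assoc, hk, one_mul]

lemma withDensity_isCompact_lt_top {X : Type*} [MeasurableSpace X] [TopologicalSpace X]
    [OpensMeasurableSpace X] [T2Space X] {μ : Measure X} [IsFiniteMeasureOnCompacts μ] {K : Set X}
    (hK : IsCompact K) {w : X → ℝ} (hw : ContinuousOn w K) :
    μ.withDensity (fun x => ENNReal.ofReal (w x)) K < ⊤ := by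
  rw [withDensity_apply _ hK.measurableSet]
  exact (hw.integrableOn_compact hK).lintegral_lt_top

/-- The invariant measure `dh / |h|` of the multiplicative group `ℝ_*`. -/
def nu : Measure ℝ := volume.withDensity fun h => ENNReal.ofReal (1 / |h|)

instance : SFinite nu := by unfold nu; infer_instance
instance : SFinite mu := by unfold mu; infer_instance

lemma measurable_nu_density : Measurable fun h : ℝ => ENNReal.ofReal (1 / |h|) := by fun_prop

lemma measurable_mu_density : Measurable fun p : P => ENNReal.ofReal (1 / p.2 ^ 2) := by fun_prop

lemma measurePreserving_mul_nu {a : ℝ} (ha : a ≠ 0) : MeasurePreserving (fun h => a * h) nu nu := by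
  refine measurePreserving_withDensity (by fun_prop) (k := ENNReal.ofReal |a⁻¹|)
    (k' := ENNReal.ofReal |a|) ?_ (Real.map_volume_mul_left ha) measurable_nu_density fun x => ?_
  · rw [← ENNReal.ofReal_mul (abs_nonneg _), ← abs_mul, mul_inv_cancel₀ ha]; simp
  · rw [← ENNReal.ofReal_mul (abs_nonneg _)]
    congr 1
    rw [abs_mul]
    have := abs_pos.2 ha
    field_simp

lemma nu_singleton_zero : nu {0} = 0 := by
  rw [nu, withDensity_apply _ (measurableSet_singleton 0)]
  simp

lemma ae_nu_ne_zero : ∀ᵐ h ∂nu, h ≠ 0 := by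
  rw [ae_iff]
  simpa using nu_singleton_zero

lemma nu_restrict_ne_zero : nu.restrict {0}ᶜ = nu :=
  Measure.restrict_eq_self_of_ae_mem ae_nu_ne_zero

lemma measurePreserving_inv_nu : MeasurePreserving (fun h : ℝ => h⁻¹) nu nu := by
  refine ⟨measurable_inv, ?_⟩
  ext s hs
  rw [Measure.map_apply measurable_inv hs]
  -- The null point 0 is removed: inversion is differentiable and the density meaningful only away
  -- from it.
  have key : ∀ u : Set ℝ, MeasurableSet u →
      nu u = ∫⁻ h in {0}ᶜ, u.indicator (fun h => ENNReal.ofReal (1 / |h|)) h := by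
    intro u hu
    rw [lintegral_indicator hu, Measure.restrict_restrict hu, ← withDensity_apply _
      (hu.inter (measurableSet_singleton 0).compl)]
    change nu u = nu (u ∩ {0}ᶜ)
    rw [← Measure.restrict_apply hu, nu_restrict_ne_zero]
  rw [key _ (measurable_inv hs), key _ hs]
  have himg : (fun h : ℝ => h⁻¹) '' {0}ᶜ = {0}ᶜ := by
    ext x
    simp only [mem_image, mem_compl_iff, mem_singleton_iff]
    constructor
    · rintro ⟨y, hy, rfl⟩
      exact inv_ne_zero hy
    · intro hx
      exact ⟨x⁻¹, inv_ne_zero hx, inv_inv x⟩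
  have := lintegral_image_eq_lintegral_abs_deriv_mul (s := ({0}ᶜ : Set ℝ)) (f := fun h : ℝ => h⁻¹)
    (f' := fun h => -(h ^ 2)⁻¹) (measurableSet_singleton 0).compl
    (fun x hx => (hasDerivAt_inv hx).hasDerivWithinAt) (inv_injective.injOn)
    (s.indicator (fun h => ENNReal.ofReal (1 / |h|)))
  rw [himg] at this
  rw [this]
  refine setLIntegral_congr_fun (measurableSet_singleton 0).compl fun x hx => ?_
  have hx0 : x ≠ 0 := hx
  by_cases hxs : x⁻¹ ∈ s
  · rw [indicator_of_mem (show x ∈ (fun h : ℝ => h⁻¹) ⁻¹' s from hxs), indicator_of_mem hxs,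
      ← ENNReal.ofReal_mul (abs_nonneg _)]
    congr 1
    rw [abs_neg, abs_inv, abs_inv, abs_pow]
    have := abs_pos.2 hx0
    field_simp
  · rw [indicator_of_notMem (show x ∉ (fun h : ℝ => h⁻¹) ⁻¹' s from hxs),
      indicator_of_notMem hxs, mul_zero]

lemma integral_nu (f : ℝ → ℂ) : ∫ h, f h ∂nu = ∫ h, f h / |h| := by
  rw [nu, integral_withDensity_eq_integral_toReal_smul measurable_nu_density
    (Eventually.of_forall fun _ => ENNReal.ofReal_lt_top)]
  congr 1
  ext h
  rw [ENNReal.toReal_ofReal (by positivity), Complex.real_smul]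
  push_cast
  ring

lemma nu_prod : nu.prod nu = (volume : Measure (ℝ × ℝ)).withDensity
    fun h => ENNReal.ofReal (1 / |h.1|) * ENNReal.ofReal (1 / |h.2|) :=
  prod_withDensity measurable_nu_density measurable_nu_density

lemma integral_nu_prod (f : ℝ × ℝ → ℂ) :
    ∫ h, f h ∂(nu.prod nu) = ∫ h : ℝ × ℝ, f h / (|h.1| * |h.2|) := by
  have hm : Measurable fun h : ℝ × ℝ => ENNReal.ofReal (1 / |h.1|) * ENNReal.ofReal (1 / |h.2|) :=
    (measurable_nu_density.comp measurable_fst).mul (measurable_nu_density.comp measurable_snd)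
  rw [nu_prod, integral_withDensity_eq_integral_toReal_smul hm
    (Eventually.of_forall fun _ => ENNReal.mul_lt_top ENNReal.ofReal_lt_top ENNReal.ofReal_lt_top)]
  congr 1
  ext h
  rw [← ENNReal.ofReal_mul (by positivity), ENNReal.toReal_ofReal (by positivity),
    Complex.real_smul]
  push_cast
  ring

lemma nu_lt_top {K : Set ℝ} (hK : IsCompact K) (h : K ⊆ {0}ᶜ) : nu K < ⊤ := by
  refine withDensity_isCompact_lt_top hK ?_
  refine ContinuousOn.div continuousOn_const continuous_abs.continuousOn fun x hx => ?_
  exact abs_ne_zero.2 (h hx)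

/-- Lebesgue measure of the plane scales by a², and so does c². All unitarity in the sequel, that of
the twist included, comes from this. -/
lemma measurePreserving_smul_mu {a : ℝ} (ha : a ≠ 0) : MeasurePreserving (fun p : P => a • p) mu mu := by
  refine measurePreserving_withDensity (by fun_prop) (k := ENNReal.ofReal |(a ^ 2)⁻¹|)
    (k' := ENNReal.ofReal |a ^ 2|) ?_ ?_ measurable_mu_density fun x => ?_
  · rw [← ENNReal.ofReal_mul (abs_nonneg _), ← abs_mul, mul_inv_cancel₀ (pow_ne_zero 2 ha)]; simp
  · have := Measure.map_addHaar_smul (volume : Measure P) ha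
    simpa using this
  · rw [← ENNReal.ofReal_mul (abs_nonneg _)]
    congr 1
    simp only [Prod.smul_snd, smul_eq_mul]
    rw [abs_of_nonneg (sq_nonneg a)]
    field_simp

lemma measurePreserving_add_mu (s : ℝ) : MeasurePreserving (fun p : P => (p.1 + s, p.2)) mu mu := by
  refine measurePreserving_withDensity (by fun_prop) (k := 1) (k' := 1) (by simp) ?_
    measurable_mu_density fun x => by simp
  rw [one_smul]
  have := ((measurePreserving_add_right (volume : Measure ℝ) s).prod
    (MeasurePreserving.id (volume : Measure ℝ))).map_eq
  exact this

lemma mu_absolutelyContinuous : mu ≪ volume := withDensity_absolutelyContinuous _ _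

lemma ae_mu_snd_ne_zero : ∀ᵐ p ∂mu, p.2 ≠ 0 := by
  have : ∀ᵐ p : P, p.2 ≠ 0 := by
    have h2 : ∀ᵐ x : ℝ, x ≠ 0 := by simp [ae_iff]
    exact Measure.quasiMeasurePreserving_snd.ae h2
  exact mu_absolutelyContinuous.ae_le this

lemma ae_mu_fst_ne (a : ℝ) : ∀ᵐ p ∂mu, p.1 ≠ a := by
  have : ∀ᵐ p : P, p.1 ≠ a := by
    have h2 : ∀ᵐ x : ℝ, x ≠ a := by simp [ae_iff]
    exact Measure.quasiMeasurePreserving_fst.ae h2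
  exact mu_absolutelyContinuous.ae_le this

lemma ae_mu_mu_fst {p : P → Prop} (h : ∀ᵐ x ∂mu, p x) : ∀ᵐ q ∂(mu.prod mu), p q.1 :=
  Measure.quasiMeasurePreserving_fst.ae h

lemma ae_mu_mu_snd {p : P → Prop} (h : ∀ᵐ x ∂mu, p x) : ∀ᵐ q ∂(mu.prod mu), p q.2 :=
  Measure.quasiMeasurePreserving_snd.ae h

lemma mu_lt_top {K : Set P} (hK : IsCompact K) (h : K ⊆ {p | p.2 ≠ 0}) : mu K < ⊤ := by
  refine withDensity_isCompact_lt_top hK ?_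
  refine ContinuousOn.div continuousOn_const (by fun_prop) fun x hx => ?_
  exact pow_ne_zero 2 (h hx)

lemma mu_prod_lt_top {K : Set Q} (hK : IsCompact K) (h : K ⊆ {q | q.1.2 ≠ 0 ∧ q.2.2 ≠ 0}) :
    (mu.prod mu) K < ⊤ := by
  have h1 : K ⊆ (Prod.fst '' K) ×ˢ (Prod.snd '' K) := fun x hx => ⟨⟨x, hx, rfl⟩, ⟨x, hx, rfl⟩⟩
  refine (measure_mono h1).trans_lt ?_
  rw [Measure.prod_prod]
  refine ENNReal.mul_lt_top (mu_lt_top (hK.image continuous_fst) ?_)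
    (mu_lt_top (hK.image continuous_snd) ?_)
  · rintro _ ⟨x, hx, rfl⟩
    exact (h hx).1
  · rintro _ ⟨x, hx, rfl⟩
    exact (h hx).2

/-- For fixed x₂ the map of x₁ is a dilation, so this is a skew product over the second variable.
The two swaps put the base first. -/
lemma measurePreserving_scale₂ {l : P → ℝ} (hl : Measurable l) (hl0 : ∀ᵐ x ∂mu, l x ≠ 0) {k : ℝ}
    (hk : k ≠ 0) : MeasurePreserving (fun q : Q => (l q.2 • q.1, k • q.2)) (mu.prod mu) (mu.prod mu) := by
  have h1 := (measurePreserving_smul_mu hk).skew_product (μc := mu) (μd := mu)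
    (g := fun x y => l x • y)
    (show Measurable fun p : P × P => l p.1 • p.2 from
      (hl.comp measurable_fst).smul measurable_snd)
    (by filter_upwards [hl0] with x hx using (measurePreserving_smul_mu hx).map_eq)
  have h2 := (Measure.measurePreserving_swap (μ := mu) (ν := mu))
  exact h2.comp (h1.comp h2)

/-- The coordinates `(x₁ / c₂, (z₁ + z₂, c₂))` of `Γ × Γ`, in which the diagonal action is an action
on the second variable; this is the inverse coordinate change. -/
def diagCoord (q : Q) : Q := (q.2.2 • q.1, (q.2.1 - q.2.2 * q.1.1, q.2.2))

/-- The coordinates `(x₁ / c₂, (z₁ + z₂, c₂))`. -/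
def diagCoordInv (q : Q) : Q := (q.2.2⁻¹ • q.1, (q.2.1 + q.1.1, q.2.2))

lemma measurePreserving_diagCoord : MeasurePreserving diagCoord (mu.prod mu) (mu.prod mu) := by
  have h1 := measurePreserving_scale₂ (l := fun x => x.2) measurable_snd ae_mu_snd_ne_zero
    (one_ne_zero)
  have h2 := (MeasurePreserving.id mu).skew_product (μc := mu) (μd := mu)
    (g := fun x y => (y.1 + -x.1, y.2))
    (show Measurable fun p : P × P => (p.2.1 + -p.1.1, p.2.2) by fun_prop)
    (Eventually.of_forall fun x => (measurePreserving_add_mu _).map_eq)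
  convert h2.comp h1 using 1
  ext q <;> simp [diagCoord, sub_eq_add_neg]

lemma measurePreserving_diagCoordInv : MeasurePreserving diagCoordInv (mu.prod mu) (mu.prod mu) := by
  have h1 := measurePreserving_scale₂ (l := fun x => x.2⁻¹) measurable_snd.inv
    (by filter_upwards [ae_mu_snd_ne_zero] with x hx using inv_ne_zero hx) (one_ne_zero)
  have h2 := (MeasurePreserving.id mu).skew_product (μc := mu) (μd := mu)
    (g := fun x y => (y.1 + x.1, y.2))
    (show Measurable fun p : P × P => (p.2.1 + p.1.1, p.2.2) by fun_prop)
    (Eventually.of_forall fun x => (measurePreserving_add_mu _).map_eq)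
  convert h1.comp h2 using 1
  ext q <;> simp [diagCoordInv]

lemma diagCoord_inv {q : Q} (h : q.2.2 ≠ 0) : diagCoord (diagCoordInv q) = q := by
  ext <;> simp [diagCoord, diagCoordInv, h]

lemma diagCoordInv_diagCoord {q : Q} (h : q.2.2 ≠ 0) : diagCoordInv (diagCoord q) = q := by
  ext <;> simp [diagCoord, diagCoordInv, h]

end Measures

/-! ### Totality of test functions in L² -/

section TestFunctions

lemma memLp_of_bounded_support {X : Type*} [MeasurableSpace X] {μ : Measure X} {f : X → ℂ}
    (hf : AEStronglyMeasurable f μ) {C : ℝ} {K : Set X} (hK : MeasurableSet K) (hμ : μ K < ⊤)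
    (hC : ∀ x, ‖f x‖ ≤ C) (h0 : ∀ x, x ∉ K → f x = 0) : MemLp f 2 μ := by
  have h1 : MemLp (K.indicator fun _ => C) 2 μ := memLp_indicator_const 2 hK C (Or.inr hμ.ne)
  refine h1.mono hf (Eventually.of_forall fun x => ?_)
  by_cases hx : x ∈ K
  · rw [indicator_of_mem hx]
    exact (hC x).trans (le_abs_self C)
  · rw [h0 x hx]; simp

lemma norm_le_of_bounded_support {X : Type*} [MeasurableSpace X] {μ : Measure X} {f : X → ℂ}
    {C : ℝ} {K : Set X} (hK : MeasurableSet K) (hμ : μ K < ⊤)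
    (hC : ∀ x, ‖f x‖ ≤ C) (h0 : ∀ x, x ∉ K → f x = 0) {ψ : Lp ℂ 2 μ} (hψ : ψ =ᵐ[μ] f) :
    ‖ψ‖ ≤ C * ‖indicatorConstLp 2 hK hμ.ne (1 : ℂ)‖ := by
  refine norm_le_mul_of_ae ?_
  filter_upwards [hψ, indicatorConstLp_coeFn (p := 2) (hs := hK) (hμs := hμ.ne) (c := (1 : ℂ))] with x h1 h2
  rw [h1, h2]
  by_cases hx : x ∈ K
  · rw [indicator_of_mem hx]
    simpa using hC x
  · rw [h0 x hx]; simp [hx]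

/-- Φ is locally integrable on Ω because compact subsets of Ω have finite measure, so the
fundamental lemma of the calculus of variations applies there. Real test functions already suffice.
-/
lemma eq_zero_of_orthogonal_test {E : Type*} [NormedAddCommGroup E] [NormedSpace ℝ E]
    [FiniteDimensional ℝ E] [MeasurableSpace E] [BorelSpace E] {μ : Measure E} {Ω : Set E}
    (hΩ : IsOpen Ω) (hae : ∀ᵐ x ∂μ, x ∈ Ω) (hK : ∀ K, IsCompact K → K ⊆ Ω → μ K < ⊤)
    {Φ : Lp ℂ 2 μ} (h : ∀ g : E → ℂ, ContDiff ℝ ∞ g → HasCompactSupport g → tsupport g ⊆ Ω →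
      ∀ ψ : Lp ℂ 2 μ, ψ =ᵐ[μ] g → ⟪Φ, ψ⟫_ℂ = 0) : Φ = 0 := by
  have hloc : LocallyIntegrableOn (fun x => Φ x) Ω μ := by
    refine (locallyIntegrableOn_iff hΩ.isLocallyClosed).2 fun K hKΩ hKc => ?_
    have : IsFiniteMeasure (μ.restrict K) := ⟨by simpa using hK K hKc hKΩ⟩
    exact ((Lp.memLp Φ).restrict K).integrable (by norm_num)
  have h1 := hΩ.ae_eq_zero_of_integral_contDiff_smul_eq_zero hloc fun g hg hgc hgs => by
    have hcg : ContDiff ℝ ∞ fun x => (g x : ℂ) := Complex.ofRealCLM.contDiff.comp hg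
    have hts : tsupport (fun x => (g x : ℂ)) = tsupport g := by
      unfold tsupport
      congr 1
      ext x; simp
    have hcs : HasCompactSupport fun x => (g x : ℂ) := by
      unfold HasCompactSupport
      rw [hts]; exact hgc
    obtain ⟨C, hC⟩ := hcs.exists_bound_of_continuous hcg.continuous
    have hm : MemLp (fun x => (g x : ℂ)) 2 μ := by
      refine memLp_of_bounded_support hcg.continuous.aestronglyMeasurable
        (K := tsupport g) hgc.isCompact.measurableSet (hK _ hgc hgs) hC fun x hx => ?_
      rw [image_eq_zero_of_notMem_tsupport hx]; simp
    have h2 := h _ hcg hcs (by rw [hts]; exact hgs) hm.toLp hm.coeFn_toLp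
    rw [← inner_conj_symm, map_eq_zero, L2.inner_def] at h2
    rw [← h2]
    refine integral_congr_ae ?_
    filter_upwards [hm.coeFn_toLp] with x hx
    rw [hx]
    simp [mul_comm]
  apply Lp.ext
  filter_upwards [h1, hae, Lp.coeFn_zero ℂ 2 μ] with x h1 h2 h3
  rw [h1 h2, h3]; rfl

lemma isOpen_gamma : IsOpen {p : P | p.2 ≠ 0} := isOpen_ne_fun continuous_snd continuous_const

lemma isOpen_gamma₂ : IsOpen {q : Q | q.1.2 ≠ 0 ∧ q.2.2 ≠ 0} :=
  (isOpen_ne_fun (by fun_prop) continuous_const).inter (isOpen_ne_fun (by fun_prop) continuous_const)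

lemma isOpen_gammaU : IsOpen {q : Q | (q.1.2 ≠ 0 ∧ q.2.2 ≠ 0) ∧ q.2.1 + 1 ≠ 0} :=
  isOpen_gamma₂.inter (isOpen_ne_fun (by fun_prop) continuous_const)

lemma eq_zero_of_orthogonal_isTest {Φ : H} (h : ∀ g, IsTest g → ∀ ψ : H, ψ =ᵐ[mu] g →
    ⟪Φ, ψ⟫_ℂ = 0) : Φ = 0 :=
  eq_zero_of_orthogonal_test isOpen_gamma ae_mu_snd_ne_zero (fun _ h1 h2 => mu_lt_top h1 h2)
    fun g h1 h2 h3 => h g ⟨h1, h2, h3⟩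

lemma ae_mem_gamma₂ : ∀ᵐ q ∂(mu.prod mu), q.1.2 ≠ 0 ∧ q.2.2 ≠ 0 := by
  filter_upwards [ae_mu_mu_fst ae_mu_snd_ne_zero, ae_mu_mu_snd ae_mu_snd_ne_zero] with q h1 h2
  exact ⟨h1, h2⟩

lemma ae_add_one_ne_zero : ∀ᵐ p ∂mu, p.1 + 1 ≠ 0 := by
  filter_upwards [ae_mu_fst_ne (-1)] with q h1 h2
  exact h1 (by linarith)

lemma eq_zero_of_orthogonal_isTestU {Φ : H₂} (h : ∀ g, IsTestU g → ∀ ψ : H₂, ψ =ᵐ[mu.prod mu] g →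
    ⟪Φ, ψ⟫_ℂ = 0) : Φ = 0 := by
  refine eq_zero_of_orthogonal_test isOpen_gammaU ?_
    (fun K h1 h2 => mu_prod_lt_top h1 fun x hx => (h2 hx).1)
    fun g h1 h2 h3 => h g ⟨⟨h1, h2, fun x hx => (h3 hx).1⟩, fun x hx => (h3 hx).2⟩
  filter_upwards [ae_mem_gamma₂, ae_mu_mu_snd ae_add_one_ne_zero] with q h1 h2
  exact ⟨h1, h2⟩

lemma IsTest.memLp {f : P → ℂ} (hf : IsTest f) : MemLp f 2 mu := by
  obtain ⟨C, hC⟩ := hf.2.1.exists_bound_of_continuous hf.1.continuous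
  exact memLp_of_bounded_support hf.1.continuous.aestronglyMeasurable
    hf.2.1.isCompact.measurableSet (mu_lt_top hf.2.1 hf.2.2) hC
    fun x hx => image_eq_zero_of_notMem_tsupport hx

lemma IsTest₂.memLp {F : Q → ℂ} (hF : IsTest₂ F) : MemLp F 2 (mu.prod mu) := by
  obtain ⟨C, hC⟩ := hF.2.1.exists_bound_of_continuous hF.1.continuous
  exact memLp_of_bounded_support hF.1.continuous.aestronglyMeasurable
    hF.2.1.isCompact.measurableSet (mu_prod_lt_top hF.2.1 hF.2.2) hC
    fun x hx => image_eq_zero_of_notMem_tsupport hx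

/-- As `D` is total, the operator chosen in `opOn` is unique, so any operator with the right action
on `D` is that one. -/
lemma opOn_eq {X : Type*} [MeasurableSpace X] {μ : Measure X} {D : (X → ℂ) → Prop}
    {K : (X → ℂ) → X → ℂ}
    (hd : ∀ Φ : Lp ℂ 2 μ, (∀ g, D g → ∀ ψ : Lp ℂ 2 μ, ψ =ᵐ[μ] g → ⟪Φ, ψ⟫_ℂ = 0) → Φ = 0)
    {A : Lp ℂ 2 μ →L[ℂ] Lp ℂ 2 μ} (hA : ∀ f, D f → ∀ ψ : Lp ℂ 2 μ, ψ =ᵐ[μ] f → A ψ =ᵐ[μ] K f) :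
    opOn μ D K = A := by
  have h : ∃ m : Lp ℂ 2 μ →L[ℂ] Lp ℂ 2 μ, ∀ f, D f → ∀ ψ : Lp ℂ 2 μ, ψ =ᵐ[μ] f → m ψ =ᵐ[μ] K f :=
    ⟨A, hA⟩
  rw [opOn, dif_pos h]
  refine ext_of_inner_dense (D := {ψ : Lp ℂ 2 μ | ∃ g, D g ∧ ψ =ᵐ[μ] g}) (fun Φ hΦ => hd Φ fun g hg ψ hψ =>
    hΦ ψ ⟨g, hg, hψ⟩) ?_
  rintro ψ ⟨g, hg, hψ⟩
  exact Lp.ext ((h.choose_spec g hg ψ hψ).trans (hA g hg ψ hψ).symm)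

end TestFunctions

/-! ### Schur's test -/

section Schur

open scoped NNReal

variable {X Y : Type*} [MeasurableSpace X] [MeasurableSpace Y] {m : Measure X} {n : Measure Y}

lemma eLpNorm_two_sq (f : X → ℂ) : eLpNorm f 2 m ^ 2 = ∫⁻ x, ‖f x‖ₑ ^ 2 ∂m := by
  have := eLpNorm_nnreal_pow_eq_lintegral (μ := m) (f := f) (p := 2) (by norm_num)
  simpa using this

/-- The Cauchy–Schwarz inequality with weight f, from the splitting f g = f^(1/2) (f g²)^(1/2). -/
lemma lintegral_mul_sq_le {f g : Y → ℝ≥0∞} (hf : Measurable f) (hg : Measurable g) :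
    (∫⁻ y, f y * g y ∂n) ^ 2 ≤ (∫⁻ y, f y ∂n) * ∫⁻ y, f y * g y ^ 2 ∂n := by
  have h := ENNReal.lintegral_mul_norm_pow_le (μ := n) hf.aemeasurable
    (hf.mul (hg.pow_const 2)).aemeasurable (p := 1 / 2) (q := 1 / 2) (by norm_num) (by norm_num)
    (by norm_num)
  have h1 : ∀ y, f y ^ (1 / 2 : ℝ) * (f * fun x => g x ^ 2) y ^ (1 / 2 : ℝ) = f y * g y := by
    intro y
    rw [← ENNReal.mul_rpow_of_nonneg _ _ (by norm_num), Pi.mul_apply,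
      show f y * (f y * g y ^ 2) = (f y * g y) ^ 2 by ring, ← ENNReal.rpow_natCast,
      ← ENNReal.rpow_mul]
    norm_num
  simp only [h1] at h
  calc (∫⁻ y, f y * g y ∂n) ^ 2
      ≤ ((∫⁻ y, f y ∂n) ^ (1 / 2 : ℝ) * (∫⁻ y, f y * g y ^ 2 ∂n) ^ (1 / 2 : ℝ)) ^ 2 := by
        gcongr
        exact h
    _ = _ := by
        rw [mul_pow, ← ENNReal.rpow_natCast, ← ENNReal.rpow_natCast, ← ENNReal.rpow_mul,
          ← ENNReal.rpow_mul]
        norm_num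

variable (m n) in
/-- Hypotheses of Schur's test for the operator `ψ ↦ ∫ k(x, y) ψ(s(x, y)) dn(y)`. -/
structure IsSchur (k : X → Y → ℂ) (s : X → Y → X) (C₁ C₂ : ℝ≥0) : Prop where
  measurable_ker : Measurable (Function.uncurry k)
  measurable_map : Measurable (Function.uncurry s)
  bound : ∀ x, ∫⁻ y, ‖k x y‖ₑ ∂n ≤ C₁
  bound' : ∀ u : X → ℝ≥0∞, Measurable u →
    ∫⁻ x, ∫⁻ y, ‖k x y‖ₑ * u (s x y) ∂n ∂m ≤ C₂ * ∫⁻ x, u x ∂m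

/-- By Tonelli and, for fixed y, the substitution of τ(x, y) for x, the second condition becomes a
pointwise bound on ∫ |k(τ(x, y), y)| dn(y). -/
lemma isSchur_of_measurePreserving [SFinite m] [SFinite n] {k : X → Y → ℂ} {s τ : X → Y → X} {C₁ C₂ : ℝ≥0}
    (hk : Measurable (Function.uncurry k)) (hs : Measurable (Function.uncurry s))
    (hτ : Measurable (Function.uncurry τ))
    (hmp : ∀ᵐ y ∂n, MeasurePreserving (fun x => τ x y) m m ∧ ∀ x, s (τ x y) y = x)
    (h₁ : ∀ x, ∫⁻ y, ‖k x y‖ₑ ∂n ≤ C₁) (h₂ : ∀ x, ∫⁻ y, ‖k (τ x y) y‖ₑ ∂n ≤ C₂) :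
    IsSchur m n k s C₁ C₂ where
  measurable_ker := hk
  measurable_map := hs
  bound := h₁
  bound' u hu := by
    have hm1 : Measurable (Function.uncurry fun x y => ‖k x y‖ₑ * u (s x y)) :=
      hk.enorm.mul (hu.comp hs)
    have hkt : Measurable (Function.uncurry fun x y => ‖k (τ x y) y‖ₑ) :=
      (hk.comp (hτ.prodMk measurable_snd)).enorm
    rw [lintegral_lintegral_swap hm1.aemeasurable]
    have h3 : ∫⁻ y, ∫⁻ x, ‖k x y‖ₑ * u (s x y) ∂m ∂n = ∫⁻ y, ∫⁻ x, ‖k (τ x y) y‖ₑ * u x ∂m ∂n := by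
      refine lintegral_congr_ae ?_
      filter_upwards [hmp] with y hy
      rw [← hy.1.lintegral_comp (hm1.of_uncurry_right (y := y))]
      simp only [hy.2]
    have hm2 : Measurable (Function.uncurry fun y x => ‖k (τ x y) y‖ₑ * u x) :=
      (hkt.comp measurable_swap).mul (hu.comp measurable_snd)
    rw [h3, lintegral_lintegral_swap hm2.aemeasurable, ← lintegral_const_mul _ hu]
    refine lintegral_mono fun x => ?_
    change ∫⁻ y, ‖k (τ x y) y‖ₑ * u x ∂n ≤ C₂ * u x
    rw [lintegral_mul_const _ hkt.of_uncurry_left]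
    gcongr
    exact h₂ x

/-- The function `x ↦ ∫ k(x, y) ψ(s(x, y)) dn(y)`. -/
def kerFun (n : Measure Y) (k : X → Y → ℂ) (s : X → Y → X) (ψ : X → ℂ) (x : X) : ℂ :=
  ∫ y, k x y * ψ (s x y) ∂n

namespace IsSchur

variable [SFinite n] {k : X → Y → ℂ} {s : X → Y → X} {C₁ C₂ : ℝ≥0}

/-- The second Schur bound for the indicator of a null set N says that s(x, y) ∈ N forces k(x, y) =
0 almost everywhere. So the integral depends only on the class of ψ, although s(x, ·) itself may
charge null sets. -/
lemma ae_eq (h : IsSchur m n k s C₁ C₂) {ψ φ : X → ℂ} (hψ : ψ =ᵐ[m] φ) :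
    ∀ᵐ x ∂m, ∀ᵐ y ∂n, k x y * ψ (s x y) = k x y * φ (s x y) := by
  obtain ⟨N, hN, hNm, hN0⟩ := exists_measurable_superset_of_null (ae_iff.1 hψ)
  have h1 := h.bound' (N.indicator 1) (measurable_one.indicator hNm)
  rw [lintegral_indicator_one hNm, hN0, mul_zero, nonpos_iff_eq_zero] at h1
  have hm : Measurable (Function.uncurry fun x y => ‖k x y‖ₑ * (N.indicator 1 : X → ℝ≥0∞) (s x y)) :=
    h.measurable_ker.enorm.mul ((measurable_one.indicator hNm).comp h.measurable_map)
  rw [lintegral_eq_zero_iff hm.lintegral_prod_right] at h1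
  filter_upwards [h1] with x hx
  have hx' : ∫⁻ y, ‖k x y‖ₑ * (N.indicator 1 : X → ℝ≥0∞) (s x y) ∂n = 0 := hx
  rw [lintegral_eq_zero_iff hm.of_uncurry_left] at hx'
  filter_upwards [hx'] with y hy
  have hy' : ‖k x y‖ₑ * (N.indicator 1 : X → ℝ≥0∞) (s x y) = 0 := hy
  rcases mul_eq_zero.1 hy' with h2 | h2
  · rw [enorm_eq_zero.1 h2, zero_mul, zero_mul]
  · have : s x y ∉ N := fun hin => by simp [indicator_of_mem hin] at h2
    have h3 : ψ (s x y) = φ (s x y) := by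
      by_contra hne
      exact this (hN hne)
    rw [h3]

lemma kerFun_ae_eq (h : IsSchur m n k s C₁ C₂) {ψ φ : X → ℂ} (hψ : ψ =ᵐ[m] φ) :
    kerFun n k s ψ =ᵐ[m] kerFun n k s φ := by
  filter_upwards [h.ae_eq hψ] with x hx
  exact integral_congr_ae hx

/-- Cauchy–Schwarz in y costs the factor C₁; integration over x then costs C₂. -/
lemma lintegral_sq_le (h : IsSchur m n k s C₁ C₂) {ψ : X → ℂ} (hψ : Measurable ψ) :
    ∫⁻ x, (∫⁻ y, ‖k x y * ψ (s x y)‖ₑ ∂n) ^ 2 ∂m ≤ (C₁ * C₂ : ℝ≥0) * ∫⁻ x, ‖ψ x‖ₑ ^ 2 ∂m := by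
  have h1 : ∀ x, (∫⁻ y, ‖k x y * ψ (s x y)‖ₑ ∂n) ^ 2 ≤
      C₁ * ∫⁻ y, ‖k x y‖ₑ * ‖ψ (s x y)‖ₑ ^ 2 ∂n := by
    intro x
    simp_rw [enorm_mul]
    have hu : Measurable (Function.uncurry fun x y => ‖ψ (s x y)‖ₑ) :=
      (hψ.comp h.measurable_map).enorm
    have hk : Measurable (Function.uncurry fun x y => ‖k x y‖ₑ) := h.measurable_ker.enorm
    refine (lintegral_mul_sq_le hk.of_uncurry_left hu.of_uncurry_left).trans ?_
    gcongr
    exact h.bound x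
  refine (lintegral_mono h1).trans ?_
  have hm : Measurable (Function.uncurry fun x y => ‖k x y‖ₑ * ‖ψ (s x y)‖ₑ ^ 2) :=
    h.measurable_ker.enorm.mul ((hψ.comp h.measurable_map).enorm.pow_const 2)
  rw [lintegral_const_mul _ hm.lintegral_prod_right, ENNReal.coe_mul, mul_assoc]
  gcongr
  exact h.bound' (fun x => ‖ψ x‖ₑ ^ 2) (hψ.enorm.pow_const 2)

lemma aestronglyMeasurable (h : IsSchur m n k s C₁ C₂) {ψ : X → ℂ} (hψ : Measurable ψ) :
    StronglyMeasurable (kerFun n k s ψ) :=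
  StronglyMeasurable.integral_prod_right
    (f := fun x y => k x y * ψ (s x y)) (h.measurable_ker.mul (hψ.comp h.measurable_map)).stronglyMeasurable

lemma memLp (h : IsSchur m n k s C₁ C₂) (ψ : Lp ℂ 2 m) : MemLp (kerFun n k s ψ) 2 m := by
  have hψ : Measurable ψ := (Lp.stronglyMeasurable ψ).measurable
  refine ⟨(h.aestronglyMeasurable hψ).aestronglyMeasurable, ?_⟩
  have h1 : eLpNorm (kerFun n k s ψ) 2 m ^ 2 < ⊤ := by
    rw [eLpNorm_two_sq]
    refine lt_of_le_of_lt (lintegral_mono fun x => ?_)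
      ((h.lintegral_sq_le hψ).trans_lt (ENNReal.mul_lt_top ENNReal.coe_lt_top ?_))
    · gcongr
      exact enorm_integral_le_lintegral_enorm _
    · rw [← eLpNorm_two_sq]
      exact ENNReal.pow_lt_top (Lp.memLp ψ).2
  by_contra hc
  rw [not_lt, top_le_iff] at hc
  rw [hc] at h1
  simp at h1

lemma ae_integrable (h : IsSchur m n k s C₁ C₂) (ψ : Lp ℂ 2 m) :
    ∀ᵐ x ∂m, Integrable (fun y => k x y * ψ (s x y)) n := by
  have hψ : Measurable ψ := (Lp.stronglyMeasurable ψ).measurable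
  have hm : Measurable (Function.uncurry fun x y => k x y * ψ (s x y)) :=
    h.measurable_ker.mul (hψ.comp h.measurable_map)
  have h2 : ∫⁻ x, (∫⁻ y, ‖k x y * ψ (s x y)‖ₑ ∂n) ^ 2 ∂m ≠ ⊤ := by
    refine ((h.lintegral_sq_le hψ).trans_lt (ENNReal.mul_lt_top ENNReal.coe_lt_top ?_)).ne
    rw [← eLpNorm_two_sq]
    exact ENNReal.pow_lt_top (Lp.memLp ψ).2
  have hm2 : Measurable fun x => (∫⁻ y, ‖k x y * ψ (s x y)‖ₑ ∂n) ^ 2 :=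
    (Measurable.lintegral_prod_right (f := fun x y => ‖k x y * ψ (s x y)‖ₑ) hm.enorm).pow_const 2
  filter_upwards [ae_lt_top hm2 h2] with x hx
  refine ⟨(hm.of_uncurry_left (f := fun x y => k x y * ψ (s x y)) (x := x)).aestronglyMeasurable, ?_⟩
  by_contra hc
  rw [HasFiniteIntegral, not_lt, top_le_iff] at hc
  rw [hc] at hx
  simp at hx

lemma norm_toLp_le (h : IsSchur m n k s C₁ C₂) (ψ : Lp ℂ 2 m) :
    ‖(h.memLp ψ).toLp‖ ≤ Real.sqrt (C₁ * C₂) * ‖ψ‖ := by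
  have hψ : Measurable ψ := (Lp.stronglyMeasurable ψ).measurable
  have h1 : eLpNorm (kerFun n k s ψ) 2 m ^ 2 ≤ (C₁ * C₂ : ℝ≥0) * eLpNorm ψ 2 m ^ 2 := by
    rw [eLpNorm_two_sq, eLpNorm_two_sq]
    refine le_trans (lintegral_mono fun x => ?_) (h.lintegral_sq_le hψ)
    gcongr
    exact enorm_integral_le_lintegral_enorm _
  rw [Lp.norm_toLp, Lp.norm_def]
  have h2 := ENNReal.toReal_mono (ENNReal.mul_ne_top ENNReal.coe_ne_top
    (ENNReal.pow_ne_top (Lp.memLp ψ).2.ne)) h1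
  rw [ENNReal.toReal_mul, ENNReal.toReal_pow, ENNReal.toReal_pow, ENNReal.coe_toReal] at h2
  refine abs_le_of_sq_le_sq' ?_ (by positivity) |>.2
  rw [mul_pow, Real.sq_sqrt (by positivity)]
  exact_mod_cast h2

/-- The operator `ψ ↦ ∫ k(x, y) ψ(s(x, y)) dn(y)`. -/
def op (h : IsSchur m n k s C₁ C₂) : Lp ℂ 2 m →L[ℂ] Lp ℂ 2 m :=
  LinearMap.mkContinuous
    { toFun := fun ψ => (h.memLp ψ).toLp
      map_add' := fun ψ φ => by
        apply Lp.ext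
        filter_upwards [(h.memLp (ψ + φ)).coeFn_toLp, (h.memLp ψ).coeFn_toLp, (h.memLp φ).coeFn_toLp,
          Lp.coeFn_add (h.memLp ψ).toLp (h.memLp φ).toLp, h.kerFun_ae_eq (Lp.coeFn_add ψ φ),
          h.ae_integrable ψ, h.ae_integrable φ] with x h1 h2 h3 h4 h5 h6 h7
        rw [h1, h4, Pi.add_apply, h2, h3, h5, kerFun, kerFun, kerFun, ← integral_add h6 h7]
        congr 1
        ext y
        rw [Pi.add_apply]; ring
      map_smul' := fun c ψ => by
        apply Lp.ext
        filter_upwards [(h.memLp (c • ψ)).coeFn_toLp, (h.memLp ψ).coeFn_toLp,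
          Lp.coeFn_smul c (h.memLp ψ).toLp, h.kerFun_ae_eq (Lp.coeFn_smul c ψ)] with x h1 h2 h3 h4
        simp only [RingHom.id_apply]
        rw [h1, h3, Pi.smul_apply, h2, h4, kerFun, kerFun, smul_eq_mul, ← integral_const_mul]
        congr 1
        ext y
        rw [Pi.smul_apply, smul_eq_mul]; ring }
    (Real.sqrt (C₁ * C₂)) h.norm_toLp_le

lemma op_ae (h : IsSchur m n k s C₁ C₂) (ψ : Lp ℂ 2 m) : h.op ψ =ᵐ[m] kerFun n k s ψ :=
  (h.memLp ψ).coeFn_toLp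

lemma op_ae_of_ae_eq (h : IsSchur m n k s C₁ C₂) {ψ : Lp ℂ 2 m} {f : X → ℂ} (hf : ψ =ᵐ[m] f) :
    h.op ψ =ᵐ[m] kerFun n k s f := (h.op_ae ψ).trans (h.kerFun_ae_eq hf)

lemma norm_op_le (h : IsSchur m n k s C₁ C₂) : ‖h.op‖ ≤ Real.sqrt (C₁ * C₂) :=
  LinearMap.mkContinuous_norm_le _ (Real.sqrt_nonneg _) _

end IsSchur

lemma lintegral_enorm_le_of_support {k : Y → ℂ} {C : ℝ≥0} {A : Set Y} (hA : MeasurableSet A)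
    (hC : ∀ y, ‖k y‖ ≤ C) (h0 : ∀ y, y ∉ A → k y = 0) : ∫⁻ y, ‖k y‖ₑ ∂n ≤ C * n A := by
  calc ∫⁻ y, ‖k y‖ₑ ∂n ≤ ∫⁻ y, A.indicator (fun _ => (C : ℝ≥0∞)) y ∂n := by
        refine lintegral_mono fun y => ?_
        by_cases hy : y ∈ A
        · rw [indicator_of_mem hy]
          exact enorm_le_coe.2 (by exact_mod_cast hC y)
        · rw [h0 y hy]; simp
    _ = _ := lintegral_indicator_const hA _

end Schur

/-! ### Left convolution operators -/

section Representations

open scoped NNReal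

lemma isSchur_conv {f : P → ℂ} (hf : Measurable f) {C : ℝ≥0} {A : Set ℝ} (hA : IsCompact A)
    (hA0 : A ⊆ {0}ᶜ) (hC : ∀ p, ‖f p‖ ≤ C) (h0 : ∀ p : P, p.2 ∉ A → f p = 0) :
    IsSchur mu nu (fun p h => f (p.1, h)) (fun p h => (p.1 / h, p.2 / h))
      (C * (nu A).toNNReal) (C * (nu A).toNNReal) := by
  have hb : ((C * (nu A).toNNReal : ℝ≥0) : ℝ≥0∞) = C * nu A := by
    rw [ENNReal.coe_mul, ENNReal.coe_toNNReal (nu_lt_top hA hA0).ne]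
  refine isSchur_of_measurePreserving (τ := fun p h => h • p) (by fun_prop) (by fun_prop)
    (by fun_prop) ?_ (fun p => ?_) fun p => ?_
  · filter_upwards [ae_nu_ne_zero] with h hh
    refine ⟨measurePreserving_smul_mu hh, fun p => ?_⟩
    ext <;> simp [hh]
  · rw [hb]
    exact lintegral_enorm_le_of_support hA.measurableSet (fun h => hC _) fun h hh => h0 _ hh
  · rw [hb]
    exact lintegral_enorm_le_of_support hA.measurableSet (fun h => hC _) fun h hh => h0 _ hh

lemma conv_eq_kerFun (f g : P → ℂ) :
    conv f g = kerFun nu (fun p h => f (p.1, h)) (fun p h => (p.1 / h, p.2 / h)) g := by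
  funext p
  rw [conv, kerFun, integral_nu]

lemma IsTest.exists_bounds {f : P → ℂ} (hf : IsTest f) : ∃ (C : ℝ≥0) (A : Set ℝ), IsCompact A ∧
    A ⊆ {0}ᶜ ∧ (∀ p, ‖f p‖ ≤ C) ∧ ∀ p : P, p.2 ∉ A → f p = 0 := by
  obtain ⟨C, hC⟩ := hf.2.1.exists_bound_of_continuous hf.1.continuous
  refine ⟨⟨C, (norm_nonneg _).trans (hC 0)⟩, Prod.snd '' tsupport f,
    hf.2.1.isCompact.image continuous_snd, ?_, hC, fun p hp => ?_⟩
  · rintro _ ⟨p, hp, rfl⟩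
    exact hf.2.2 hp
  · by_contra hne
    exact hp ⟨p, subset_tsupport f hne, rfl⟩

lemma rep_eq_op {f : P → ℂ} {C₁ C₂ : ℝ≥0} (hs : IsSchur mu nu (fun p h => f (p.1, h))
    (fun p h => (p.1 / h, p.2 / h)) C₁ C₂) : rep f = hs.op := by
  refine opOn_eq (fun Φ => eq_zero_of_orthogonal_isTest) fun g _ ψ hψ => ?_
  rw [conv_eq_kerFun]
  exact hs.op_ae_of_ae_eq hψ

lemma rep_ae {f : P → ℂ} (hf : IsTest f) {ψ : H} {g : P → ℂ} (hg : ψ =ᵐ[mu] g) :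
    rep f ψ =ᵐ[mu] conv f g := by
  obtain ⟨C, A, hA, hA0, hC, h0⟩ := hf.exists_bounds
  have hs := isSchur_conv hf.1.continuous.measurable hA hA0 hC h0
  rw [rep_eq_op hs, conv_eq_kerFun]
  exact hs.op_ae_of_ae_eq hg

lemma norm_rep_le {f : P → ℂ} (hf : IsTest f) {C : ℝ} {A : Set ℝ} (hA : IsCompact A)
    (hA0 : A ⊆ {0}ᶜ) (hC : ∀ p, ‖f p‖ ≤ C) (h0 : ∀ p : P, p.2 ∉ A → f p = 0) :
    ‖rep f‖ ≤ C * (nu A).toReal := by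
  lift C to ℝ≥0 using (norm_nonneg _).trans (hC 0)
  have hs := isSchur_conv hf.1.continuous.measurable hA hA0 hC h0
  rw [rep_eq_op hs]
  refine hs.norm_op_le.trans ?_
  rw [Real.sqrt_mul_self (by positivity)]
  exact le_rfl

/-- The two Schur constants are kept apart: for functions concentrated near z₂ = -1 only the second
one becomes small. -/
lemma isSchur_conv₂ {F : Q → ℂ} (hF : Measurable F) {C₁ C₂ : ℝ≥0}
    (h₁ : ∀ q : Q, ∫⁻ h : ℝ × ℝ, ‖F ((q.1.1, h.1), (q.2.1, h.2))‖ₑ ∂(nu.prod nu) ≤ C₁)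
    (h₂ : ∀ q : Q, ∫⁻ h : ℝ × ℝ, ‖F ((h.1 * q.1.1, h.1), (h.2 * q.2.1, h.2))‖ₑ ∂(nu.prod nu) ≤ C₂) :
    IsSchur (mu.prod mu) (nu.prod nu) (fun (q : Q) (h : ℝ × ℝ) => F ((q.1.1, h.1), (q.2.1, h.2)))
      (fun q h => ((q.1.1 / h.1, q.1.2 / h.1), (q.2.1 / h.2, q.2.2 / h.2))) C₁ C₂ := by
  refine isSchur_of_measurePreserving (τ := fun q h => (h.1 • q.1, h.2 • q.2)) (by fun_prop)
    (by fun_prop) (by fun_prop) ?_ h₁ h₂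
  have h1 : ∀ᵐ h ∂(nu.prod nu), h.1 ≠ 0 := Measure.quasiMeasurePreserving_fst.ae ae_nu_ne_zero
  have h2 : ∀ᵐ h ∂(nu.prod nu), h.2 ≠ 0 := Measure.quasiMeasurePreserving_snd.ae ae_nu_ne_zero
  filter_upwards [h1, h2] with h hh1 hh2
  refine ⟨(measurePreserving_smul_mu hh1).prod (measurePreserving_smul_mu hh2), fun p => ?_⟩
  ext <;> simp [hh1, hh2]

lemma conv₂_eq_kerFun (F G : Q → ℂ) :
    conv₂ F G = kerFun (nu.prod nu) (fun (q : Q) (h : ℝ × ℝ) => F ((q.1.1, h.1), (q.2.1, h.2)))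
      (fun q h => ((q.1.1 / h.1, q.1.2 / h.1), (q.2.1 / h.2, q.2.2 / h.2))) G := by
  funext q
  rw [conv₂, kerFun, integral_nu_prod]

lemma IsTest₂.exists_bounds {F : Q → ℂ} (hF : IsTest₂ F) : ∃ (C : ℝ≥0) (A : Set ℝ), IsCompact A ∧
    A ⊆ {0}ᶜ ∧ (∀ q, ‖F q‖ ≤ C) ∧ ∀ q : Q, ¬(q.1.2 ∈ A ∧ q.2.2 ∈ A) → F q = 0 := by
  obtain ⟨C, hC⟩ := hF.2.1.exists_bound_of_continuous hF.1.continuous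
  refine ⟨⟨C, (norm_nonneg _).trans (hC 0)⟩,
    ((fun q : Q => q.1.2) '' tsupport F) ∪ ((fun q : Q => q.2.2) '' tsupport F),
    (hF.2.1.isCompact.image (by fun_prop)).union (hF.2.1.isCompact.image (by fun_prop)), ?_, hC,
    fun q hq => ?_⟩
  · rintro _ (⟨p, hp, rfl⟩ | ⟨p, hp, rfl⟩)
    · exact (hF.2.2 hp).1
    · exact (hF.2.2 hp).2
  · by_contra hne
    have := subset_tsupport F hne
    exact hq ⟨Or.inl ⟨q, this, rfl⟩, Or.inr ⟨q, this, rfl⟩⟩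

lemma rep₂_eq_op {F : Q → ℂ} {C₁ C₂ : ℝ≥0} (hs : IsSchur (mu.prod mu) (nu.prod nu)
    (fun (q : Q) (h : ℝ × ℝ) => F ((q.1.1, h.1), (q.2.1, h.2)))
      (fun q h => ((q.1.1 / h.1, q.1.2 / h.1), (q.2.1 / h.2, q.2.2 / h.2))) C₁ C₂) :
    rep₂ F = hs.op := by
  refine opOn_eq (fun Φ h => eq_zero_of_orthogonal_isTestU fun g hg => h g hg.1) fun g _ ψ hψ => ?_
  rw [conv₂_eq_kerFun]
  exact hs.op_ae_of_ae_eq hψ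

lemma lintegral_prod_le_of_support {F : ℝ × ℝ → ℂ} {C : ℝ≥0} {A B : Set ℝ} (hA : MeasurableSet A)
    (hB : MeasurableSet B) (hC : ∀ h, ‖F h‖ ≤ C) (h0 : ∀ h : ℝ × ℝ, ¬(h.1 ∈ A ∧ h.2 ∈ B) → F h = 0) :
    ∫⁻ h, ‖F h‖ₑ ∂(nu.prod nu) ≤ C * (nu A * nu B) := by
  rw [← Measure.prod_prod]
  exact lintegral_enorm_le_of_support (hA.prod hB) hC h0

lemma isSchur_conv₂_of_support {F : Q → ℂ} (hF : Measurable F) {C : ℝ≥0} {A : Set ℝ}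
    (hA : IsCompact A) (hA0 : A ⊆ {0}ᶜ) (hC : ∀ p, ‖F p‖ ≤ C)
    (h0 : ∀ q : Q, ¬(q.1.2 ∈ A ∧ q.2.2 ∈ A) → F q = 0) :
    IsSchur (mu.prod mu) (nu.prod nu) (fun (q : Q) (h : ℝ × ℝ) => F ((q.1.1, h.1), (q.2.1, h.2)))
      (fun q h => ((q.1.1 / h.1, q.1.2 / h.1), (q.2.1 / h.2, q.2.2 / h.2)))
      (C * ((nu A).toNNReal * (nu A).toNNReal)) (C * ((nu A).toNNReal * (nu A).toNNReal)) := by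
  have hb : ((C * ((nu A).toNNReal * (nu A).toNNReal) : ℝ≥0) : ℝ≥0∞) = C * (nu A * nu A) := by
    rw [ENNReal.coe_mul, ENNReal.coe_mul, ENNReal.coe_toNNReal (nu_lt_top hA hA0).ne]
  refine isSchur_conv₂ hF (fun q => ?_) fun q => ?_
  · rw [hb]
    exact lintegral_prod_le_of_support hA.measurableSet hA.measurableSet (fun h => hC _)
      fun h hh => h0 _ hh
  · rw [hb]
    exact lintegral_prod_le_of_support hA.measurableSet hA.measurableSet (fun h => hC _)
      fun h hh => h0 _ hh

lemma rep₂_ae {F : Q → ℂ} (hF : IsTest₂ F) {ψ : H₂} {g : Q → ℂ} (hg : ψ =ᵐ[mu.prod mu] g) :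
    rep₂ F ψ =ᵐ[mu.prod mu] conv₂ F g := by
  obtain ⟨C, A, hA, hA0, hC, h0⟩ := hF.exists_bounds
  have hs := isSchur_conv₂_of_support hF.1.continuous.measurable hA hA0 hC h0
  rw [rep₂_eq_op hs, conv₂_eq_kerFun]
  exact hs.op_ae_of_ae_eq hg

lemma norm_rep₂_le {F : Q → ℂ} (hF : IsTest₂ F) {C : ℝ} {A : Set ℝ} (hA : IsCompact A)
    (hA0 : A ⊆ {0}ᶜ) (hC : ∀ p, ‖F p‖ ≤ C)
    (h0 : ∀ q : Q, ¬(q.1.2 ∈ A ∧ q.2.2 ∈ A) → F q = 0) :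
    ‖rep₂ F‖ ≤ C * ((nu A).toReal * (nu A).toReal) := by
  lift C to ℝ≥0 using (norm_nonneg _).trans (hC 0)
  have hs := isSchur_conv₂_of_support hF.1.continuous.measurable hA hA0 hC h0
  rw [rep₂_eq_op hs]
  refine hs.norm_op_le.trans ?_
  rw [Real.sqrt_mul_self (by positivity)]
  exact le_rfl

/-- The operator on `L²(Γ × Γ)` which acts on test functions as `δ̂₀(f)`. -/
def deltaOp (f : P → ℂ) : H₂ →L[ℂ] H₂ := opOn (mu.prod mu) IsTest₂ (delta₀ f)

lemma delta₀_eq_kerFun (f : P → ℂ) (G : Q → ℂ) :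
    delta₀ f G = kerFun nu (fun (q : Q) (h : ℝ) => f (q.1.1 + q.2.1, h))
      (fun q h => ((q.1.1 / h, q.1.2 / h), (q.2.1 / h, q.2.2 / h))) G := by
  funext q
  rw [delta₀, kerFun, integral_nu]

lemma isSchur_delta₀ {f : P → ℂ} (hf : Measurable f) {C : ℝ≥0} {A : Set ℝ} (hA : IsCompact A)
    (hA0 : A ⊆ {0}ᶜ) (hC : ∀ p, ‖f p‖ ≤ C) (h0 : ∀ p : P, p.2 ∉ A → f p = 0) :
    IsSchur (mu.prod mu) nu (fun (q : Q) (h : ℝ) => f (q.1.1 + q.2.1, h))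
      (fun q h => ((q.1.1 / h, q.1.2 / h), (q.2.1 / h, q.2.2 / h)))
      (C * (nu A).toNNReal) (C * (nu A).toNNReal) := by
  have hb : ((C * (nu A).toNNReal : ℝ≥0) : ℝ≥0∞) = C * nu A := by
    rw [ENNReal.coe_mul, ENNReal.coe_toNNReal (nu_lt_top hA hA0).ne]
  refine isSchur_of_measurePreserving (τ := fun q h => (h • q.1, h • q.2)) (by fun_prop) (by fun_prop)
    (by fun_prop) ?_ (fun p => ?_) fun p => ?_
  · filter_upwards [ae_nu_ne_zero] with h hh
    refine ⟨(measurePreserving_smul_mu hh).prod (measurePreserving_smul_mu hh), fun p => ?_⟩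
    ext <;> simp [hh]
  · rw [hb]
    exact lintegral_enorm_le_of_support hA.measurableSet (fun h => hC _) fun h hh => h0 _ hh
  · rw [hb]
    exact lintegral_enorm_le_of_support hA.measurableSet (fun h => hC _) fun h hh => h0 _ hh

lemma deltaOp_ae {f : P → ℂ} (hf : IsTest f) {ψ : H₂} {g : Q → ℂ} (hg : ψ =ᵐ[mu.prod mu] g) :
    deltaOp f ψ =ᵐ[mu.prod mu] delta₀ f g := by
  obtain ⟨C, A, hA, hA0, hC, h0⟩ := hf.exists_bounds
  have hs := isSchur_delta₀ hf.1.continuous.measurable hA hA0 hC h0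
  have h1 : deltaOp f = hs.op := by
    refine opOn_eq (fun Φ h => eq_zero_of_orthogonal_isTestU fun g hg => h g hg.1)
      fun g _ ψ hψ => ?_
    rw [delta₀_eq_kerFun]
    exact hs.op_ae_of_ae_eq hψ
  rw [h1, delta₀_eq_kerFun]
  exact hs.op_ae_of_ae_eq hg

lemma isTest_of {f : P → ℂ} (hf : ContDiff ℝ ∞ f) {K : Set P} (hK : IsCompact K)
    (hKΓ : K ⊆ {p | p.2 ≠ 0}) (h0 : ∀ x, x ∉ K → f x = 0) : IsTest f := by
  have : tsupport f ⊆ K := closure_minimal (fun x hx => by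
    by_contra hc; exact hx (h0 x hc)) hK.isClosed
  exact ⟨hf, hK.of_isClosed_subset isClosed_closure this, this.trans hKΓ⟩

lemma isTest₂_of {F : Q → ℂ} (hF : ContDiff ℝ ∞ F) {K : Set Q} (hK : IsCompact K)
    (hKΓ : K ⊆ {q | q.1.2 ≠ 0 ∧ q.2.2 ≠ 0}) (h0 : ∀ x, x ∉ K → F x = 0) : IsTest₂ F := by
  have : tsupport F ⊆ K := closure_minimal (fun x hx => by
    by_contra hc; exact hx (h0 x hc)) hK.isClosed
  exact ⟨hF, hK.of_isClosed_subset isClosed_closure this, this.trans hKΓ⟩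

lemma isTestU_of {F : Q → ℂ} (hF : ContDiff ℝ ∞ F) {K : Set Q} (hK : IsCompact K)
    (hKΓ : K ⊆ {q | q.1.2 ≠ 0 ∧ q.2.2 ≠ 0}) (hKU : K ⊆ {q | q.2.1 + 1 ≠ 0})
    (h0 : ∀ x, x ∉ K → F x = 0) : IsTestU F :=
  ⟨isTest₂_of hF hK hKΓ h0, (closure_minimal (fun x hx => by
    by_contra hc; exact hx (h0 x hc)) hK.isClosed).trans hKU⟩

end Representations

/-! ### Adjoints of convolution operators -/

section Adjoint

variable {X Y : Type*} [MeasurableSpace X] [MeasurableSpace Y] {m : Measure X} {n : Measure Y}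

lemma integrable_of_bounded_support {f : X → ℂ} (hf : AEStronglyMeasurable f m) {C : ℝ} {K : Set X}
    (hK : MeasurableSet K) (hm : m K < ⊤) (hC : ∀ x, ‖f x‖ ≤ C) (h0 : ∀ x, x ∉ K → f x = 0) :
    Integrable f m := by
  have h1 : Integrable (K.indicator fun _ => C) m :=
    (integrable_indicator_iff hK).2 (integrableOn_const hm.ne)
  refine h1.mono hf (Eventually.of_forall fun x => ?_)
  by_cases hx : x ∈ K
  · rw [indicator_of_mem hx]
    exact (hC x).trans (le_abs_self C)
  · rw [h0 x hx]; simp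

variable [SFinite m] [SFinite n]

/-- Substituting (s(x, y), ι y) for (x, y) in the double integral turns ψ(s(x, y)) into ψ(x) and
φ(x) into φ(s(x, y)), and Fubini's theorem is used on both sides. -/
lemma integral_conj_mul_kerFun {k k' : X → Y → ℂ} {s : X → Y → X} {ι : Y → Y} {φ ψ : X → ℂ}
    (hint : Integrable (fun p : X × Y => (starRingEnd ℂ) (φ p.1) * (k p.1 p.2 * ψ (s p.1 p.2)))
      (m.prod n))
    (hmp : MeasurePreserving (fun p : X × Y => (s p.1 p.2, ι p.2)) (m.prod n) (m.prod n))
    (hs : ∀ᵐ p ∂(m.prod n), s (s p.1 p.2) (ι p.2) = p.1)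
    (hk : ∀ x y, k' x y = (starRingEnd ℂ) (k (s x y) (ι y))) :
    ∫ x, (starRingEnd ℂ) (φ x) * kerFun n k s ψ x ∂m =
      ∫ x, (starRingEnd ℂ) (kerFun n k' s φ x) * ψ x ∂m := by
  have h1 : ∫ x, (starRingEnd ℂ) (φ x) * kerFun n k s ψ x ∂m =
      ∫ p, (starRingEnd ℂ) (φ p.1) * (k p.1 p.2 * ψ (s p.1 p.2)) ∂(m.prod n) := by
    rw [integral_prod _ hint]
    simp only [kerFun, integral_const_mul]
  have h2 : Integrable (fun p : X × Y => (starRingEnd ℂ) (k' p.1 p.2 * φ (s p.1 p.2)) * ψ p.1)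
      (m.prod n) := by
    refine (hmp.integrable_comp_of_integrable hint).congr ?_
    filter_upwards [hs] with p hp
    simp only [Function.comp_apply, hp, hk, map_mul, Complex.conj_conj]
    ring
  rw [h1, ← hmp.map_eq, integral_map hmp.measurable.aemeasurable (by rw [hmp.map_eq]; exact hint.1)]
  have h3 : ∫ x, (starRingEnd ℂ) (kerFun n k' s φ x) * ψ x ∂m =
      ∫ p, (starRingEnd ℂ) (k' p.1 p.2 * φ (s p.1 p.2)) * ψ p.1 ∂(m.prod n) := by
    rw [integral_prod _ h2]
    simp only [kerFun, integral_mul_const, ← integral_conj]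
  rw [h3]
  refine integral_congr_ae ?_
  filter_upwards [hs] with p hp
  simp only [hp, hk, map_mul, Complex.conj_conj]
  ring

lemma measurePreserving_shear {s : X → Y → X} {ι : Y → Y} (hs : Measurable (Function.uncurry s))
    (hι : MeasurePreserving ι n n) (h : ∀ᵐ y ∂n, MeasurePreserving (fun x => s x y) m m) :
    MeasurePreserving (fun p : X × Y => (s p.1 p.2, ι p.2)) (m.prod n) (m.prod n) := by
  have h1 := hι.skew_product (μc := m) (μd := m) (g := fun y x => s x y)
    (hs.comp measurable_swap) (h.mono fun y hy => hy.map_eq)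
  exact (Measure.measurePreserving_swap (μ := n) (ν := m)).comp
    (h1.comp (Measure.measurePreserving_swap (μ := m) (ν := n)))

end Adjoint

section AdjointRep

/-- The involution of the groupoid algebra of `Γ`. -/
def adj (f : P → ℂ) (p : P) : ℂ := (starRingEnd ℂ) (f (p.1 / p.2, 1 / p.2))

/-- The involution of the groupoid algebra of `Γ × Γ`. -/
def adj₂ (F : Q → ℂ) (q : Q) : ℂ :=
  (starRingEnd ℂ) (F ((q.1.1 / q.1.2, 1 / q.1.2), (q.2.1 / q.2.2, 1 / q.2.2)))

/-- This disposes of formulas with denominators: smoothness is checked only on O, and elsewhere the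
function vanishes in a neighbourhood because K is closed in the whole space. -/
lemma contDiff_of_vanish {E : Type*} [NormedAddCommGroup E] [NormedSpace ℝ E] {f : E → ℂ}
    {O K : Set E} (hO : IsOpen O) (hf : ContDiffOn ℝ ∞ f O) (hK : IsClosed K) (hKO : K ⊆ O)
    (h0 : ∀ x, x ∉ K → f x = 0) : ContDiff ℝ ∞ f := by
  rw [contDiff_iff_contDiffAt]
  intro x
  by_cases hx : x ∈ O
  · exact hf.contDiffAt (hO.mem_nhds hx)
  · have h1 : f =ᶠ[𝓝 x] fun _ => 0 := by
      filter_upwards [hK.isOpen_compl.mem_nhds fun h => hx (hKO h)] with y hy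
      exact h0 y hy
    exact contDiffAt_const.congr_of_eventuallyEq h1

lemma isTest_adj {f : P → ℂ} (hf : IsTest f) : IsTest (adj f) := by
  have hK : IsCompact ((fun p : P => (p.1 / p.2, 1 / p.2)) '' tsupport f) := by
    refine hf.2.1.isCompact.image_of_continuousOn ?_
    have : ∀ p ∈ tsupport f, p.2 ≠ 0 := fun p hp => hf.2.2 hp
    fun_prop (disch := assumption)
  have hKΓ : (fun p : P => (p.1 / p.2, 1 / p.2)) '' tsupport f ⊆ {p | p.2 ≠ 0} := by
    rintro _ ⟨p, hp, rfl⟩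
    exact one_div_ne_zero (hf.2.2 hp)
  have h0 : ∀ p, p ∉ (fun p : P => (p.1 / p.2, 1 / p.2)) '' tsupport f → adj f p = 0 := by
    intro p hp
    rw [adj, map_eq_zero]
    by_contra hne
    have h1 := subset_tsupport f hne
    have h2 : p.2 ≠ 0 := fun h => hf.2.2 h1 (by simp [h])
    exact hp ⟨_, h1, by ext <;> field_simp⟩
  refine isTest_of (contDiff_of_vanish isOpen_gamma ?_ hK.isClosed hKΓ h0) hK hKΓ h0
  refine Complex.conjCLE.contDiff.comp_contDiffOn (hf.1.comp_contDiffOn ?_)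
  have : ∀ p ∈ {p : P | p.2 ≠ 0}, p.2 ≠ 0 := fun p hp => hp
  exact (contDiffOn_fst.div contDiffOn_snd this).prodMk (contDiffOn_const.div contDiffOn_snd this)

lemma isTest₂_adj₂ {F : Q → ℂ} (hF : IsTest₂ F) : IsTest₂ (adj₂ F) := by
  set j : Q → Q := fun q => ((q.1.1 / q.1.2, 1 / q.1.2), (q.2.1 / q.2.2, 1 / q.2.2)) with hj
  have hjc : ContDiffOn ℝ ∞ j {q | q.1.2 ≠ 0 ∧ q.2.2 ≠ 0} := by
    have h1 : ∀ q ∈ {q : Q | q.1.2 ≠ 0 ∧ q.2.2 ≠ 0}, q.1.2 ≠ 0 := fun q hq => hq.1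
    have h2 : ∀ q ∈ {q : Q | q.1.2 ≠ 0 ∧ q.2.2 ≠ 0}, q.2.2 ≠ 0 := fun q hq => hq.2
    exact ((contDiff_fst.fst.contDiffOn.div contDiff_fst.snd.contDiffOn h1).prodMk
      (contDiffOn_const.div contDiff_fst.snd.contDiffOn h1)).prodMk
      ((contDiff_snd.fst.contDiffOn.div contDiff_snd.snd.contDiffOn h2).prodMk
      (contDiffOn_const.div contDiff_snd.snd.contDiffOn h2))
  have hK : IsCompact (j '' tsupport F) :=
    hF.2.1.isCompact.image_of_continuousOn (hjc.continuousOn.mono hF.2.2)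
  have hKΓ : j '' tsupport F ⊆ {q | q.1.2 ≠ 0 ∧ q.2.2 ≠ 0} := by
    rintro _ ⟨p, hp, rfl⟩
    exact ⟨one_div_ne_zero (hF.2.2 hp).1, one_div_ne_zero (hF.2.2 hp).2⟩
  have h0 : ∀ q, q ∉ j '' tsupport F → adj₂ F q = 0 := by
    intro q hq
    rw [adj₂, map_eq_zero]
    by_contra hne
    have h1 := subset_tsupport F hne
    have h2 : q.1.2 ≠ 0 := fun h => (hF.2.2 h1).1 (by simp [h])
    have h3 : q.2.2 ≠ 0 := fun h => (hF.2.2 h1).2 (by simp [h])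
    exact hq ⟨_, h1, by ext <;> simp only [hj] <;> field_simp⟩
  refine isTest₂_of (contDiff_of_vanish isOpen_gamma₂ ?_ hK.isClosed hKΓ h0) hK hKΓ h0
  exact Complex.conjCLE.contDiff.comp_contDiffOn (hF.1.comp_contDiffOn hjc)

lemma star_eq_of_inner {X : Type*} [MeasurableSpace X] {μ : Measure X} {D : (X → ℂ) → Prop}
    (hd : ∀ Φ : Lp ℂ 2 μ, (∀ g, D g → ∀ ψ : Lp ℂ 2 μ, ψ =ᵐ[μ] g → ⟪Φ, ψ⟫_ℂ = 0) → Φ = 0)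
    {A B : Lp ℂ 2 μ →L[ℂ] Lp ℂ 2 μ}
    (h : ∀ f g, D f → D g → ∀ φ ψ : Lp ℂ 2 μ, φ =ᵐ[μ] f → ψ =ᵐ[μ] g → ⟪φ, A ψ⟫_ℂ = ⟪B φ, ψ⟫_ℂ) :
    star A = B := by
  rw [ContinuousLinearMap.star_eq_adjoint]
  refine ext_of_inner_dense (D := {ψ : Lp ℂ 2 μ | ∃ g, D g ∧ ψ =ᵐ[μ] g}) (fun Φ hΦ => hd Φ fun g hg ψ hψ =>
    hΦ ψ ⟨g, hg, hψ⟩) ?_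
  rintro φ ⟨f, hf, hφ⟩
  rw [← sub_eq_zero]
  refine hd _ fun g hg ψ hψ => ?_
  rw [inner_sub_left, ContinuousLinearMap.adjoint_inner_left, h f g hf hg φ ψ hφ hψ, sub_self]

lemma star_rep {f : P → ℂ} (hf : IsTest f) : star (rep f) = rep (adj f) := by
  refine star_eq_of_inner (D := IsTest) (fun Φ => eq_zero_of_orthogonal_isTest)
    fun g g' hg hg' φ ψ hφ hψ => ?_
  rw [L2.inner_def, L2.inner_def]
  obtain ⟨C, A, hA, hA0, hC, h0⟩ := hf.exists_bounds
  obtain ⟨Cg, hCg⟩ := hg.2.1.exists_bound_of_continuous hg.1.continuous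
  obtain ⟨Cg', hCg'⟩ := hg'.2.1.exists_bound_of_continuous hg'.1.continuous
  have key := integral_conj_mul_kerFun (m := mu) (n := nu) (k := fun p h => f (p.1, h))
    (k' := fun p h => adj f (p.1, h)) (s := fun p h => (p.1 / h, p.2 / h)) (ι := fun h => h⁻¹)
    (φ := g) (ψ := g') ?_ ?_ ?_ ?_
  · rw [← conv_eq_kerFun, ← conv_eq_kerFun] at key
    refine Eq.trans (integral_congr_ae ?_) (key.trans (integral_congr_ae ?_))
    · filter_upwards [hφ, rep_ae hf hψ] with p h1 h2
      rw [h1, h2, RCLike.inner_apply, mul_comm]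
    · filter_upwards [hψ, rep_ae (isTest_adj hf) hφ] with p h1 h2
      rw [h1, h2, RCLike.inner_apply, mul_comm]
  · refine integrable_of_bounded_support (K := tsupport g ×ˢ A) (C := Cg * (C * Cg')) ?_
      (hg.2.1.isCompact.measurableSet.prod hA.measurableSet) ?_ ?_ ?_
    · have h1 := hf.1.continuous.measurable
      have h2 := hg.1.continuous.measurable
      have h3 := hg'.1.continuous.measurable
      exact Measurable.aestronglyMeasurable (by fun_prop)
    · rw [Measure.prod_prod]
      exact ENNReal.mul_lt_top (mu_lt_top hg.2.1 hg.2.2) (nu_lt_top hA hA0)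
    · intro p
      rw [norm_mul, norm_mul, RCLike.norm_conj]
      have := (norm_nonneg _).trans (hCg 0)
      gcongr
      · exact hCg _
      · exact hC _
      · exact hCg' _
    · intro p hp
      by_cases h1 : p.1 ∈ tsupport g
      · have h2 : p.2 ∉ A := fun h2 => hp ⟨h1, h2⟩
        rw [h0 (p.1.1, p.2) h2]; ring
      · rw [image_eq_zero_of_notMem_tsupport h1]; simp
  · refine measurePreserving_shear (s := fun (p : P) h => (p.1 / h, p.2 / h)) (by fun_prop) measurePreserving_inv_nu ?_
    filter_upwards [ae_nu_ne_zero] with h hh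
    convert measurePreserving_smul_mu (inv_ne_zero hh) using 1
    ext p <;> simp [div_eq_inv_mul]
  · have h2 : ∀ᵐ p ∂(mu.prod nu), p.2 ≠ 0 := Measure.quasiMeasurePreserving_snd.ae ae_nu_ne_zero
    filter_upwards [h2] with p hp
    ext <;> simp [hp]
  · intro p h
    simp [adj]

lemma star_rep₂ {F : Q → ℂ} (hF : IsTest₂ F) : star (rep₂ F) = rep₂ (adj₂ F) := by
  refine star_eq_of_inner (D := IsTest₂)
    (fun Φ h => eq_zero_of_orthogonal_isTestU fun g hg => h g hg.1)
    fun g g' hg hg' φ ψ hφ hψ => ?_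
  rw [L2.inner_def, L2.inner_def]
  obtain ⟨C, A, hA, hA0, hC, h0⟩ := hF.exists_bounds
  obtain ⟨Cg, hCg⟩ := hg.2.1.exists_bound_of_continuous hg.1.continuous
  obtain ⟨Cg', hCg'⟩ := hg'.2.1.exists_bound_of_continuous hg'.1.continuous
  have key := integral_conj_mul_kerFun (m := mu.prod mu) (n := nu.prod nu)
    (k := fun (q : Q) (h : ℝ × ℝ) => F ((q.1.1, h.1), (q.2.1, h.2)))
    (k' := fun (q : Q) (h : ℝ × ℝ) => adj₂ F ((q.1.1, h.1), (q.2.1, h.2)))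
    (s := fun q h => ((q.1.1 / h.1, q.1.2 / h.1), (q.2.1 / h.2, q.2.2 / h.2)))
    (ι := fun h => (h.1⁻¹, h.2⁻¹)) (φ := g) (ψ := g') ?_ ?_ ?_ ?_
  · rw [← conv₂_eq_kerFun, ← conv₂_eq_kerFun] at key
    refine Eq.trans (integral_congr_ae ?_) (key.trans (integral_congr_ae ?_))
    · filter_upwards [hφ, rep₂_ae hF hψ] with p h1 h2
      rw [h1, h2, RCLike.inner_apply, mul_comm]
    · filter_upwards [hψ, rep₂_ae (isTest₂_adj₂ hF) hφ] with p h1 h2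
      rw [h1, h2, RCLike.inner_apply, mul_comm]
  · refine integrable_of_bounded_support (K := tsupport g ×ˢ (A ×ˢ A)) (C := Cg * (C * Cg')) ?_
      (hg.2.1.isCompact.measurableSet.prod (hA.measurableSet.prod hA.measurableSet)) ?_ ?_ ?_
    · have h1 := hF.1.continuous.measurable
      have h2 := hg.1.continuous.measurable
      have h3 := hg'.1.continuous.measurable
      exact Measurable.aestronglyMeasurable (by fun_prop)
    · rw [Measure.prod_prod, Measure.prod_prod]
      exact ENNReal.mul_lt_top (mu_prod_lt_top hg.2.1 hg.2.2)
        (ENNReal.mul_lt_top (nu_lt_top hA hA0) (nu_lt_top hA hA0))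
    · intro p
      rw [norm_mul, norm_mul, RCLike.norm_conj]
      have := (norm_nonneg _).trans (hCg 0)
      gcongr
      · exact hCg _
      · exact hC _
      · exact hCg' _
    · intro p hp
      by_cases h1 : p.1 ∈ tsupport g
      · have h2 : ¬(p.2.1 ∈ A ∧ p.2.2 ∈ A) := fun h2 => hp ⟨h1, h2⟩
        rw [h0 ((p.1.1.1, p.2.1), (p.1.2.1, p.2.2)) h2]; ring
      · rw [image_eq_zero_of_notMem_tsupport h1]; simp
  · refine measurePreserving_shear
      (s := fun (q : Q) (h : ℝ × ℝ) => ((q.1.1 / h.1, q.1.2 / h.1), (q.2.1 / h.2, q.2.2 / h.2)))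
      (by fun_prop) (measurePreserving_inv_nu.prod measurePreserving_inv_nu) ?_
    have h1 : ∀ᵐ h ∂(nu.prod nu), h.1 ≠ 0 := Measure.quasiMeasurePreserving_fst.ae ae_nu_ne_zero
    have h2 : ∀ᵐ h ∂(nu.prod nu), h.2 ≠ 0 := Measure.quasiMeasurePreserving_snd.ae ae_nu_ne_zero
    filter_upwards [h1, h2] with h hh1 hh2
    convert (measurePreserving_smul_mu (inv_ne_zero hh1)).prod
      (measurePreserving_smul_mu (inv_ne_zero hh2)) using 1
    ext p <;> simp [div_eq_inv_mul]
  · have h1 : ∀ᵐ h ∂(nu.prod nu), h.1 ≠ 0 := Measure.quasiMeasurePreserving_fst.ae ae_nu_ne_zero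
    have h2 : ∀ᵐ h ∂(nu.prod nu), h.2 ≠ 0 := Measure.quasiMeasurePreserving_snd.ae ae_nu_ne_zero
    have h3 : ∀ᵐ p ∂((mu.prod mu).prod (nu.prod nu)), p.2.1 ≠ 0 :=
      Measure.quasiMeasurePreserving_snd.ae h1
    have h4 : ∀ᵐ p ∂((mu.prod mu).prod (nu.prod nu)), p.2.2 ≠ 0 :=
      Measure.quasiMeasurePreserving_snd.ae h2
    filter_upwards [h3, h4] with p hp1 hp2
    ext <;> simp [hp1, hp2]
  · intro p h
    simp [adj₂]

end AdjointRep

/-! ### Integrals depending smoothly on parameters -/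

section ParametricIntegral

/-- The integral is the convolution at 0 of the constant 1 with h ↦ k x (-h), which depends smoothly
on the parameter when the supports lie in a fixed compact set. -/
lemma contDiff_integral_param {E : Type*} [NormedAddCommGroup E] [NormedSpace ℝ E]
    {k : E → ℝ → ℂ} (hk : ContDiff ℝ ∞ (Function.uncurry k)) {A : Set ℝ} (hA : IsCompact A)
    (h0 : ∀ x, ∀ h, h ∉ A → k x h = 0) : ContDiff ℝ ∞ fun x => ∫ h, k x h := by
  have h1 := contDiffOn_convolution_right_with_param (n := ⊤) (𝕜 := ℝ) (μ := (volume : Measure ℝ))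
    (f := fun _ : ℝ => (1 : ℝ)) (ContinuousLinearMap.lsmul ℝ ℝ) (g := fun x h => k x (-h))
    (s := univ) (k := (fun h => -h) '' A) isOpen_univ (hA.image continuous_neg) ?_ ?_ ?_
  · rw [univ_prod_univ, contDiffOn_univ] at h1
    have h2 := h1.comp (contDiff_id.prodMk (contDiff_const (c := (0 : ℝ))))
    have h3 : (fun x => ∫ h, k x h) = (fun q : E × ℝ => convolution (fun _ : ℝ => (1 : ℝ))
        (fun h => k q.1 (-h)) (ContinuousLinearMap.lsmul ℝ ℝ) volume q.2) ∘ fun x => (id x, 0) := by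
      funext x
      simp [convolution]
    rw [h3]
    exact h2
  · intro x h _ hh
    exact h0 x _ fun h2 => hh ⟨_, h2, neg_neg h⟩
  · exact continuous_const.locallyIntegrable
  · exact (hk.comp (contDiff_fst.prodMk contDiff_snd.neg)).contDiffOn

end ParametricIntegral

/-! ### The action of δ̂₀ on test functions -/

section Delta

lemma contDiffOn_abs_inv : ContDiffOn ℝ ∞ (fun h : ℝ => ((|h| : ℝ) : ℂ)⁻¹) {h | h ≠ 0} := by
  intro h hh
  have h1 : ContDiffAt ℝ ∞ (fun h : ℝ => |h|) h := contDiffAt_abs hh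
  have h2 : ContDiffAt ℝ ∞ (fun h : ℝ => (|h|)⁻¹) h := h1.inv (abs_ne_zero.2 hh)
  have h3 : ContDiffAt ℝ ∞ (fun h : ℝ => (((|h|)⁻¹ : ℝ) : ℂ)) h :=
    Complex.ofRealCLM.contDiff.contDiffAt.comp h h2
  simp only [Complex.ofReal_inv] at h3
  exact h3.contDiffWithinAt

lemma isTest₂_delta₀ {f : P → ℂ} (hf : IsTest f) {F : Q → ℂ} (hF : IsTest₂ F) :
    IsTest₂ (delta₀ f F) := by
  obtain ⟨C, A, hA, hA0, hC, h0⟩ := hf.exists_bounds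
  have hK : IsCompact ((fun x : ℝ × Q => (x.1 • x.2)) '' (A ×ˢ tsupport F)) :=
    (hA.prod hF.2.1.isCompact).image (by fun_prop)
  have hdiv : ∀ (q : Q) (h : ℝ),
      ((q.1.1 / h, q.1.2 / h), (q.2.1 / h, q.2.2 / h)) = h⁻¹ • q := by
    intro q h
    ext <;> simp [div_eq_inv_mul]
  refine isTest₂_of (contDiff_integral_param ?_ hA ?_) hK ?_ ?_
  · refine contDiff_of_vanish (O := {x : Q × ℝ | x.2 ≠ 0}) (K := univ ×ˢ A)
      (isOpen_ne_fun continuous_snd continuous_const) ?_ (isClosed_univ.prod hA.isClosed)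
      (fun x hx => hA0 hx.2) ?_
    · have h1 : ContDiffOn ℝ ∞ (fun x : Q × ℝ => x.2⁻¹) {x : Q × ℝ | x.2 ≠ 0} :=
        contDiffOn_snd.inv fun x hx => hx
      have h2 : ContDiffOn ℝ ∞ (fun x : Q × ℝ => F (x.2⁻¹ • x.1)) {x : Q × ℝ | x.2 ≠ 0} :=
        hF.1.comp_contDiffOn (h1.smul contDiffOn_fst)
      have h3 : ContDiff ℝ ∞ (fun x : Q × ℝ => f (x.1.1.1 + x.1.2.1, x.2)) :=
        hf.1.comp (by fun_prop)
      have h4 := (h3.contDiffOn.mul h2).mul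
        (contDiffOn_abs_inv.comp contDiffOn_snd (s := {x : Q × ℝ | x.2 ≠ 0}) fun x hx => hx)
      refine h4.congr fun x hx => ?_
      simp only [Function.uncurry, hdiv, Function.comp_apply]
      rw [div_eq_mul_inv]
    · rintro ⟨q, h⟩ hx
      have : h ∉ A := fun hh => hx ⟨trivial, hh⟩
      simp [Function.uncurry, h0 (_, h) this]
  · intro q h hh
    simp [h0 (_, h) hh]
  · rintro _ ⟨⟨h, q⟩, ⟨hh, hq⟩, rfl⟩
    have hh' : h ≠ 0 := hA0 hh
    exact ⟨mul_ne_zero hh' (hF.2.2 hq).1, mul_ne_zero hh' (hF.2.2 hq).2⟩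
  · intro q hq
    refine (integral_congr_ae (Eventually.of_forall fun h => ?_)).trans (integral_zero' _ _)
    by_cases hh : h ∈ A
    · have hh' : h ≠ 0 := hA0 hh
      simp only [hdiv, Pi.zero_apply]
      rw [image_eq_zero_of_notMem_tsupport (f := F)]
      · simp
      · intro h2
        exact hq ⟨(h, h⁻¹ • q), ⟨hh, h2⟩, by simp [smul_smul, hh']⟩
    · simp [h0 (_, h) hh]

/-- The diagonal action is on the left and commutes with convolution from the right: substitute k ↦
h k in the inner integral, which preserves dk₁ dk₂ / |k₁ k₂|, and interchange the integrals. -/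
lemma delta₀_conv₂ {f : P → ℂ} (hf : IsTest f) {F g : Q → ℂ} (hF : IsTest₂ F) (hg : IsTest₂ g) :
    delta₀ f (conv₂ F g) = conv₂ (delta₀ f F) g := by
  obtain ⟨C, A, hA, hA0, hC, h0⟩ := hf.exists_bounds
  obtain ⟨C', B, hB, hB0, hC', h0'⟩ := hF.exists_bounds
  obtain ⟨Cg, hCg⟩ := hg.2.1.exists_bound_of_continuous hg.1.continuous
  -- After the substitution F is evaluated at k / h with h ∈ A, so both components of k are confined
  -- to the compact set A · B, which avoids 0. This makes the double integral absolutely convergent.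
  have hAB : IsCompact ((fun x : ℝ × ℝ => x.1 * x.2) '' (A ×ˢ B)) :=
    (hA.prod hB).image (by fun_prop)
  have hAB0 : (fun x : ℝ × ℝ => x.1 * x.2) '' (A ×ˢ B) ⊆ {0}ᶜ := by
    rintro _ ⟨x, hx, rfl⟩
    exact mul_ne_zero (hA0 hx.1) (hB0 hx.2)
  set AB := (fun x : ℝ × ℝ => x.1 * x.2) '' (A ×ˢ B) with hABdef
  funext q
  set G : ℝ → ℝ × ℝ → ℂ := fun h k => f (q.1.1 + q.2.1, h) *
    (F ((q.1.1 / h, k.1 / h), (q.2.1 / h, k.2 / h)) *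
      g ((q.1.1 / k.1, q.1.2 / k.1), (q.2.1 / k.2, q.2.2 / k.2))) with hG
  have hmf := hf.1.continuous.measurable
  have hmF := hF.1.continuous.measurable
  have hmg := hg.1.continuous.measurable
  have hint : Integrable (Function.uncurry G) (nu.prod (nu.prod nu)) := by
    refine integrable_of_bounded_support (K := A ×ˢ (AB ×ˢ AB)) (C := C * (C' * Cg)) ?_
      (hA.measurableSet.prod (hAB.measurableSet.prod hAB.measurableSet)) ?_ ?_ ?_
    · have : Measurable (Function.uncurry G) := by
        simp only [hG, Function.uncurry_def]
        fun_prop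
      exact this.aestronglyMeasurable
    · rw [Measure.prod_prod, Measure.prod_prod]
      exact ENNReal.mul_lt_top (nu_lt_top hA hA0)
        (ENNReal.mul_lt_top (nu_lt_top hAB hAB0) (nu_lt_top hAB hAB0))
    · intro p
      simp only [Function.uncurry, hG]
      rw [norm_mul, norm_mul]
      have := (norm_nonneg _).trans (hCg 0)
      gcongr
      · exact hC _
      · exact hC' _
      · exact hCg _
    · rintro ⟨h, k⟩ hp
      simp only [Function.uncurry, hG]
      by_cases hh : h ∈ A
      · rw [h0' _ fun h2 => hp ⟨hh, ⟨⟨(h, _), ⟨hh, h2.1⟩, ?_⟩, ⟨(h, _), ⟨hh, h2.2⟩, ?_⟩⟩⟩]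
        · ring
        all_goals
          have hh' : h ≠ 0 := hA0 hh
          simp only
          field_simp
      · rw [h0 _ hh]; ring
  have h1 : delta₀ f (conv₂ F g) q = ∫ h, ∫ k, G h k ∂(nu.prod nu) ∂nu := by
    rw [delta₀_eq_kerFun, kerFun]
    refine integral_congr_ae ?_
    filter_upwards [ae_nu_ne_zero] with h hh
    rw [conv₂_eq_kerFun, kerFun]
    simp only [hG]
    rw [integral_const_mul]
    congr 1
    rw [← ((measurePreserving_mul_nu hh).prod (measurePreserving_mul_nu hh)).map_eq]
    have hsm : Measurable (fun k : ℝ × ℝ => F ((q.1.1 / h, k.1 / h), (q.2.1 / h, k.2 / h)) *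
        g ((q.1.1 / k.1, q.1.2 / k.1), (q.2.1 / k.2, q.2.2 / k.2))) := by fun_prop
    rw [integral_map (by fun_prop) hsm.aestronglyMeasurable,
      ((measurePreserving_mul_nu hh).prod (measurePreserving_mul_nu hh)).map_eq]
    refine integral_congr_ae (Eventually.of_forall fun k => ?_)
    simp only [Prod.map, mul_div_cancel_left₀ _ hh, div_div]
  have h2 : conv₂ (delta₀ f F) g q = ∫ k, ∫ h, G h k ∂nu ∂(nu.prod nu) := by
    rw [conv₂_eq_kerFun, kerFun]
    refine integral_congr_ae (Eventually.of_forall fun k => ?_)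
    simp only [hG]
    rw [delta₀_eq_kerFun, kerFun, ← integral_mul_const]
    refine integral_congr_ae (Eventually.of_forall fun h => ?_)
    simp only [mul_assoc]
  rw [h1, h2]
  exact integral_integral_swap hint

lemma ext_isTest₂ {A B : H₂ →L[ℂ] H₂}
    (h : ∀ g, IsTest₂ g → ∀ ψ : H₂, ψ =ᵐ[mu.prod mu] g → A ψ = B ψ) : A = B :=
  ext_of_inner_dense (D := {ψ : H₂ | ∃ g, IsTest₂ g ∧ ψ =ᵐ[mu.prod mu] g})
    (fun _ hΦ => eq_zero_of_orthogonal_isTestU fun g hg ψ hψ => hΦ ψ ⟨g, hg.1, hψ⟩)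
    fun ψ ⟨g, hg, hψ⟩ => h g hg ψ hψ

lemma ext_isTest {A B : H →L[ℂ] H}
    (h : ∀ g, IsTest g → ∀ ψ : H, ψ =ᵐ[mu] g → A ψ = B ψ) : A = B :=
  ext_of_inner_dense (D := {ψ : H | ∃ g, IsTest g ∧ ψ =ᵐ[mu] g})
    (fun _ hΦ => eq_zero_of_orthogonal_isTest fun g hg ψ hψ => hΦ ψ ⟨g, hg, hψ⟩)
    fun ψ ⟨g, hg, hψ⟩ => h g hg ψ hψ

lemma deltaOp_mul_rep₂ {f : P → ℂ} (hf : IsTest f) {F : Q → ℂ} (hF : IsTest₂ F) :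
    deltaOp f * rep₂ F = rep₂ (delta₀ f F) := by
  refine ext_isTest₂ fun g hg ψ hψ => Lp.ext ?_
  have h1 := deltaOp_ae hf (rep₂_ae hF hψ)
  have h2 := rep₂_ae (isTest₂_delta₀ hf hF) hψ
  rw [delta₀_conv₂ hf hF hg] at h1
  rw [mul_apply_eq_comp]
  exact h1.trans h2.symm

end Delta

/-! ### Induction in the generated C*-algebras -/

section ClosedAlgebra

variable {A : Type*} [NonUnitalNormedRing A] [StarRing A] [NormedStarGroup A] [NormedSpace ℂ A]
  [IsScalarTower ℂ A A] [SMulCommClass ℂ A A] [StarModule ℂ A]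

/-- A set closed under star generates the same algebra with or without stars, so no star case
occurs. The predicate lives on the closure itself, so that it may speak of homomorphisms defined
only there. -/
lemma closure_adjoin_induction {S : Set A} (hS : ∀ a ∈ S, star a ∈ S)
    {p : (NonUnitalStarAlgebra.adjoin ℂ S).topologicalClosure → Prop}
    (hcl : IsClosed {a | p a}) (h : ∀ a (ha : a ∈ (NonUnitalStarAlgebra.adjoin ℂ S).topologicalClosure),
      a ∈ S → p ⟨a, ha⟩) (h0 : p 0)
    (hadd : ∀ a b, p a → p b → p (a + b)) (hsmul : ∀ (c : ℂ) a, p a → p (c • a))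
    (hmul : ∀ a b, p a → p b → p (a * b)) (a) : p a := by
  have hle := (NonUnitalStarAlgebra.adjoin ℂ S).le_topologicalClosure
  have h1 : ∀ x ∈ NonUnitalAlgebra.adjoin ℂ S,
      ∃ hx : x ∈ (NonUnitalStarAlgebra.adjoin ℂ S).topologicalClosure, p ⟨x, hx⟩ := by
    intro x hx
    induction hx using NonUnitalAlgebra.adjoin_induction with
    | mem x hx => exact ⟨hle (NonUnitalStarAlgebra.subset_adjoin ℂ S hx), h _ _ hx⟩
    | add x y _ _ hx hy => exact ⟨add_mem hx.1 hy.1, hadd _ _ hx.2 hy.2⟩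
    | zero => exact ⟨zero_mem _, h0⟩
    | mul x y _ _ hx hy => exact ⟨mul_mem hx.1 hy.1, hmul _ _ hx.2 hy.2⟩
    | smul c x _ hx => exact ⟨SMulMemClass.smul_mem c hx.1, hsmul _ _ hx.2⟩
  have h2 : ∀ x ∈ NonUnitalStarAlgebra.adjoin ℂ S, x ∈ NonUnitalAlgebra.adjoin ℂ S := by
    intro x hx
    have h3 : x ∈ (NonUnitalStarAlgebra.adjoin ℂ S).toNonUnitalSubalgebra := hx
    rw [NonUnitalStarAlgebra.adjoin_toNonUnitalSubalgebra] at h3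
    rwa [union_eq_left.2 fun y hy => by simpa using hS _ hy] at h3
  have h4 : (a : A) ∈ closure (NonUnitalStarAlgebra.adjoin ℂ S : Set A) := a.2
  have h5 : a ∈ closure {a : (NonUnitalStarAlgebra.adjoin ℂ S).topologicalClosure |
      (a : A) ∈ NonUnitalStarAlgebra.adjoin ℂ S} := by
    rw [closure_subtype]
    refine closure_mono (fun x hx => ?_) h4
    exact ⟨⟨x, hle hx⟩, hx, rfl⟩
  refine hcl.closure_subset_iff.2 (fun x hx => ?_) h5
  exact (h1 _ (h2 _ hx)).2

lemma mul_mem_closure_adjoin {S : Set A} (hS : ∀ a ∈ S, star a ∈ S) {m : A}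
    (h : ∀ a ∈ S, m * a ∈ (NonUnitalStarAlgebra.adjoin ℂ S).topologicalClosure) {a : A}
    (ha : a ∈ (NonUnitalStarAlgebra.adjoin ℂ S).topologicalClosure) :
    m * a ∈ (NonUnitalStarAlgebra.adjoin ℂ S).topologicalClosure := by
  refine closure_adjoin_induction hS (p := fun a => m * (a : A) ∈
    (NonUnitalStarAlgebra.adjoin ℂ S).topologicalClosure) ?_ (fun a _ ha => h a ha) ?_ ?_ ?_ ?_ ⟨a, ha⟩
  · have h1 : IsClosed ((NonUnitalStarAlgebra.adjoin ℂ S).topologicalClosure : Set A) :=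
      NonUnitalStarSubalgebra.isClosed_topologicalClosure _
    exact h1.preimage (continuous_const.mul continuous_subtype_val)
  · simp
  · intro a b ha hb
    simpa [mul_add] using add_mem ha hb
  · intro c a ha
    simpa [mul_smul_comm] using SMulMemClass.smul_mem c ha
  · intro a b ha _
    simpa [← mul_assoc] using mul_mem ha b.2

end ClosedAlgebra

section Generators

lemma rep_mem_Cr {f : P → ℂ} (hf : IsTest f) : rep f ∈ Cr :=
  NonUnitalStarSubalgebra.le_topologicalClosure _
    (NonUnitalStarAlgebra.subset_adjoin ℂ _ ⟨f, hf, rfl⟩)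

lemma rep₂_mem_Cr₂ {F : Q → ℂ} (hF : IsTest₂ F) : rep₂ F ∈ Cr₂ :=
  NonUnitalStarSubalgebra.le_topologicalClosure _
    (NonUnitalStarAlgebra.subset_adjoin ℂ _ ⟨F, hF, rfl⟩)

lemma isClosed_Cr₂ : IsClosed (Cr₂ : Set (H₂ →L[ℂ] H₂)) :=
  NonUnitalStarSubalgebra.isClosed_topologicalClosure _

lemma Cr_induction {p : Cr → Prop} (hcl : IsClosed {a | p a})
    (h : ∀ f (hf : IsTest f), p ⟨rep f, rep_mem_Cr hf⟩) (h0 : p 0)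
    (hadd : ∀ a b, p a → p b → p (a + b)) (hsmul : ∀ (c : ℂ) a, p a → p (c • a))
    (hmul : ∀ a b, p a → p b → p (a * b)) (a : Cr) : p a := by
  refine closure_adjoin_induction ?_ hcl ?_ h0 hadd hsmul hmul a
  · rintro _ ⟨f, hf, rfl⟩
    exact ⟨adj f, isTest_adj hf, star_rep hf⟩
  · rintro _ ha ⟨f, hf, rfl⟩
    exact h f hf

lemma mul_mem_Cr {m : H →L[ℂ] H} (h : ∀ f, IsTest f → m * rep f ∈ Cr) {a : H →L[ℂ] H}
    (ha : a ∈ Cr) : m * a ∈ Cr := by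
  refine mul_mem_closure_adjoin ?_ ?_ ha
  · rintro _ ⟨f, hf, rfl⟩
    exact ⟨adj f, isTest_adj hf, star_rep hf⟩
  · rintro _ ⟨f, hf, rfl⟩
    exact h f hf

lemma mul_mem_Cr₂ {m : H₂ →L[ℂ] H₂} (h : ∀ F, IsTest₂ F → m * rep₂ F ∈ Cr₂) {a : H₂ →L[ℂ] H₂}
    (ha : a ∈ Cr₂) : m * a ∈ Cr₂ := by
  refine mul_mem_closure_adjoin ?_ ?_ ha
  · rintro _ ⟨f, hf, rfl⟩
    exact ⟨adj₂ f, isTest₂_adj₂ hf, star_rep₂ hf⟩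
  · rintro _ ⟨f, hf, rfl⟩
    exact h f hf

/-- Multiplication from the right reduces to multiplication from the left through a m = (m* a*)*. -/
lemma isMultiplier₂_of {m : H₂ →L[ℂ] H₂} (h : ∀ F, IsTest₂ F → m * rep₂ F ∈ Cr₂)
    (h' : ∀ F, IsTest₂ F → star m * rep₂ F ∈ Cr₂) : IsMultiplier₂ m := by
  intro a ha
  refine ⟨mul_mem_Cr₂ h ha, ?_⟩
  have h1 := star_mem (mul_mem_Cr₂ h' (star_mem ha))
  rwa [star_mul, star_star, star_star] at h1

end Generators

/-! ### Linearity of the representations -/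

section Linearity

variable {X Y : Type*} [MeasurableSpace X] [MeasurableSpace Y] {m : Measure X} {n : Measure Y}
  [SFinite n] {s : X → Y → X}

open scoped NNReal

lemma IsSchur.op_eq_sub {k k' k'' : X → Y → ℂ} {C₁ C₂ C₁' C₂' C₁'' C₂'' : ℝ≥0}
    (h : IsSchur m n k s C₁ C₂) (h' : IsSchur m n k' s C₁' C₂') (h'' : IsSchur m n k'' s C₁'' C₂'')
    (hk : ∀ x y, k'' x y = k x y - k' x y) : h''.op = h.op - h'.op := by
  ext1 ψ
  refine Lp.ext ?_
  rw [sub_apply]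
  filter_upwards [h.op_ae ψ, h'.op_ae ψ, h''.op_ae ψ, Lp.coeFn_sub (h.op ψ) (h'.op ψ),
    h.ae_integrable ψ, h'.ae_integrable ψ] with x h1 h2 h3 h4 h5 h6
  rw [h3, h4, Pi.sub_apply, h1, h2, kerFun, kerFun, kerFun, ← integral_sub h5 h6]
  simp only [hk, sub_mul]

lemma IsSchur.op_eq_smul {k k' : X → Y → ℂ} {C₁ C₂ C₁' C₂' : ℝ≥0} {c : ℂ}
    (h : IsSchur m n k s C₁ C₂) (h' : IsSchur m n k' s C₁' C₂')
    (hk : ∀ x y, k' x y = c * k x y) : h'.op = c • h.op := by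
  ext1 ψ
  refine Lp.ext ?_
  rw [smul_apply]
  filter_upwards [h.op_ae ψ, h'.op_ae ψ, Lp.coeFn_smul c (h.op ψ)] with x h1 h2 h3
  rw [h2, h3, Pi.smul_apply, h1, kerFun, kerFun, smul_eq_mul, ← integral_const_mul]
  simp only [hk, mul_assoc]

lemma IsTest.exists_isSchur {f : P → ℂ} (hf : IsTest f) : ∃ C₁ C₂,
    IsSchur mu nu (fun p h => f (p.1, h)) (fun p h => (p.1 / h, p.2 / h)) C₁ C₂ := by
  obtain ⟨C, A, hA, hA0, hC, h0⟩ := hf.exists_bounds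
  exact ⟨_, _, isSchur_conv hf.1.continuous.measurable hA hA0 hC h0⟩

lemma IsTest₂.exists_isSchur {F : Q → ℂ} (hF : IsTest₂ F) : ∃ C₁ C₂,
    IsSchur (mu.prod mu) (nu.prod nu) (fun (q : Q) (h : ℝ × ℝ) => F ((q.1.1, h.1), (q.2.1, h.2)))
      (fun q h => ((q.1.1 / h.1, q.1.2 / h.1), (q.2.1 / h.2, q.2.2 / h.2))) C₁ C₂ := by
  obtain ⟨C, A, hA, hA0, hC, h0⟩ := hF.exists_bounds
  exact ⟨_, _, isSchur_conv₂_of_support hF.1.continuous.measurable hA hA0 hC h0⟩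

lemma IsTest.mul {f : P → ℂ} (hf : IsTest f) {b : P → ℂ} (hb : ContDiff ℝ ∞ b) :
    IsTest fun p => b p * f p :=
  isTest_of (hb.mul hf.1) hf.2.1.isCompact hf.2.2 fun x hx => by
    rw [image_eq_zero_of_notMem_tsupport hx, mul_zero]

lemma IsTest₂.mul {F : Q → ℂ} (hF : IsTest₂ F) {b : Q → ℂ} (hb : ContDiff ℝ ∞ b) :
    IsTest₂ fun p => b p * F p :=
  isTest₂_of (hb.mul hF.1) hF.2.1.isCompact hF.2.2 fun x hx => by
    rw [image_eq_zero_of_notMem_tsupport hx, mul_zero]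

lemma IsTest.sub {f g : P → ℂ} (hf : IsTest f) (hg : IsTest g) : IsTest fun p => f p - g p :=
  isTest_of (hf.1.sub hg.1) (hf.2.1.isCompact.union hg.2.1.isCompact)
    (union_subset hf.2.2 hg.2.2) fun x hx => by
    rw [image_eq_zero_of_notMem_tsupport fun h => hx (Or.inl h),
      image_eq_zero_of_notMem_tsupport fun h => hx (Or.inr h), sub_zero]

lemma IsTest₂.sub {F G : Q → ℂ} (hF : IsTest₂ F) (hG : IsTest₂ G) : IsTest₂ fun p => F p - G p :=
  isTest₂_of (hF.1.sub hG.1) (hF.2.1.isCompact.union hG.2.1.isCompact)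
    (union_subset hF.2.2 hG.2.2) fun x hx => by
    rw [image_eq_zero_of_notMem_tsupport fun h => hx (Or.inl h),
      image_eq_zero_of_notMem_tsupport fun h => hx (Or.inr h), sub_zero]

lemma rep_sub {f g : P → ℂ} (hf : IsTest f) (hg : IsTest g) :
    rep (fun p => f p - g p) = rep f - rep g := by
  obtain ⟨_, _, h⟩ := hf.exists_isSchur
  obtain ⟨_, _, h'⟩ := hg.exists_isSchur
  obtain ⟨_, _, h''⟩ := (hf.sub hg).exists_isSchur
  rw [rep_eq_op h, rep_eq_op h', rep_eq_op h'']
  exact h.op_eq_sub h' h'' fun _ _ => rfl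

lemma rep_smul {f : P → ℂ} (hf : IsTest f) (c : ℂ) : rep (fun p => c * f p) = c • rep f := by
  obtain ⟨_, _, h⟩ := hf.exists_isSchur
  obtain ⟨_, _, h'⟩ := (hf.mul (contDiff_const (c := c))).exists_isSchur
  rw [rep_eq_op h, rep_eq_op h']
  exact h.op_eq_smul h' fun _ _ => rfl

lemma rep₂_sub {F G : Q → ℂ} (hF : IsTest₂ F) (hG : IsTest₂ G) :
    rep₂ (fun p => F p - G p) = rep₂ F - rep₂ G := by
  obtain ⟨_, _, h⟩ := hF.exists_isSchur
  obtain ⟨_, _, h'⟩ := hG.exists_isSchur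
  obtain ⟨_, _, h''⟩ := (hF.sub hG).exists_isSchur
  rw [rep₂_eq_op h, rep₂_eq_op h', rep₂_eq_op h'']
  exact h.op_eq_sub h' h'' fun _ _ => rfl

lemma rep₂_smul {F : Q → ℂ} (hF : IsTest₂ F) (c : ℂ) :
    rep₂ (fun p => c * F p) = c • rep₂ F := by
  obtain ⟨_, _, h⟩ := hF.exists_isSchur
  obtain ⟨_, _, h'⟩ := (hF.mul (contDiff_const (c := c))).exists_isSchur
  rw [rep₂_eq_op h, rep₂_eq_op h']
  exact h.op_eq_smul h' fun _ _ => rfl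

end Linearity

/-! ### Push-forward by bisections in coordinates -/

section PushForward

/-- The sum has at most the one term g = y. The second hypothesis covers the points x with no
factorization, where the push-forward is 0 by definition while the formula f y must be 0 for another
reason. -/
lemma push_of_unique {X : Type*} {mul : X → X → X → Prop} {S : Set X} {f : X → ℂ} {x y : X}
    (h : ∀ g, (∃ t ∈ S, mul x t g) → g = y) (h' : (¬∃ t ∈ S, mul x t y) → f y = 0) :
    push mul S f x = f y := by
  rw [push]
  by_cases hy : ∃ t ∈ S, mul x t y
  · have : {g | ∃ t ∈ S, mul x t g} = {y} := by
      ext g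
      simp only [mem_ofPred_eq, mem_singleton_iff]
      exact ⟨h g, fun hg => hg ▸ hy⟩
    rw [this, finsum_mem_singleton]
  · have : {g | ∃ t ∈ S, mul x t g} = ∅ := by
      ext g
      simp only [mem_ofPred_eq, mem_empty_iff_false, iff_false]
      intro hg
      exact hy (h g hg ▸ hg)
    rw [this, finsum_mem_empty, h' hy]

lemma push_const {a : ℝ} (ha : a ≠ 0) {f : P → ℂ} (hf : ∀ p : P, p.2 = 0 → f p = 0) :
    push IsMul {p | p.2 = a} f = fun x => f (a⁻¹ • x) := by
  funext x
  refine push_of_unique ?_ ?_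
  · rintro g ⟨t, ht, h1, h2, h3, h4, h5⟩
    rw [mem_ofPred_eq] at ht
    ext
    · simp [h3, h4, ht, div_eq_inv_mul]
    · simp [h5, ht, ha]
  · intro h
    refine hf _ ?_
    by_contra hne
    exact h ⟨(x.1, a), rfl, ha, hne, by simp [div_eq_inv_mul], rfl, by simp [ha]⟩

/-- From t g = x the first coordinates of t are those of x, so t is determined by x and g = ((1 +
z₂) x₁, x₂). If 1 + z₂ = 0, this point lies outside Γ × Γ, where F vanishes. -/
lemma push_T {F : Q → ℂ} (hF : ∀ q : Q, q.1.2 = 0 ∨ q.2.2 = 0 → F q = 0) :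
    push IsMul₂ T F = fun x => F ((1 + x.2.1) • x.1, x.2) := by
  funext x
  refine push_of_unique ?_ ?_
  · rintro g ⟨t, ⟨z₁, z₂, hz, rfl⟩, ⟨h1, h2, h3, h4, h5⟩, k1, k2, k3, k4, k5⟩
    simp only at h1 h2 h3 h4 h5 k1 k2 k3 k4 k5
    ext
    · simp [h3, h4, k4, mul_comm]
    · simp [h5, k4, hz]
    · simp [k3, k4]
    · simp [k5]
  · intro h
    refine hF _ ?_
    by_contra! hne
    simp only [Prod.smul_snd, smul_eq_mul, ne_eq, mul_eq_zero, not_or] at hne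
    refine h ⟨((x.1.1, 1 / (1 + x.2.1)), (x.2.1, 1)), ⟨_, _, hne.1.1, rfl⟩,
      ⟨one_div_ne_zero hne.1.1, mul_ne_zero hne.1.1 hne.1.2, ?_, rfl, ?_⟩, one_ne_zero, hne.2, ?_, rfl, ?_⟩
    · simp [mul_comm]
    · have := hne.1.1
      simp only [Prod.smul_snd, smul_eq_mul]
      field_simp
    · simp
    · simp

lemma IsTest.eq_zero {f : P → ℂ} (hf : IsTest f) {p : P} (hp : p.2 = 0) : f p = 0 :=
  image_eq_zero_of_notMem_tsupport fun h => hf.2.2 h hp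

lemma IsTest₂.eq_zero {F : Q → ℂ} (hF : IsTest₂ F) {q : Q} (hq : q.1.2 = 0 ∨ q.2.2 = 0) :
    F q = 0 :=
  image_eq_zero_of_notMem_tsupport fun h => by
    obtain ⟨h1, h2⟩ := hF.2.2 h
    tauto

end PushForward

/-! ### Unitaries given by dilations -/

section Scaling

/-- `ψ ↦ ψ(a ·)` on `L²(Γ)`. -/
def dil {a : ℝ} (ha : a ≠ 0) : H →L[ℂ] H := compOp (measurePreserving_smul_mu ha)

lemma dil_ae {a : ℝ} (ha : a ≠ 0) {ψ : H} {f : P → ℂ} (h : ψ =ᵐ[mu] f) :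
    dil ha ψ =ᵐ[mu] fun x => f (a • x) := compOp_toLp_ae _ h

lemma opOn_push {a : ℝ} (ha : a ≠ 0) :
    opOn mu IsTest (push IsMul {p | p.2 = a}) = dil (inv_ne_zero ha) := by
  refine opOn_eq (fun Φ => eq_zero_of_orthogonal_isTest) fun f hf ψ hψ => ?_
  rw [push_const ha fun p => hf.eq_zero]
  exact dil_ae _ hψ

lemma dil_mul {a b c : ℝ} (ha : a ≠ 0) (hb : b ≠ 0) (hc : c ≠ 0) (h : a * b = c) :
    dil ha * dil hb = dil hc :=
  compOp_mul _ _ _ (Eventually.of_forall fun x => by rw [smul_smul, mul_comm, h])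

lemma dil_one {a : ℝ} (ha : a ≠ 0) (h : a = 1) : dil ha = 1 :=
  compOp_one _ (Eventually.of_forall fun x => by rw [h, one_smul])

lemma dil_mem_unitary {a : ℝ} (ha : a ≠ 0) : dil ha ∈ unitary (H →L[ℂ] H) :=
  compOp_mem_unitary _ (measurePreserving_smul_mu (inv_ne_zero ha))
    (Eventually.of_forall fun x => by rw [smul_smul, inv_mul_cancel₀ ha, one_smul])
    (Eventually.of_forall fun x => by rw [smul_smul, mul_inv_cancel₀ ha, one_smul])

lemma Jhat_eq : Jhat = dil (a := -1) (by norm_num) := by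
  rw [Jhat, opOn_push (by norm_num)]
  congr 1
  norm_num

lemma Bhat_eq (t : ℝ) : Bhat t = dil (Real.exp_ne_zero (-t)) := by
  rw [Bhat, opOn_push (Real.exp_ne_zero t)]
  congr 1
  rw [Real.exp_neg]

/-- Functions by which the first factor may be scaled, depending on the unit in the second. -/
structure IsScale (l : ℝ → ℝ) : Prop where
  meas : Measurable l
  ne_zero : ∀ᵐ x ∂mu, l x.1 ≠ 0

/-- `ψ ↦ ψ(l(z₂) x₁, k x₂)` on `L²(Γ × Γ)`. -/
def scaleOp {l : ℝ → ℝ} (hl : IsScale l) {k : ℝ} (hk : k ≠ 0) : H₂ →L[ℂ] H₂ :=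
  compOp (measurePreserving_scale₂ (l := fun x => l x.1) (hl.meas.comp measurable_fst) hl.ne_zero hk)

variable {l l' l'' : ℝ → ℝ} (hl : IsScale l) (hl' : IsScale l') (hl'' : IsScale l'')
  {k k' k'' : ℝ} (hk : k ≠ 0) (hk' : k' ≠ 0) (hk'' : k'' ≠ 0)

lemma scaleOp_ae {ψ : H₂} {F : Q → ℂ} (h : ψ =ᵐ[mu.prod mu] F) :
    scaleOp hl hk ψ =ᵐ[mu.prod mu] fun q => F (l q.2.1 • q.1, k • q.2) := compOp_toLp_ae _ h


lemma scaleOp_mul (h : ∀ᵐ x ∂mu, l' (k * x.1) * l x.1 = l'' x.1) (hkk : k * k' = k'') :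
    scaleOp hl hk * scaleOp hl' hk' = scaleOp hl'' hk'' := by
  refine compOp_mul _ _ _ ?_
  filter_upwards [ae_mu_mu_snd h] with q hq
  simp only [smul_smul, Prod.smul_fst, smul_eq_mul, hq, mul_comm k', hkk]

lemma scaleOp_one (h : ∀ᵐ x ∂mu, l x.1 = 1) (hk1 : k = 1) : scaleOp hl hk = 1 := by
  refine compOp_one _ ?_
  filter_upwards [ae_mu_mu_snd h] with q hq
  simp only [hq, hk1, one_smul]

lemma scaleOp_mem_unitary {l l' : ℝ → ℝ} (hl : IsScale l) (hl' : IsScale l') {k k' : ℝ} (hk : k ≠ 0)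
    (hk' : k' ≠ 0) (h : ∀ᵐ x ∂mu, l' (k * x.1) * l x.1 = 1)
    (h' : ∀ᵐ x ∂mu, l (k' * x.1) * l' x.1 = 1) (hkk : k * k' = 1) :
    scaleOp hl hk ∈ unitary (H₂ →L[ℂ] H₂) := by
  refine compOp_mem_unitary _ (measurePreserving_scale₂ (l := fun x => l' x.1)
    (hl'.meas.comp measurable_fst) hl'.ne_zero hk') ?_ ?_
  · filter_upwards [ae_mu_mu_snd h] with q hq
    simp only [smul_smul, Prod.smul_fst, smul_eq_mul, hq, mul_comm k', hkk, one_smul]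
  · filter_upwards [ae_mu_mu_snd h'] with q hq
    simp only [smul_smul, Prod.smul_fst, smul_eq_mul, hq, hkk, one_smul]

lemma star_scaleOp (h : ∀ᵐ x ∂mu, l' (k * x.1) * l x.1 = 1) (hkk : k * k' = 1) :
    star (scaleOp hl hk) = scaleOp hl' hk' := by
  refine star_compOp _ _ ?_
  filter_upwards [ae_mu_mu_snd h] with q hq
  simp only [smul_smul, Prod.smul_fst, smul_eq_mul, hq, mul_comm k', hkk, one_smul]

end Scaling

/-! ### Dilations and multiplications as left multipliers -/

section LeftMultiplication

lemma integral_nu_scale {a : ℝ} (ha : a ≠ 0) {f : ℝ → ℂ} (hf : Measurable f) :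
    ∫ h, f h ∂nu = ∫ h, f (a * h) ∂nu := by
  conv_lhs => rw [← (measurePreserving_mul_nu ha).map_eq]
  exact integral_map (by fun_prop) hf.aestronglyMeasurable

lemma integral_nu_prod_scale {a b : ℝ} (ha : a ≠ 0) (hb : b ≠ 0) {f : ℝ × ℝ → ℂ}
    (hf : Measurable f) :
    ∫ h, f h ∂(nu.prod nu) = ∫ h : ℝ × ℝ, f (a * h.1, b * h.2) ∂(nu.prod nu) := by
  conv_lhs => rw [← ((measurePreserving_mul_nu ha).prod (measurePreserving_mul_nu hb)).map_eq]
  exact integral_map (by fun_prop) hf.aestronglyMeasurable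

/-- Substitute a h for h: the measure dh / |h| is invariant, and the argument of g is a quotient in
which a cancels. -/
lemma conv_smul {a : ℝ} (ha : a ≠ 0) {f g : P → ℂ} (hf : Measurable f) (hg : Measurable g) (x : P) :
    conv f g (a • x) = conv (fun y => f (a • y)) g x := by
  rw [conv_eq_kerFun, conv_eq_kerFun, kerFun, kerFun, integral_nu_scale ha (by fun_prop)]
  simp [mul_div_mul_left _ _ ha]

lemma dil_mul_rep {a : ℝ} (ha : a ≠ 0) {f f' : P → ℂ} (hf : IsTest f) (hf' : IsTest f')
    (h : ∀ x, f' x = f (a • x)) : dil ha * rep f = rep f' := by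
  obtain rfl : f' = fun x => f (a • x) := funext h
  refine ext_isTest fun g hg ψ hψ => Lp.ext ?_
  rw [mul_apply_eq_comp]
  refine (dil_ae ha (rep_ae hf hψ)).trans (EventuallyEq.trans ?_ (rep_ae hf' hψ).symm)
  exact Eventually.of_forall fun x =>
    conv_smul ha hf.1.continuous.measurable hg.1.continuous.measurable x

lemma conv₂_scale {a b : ℝ} (ha : a ≠ 0) (hb : b ≠ 0) {F G : Q → ℂ} (hF : Measurable F)
    (hG : Measurable G) (x : Q) :
    conv₂ F G (a • x.1, b • x.2) = conv₂ (fun y => F (a • y.1, b • y.2)) G x := by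
  rw [conv₂_eq_kerFun, conv₂_eq_kerFun, kerFun, kerFun, integral_nu_prod_scale ha hb (by fun_prop)]
  simp [mul_div_mul_left _ _ ha, mul_div_mul_left _ _ hb]

lemma scaleOp_mul_rep₂ {l : ℝ → ℝ} (hl : IsScale l) {k : ℝ} (hk : k ≠ 0) {F F' : Q → ℂ}
    (hF : IsTest₂ F) (hF' : IsTest₂ F') (h : ∀ q, F' q = F (l q.2.1 • q.1, k • q.2)) :
    scaleOp hl hk * rep₂ F = rep₂ F' := by
  obtain rfl : F' = fun q => F (l q.2.1 • q.1, k • q.2) := funext h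
  refine ext_isTest₂ fun g hg ψ hψ => Lp.ext ?_
  rw [mul_apply_eq_comp]
  refine (scaleOp_ae hl hk (rep₂_ae hF hψ)).trans (EventuallyEq.trans ?_ (rep₂_ae hF' hψ).symm)
  filter_upwards [ae_mu_mu_snd hl.ne_zero] with q hq
  exact conv₂_scale hq hk hF.1.continuous.measurable hg.1.continuous.measurable q

lemma delta₀_scale {a : ℝ} (ha : a ≠ 0) {f : P → ℂ} {G : Q → ℂ} (hf : Measurable f)
    (hG : Measurable G) (x : Q) :
    delta₀ f G (a • x.1, a • x.2) = delta₀ (fun y => f (a • y)) G x := by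
  rw [delta₀_eq_kerFun, delta₀_eq_kerFun, kerFun, kerFun, integral_nu_scale ha (by fun_prop)]
  simp [mul_div_mul_left _ _ ha, mul_add]

lemma scaleOp_mul_deltaOp {a : ℝ} (ha : a ≠ 0) {l : ℝ → ℝ} (hl : IsScale l) (hla : ∀ x, l x = a)
    {f f' : P → ℂ} (hf : IsTest f) (hf' : IsTest f') (h : ∀ x, f' x = f (a • x)) :
    scaleOp hl ha * deltaOp f = deltaOp f' := by
  obtain rfl : f' = fun x => f (a • x) := funext h
  refine ext_isTest₂ fun g hg ψ hψ => Lp.ext ?_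
  rw [mul_apply_eq_comp]
  refine (scaleOp_ae hl ha (deltaOp_ae hf hψ)).trans
    (EventuallyEq.trans ?_ (deltaOp_ae hf' hψ).symm)
  refine Eventually.of_forall fun x => ?_
  simp only [hla]
  exact delta₀_scale ha hf.1.continuous.measurable hg.1.continuous.measurable x

/-- A function of z alone depends only on the left unit, which f(z, h) and the product share, so it
can be moved under the convolution integral. -/
lemma mulOp_mul_rep {b : P → ℂ} (hb : IsBddMeas b) (hbz : ∀ z c c', b (z, c) = b (z, c'))
    {f : P → ℂ} (hf : IsTest f) (hf' : IsTest fun x => b x * f x) :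
    mulOp mu hb * rep f = rep fun x => b x * f x := by
  refine ext_isTest fun g hg ψ hψ => Lp.ext ?_
  rw [mul_apply_eq_comp]
  filter_upwards [mulOp_ae hb (rep f ψ), rep_ae hf hψ, rep_ae hf' hψ] with x h1 h2 h3
  rw [h1, h2, h3, conv_eq_kerFun, conv_eq_kerFun, kerFun, kerFun, ← integral_const_mul]
  congr 1
  funext h
  simp only [hbz x.1 h x.2, mul_assoc]

lemma mulOp_mul_deltaOp {b : Q → ℂ} (hb : IsBddMeas b) {b₀ : P → ℂ}
    (hbz : ∀ (q : Q) (c : ℝ), b q = b₀ (q.1.1 + q.2.1, c))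
    {f : P → ℂ} (hf : IsTest f) (hf' : IsTest fun x => b₀ x * f x) :
    mulOp (mu.prod mu) hb * deltaOp f = deltaOp fun x => b₀ x * f x := by
  refine ext_isTest₂ fun g hg ψ hψ => Lp.ext ?_
  rw [mul_apply_eq_comp]
  filter_upwards [mulOp_ae hb (deltaOp f ψ), deltaOp_ae hf hψ, deltaOp_ae hf' hψ] with x h1 h2 h3
  rw [h1, h2, h3, delta₀_eq_kerFun, delta₀_eq_kerFun, kerFun, kerFun, ← integral_const_mul]
  congr 1
  funext h
  rw [hbz x h, mul_assoc]

end LeftMultiplication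

/-! ### Norm density of 𝒜(Γ × U) -/

section Approximation

open scoped NNReal

lemma IsCompact.exists_abs_bounds {A : Set ℝ} (hA : IsCompact A) (hA0 : A ⊆ {0}ᶜ) :
    ∃ r R : ℝ, 0 < r ∧ 0 < R ∧ ∀ h ∈ A, r ≤ |h| ∧ |h| ≤ R := by
  rcases A.eq_empty_or_nonempty with rfl | hne
  · exact ⟨1, 1, one_pos, one_pos, by simp⟩
  obtain ⟨a, ha, hmin⟩ := hA.exists_isMinOn hne continuous_abs.continuousOn
  obtain ⟨b, hb, hmax⟩ := hA.exists_isMaxOn hne continuous_abs.continuousOn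
  have h1 : 0 < |a| := abs_pos.2 (hA0 ha)
  have h2 : 0 < |b| := abs_pos.2 (hA0 hb)
  exact ⟨_, _, h1, h2, fun h hh => ⟨hmin hh, hmax hh⟩⟩

/-- If the set is not empty, |h z| ≥ 1/2 for some |h| ≤ R, so |z| ≥ 1 / (2R). Then h lies in an
interval about -1/z of length 4ε / |z| ≤ 8εR, on which dh / |h| has density at most 1/r. The bound
is uniform in z. -/
lemma nu_near_le {A : Set ℝ} (hA : MeasurableSet A) {r R ε : ℝ} (hr : 0 < r) (hR : 0 < R) (hε : ε ≤ 1 / 4)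
    (hb : ∀ h ∈ A, r ≤ |h| ∧ |h| ≤ R) (z : ℝ) :
    nu (A ∩ {h | |h * z + 1| ≤ 2 * ε}) ≤ ENNReal.ofReal (8 * ε * R / r) := by
  set S := A ∩ {h | |h * z + 1| ≤ 2 * ε} with hS
  have hSm : MeasurableSet S := hA.inter (measurableSet_le (by fun_prop) measurable_const)
  rcases S.eq_empty_or_nonempty with h0 | ⟨h₀, hh₀, hz₀⟩
  · rw [h0, measure_empty]; exact zero_le
  have hε0 : 0 ≤ ε := by
    have hz₀' : |h₀ * z + 1| ≤ 2 * ε := hz₀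
    have := (abs_nonneg _).trans hz₀'
    linarith
  have hz1 : 1 / 2 ≤ |h₀| * |z| := by
    rw [← abs_mul]
    have h1 : |h₀ * z + 1| ≤ 2 * ε := hz₀
    have h2 := abs_le.1 h1
    exact le_abs.2 (Or.inr (by linarith [h2.2]))
  have hz : 1 / (2 * R) ≤ |z| := by
    rw [div_le_iff₀ (by positivity)]
    nlinarith [(hb h₀ hh₀).2, abs_nonneg z]
  have hzpos : 0 < |z| := lt_of_lt_of_le (by positivity) hz
  have hz0 : z ≠ 0 := abs_pos.1 hzpos
  have h1 : nu S ≤ ENNReal.ofReal (1 / r) * volume S := by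
    rw [nu, withDensity_apply _ hSm, ← setLIntegral_const]
    refine setLIntegral_mono measurable_const fun h hh => ?_
    exact ENNReal.ofReal_le_ofReal (one_div_le_one_div_of_le hr (hb h hh.1).1)
  have h2 : volume S ≤ ENNReal.ofReal (2 * (2 * ε / |z|)) := by
    rw [← Real.volume_closedBall (-1 / z)]
    refine measure_mono fun h hh => ?_
    have h3 : |h * z + 1| ≤ 2 * ε := hh.2
    rw [Metric.mem_closedBall, Real.dist_eq, le_div_iff₀ hzpos, ← abs_mul]
    have h4 : (h - -1 / z) * z = h * z + 1 := by
      field_simp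
      ring
    rwa [h4]
  refine h1.trans ((mul_le_mul_right h2 _).trans ?_)
  rw [← ENNReal.ofReal_mul (by positivity)]
  refine ENNReal.ofReal_le_ofReal ?_
  have h5 : ε / |z| ≤ ε * (2 * R) := by
    rw [div_le_iff₀ hzpos]
    have : 1 ≤ 2 * R * |z| := by
      rw [div_le_iff₀ (by positivity)] at hz
      linarith
    nlinarith
  calc 1 / r * (2 * (2 * ε / |z|)) = 4 / r * (ε / |z|) := by ring
    _ ≤ 4 / r * (ε * (2 * R)) := by gcongr
    _ = 8 * ε * R / r := by ring

/-- The first Schur constant is not small: for z₂ near -1 all h contribute. In the second, F is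
evaluated at h₂ z₂, and h₂ z₂ ≈ -1 restricts h₂ to a set of measure O(ε). Since the norm is bounded
by the square root of the product, it is O(√ε). -/
lemma norm_rep₂_le_of_near {F : Q → ℂ} (hF : IsTest₂ F) {C : ℝ≥0} {A : Set ℝ} (hA : IsCompact A)
    (hA0 : A ⊆ {0}ᶜ) (hC : ∀ p, ‖F p‖ ≤ C) {r R ε : ℝ} (hr : 0 < r) (hR : 0 < R) (hε : ε ≤ 1 / 4)
    (hε0 : 0 ≤ ε)
    (hb : ∀ h ∈ A, r ≤ |h| ∧ |h| ≤ R)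
    (h0 : ∀ q : Q, ¬(q.1.2 ∈ A ∧ q.2.2 ∈ A ∧ |q.2.1 + 1| ≤ 2 * ε) → F q = 0) :
    ‖rep₂ F‖ ≤ Real.sqrt (C ^ 2 * (nu A).toReal ^ 3 * (8 * ε * R / r)) := by
  set n := (nu A).toNNReal with hn
  have hnA : (n : ℝ≥0∞) = nu A := ENNReal.coe_toNNReal (nu_lt_top hA hA0).ne
  have hs := isSchur_conv₂ hF.1.continuous.measurable (C₁ := C * (n * n))
    (C₂ := C * (n * (8 * ε * R / r).toNNReal)) (fun q => ?_) fun q => ?_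
  · rw [rep₂_eq_op hs]
    refine hs.norm_op_le.trans (Real.sqrt_le_sqrt (le_of_eq ?_))
    have h1 : 0 ≤ 8 * ε * R / r := by positivity
    simp only [NNReal.coe_mul, Real.coe_toNNReal _ h1]
    have : (n : ℝ) = (nu A).toReal := rfl
    rw [this]
    ring
  · rw [ENNReal.coe_mul, ENNReal.coe_mul, hnA]
    exact lintegral_prod_le_of_support hA.measurableSet hA.measurableSet (fun h => hC _)
      fun h hh => h0 _ fun h2 => hh ⟨h2.1, h2.2.1⟩
  · rw [ENNReal.coe_mul, ENNReal.coe_mul, hnA]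
    have hSm : MeasurableSet (A ∩ {h | |h * q.2.1 + 1| ≤ 2 * ε}) :=
      hA.measurableSet.inter (measurableSet_le (by fun_prop) measurable_const)
    refine (lintegral_prod_le_of_support (F := fun h => F ((h.1 * q.1.1, h.1), (h.2 * q.2.1, h.2)))
      hA.measurableSet hSm (fun h => hC _)
      fun h hh => h0 _ fun h2 => hh ⟨h2.1, h2.2.1, h2.2.2⟩).trans ?_
    gcongr
    exact nu_near_le hA.measurableSet hr hR hε hb _

/-- Multiply by 1 - β(z₂) with β a bump at -1 of radii ε and 2ε. The error βF is not small in the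
supremum norm, but its convolution operator is, by `norm_rep₂_le_of_near`. -/
lemma IsTest₂.exists_isTestU {F : Q → ℂ} (hF : IsTest₂ F) {δ : ℝ} (hδ : 0 < δ) :
    ∃ G, IsTestU G ∧ ‖rep₂ F - rep₂ G‖ ≤ δ := by
  obtain ⟨C, A, hA, hA0, hC, h0⟩ := hF.exists_bounds
  obtain ⟨r, R, hr, hR, hb⟩ := IsCompact.exists_abs_bounds hA hA0
  set M := C ^ 2 * (nu A).toReal ^ 3 * (8 * R / r) with hM
  have hM0 : 0 ≤ M := by positivity
  obtain ⟨ε, hε0, hε, hεδ⟩ : ∃ ε : ℝ, 0 < ε ∧ ε ≤ 1 / 4 ∧ M * ε ≤ δ ^ 2 := by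
    refine ⟨min (1 / 4) (δ ^ 2 / (M + 1)), by positivity, min_le_left _ _, ?_⟩
    calc M * min (1 / 4) (δ ^ 2 / (M + 1)) ≤ M * (δ ^ 2 / (M + 1)) := by
          gcongr; exact min_le_right _ _
      _ ≤ (M + 1) * (δ ^ 2 / (M + 1)) := by gcongr; linarith
      _ = δ ^ 2 := by field_simp
  let β : ContDiffBump (-1 : ℝ) := ⟨ε, 2 * ε, hε0, by linarith⟩
  have hβ : ContDiff ℝ ∞ fun q : Q => ((1 - β q.2.1 : ℝ) : ℂ) :=
    Complex.ofRealCLM.contDiff.comp (contDiff_const.sub (β.contDiff.comp contDiff_snd.fst))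
  have hβ' : ContDiff ℝ ∞ fun q : Q => ((β q.2.1 : ℝ) : ℂ) :=
    Complex.ofRealCLM.contDiff.comp (β.contDiff.comp contDiff_snd.fst)
  have hG := hF.mul hβ
  refine ⟨_, ⟨hG, ?_⟩, ?_⟩
  · have hcl : IsClosed {q : Q | ε ≤ |q.2.1 + 1|} := isClosed_le continuous_const (by fun_prop)
    refine (closure_minimal (fun q hq => ?_) hcl).trans fun q hq => ?_
    · by_contra hlt
      rw [mem_ofPred_eq, not_le] at hlt
      refine hq ?_
      have h1 : β q.2.1 = 1 := by
        refine β.one_of_mem_closedBall ?_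
        rw [Metric.mem_closedBall, Real.dist_eq, sub_neg_eq_add]
        exact hlt.le
      simp [h1]
    · exact abs_pos.1 (hε0.trans_le hq)
  · rw [← rep₂_sub hF hG]
    have h1 : (fun q => F q - ((1 - β q.2.1 : ℝ) : ℂ) * F q) = fun q => ((β q.2.1 : ℝ) : ℂ) * F q := by
      funext q
      push_cast
      ring
    rw [h1]
    refine (norm_rep₂_le_of_near (hF.mul hβ') hA hA0 (C := C) (fun q => ?_) hr hR hε hε0.le hb ?_).trans ?_
    · rw [norm_mul, Complex.norm_real, Real.norm_of_nonneg β.nonneg]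
      exact (mul_le_of_le_one_left (norm_nonneg _) β.le_one).trans (hC q)
    · intro q hq
      by_cases h2 : q.1.2 ∈ A ∧ q.2.2 ∈ A
      · have h3 : ¬|q.2.1 + 1| ≤ 2 * ε := fun h3 => hq ⟨h2.1, h2.2, h3⟩
        have h4 : β q.2.1 = 0 := by
          refine β.zero_of_le_dist ?_
          rw [Real.dist_eq, sub_neg_eq_add]
          exact (not_le.1 h3).le
        simp [h4]
      · rw [h0 q h2, mul_zero]
    · rw [Real.sqrt_le_left hδ.le]
      calc _ = M * ε := by rw [hM]; ring
        _ ≤ δ ^ 2 := hεδ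

lemma mul_rep₂_mem_of_isTestU {m : H₂ →L[ℂ] H₂} (h : ∀ F, IsTestU F → m * rep₂ F ∈ Cr₂)
    {F : Q → ℂ} (hF : IsTest₂ F) : m * rep₂ F ∈ Cr₂ := by
  have h1 : rep₂ F ∈ closure {a | ∃ G, IsTestU G ∧ a = rep₂ G} := by
    refine Metric.mem_closure_iff.2 fun δ hδ => ?_
    obtain ⟨G, hG, hd⟩ := hF.exists_isTestU (half_pos hδ)
    exact ⟨_, ⟨G, hG, rfl⟩, by rw [dist_eq_norm]; linarith⟩
  have h2 : IsClosed {a | m * a ∈ Cr₂} := isClosed_Cr₂.preimage (continuous_const.mul continuous_id)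
  refine (h2.closure_subset_iff.2 ?_) h1
  rintro _ ⟨G, hG, rfl⟩
  exact h G hG

end Approximation

/-! ### The twist as a unitary multiplier -/

section Twist

lemma isTestU_scale {F : Q → ℂ} (hF : IsTestU F) {l : ℝ → ℝ} (hl : ContDiffOn ℝ ∞ l {z | z + 1 ≠ 0})
    (hl0 : ∀ z, z + 1 ≠ 0 → l z ≠ 0) : IsTestU fun q => F (l q.2.1 • q.1, q.2) := by
  have hlq : ContDiffOn ℝ ∞ (fun q : Q => l q.2.1) {q : Q | q.2.1 + 1 ≠ 0} :=
    hl.comp contDiff_snd.fst.contDiffOn fun q hq => hq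
  have hlq' : ContDiffOn ℝ ∞ (fun q : Q => (l q.2.1)⁻¹) {q : Q | q.2.1 + 1 ≠ 0} :=
    hlq.inv fun q hq => hl0 _ hq
  set K := (fun q : Q => ((l q.2.1)⁻¹ • q.1, q.2)) '' tsupport F with hKdef
  have hK : IsCompact K := by
    refine hF.1.2.1.isCompact.image_of_continuousOn (ContinuousOn.mono ?_ hF.2)
    exact (hlq'.smul contDiff_fst.contDiffOn).continuousOn.prodMk continuousOn_snd
  have hKU : K ⊆ {q | q.2.1 + 1 ≠ 0} := by
    rintro _ ⟨q, hq, rfl⟩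
    have h1 : q.2.1 + 1 ≠ 0 := hF.2 hq
    exact h1
  have hKΓ : K ⊆ {q | q.1.2 ≠ 0 ∧ q.2.2 ≠ 0} := by
    rintro _ ⟨q, hq, rfl⟩
    exact ⟨mul_ne_zero (inv_ne_zero (hl0 _ (hF.2 hq))) (hF.1.2.2 hq).1, (hF.1.2.2 hq).2⟩
  have h0 : ∀ q, q ∉ K → F (l q.2.1 • q.1, q.2) = 0 := by
    intro q hq
    by_contra hne
    have h1 := subset_tsupport F hne
    have h2 : l q.2.1 ≠ 0 := by
      have h3 := hF.2 h1
      exact hl0 _ h3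
    exact hq ⟨_, h1, by simp [smul_smul, h2]⟩
  refine isTestU_of (contDiff_of_vanish (O := {q : Q | q.2.1 + 1 ≠ 0})
    (isOpen_ne_fun (by fun_prop) continuous_const) ?_ hK.isClosed hKU h0) hK hKΓ hKU h0
  exact hF.1.1.comp_contDiffOn ((hlq.smul contDiff_fst.contDiffOn).prodMk contDiff_snd.contDiffOn)

lemma isScale_add : IsScale fun z => 1 + z where
  meas := by fun_prop
  ne_zero := by
    filter_upwards [ae_add_one_ne_zero] with x hx
    rwa [add_comm]

lemma isScale_add_inv : IsScale fun z => (1 + z)⁻¹ where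
  meas := by fun_prop
  ne_zero := by
    filter_upwards [isScale_add.ne_zero] with x hx
    exact inv_ne_zero hx

/-- The unitary `ψ ↦ ψ((1 + z₂) x₁, x₂)`. -/
def twist : H₂ →L[ℂ] H₂ := scaleOp isScale_add one_ne_zero

lemma twist_mem_unitary : twist ∈ unitary (H₂ →L[ℂ] H₂) := by
  refine scaleOp_mem_unitary isScale_add isScale_add_inv one_ne_zero one_ne_zero ?_ ?_ (by norm_num)
  all_goals
    filter_upwards [isScale_add.ne_zero] with x hx
    simp [hx]

lemma star_twist : star twist = scaleOp isScale_add_inv one_ne_zero := by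
  refine star_scaleOp _ _ _ _ ?_ (by norm_num)
  filter_upwards [isScale_add.ne_zero] with x hx
  simp [hx]

lemma contDiffOn_add : ContDiffOn ℝ ∞ (fun z : ℝ => 1 + z) {z | z + 1 ≠ 0} := by fun_prop

lemma isTestU_twist {F : Q → ℂ} (hF : IsTestU F) :
    IsTestU fun q => F ((1 + q.2.1) • q.1, q.2) :=
  isTestU_scale hF contDiffOn_add fun z hz => by rwa [add_comm]

lemma isTestU_twist_inv {F : Q → ℂ} (hF : IsTestU F) :
    IsTestU fun q => F ((1 + q.2.1)⁻¹ • q.1, q.2) := by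
  have h1 : ∀ z : ℝ, z + 1 ≠ 0 → 1 + z ≠ 0 := fun z hz => by rwa [add_comm]
  exact isTestU_scale hF (contDiffOn_add.inv fun z hz => h1 z hz) fun z hz => inv_ne_zero (h1 z hz)

lemma twist_mul_rep₂ {F : Q → ℂ} (hF : IsTestU F) :
    twist * rep₂ F = rep₂ fun q => F ((1 + q.2.1) • q.1, q.2) :=
  scaleOp_mul_rep₂ _ _ hF.1 (isTestU_twist hF).1 fun q => by simp

lemma star_twist_mul_rep₂ {F : Q → ℂ} (hF : IsTestU F) :
    star twist * rep₂ F = rep₂ fun q => F ((1 + q.2.1)⁻¹ • q.1, q.2) := by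
  rw [star_twist]
  exact scaleOp_mul_rep₂ _ _ hF.1 (isTestU_twist_inv hF).1 fun q => by simp

/-- The twist and its inverse both preserve 𝒜(Γ × U), whose operators are norm dense in those of 𝒟(Γ
× Γ). Hence products with either stay in the C*-algebra. -/
lemma isTwist_twist : IsTwist twist where
  unitary := twist_mem_unitary
  multiplier := by
    refine isMultiplier₂_of (fun F hF => mul_rep₂_mem_of_isTestU (fun G hG => ?_) hF)
      fun F hF => mul_rep₂_mem_of_isTestU (fun G hG => ?_) hF
    · rw [twist_mul_rep₂ hG]
      exact rep₂_mem_Cr₂ (isTestU_twist hG).1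
    · rw [star_twist_mul_rep₂ hG]
      exact rep₂_mem_Cr₂ (isTestU_twist_inv hG).1
  extend F hF := by
    rw [push_T fun q => hF.1.eq_zero]
    exact ⟨isTestU_twist hF, twist_mul_rep₂ hF⟩

end Twist

/-! ### Approximate identities -/

section ApproximateIdentity

/-- A sequence of bump functions at `0` which shrink to a point. -/
def shrinkingBump (E : Type*) [NormedAddCommGroup E] (n : ℕ) : ContDiffBump (0 : E) :=
  ⟨1 / (4 * (n + 1)), 1 / (2 * (n + 1)), by positivity, by
    apply one_div_lt_one_div_of_lt <;> nlinarith [(Nat.cast_nonneg n : (0 : ℝ) ≤ n)]⟩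

lemma rOut_shrinkingBump_le {E : Type*} [NormedAddCommGroup E] (n : ℕ) : (shrinkingBump E n).rOut ≤ 1 / 2 := by
  change 1 / (2 * ((n : ℝ) + 1)) ≤ 1 / 2
  apply one_div_le_one_div_of_le <;> nlinarith [(Nat.cast_nonneg n : (0 : ℝ) ≤ n)]

variable {E : Type*} [NormedAddCommGroup E] [NormedSpace ℝ E] [FiniteDimensional ℝ E]
  [MeasureSpace E]

/-- An approximate identity at `x₀`. -/
def approxId (x₀ : E) (n : ℕ) (x : E) : ℝ := (shrinkingBump E n).normed volume (x₀ - x)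

lemma contDiff_approxId (x₀ : E) (n : ℕ) : ContDiff ℝ ∞ (approxId x₀ n) :=
  ((shrinkingBump E n).contDiff_normed (n := ⊤)).comp (contDiff_const.sub contDiff_id)

lemma approxId_nonneg (x₀ : E) (n : ℕ) (x : E) : 0 ≤ approxId x₀ n x :=
  ContDiffBump.nonneg_normed _ _

variable [BorelSpace E] [(volume : Measure E).IsAddHaarMeasure]

lemma approxId_eq_zero {x₀ x : E} {n : ℕ} (hx : x ∉ Metric.closedBall x₀ (1 / 2)) :
    approxId x₀ n x = 0 := by
  rw [approxId, ← Function.notMem_support, ContDiffBump.support_normed_eq]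
  intro h
  rw [Metric.mem_ball, dist_zero_right] at h
  rw [Metric.mem_closedBall, dist_comm, dist_eq_norm] at hx
  exact hx (h.le.trans (rOut_shrinkingBump_le n))

lemma tendsto_approxId {x₀ : E} {g : E → ℂ} (hm : Measurable g) (hc : ContinuousAt g x₀) :
    Tendsto (fun n => ∫ x, (approxId x₀ n x : ℂ) * g x) atTop (𝓝 (g x₀)) := by
  have h1 := ContDiffBump.convolution_tendsto_right (μ := (volume : Measure E)) (g := fun _ : ℕ => g)
    (φ := fun n => shrinkingBump E n) (k := fun _ => x₀) (x₀ := x₀) (z₀ := g x₀) (l := atTop) ?_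
    (Eventually.of_forall fun _ => hm.aestronglyMeasurable) ?_ tendsto_const_nhds
  · refine h1.congr fun n => ?_
    rw [convolution_eq_swap]
    simp [approxId]
  · have h2 := (tendsto_one_div_add_atTop_nhds_zero_nat (𝕜 := ℝ)).const_mul (1 / 2)
    rw [mul_zero] at h2
    refine h2.congr fun n => ?_
    change _ = 1 / (2 * ((n : ℝ) + 1))
    rw [one_div_mul_one_div]
  · exact hc.tendsto.comp tendsto_snd

lemma norm_integral_approxId_le {x₀ : E} {g : E → ℂ} {M : ℝ} (n : ℕ)
    (hM : ∀ x ∈ Metric.closedBall x₀ (1 / 2), ‖g x‖ ≤ M) :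
    ‖∫ x, (approxId x₀ n x : ℂ) * g x‖ ≤ M := by
  have h1 : Integrable fun x => approxId x₀ n x * M :=
    ((ContDiffBump.integrable_normed (μ := (volume : Measure E))
      (shrinkingBump E n)).comp_sub_left x₀).mul_const M
  refine (norm_integral_le_of_norm_le h1 (Eventually.of_forall fun x => ?_)).trans (le_of_eq ?_)
  · rw [norm_mul, Complex.norm_real, Real.norm_of_nonneg (approxId_nonneg _ _ _)]
    by_cases hx : x ∈ Metric.closedBall x₀ (1 / 2)
    · exact mul_le_mul_of_nonneg_left (hM x hx) (approxId_nonneg _ _ _)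
    · simp [approxId_eq_zero hx]
  · rw [integral_mul_const]
    have h2 : ∫ x, approxId x₀ n x = 1 := by
      simp only [approxId]
      rw [integral_sub_left_eq_self (fun x => (shrinkingBump E n).normed volume x) volume x₀]
      exact ContDiffBump.integral_normed _
    rw [h2, one_mul]

end ApproximateIdentity

/-! ### Nondegeneracy, and uniqueness of the twist -/

section Totality

lemma abs_ge_of_mem_closedBall {x : ℝ} (hx : x ∈ Metric.closedBall (1 : ℝ) (1 / 2)) : 1 / 2 ≤ |x| := by
  rw [Metric.mem_closedBall, Real.dist_eq, abs_le] at hx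
  exact le_abs.2 (Or.inl (by linarith [hx.1]))

lemma closedBall_subset : Metric.closedBall (1 : ℝ) (1 / 2) ⊆ {0}ᶜ := by
  intro x hx h
  rw [mem_singleton_iff] at h
  have := abs_ge_of_mem_closedBall hx
  rw [h, abs_zero] at this
  linarith

/-- If the functions `f n` converge pointwise to `G` and are dominated, then a vector orthogonal
to all of them is orthogonal to `G`. -/
lemma inner_eq_zero_of_dominated {X : Type*} [MeasurableSpace X] {m : Measure X}
    {Φ : Lp ℂ 2 m} {ψ : ℕ → Lp ℂ 2 m} {G : Lp ℂ 2 m} (h : ∀ n, ⟪Φ, ψ n⟫_ℂ = 0)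
    (hlim : Tendsto ψ atTop (𝓝 G)) : ⟪Φ, G⟫_ℂ = 0 := by
  have h1 : Tendsto (fun n => ⟪Φ, ψ n⟫_ℂ) atTop (𝓝 ⟪Φ, G⟫_ℂ) := tendsto_const_nhds.inner hlim
  simp only [h] at h1
  exact tendsto_nhds_unique h1 tendsto_const_nhds |>.symm ▸ rfl

lemma exists_bump_one {E : Type*} [NormedAddCommGroup E] [NormedSpace ℝ E] [FiniteDimensional ℝ E]
    {K : Set E} (hK : IsCompact K) : ∃ a : E → ℝ, ContDiff ℝ ∞ a ∧ HasCompactSupport a ∧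
      (∀ x ∈ K, a x = 1) ∧ ∀ x, |a x| ≤ 1 := by
  obtain ⟨r, hr0, hr⟩ := hK.isBounded.subset_closedBall_lt 0 0
  let β : ContDiffBump (0 : E) := ⟨r, r + 1, hr0, by linarith⟩
  exact ⟨β, β.contDiff, β.hasCompactSupport, fun x hx => β.one_of_mem_closedBall (hr hx),
    fun x => abs_le.2 ⟨by linarith [β.nonneg (x := x)], β.le_one⟩⟩

lemma isTest₂_approxId {a : ℝ × ℝ → ℝ} (ha : ContDiff ℝ ∞ a) (hac : HasCompactSupport a) (n : ℕ) :
    IsTest₂ fun q => ((approxId ((1 : ℝ), (1 : ℝ)) n (q.1.2, q.2.2) * a (q.1.1, q.2.1) : ℝ) : ℂ) := by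
  have hK : IsCompact ((fun x : (ℝ × ℝ) × (ℝ × ℝ) => (((x.1.1, x.2.1), (x.1.2, x.2.2)) : Q)) ''
      (tsupport a ×ˢ Metric.closedBall ((1 : ℝ), (1 : ℝ)) (1 / 2))) :=
    (hac.isCompact.prod (isCompact_closedBall _ _)).image (by fun_prop)
  refine isTest₂_of ?_ hK ?_ fun q hq => ?_
  · have h1 := contDiff_approxId ((1 : ℝ), (1 : ℝ)) n
    refine Complex.ofRealCLM.contDiff.comp ?_
    exact (h1.comp (by fun_prop)).mul (ha.comp (by fun_prop))
  · rintro _ ⟨⟨x, y⟩, ⟨_, hy⟩, rfl⟩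
    rw [← closedBall_prod_same] at hy
    exact ⟨closedBall_subset hy.1, closedBall_subset hy.2⟩
  · rw [Complex.ofReal_eq_zero, mul_eq_zero]
    by_contra! h
    refine hq ⟨((q.1.1, q.2.1), (q.1.2, q.2.2)), ⟨subset_tsupport _ h.2, ?_⟩, rfl⟩
    by_contra h2
    exact h.1 (approxId_eq_zero h2)

lemma isTest_approxId {a : ℝ → ℝ} (ha : ContDiff ℝ ∞ a) (hac : HasCompactSupport a) (n : ℕ) :
    IsTest fun p => ((approxId (1 : ℝ) n p.2 * a p.1 : ℝ) : ℂ) := by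
  refine isTest_of (K := tsupport a ×ˢ Metric.closedBall 1 (1 / 2)) ?_
    (hac.isCompact.prod (isCompact_closedBall _ _)) (fun p hp => closedBall_subset hp.2)
    fun p hp => ?_
  · have h1 := contDiff_approxId (1 : ℝ) n
    refine Complex.ofRealCLM.contDiff.comp ?_
    exact (h1.comp (by fun_prop)).mul (ha.comp (by fun_prop))
  · rw [Complex.ofReal_eq_zero, mul_eq_zero]
    by_contra! h
    refine hp ⟨subset_tsupport _ h.2, ?_⟩
    by_contra h2
    exact h.1 (approxId_eq_zero h2)

/-- K is the set of all h, h' dilates of the support of G with h and h' within 1/2 of 1. It serves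
as one support for G and for all its averages over such dilations. -/
lemma exists_support_closedBall_smul {G : Q → ℂ} (hG : IsTest₂ G) : ∃ K : Set Q, IsCompact K ∧
    K ⊆ {q | q.1.2 ≠ 0 ∧ q.2.2 ≠ 0} ∧ (∀ q, q ∉ K → G q = 0) ∧
    ∀ q, q ∉ K → ∀ h ∈ Metric.closedBall (1 : ℝ) (1 / 2), ∀ h' ∈ Metric.closedBall (1 : ℝ) (1 / 2),
      G ((q.1.1 / h, q.1.2 / h), (q.2.1 / h', q.2.2 / h')) = 0 := by
  set B := Metric.closedBall (1 : ℝ) (1 / 2)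
  have hB : IsCompact B := isCompact_closedBall _ _
  set θ : (ℝ × ℝ) × Q → Q := fun x => (x.1.1 • x.2.1, x.1.2 • x.2.2)
  have key : ∀ q, q ∉ θ '' ((B ×ˢ B) ×ˢ tsupport G) → ∀ h ∈ B, ∀ h' ∈ B,
      G ((q.1.1 / h, q.1.2 / h), (q.2.1 / h', q.2.2 / h')) = 0 := by
    intro q hq h hh h' hh'
    by_contra hne
    have h0 : h ≠ 0 := closedBall_subset hh
    have h0' : h' ≠ 0 := closedBall_subset hh'
    refine hq ⟨((h, h'), _), ⟨⟨hh, hh'⟩, subset_tsupport G hne⟩, ?_⟩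
    ext <;> simp [θ] <;> field_simp
  refine ⟨θ '' ((B ×ˢ B) ×ˢ tsupport G), ?_, ?_, fun q hq => ?_, key⟩
  · exact ((hB.prod hB).prod hG.2.1.isCompact).image (by fun_prop)
  · rintro _ ⟨⟨⟨h, h'⟩, q⟩, ⟨⟨hh, hh'⟩, hq⟩, rfl⟩
    exact ⟨mul_ne_zero (closedBall_subset hh) (hG.2.2 hq).1,
      mul_ne_zero (closedBall_subset hh') (hG.2.2 hq).2⟩
  · have h1 : (1 : ℝ) ∈ B := Metric.mem_closedBall_self (by norm_num)
    simpa using key q hq 1 h1 1 h1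

lemma memLp_indicator_of_isCompact {K : Set Q} (hK : IsCompact K)
    (hKΓ : K ⊆ {q | q.1.2 ≠ 0 ∧ q.2.2 ≠ 0}) (C : ℝ) :
    MemLp (K.indicator fun _ => C) 2 (mu.prod mu) :=
  MeasureTheory.memLp_indicator_const 2 hK.measurableSet C (Or.inr (mu_prod_lt_top hK hKΓ).ne)

lemma inv_abs_le_two {x : ℝ} (hx : x ∈ Metric.closedBall (1 : ℝ) (1 / 2)) : |x|⁻¹ ≤ 2 := by
  rw [inv_le_comm₀ (by linarith [abs_ge_of_mem_closedBall hx]) (by norm_num)]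
  linarith [abs_ge_of_mem_closedBall hx]

/-- Let F_n be an approximate identity at (1, 1) in the variables (c₁, c₂), times a cutoff in (z₁,
z₂) that is 1 over K. Then F_n * G converges to G pointwise with a common bound supported in K,
hence in L². -/
lemma eq_zero_of_orthogonal_rep₂ {Φ : H₂} (h : ∀ F, IsTest₂ F → ∀ Ψ, ⟪Φ, rep₂ F Ψ⟫_ℂ = 0) :
    Φ = 0 := by
  refine eq_zero_of_orthogonal_isTestU fun G hG ψ hψ => ?_
  obtain ⟨K, hK, hKΓ, hG0, hK0⟩ := exists_support_closedBall_smul hG.1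
  obtain ⟨C, hC⟩ := hG.1.2.1.exists_bound_of_continuous hG.1.1.continuous
  have hC0 : 0 ≤ C := (norm_nonneg _).trans (hC 0)
  obtain ⟨a, ha, hac, ha1, hab⟩ := exists_bump_one (hK.image (f := fun q : Q => (q.1.1, q.2.1)) (by fun_prop))
  have hF := isTest₂_approxId ha hac
  set F : ℕ → Q → ℂ := fun n q =>
    ((approxId ((1 : ℝ), (1 : ℝ)) n (q.1.2, q.2.2) * a (q.1.1, q.2.1) : ℝ) : ℂ)
  set g : Q → ℝ × ℝ → ℂ := fun q h =>
    G ((q.1.1 / h.1, q.1.2 / h.1), (q.2.1 / h.2, q.2.2 / h.2)) / (|h.1| * |h.2|)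
  have hconv : ∀ n q, conv₂ (F n) G q = a (q.1.1, q.2.1) *
      ∫ h, (approxId ((1 : ℝ), (1 : ℝ)) n h : ℂ) * g q h := by
    intro n q
    rw [conv₂, ← integral_const_mul]
    congr 1
    funext h
    simp only [F, g]
    push_cast
    ring
  have hgK : ∀ q, q ∉ K → ∀ h ∈ Metric.closedBall ((1 : ℝ), (1 : ℝ)) (1 / 2), g q h = 0 := by
    intro q hq h hh
    rw [← closedBall_prod_same] at hh
    simp only [g]
    rw [hK0 q hq _ hh.1 _ hh.2, zero_div]
  -- The bound 5C is 4C for the convolution, as 1 / (|h| |h'|) ≤ 4 on the ball, plus C for G itself.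
  refine inner_eq_zero_of_dominated (fun n => h (F n) (hF n) ψ)
    (tendsto_of_dominated (fun n => rep₂_ae (hF n) hψ) hψ
      (memLp_indicator_of_isCompact hK hKΓ (5 * C)) (Eventually.of_forall fun n =>
      Eventually.of_forall fun q => ?_) (Eventually.of_forall fun q => ?_))
  · by_cases hq : q ∈ K
    · rw [indicator_of_mem hq, hconv]
      have h1 : ‖∫ h, (approxId ((1 : ℝ), (1 : ℝ)) n h : ℂ) * g q h‖ ≤ 4 * C := by
        refine norm_integral_approxId_le n fun h hh => ?_
        rw [← closedBall_prod_same] at hh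
        simp only [g, norm_div, norm_mul, Complex.norm_real, Real.norm_eq_abs, abs_abs]
        have h3 := inv_abs_le_two hh.1
        have h4 := inv_abs_le_two hh.2
        rw [div_eq_mul_inv, mul_inv, mul_comm (4 : ℝ)]
        have h5 : |h.1|⁻¹ * |h.2|⁻¹ ≤ 4 := by
          calc _ ≤ (2 : ℝ) * 2 := by gcongr
            _ = 4 := by norm_num
        exact mul_le_mul (hC _) h5 (by positivity) hC0
      calc _ ≤ ‖((a (q.1.1, q.2.1) : ℝ) : ℂ) * ∫ h, (approxId ((1 : ℝ), (1 : ℝ)) n h : ℂ) * g q h‖ + ‖G q‖ :=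
            norm_sub_le _ _
        _ ≤ 1 * (4 * C) + C := by
            gcongr
            · rw [norm_mul, Complex.norm_real, Real.norm_eq_abs]
              gcongr
              exact hab _
            · exact hC q
        _ = 5 * C := by ring
    · rw [indicator_of_notMem hq, hconv, hG0 q hq, sub_zero]
      have h1 : ‖∫ h, (approxId ((1 : ℝ), (1 : ℝ)) n h : ℂ) * g q h‖ ≤ 0 :=
        norm_integral_approxId_le n fun h hh => by rw [hgK q hq h hh, norm_zero]
      rw [norm_mul, le_antisymm h1 (norm_nonneg _), mul_zero]
  · refine Tendsto.congr (fun n => (hconv n q).symm) ?_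
    have hm : Measurable (g q) := by
      have := hG.1.1.continuous.measurable
      simp only [g]
      fun_prop
    have hcont : ContinuousAt (g q) (1, 1) := by
      have := hG.1.1.continuous
      simp only [g]
      refine ContinuousAt.div ?_ (by fun_prop) (by simp)
      refine ContinuousAt.comp (g := G) this.continuousAt ?_
      have e1 : ContinuousAt (fun h : ℝ × ℝ => h.1) (1, 1) := by fun_prop
      have e2 : ContinuousAt (fun h : ℝ × ℝ => h.2) (1, 1) := by fun_prop
      exact ((continuousAt_const.div e1 one_ne_zero).prodMk
        (continuousAt_const.div e1 one_ne_zero)).prodMk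
        ((continuousAt_const.div e2 one_ne_zero).prodMk (continuousAt_const.div e2 one_ne_zero))
    have h1 := (tendsto_approxId hm hcont).const_mul ((a (q.1.1, q.2.1) : ℝ) : ℂ)
    convert h1 using 2
    have h2 : g q (1, 1) = G q := by simp [g]
    rw [h2]
    by_cases hq : q ∈ K
    · rw [ha1 _ ⟨q, hq, rfl⟩, Complex.ofReal_one, one_mul]
    · rw [hG0 q hq, mul_zero]

lemma eq_zero_of_orthogonal_rep₂U {Φ : H₂} (h : ∀ F, IsTestU F → ∀ Ψ, ⟪Φ, rep₂ F Ψ⟫_ℂ = 0) :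
    Φ = 0 := by
  refine eq_zero_of_orthogonal_rep₂ fun F hF Ψ => ?_
  have h1 : ∀ δ > 0, ‖⟪Φ, rep₂ F Ψ⟫_ℂ‖ ≤ ‖Φ‖ * (δ * ‖Ψ‖) := by
    intro δ hδ
    obtain ⟨G, hG, hd⟩ := hF.exists_isTestU hδ
    have h2 : ⟪Φ, rep₂ F Ψ⟫_ℂ = ⟪Φ, (rep₂ F - rep₂ G) Ψ⟫_ℂ := by
      rw [sub_apply, inner_sub_right, h G hG, sub_zero]
    rw [h2]
    refine (norm_inner_le_norm _ _).trans (mul_le_mul_of_nonneg_left ?_ (norm_nonneg _))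
    exact ((rep₂ F - rep₂ G).le_opNorm Ψ).trans (mul_le_mul_of_nonneg_right hd (norm_nonneg _))
  have h2 : Tendsto (fun δ : ℝ => ‖Φ‖ * (δ * ‖Ψ‖)) (𝓝[>] 0) (𝓝 (‖Φ‖ * (0 * ‖Ψ‖))) :=
    (Continuous.tendsto (by fun_prop) 0).mono_left nhdsWithin_le_nhds
  rw [zero_mul, mul_zero] at h2
  have h3 := ge_of_tendsto h2 (eventually_nhdsWithin_of_forall h1)
  exact norm_le_zero_iff.1 h3

/-- The argument for `rep₂` with one dilation parameter, and with the cutoff in z₁ + z₂. It says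
that Δ₀ is nondegenerate. -/
lemma eq_zero_of_orthogonal_deltaOp {Φ : H₂} (h : ∀ f, IsTest f → ∀ Ψ, ⟪Φ, deltaOp f Ψ⟫_ℂ = 0) :
    Φ = 0 := by
  refine eq_zero_of_orthogonal_isTestU fun G hG ψ hψ => ?_
  obtain ⟨K, hK, hKΓ, hG0, hK0⟩ := exists_support_closedBall_smul hG.1
  obtain ⟨C, hC⟩ := hG.1.2.1.exists_bound_of_continuous hG.1.1.continuous
  have hC0 : 0 ≤ C := (norm_nonneg _).trans (hC 0)
  obtain ⟨a, ha, hac, ha1, hab⟩ := exists_bump_one (hK.image (f := fun q : Q => q.1.1 + q.2.1) (by fun_prop))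
  have hF := isTest_approxId ha hac
  set F : ℕ → P → ℂ := fun n p => ((approxId (1 : ℝ) n p.2 * a p.1 : ℝ) : ℂ)
  set g : Q → ℝ → ℂ := fun q h => G ((q.1.1 / h, q.1.2 / h), (q.2.1 / h, q.2.2 / h)) / |h|
  have hconv : ∀ n q, delta₀ (F n) G q = a (q.1.1 + q.2.1) *
      ∫ h, (approxId (1 : ℝ) n h : ℂ) * g q h := by
    intro n q
    rw [delta₀, ← integral_const_mul]
    congr 1
    funext h
    simp only [F, g]
    push_cast
    ring
  refine inner_eq_zero_of_dominated (fun n => h (F n) (hF n) ψ)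
    (tendsto_of_dominated (fun n => deltaOp_ae (hF n) hψ) hψ
      (memLp_indicator_of_isCompact hK hKΓ (3 * C)) (Eventually.of_forall fun n =>
      Eventually.of_forall fun q => ?_) (Eventually.of_forall fun q => ?_))
  · by_cases hq : q ∈ K
    · rw [indicator_of_mem hq, hconv]
      have h1 : ‖∫ h, (approxId (1 : ℝ) n h : ℂ) * g q h‖ ≤ 2 * C := by
        refine norm_integral_approxId_le n fun h hh => ?_
        simp only [g, norm_div, Complex.norm_real, Real.norm_eq_abs, abs_abs]
        rw [div_eq_mul_inv, mul_comm (2 : ℝ)]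
        exact mul_le_mul (hC _) (inv_abs_le_two hh) (by positivity) hC0
      calc _ ≤ ‖((a (q.1.1 + q.2.1) : ℝ) : ℂ) * ∫ h, (approxId (1 : ℝ) n h : ℂ) * g q h‖ + ‖G q‖ :=
            norm_sub_le _ _
        _ ≤ 1 * (2 * C) + C := by
            gcongr
            · rw [norm_mul, Complex.norm_real, Real.norm_eq_abs]
              gcongr
              exact hab _
            · exact hC q
        _ = 3 * C := by ring
    · rw [indicator_of_notMem hq, hconv, hG0 q hq, sub_zero]
      have h1 : ‖∫ h, (approxId (1 : ℝ) n h : ℂ) * g q h‖ ≤ 0 :=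
        norm_integral_approxId_le n fun h hh => by
          simp only [g]
          rw [hK0 q hq h hh h hh, zero_div, norm_zero]
      rw [norm_mul, le_antisymm h1 (norm_nonneg _), mul_zero]
  · refine Tendsto.congr (fun n => (hconv n q).symm) ?_
    have hm : Measurable (g q) := by
      have := hG.1.1.continuous.measurable
      simp only [g]
      fun_prop
    have hcont : ContinuousAt (g q) 1 := by
      have := hG.1.1.continuous
      simp only [g]
      refine ContinuousAt.div ?_ (by fun_prop) (by simp)
      refine ContinuousAt.comp (g := G) this.continuousAt ?_
      have e1 : ContinuousAt (fun h : ℝ => h) 1 := by fun_prop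
      exact ((continuousAt_const.div e1 one_ne_zero).prodMk
        (continuousAt_const.div e1 one_ne_zero)).prodMk
        ((continuousAt_const.div e1 one_ne_zero).prodMk (continuousAt_const.div e1 one_ne_zero))
    have h1 := (tendsto_approxId hm hcont).const_mul ((a (q.1.1 + q.2.1) : ℝ) : ℂ)
    convert h1 using 2
    have h2 : g q 1 = G q := by simp [g]
    rw [h2]
    by_cases hq : q ∈ K
    · rw [ha1 _ ⟨q, hq, rfl⟩, Complex.ofReal_one, one_mul]
    · rw [hG0 q hq, mul_zero]

/-- The ranges of these operators are total, so the products determine m. Uniqueness of both the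
twist and Δ₀ rests on this. -/
lemma eq_of_mul_rep₂U {m m' : H₂ →L[ℂ] H₂} (h : ∀ F, IsTestU F → m * rep₂ F = m' * rep₂ F) :
    m = m' := by
  refine ext_of_inner_dense (D := {ψ : H₂ | ∃ F Ψ, IsTestU F ∧ ψ = rep₂ F Ψ})
    (fun Φ hΦ => eq_zero_of_orthogonal_rep₂U fun F hF Ψ => hΦ _ ⟨F, Ψ, hF, rfl⟩) ?_
  rintro _ ⟨F, Ψ, hF, rfl⟩
  exact congrArg (fun a : H₂ →L[ℂ] H₂ => a Ψ) (h F hF)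

lemma isTwist_iff {m : H₂ →L[ℂ] H₂} : IsTwist m ↔ m = twist := by
  refine ⟨fun hm => eq_of_mul_rep₂U fun F hF => ?_, fun h => h ▸ isTwist_twist⟩
  rw [(hm.extend F hF).2, (isTwist_twist.extend F hF).2]

end Totality

/-! ### Smooth families of test functions -/

section SmoothFamilies

/-- A family of smooth functions with supports in a common compact set `K`, which is uniformly
differentiable at `t = 0` with derivative `f'`. -/
structure IsSmoothFamily {X : Type*} [NormedAddCommGroup X] [NormedSpace ℝ X] (f : ℝ → X → ℂ)
    (f' : X → ℂ) (K : Set X) : Prop where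
  isCompact : IsCompact K
  contDiff : ∀ t ∈ Icc (-1 : ℝ) 1, ContDiff ℝ ∞ (f t)
  eq_zero : ∀ t ∈ Icc (-1 : ℝ) 1, ∀ x, x ∉ K → f t x = 0
  contDiff_deriv : ContDiff ℝ ∞ f'
  deriv_eq_zero : ∀ x, x ∉ K → f' x = 0
  bound : ∃ C, ∀ t ∈ Icc (-1 : ℝ) 1, ∀ x, ‖f t x - f 0 x - t * f' x‖ ≤ C * t ^ 2

lemma hasDerivAt_of_sq {E : Type*} [NormedAddCommGroup E] [NormedSpace ℝ E] {g : ℝ → E} {g' : E}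
    {C : ℝ} (h : ∀ t ∈ Icc (-1 : ℝ) 1, ‖g t - g 0 - t • g'‖ ≤ C * t ^ 2) : HasDerivAt g g' 0 := by
  rw [hasDerivAt_iff_isLittleO]
  have h1 : (fun t : ℝ => g t - g 0 - (t - 0) • g') =O[𝓝 0] fun t : ℝ => t ^ 2 := by
    refine Asymptotics.IsBigO.of_bound C ?_
    filter_upwards [Icc_mem_nhds (show (-1 : ℝ) < 0 by norm_num) (show (0 : ℝ) < 1 by norm_num)] with t ht
    rw [sub_zero, Real.norm_of_nonneg (sq_nonneg t)]
    exact h t ht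
  refine h1.trans_isLittleO ?_
  simp only [sub_zero]
  exact Asymptotics.isLittleO_pow_id one_lt_two

variable {X : Type*} [NormedAddCommGroup X] [NormedSpace ℝ X]

lemma norm_sub_le_of_deriv_le {g g' : ℝ → ℂ} {C : ℝ}
    (hg : ∀ t ∈ Icc (-1 : ℝ) 1, HasDerivAt g (g' t) t) {t : ℝ} (ht : t ∈ Icc (-1 : ℝ) 1)
    (h : ∀ s, |s| ≤ |t| → ‖g' s‖ ≤ C) : ‖g t - g 0‖ ≤ C * |t| := by
  have hsub : ∀ s ∈ Icc (-|t|) |t|, s ∈ Icc (-1 : ℝ) 1 := fun s hs =>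
    abs_le.1 ((abs_le.2 hs).trans (abs_le.2 ht))
  have h1 := (convex_Icc (-|t|) |t|).norm_image_sub_le_of_norm_hasDerivWithin_le (f := g) (f' := g')
    (C := C) (fun s hs => (hg s (hsub s hs)).hasDerivWithinAt) (fun s hs => h s (abs_le.2 hs))
    (x := 0) (y := t) ⟨by simp, by simp⟩ (abs_le.1 le_rfl)
  simpa using h1

/-- The second derivative in t is bounded on the compact set [-1, 1] × K. Two applications of the
mean value inequality give the remainder C t², uniformly in x. The larger open interval only leaves
room for derivatives at ±1. -/
lemma isSmoothFamily_of_contDiffOn {f : ℝ → X → ℂ} {f' : X → ℂ}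
    (hf : ContDiffOn ℝ ∞ (Function.uncurry f) (Ioo (-2) 2 ×ˢ univ)) {K : Set X} (hK : IsCompact K)
    (h0 : ∀ t ∈ Icc (-1 : ℝ) 1, ∀ x, x ∉ K → f t x = 0)
    (hf' : ∀ x, HasDerivAt (fun t => f t x) (f' x) 0) : IsSmoothFamily f f' K := by
  set O : Set (ℝ × X) := Ioo (-2) 2 ×ˢ univ with hOdef
  have hO : IsOpen O := isOpen_Ioo.prod isOpen_univ
  have hmem : ∀ t ∈ Icc (-1 : ℝ) 1, ∀ x, (t, x) ∈ O := fun t ht x =>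
    ⟨⟨by linarith [ht.1], by linarith [ht.2]⟩, trivial⟩
  have zero_mem : (0 : ℝ) ∈ Icc (-1 : ℝ) 1 := ⟨by norm_num, by norm_num⟩
  set D : ℝ × X → ℂ := fun p => fderiv ℝ (Function.uncurry f) p (1, 0) with hD
  have hDs : ContDiffOn ℝ ∞ D O :=
    (hf.fderiv_of_isOpen hO (m := ∞) (by norm_num)).clm_apply contDiffOn_const
  set D2 : ℝ × X → ℂ := fun p => fderiv ℝ D p (1, 0) with hD2
  have hD2s : ContDiffOn ℝ ∞ D2 O :=
    (hDs.fderiv_of_isOpen hO (m := ∞) (by norm_num)).clm_apply contDiffOn_const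
  have key : ∀ (g : ℝ × X → ℂ), ContDiffOn ℝ ∞ g O → ∀ t ∈ Icc (-1 : ℝ) 1, ∀ x,
      HasDerivAt (fun s => g (s, x)) (fderiv ℝ g (t, x) (1, 0)) t := by
    intro g hg t ht x
    have h1 : DifferentiableAt ℝ g (t, x) :=
      (hg.contDiffAt (hO.mem_nhds (hmem t ht x))).differentiableAt (by norm_num)
    have h2 : HasDerivAt (fun s : ℝ => (s, x)) (1, 0) t :=
      (hasDerivAt_id t).prodMk (hasDerivAt_const t x)
    exact h1.hasFDerivAt.comp_hasDerivAt t h2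
  have hfd : ∀ x, f' x = D (0, x) := fun x => (hf' x).unique (key _ hf 0 zero_mem x)
  have hcomp : ∀ t ∈ Icc (-1 : ℝ) 1, ∀ g : ℝ × X → ℂ, ContDiffOn ℝ ∞ g O →
      ContDiff ℝ ∞ fun x => g (t, x) := fun t ht g hg => by
    rw [← contDiffOn_univ]
    exact hg.comp (contDiff_const.prodMk contDiff_id).contDiffOn fun x _ => hmem t ht x
  have hf'0 : ∀ x, x ∉ K → f' x = 0 := by
    intro x hx
    refine (hf' x).unique ((hasDerivAt_const (0 : ℝ) (0 : ℂ)).congr_of_eventuallyEq ?_)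
    filter_upwards [Icc_mem_nhds (show (-1 : ℝ) < 0 by norm_num) (show (0 : ℝ) < 1 by norm_num)] with t ht
    exact h0 t ht x hx
  refine ⟨hK, fun t ht => hcomp t ht _ hf, h0, ?_, hf'0, ?_⟩
  · rw [funext hfd]
    exact hcomp 0 zero_mem D hDs
  obtain ⟨C, hC⟩ := (isCompact_Icc.prod hK).exists_bound_of_continuousOn
    (hD2s.continuousOn.mono fun p hp => hmem p.1 hp.1 p.2 :
      ContinuousOn D2 (Icc (-1 : ℝ) 1 ×ˢ K))
  refine ⟨max C 0, fun t ht x => ?_⟩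
  by_cases hx : x ∈ K
  · have h1 : ∀ s ∈ Icc (-1 : ℝ) 1, ‖D (s, x) - D (0, x)‖ ≤ max C 0 * |s| := fun s hs =>
      norm_sub_le_of_deriv_le (g := fun s => D (s, x)) (key D hDs · · x) hs fun r hr =>
        (hC (r, x) ⟨abs_le.1 (hr.trans (abs_le.2 hs)), hx⟩).trans (le_max_left _ _)
    have h2 : ‖(f t x - t * D (0, x)) - (f 0 x - (0 : ℝ) * D (0, x))‖ ≤ max C 0 * |t| * |t| := by
      refine norm_sub_le_of_deriv_le (g := fun s => f s x - s * D (0, x))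
        (g' := fun s => D (s, x) - 1 * D (0, x)) (fun s hs => ?_) ht fun s hs => ?_
      · exact (key _ hf s hs x).sub ((hasDerivAt_id s).ofReal_comp.mul_const _)
      · rw [one_mul]
        exact (h1 s (abs_le.1 (hs.trans (abs_le.2 ht)))).trans (by gcongr)
    rw [hfd x, sq, ← abs_mul_abs_self t, ← mul_assoc]
    convert h2 using 2
    push_cast
    ring
  · rw [h0 t ht x hx, h0 0 zero_mem x hx, hf'0 x hx]
    simp only [sub_zero, mul_zero, norm_zero]
    positivity

/-- The flow G may be singular outside O. The pairs (t, x) with t ∈ [-2, 2] and G t x in the support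
of F form part of the compact set of pairs (t, G' t y), y in the support, which projects into O.
Near any point outside O the family is therefore 0. -/
lemma isSmoothFamily_pullback {F : X → ℂ} (hF : ContDiff ℝ ∞ F) (hFc : HasCompactSupport F)
    {O : Set X} (hO : IsOpen O) (hFO : tsupport F ⊆ O) {G G' : ℝ → X → X} {v : X → X}
    (hG : ContDiffOn ℝ ∞ (Function.uncurry G) (univ ×ˢ O))
    (hG' : ContinuousOn (Function.uncurry G') (univ ×ˢ O)) (hmap : ∀ t, MapsTo (G' t) O O)
    (hinv : ∀ t x, G t x ∈ O → G' t (G t x) = x) (hG0 : ∀ x, G 0 x = x)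
    (hv : ∀ x ∈ O, HasDerivAt (fun t => G t x) (v x) 0) :
    ∃ K, K ⊆ O ∧ IsSmoothFamily (fun t x => F (G t x)) (fun x => fderiv ℝ F x (v x)) K := by
  set 𝒦 : Set (ℝ × X) := (fun p : ℝ × X => (p.1, G' p.1 p.2)) '' (Icc (-2) 2 ×ˢ tsupport F) with h𝒦
  have hc : IsCompact 𝒦 := by
    refine (isCompact_Icc.prod hFc.isCompact).image_of_continuousOn ?_
    exact (continuousOn_fst.prodMk hG').mono fun p hp => ⟨trivial, hFO hp.2⟩
  have hmem : ∀ t ∈ Icc (-2 : ℝ) 2, ∀ x, G t x ∈ tsupport F → (t, x) ∈ 𝒦 := fun t ht x hx =>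
    ⟨(t, G t x), ⟨ht, hx⟩, by simp [hinv t x (hFO hx)]⟩
  have hKO : Prod.snd '' 𝒦 ⊆ O := by
    rintro _ ⟨_, ⟨p, hp, rfl⟩, rfl⟩
    exact hmap _ (hFO hp.2)
  refine ⟨Prod.snd '' 𝒦, hKO, isSmoothFamily_of_contDiffOn ?_ (hc.image continuous_snd) ?_ ?_⟩
  · rintro ⟨t, x⟩ ⟨ht, -⟩
    by_cases hx : x ∈ O
    · have h1 : ContDiffAt ℝ ∞ (Function.uncurry G) (t, x) :=
        hG.contDiffAt ((isOpen_univ.prod hO).mem_nhds ⟨trivial, hx⟩)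
      exact (hF.contDiffAt.comp (t, x) h1).contDiffWithinAt
    · have h1 : (t, x) ∉ 𝒦 := fun h => hx (hKO ⟨_, h, rfl⟩)
      have h2 : Function.uncurry (fun t x => F (G t x)) =ᶠ[𝓝 (t, x)] fun _ => 0 := by
        filter_upwards [hc.isClosed.isOpen_compl.mem_nhds h1,
          (isOpen_Ioo.prod isOpen_univ).mem_nhds (⟨ht, trivial⟩ : (t, x) ∈ Ioo (-2 : ℝ) 2 ×ˢ univ)]
          with p hp hp'
        exact image_eq_zero_of_notMem_tsupport (f := F) fun h => hp (hmem p.1 ⟨hp'.1.1.le, hp'.1.2.le⟩ p.2 h)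
      exact (contDiffAt_const.congr_of_eventuallyEq h2).contDiffWithinAt
  · intro t ht x hx
    exact image_eq_zero_of_notMem_tsupport fun h =>
      hx ⟨_, hmem t ⟨by linarith [ht.1], by linarith [ht.2]⟩ x h, rfl⟩
  · intro x
    by_cases hx : x ∈ O
    · have h1 : HasFDerivAt F (fderiv ℝ F x) (G 0 x) := by
        rw [hG0]
        exact (hF.differentiable (by norm_num) x).hasFDerivAt
      exact h1.comp_hasDerivAt (0 : ℝ) (hv x hx)
    · rw [fderiv_of_notMem_tsupport ℝ fun h => hx (hFO h)]
      refine (hasDerivAt_const (0 : ℝ) (0 : ℂ)).congr_of_eventuallyEq ?_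
      filter_upwards [Icc_mem_nhds (show (-2 : ℝ) < 0 by norm_num) (show (0 : ℝ) < 2 by norm_num)]
        with t ht
      exact image_eq_zero_of_notMem_tsupport fun h => hx (hKO ⟨_, hmem t ht x h, rfl⟩)

lemma IsSmoothFamily.hasDerivAt_toLp [MeasurableSpace X] [OpensMeasurableSpace X] {m : Measure X}
    {f : ℝ → X → ℂ} {f' : X → ℂ} {K : Set X} (h : IsSmoothFamily f f' K) (hm : m K < ⊤)
    {ψ : ℝ → Lp ℂ 2 m} {η : Lp ℂ 2 m} (hψ : ∀ t, ψ t =ᵐ[m] f t) (hη : η =ᵐ[m] f') :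
    HasDerivAt ψ η 0 := by
  obtain ⟨C, hC⟩ := h.bound
  have hK := h.isCompact.measurableSet
  refine hasDerivAt_of_sq (C := C * ‖indicatorConstLp 2 hK hm.ne (1 : ℂ)‖) fun t ht => ?_
  have h1 : (ψ t - ψ 0 - t • η : Lp ℂ 2 m) =ᵐ[m] fun x => f t x - f 0 x - t * f' x := by
    filter_upwards [hψ t, hψ 0, hη, Lp.coeFn_sub (ψ t - ψ 0) (t • η), Lp.coeFn_sub (ψ t) (ψ 0),
      Lp.coeFn_smul t η] with x h1 h2 h3 h4 h5 h6
    rw [h4, Pi.sub_apply, h5, Pi.sub_apply, h6, Pi.smul_apply, h1, h2, h3, Complex.real_smul]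
  refine (norm_le_of_bounded_support hK hm (hC t ht) (fun x hx => ?_) h1).trans (le_of_eq (by ring))
  rw [h.eq_zero t ht x hx, h.eq_zero 0 ⟨by norm_num, by norm_num⟩ x hx, h.deriv_eq_zero x hx]
  ring

end SmoothFamilies

/-! ### Norm derivatives of the represented families -/

section Derivatives

variable {K : Set P} {f : ℝ → P → ℂ} {f' : P → ℂ}

lemma IsSmoothFamily.isTest (h : IsSmoothFamily f f' K) (hK : K ⊆ {p | p.2 ≠ 0}) {t : ℝ}
    (ht : t ∈ Icc (-1 : ℝ) 1) : IsTest (f t) :=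
  isTest_of (h.contDiff t ht) h.isCompact hK (h.eq_zero t ht)

lemma IsSmoothFamily.isTest_deriv (h : IsSmoothFamily f f' K) (hK : K ⊆ {p | p.2 ≠ 0}) : IsTest f' :=
  isTest_of h.contDiff_deriv h.isCompact hK h.deriv_eq_zero

lemma IsSmoothFamily.hasDerivAt_rep (h : IsSmoothFamily f f' K) (hK : K ⊆ {p | p.2 ≠ 0}) :
    HasDerivAt (fun t => rep (f t)) (rep f') 0 := by
  obtain ⟨C, hC⟩ := h.bound
  have h00 : (0 : ℝ) ∈ Icc (-1 : ℝ) 1 := ⟨by norm_num, by norm_num⟩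
  have hA : IsCompact (Prod.snd '' K) := h.isCompact.image continuous_snd
  have hA0 : Prod.snd '' K ⊆ ({0}ᶜ : Set ℝ) := by
    rintro _ ⟨p, hp, rfl⟩
    exact hK hp
  refine hasDerivAt_of_sq (C := C * (nu (Prod.snd '' K)).toReal) fun t ht => ?_
  have h1 := h.isTest hK ht
  have h2 := h.isTest hK h00
  have h3 := h.isTest_deriv hK
  have h4 : rep (f t) - rep (f 0) - t • rep f' = rep fun p => f t p - f 0 p - t * f' p := by
    rw [rep_sub (h1.sub h2) (h3.mul contDiff_const), rep_sub h1 h2, rep_smul h3]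
    rfl
  rw [h4]
  refine (norm_rep_le ((h1.sub h2).sub (h3.mul contDiff_const)) hA hA0 (hC t ht) fun p hp => ?_).trans
    (le_of_eq (by ring))
  have hp' : p ∉ K := fun hh => hp ⟨p, hh, rfl⟩
  rw [h.eq_zero t ht p hp', h.eq_zero 0 h00 p hp', h.deriv_eq_zero p hp']
  ring

variable {K₂ : Set Q} {F : ℝ → Q → ℂ} {F' : Q → ℂ}

lemma IsSmoothFamily.isTest₂ (h : IsSmoothFamily F F' K₂) (hK : K₂ ⊆ {q | q.1.2 ≠ 0 ∧ q.2.2 ≠ 0})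
    {t : ℝ} (ht : t ∈ Icc (-1 : ℝ) 1) : IsTest₂ (F t) :=
  isTest₂_of (h.contDiff t ht) h.isCompact hK (h.eq_zero t ht)

lemma IsSmoothFamily.isTest₂_deriv (h : IsSmoothFamily F F' K₂)
    (hK : K₂ ⊆ {q | q.1.2 ≠ 0 ∧ q.2.2 ≠ 0}) : IsTest₂ F' :=
  isTest₂_of h.contDiff_deriv h.isCompact hK h.deriv_eq_zero

lemma IsSmoothFamily.hasDerivAt_rep₂ (h : IsSmoothFamily F F' K₂)
    (hK : K₂ ⊆ {q | q.1.2 ≠ 0 ∧ q.2.2 ≠ 0}) : HasDerivAt (fun t => rep₂ (F t)) (rep₂ F') 0 := by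
  obtain ⟨C, hC⟩ := h.bound
  have h00 : (0 : ℝ) ∈ Icc (-1 : ℝ) 1 := ⟨by norm_num, by norm_num⟩
  set A := ((fun q : Q => q.1.2) '' K₂) ∪ ((fun q : Q => q.2.2) '' K₂)
  have hA : IsCompact A :=
    (h.isCompact.image (by fun_prop)).union (h.isCompact.image (by fun_prop))
  have hA0 : A ⊆ ({0}ᶜ : Set ℝ) := by
    rintro _ (⟨p, hp, rfl⟩ | ⟨p, hp, rfl⟩)
    · exact (hK hp).1
    · exact (hK hp).2
  refine hasDerivAt_of_sq (C := C * ((nu A).toReal * (nu A).toReal)) fun t ht => ?_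
  have h1 := h.isTest₂ hK ht
  have h2 := h.isTest₂ hK h00
  have h3 := h.isTest₂_deriv hK
  have h4 : rep₂ (F t) - rep₂ (F 0) - t • rep₂ F' = rep₂ fun p => F t p - F 0 p - t * F' p := by
    rw [rep₂_sub (h1.sub h2) (h3.mul contDiff_const), rep₂_sub h1 h2, rep₂_smul h3]
    rfl
  rw [h4]
  refine (norm_rep₂_le ((h1.sub h2).sub (h3.mul contDiff_const)) hA hA0 (hC t ht) fun p hp => ?_).trans
    (le_of_eq (by ring))
  have hp' : p ∉ K₂ := fun hh => hp ⟨Or.inl ⟨p, hh, rfl⟩, Or.inr ⟨p, hh, rfl⟩⟩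
  rw [h.eq_zero t ht p hp', h.eq_zero 0 h00 p hp', h.deriv_eq_zero p hp']
  ring

end Derivatives

section Abstract

variable {E : Type*} [NormedAddCommGroup E] [InnerProductSpace ℂ E]

lemma mem_graph_of_hasDerivAt {U : ℝ → E →L[ℂ] E} {ψ η : E}
    (h : HasDerivAt (fun t => U t ψ) η 0) : (ψ, -Complex.I • η) ∈ (generator U).graph := by
  rw [mem_graph_generator, smul_smul]
  simpa using h

lemma hasDerivAt_clm_apply {A : ℝ → E →L[ℂ] E} {A' : E →L[ℂ] E} (h : HasDerivAt A A' 0) (Φ : E) :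
    HasDerivAt (fun t => A t Φ) (A' Φ) 0 :=
  (((ContinuousLinearMap.apply ℂ E Φ).restrictScalars ℝ).hasFDerivAt).comp_hasDerivAt (0 : ℝ) h

lemma hasDerivAt_apply_of_mul {U A : ℝ → E →L[ℂ] E} {A₀ A' : E →L[ℂ] E} (h : HasDerivAt A A' 0)
    (hU : ∀ t ∈ Icc (-1 : ℝ) 1, U t * A₀ = A t) (Φ : E) :
    HasDerivAt (fun t => U t (A₀ Φ)) (A' Φ) 0 := by
  refine (hasDerivAt_clm_apply h Φ).congr_of_eventuallyEq ?_
  filter_upwards [Icc_mem_nhds (show (-1 : ℝ) < 0 by norm_num) (show (0 : ℝ) < 1 by norm_num)] with t ht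
  exact congrArg (fun A : E →L[ℂ] E => A Φ) (hU t ht)

end Abstract

/-! ### The group B̂ and its generator -/

section Dilations

/-- The derivation `-(z ∂_z + c ∂_c)`. -/
def eulerNeg (f : P → ℂ) (x : P) : ℂ := fderiv ℝ f x (-x)

lemma isTest_dil {f : P → ℂ} (hf : IsTest f) {a : ℝ} (ha : a ≠ 0) : IsTest fun x => f (a • x) := by
  refine isTest_of (K := (fun x => a⁻¹ • x) '' tsupport f) (hf.1.comp (by fun_prop))
    (hf.2.1.isCompact.image (by fun_prop)) ?_ fun x hx => ?_
  · rintro _ ⟨p, hp, rfl⟩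
    exact mul_ne_zero (inv_ne_zero ha) (hf.2.2 hp)
  · by_contra hne
    exact hx ⟨_, subset_tsupport f hne, by simp [smul_smul, ha]⟩

lemma Bhat_mul_rep {f : P → ℂ} (hf : IsTest f) (t : ℝ) :
    Bhat t * rep f = rep fun x => f (Real.exp (-t) • x) := by
  rw [Bhat_eq]
  exact dil_mul_rep _ hf (isTest_dil hf (Real.exp_ne_zero _)) fun _ => rfl

lemma exists_isSmoothFamily_dil {f : P → ℂ} (hf : IsTest f) : ∃ K, K ⊆ {p : P | p.2 ≠ 0} ∧
    IsSmoothFamily (fun t x => f (Real.exp (-t) • x)) (eulerNeg f) K := by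
  refine isSmoothFamily_pullback (G := fun t x => Real.exp (-t) • x) (v := fun x => -x)
    (G' := fun t x => Real.exp t • x) hf.1 hf.2.1 isOpen_gamma hf.2.2 ?_ ?_ ?_ ?_ ?_ ?_
  · have : ContDiff ℝ ∞ fun p : ℝ × P => Real.exp (-p.1) • p.2 := by fun_prop
    exact this.contDiffOn
  · have : Continuous fun p : ℝ × P => Real.exp p.1 • p.2 := by fun_prop
    exact this.continuousOn
  · intro t x hx
    exact mul_ne_zero (Real.exp_ne_zero t) hx
  · intro t x _
    rw [smul_smul, ← Real.exp_add, add_neg_cancel, Real.exp_zero, one_smul]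
  · intro x; simp
  · intro x _
    have h1 : HasDerivAt (fun t : ℝ => Real.exp (-t)) (-1) 0 := by
      simpa using (hasDerivAt_id (0 : ℝ)).neg.exp
    simpa using h1.smul_const x

lemma isTest_eulerNeg {f : P → ℂ} (hf : IsTest f) : IsTest (eulerNeg f) := by
  obtain ⟨K, hK, h⟩ := exists_isSmoothFamily_dil hf
  exact h.isTest_deriv hK

lemma hasDerivAt_Bhat {f : P → ℂ} (hf : IsTest f) {ψ η : H} (hψ : ψ =ᵐ[mu] f)
    (hη : η =ᵐ[mu] eulerNeg f) : HasDerivAt (fun t => Bhat t ψ) η 0 := by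
  obtain ⟨K, hK, h⟩ := exists_isSmoothFamily_dil hf
  refine h.hasDerivAt_toLp (mu_lt_top h.isCompact hK) (fun t => ?_) hη
  rw [Bhat_eq]
  exact dil_ae _ hψ

lemma hasDerivAt_Bhat_mul_rep {f : P → ℂ} (hf : IsTest f) :
    HasDerivAt (fun t => Bhat t * rep f) (rep (eulerNeg f)) 0 := by
  obtain ⟨K, hK, h⟩ := exists_isSmoothFamily_dil hf
  simp only [Bhat_mul_rep hf]
  exact h.hasDerivAt_rep hK

lemma isUnitaryGroup_Bhat : IsUnitaryGroup Bhat := by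
  refine isUnitaryGroup_of_dense (D := {ψ | ∃ f, IsTest f ∧ ψ =ᵐ[mu] f}) (fun t => ?_) ?_ ?_
    (fun Φ hΦ => eq_zero_of_orthogonal_isTest fun g hg ψ hψ => hΦ ψ ⟨g, hg, hψ⟩) ?_
  · rw [Bhat_eq]
    exact dil_mem_unitary _
  · rw [Bhat_eq]
    exact dil_one _ (by simp)
  · intro s t
    rw [Bhat_eq, Bhat_eq, Bhat_eq]
    exact (dil_mul _ _ _ (by rw [← Real.exp_add]; congr 1; ring)).symm
  · rintro ψ ⟨f, hf, hψ⟩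
    exact (hasDerivAt_Bhat hf hψ (isTest_eulerNeg hf).memLp.coeFn_toLp).continuousAt

lemma mem_graph_Xhat {f : P → ℂ} (hf : IsTest f) {ψ η : H} (hψ : ψ =ᵐ[mu] f)
    (hη : η =ᵐ[mu] eulerNeg f) : (ψ, -Complex.I • η) ∈ Xhat.graph := by
  exact mem_graph_of_hasDerivAt (hasDerivAt_Bhat hf hψ hη)

/-- Test functions are invariant under dilations and total, hence a core for X̂. -/
lemma closure_graph_Xhat : (Submodule.span ℂ {p : H × H | ∃ f, IsTest f ∧ p.1 =ᵐ[mu] f ∧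
    p ∈ Xhat.graph}).topologicalClosure = Xhat.graph := by
  refine isUnitaryGroup_Bhat.closure_eq_graph (fun p hp => hp.choose_spec.2.2)
    (isUnitaryGroup_Bhat.dense_range_of_invariant (D := {ψ | ∃ f, IsTest f ∧ ψ =ᵐ[mu] f})
      (fun p hp => hp.choose_spec.2.2) ?_ ?_
      fun Φ hΦ => eq_zero_of_orthogonal_isTest fun g hg ψ hψ => hΦ ψ ⟨g, hg, hψ⟩)
  · rintro ψ ⟨f, hf, hψ⟩
    exact ⟨_, f, hf, hψ, mem_graph_Xhat hf hψ (isTest_eulerNeg hf).memLp.coeFn_toLp⟩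
  · rintro t ψ ⟨f, hf, hψ⟩
    refine ⟨_, isTest_dil hf (Real.exp_ne_zero (-t)), ?_⟩
    rw [Bhat_eq]
    exact dil_ae _ hψ

end Dilations

/-! ### Scaling groups on L²(Γ × Γ) -/

section ScalingGroups

/-- The maps `(x₁, x₂) ↦ (exp(-t b(z₂)) x₁, exp(-t a) x₂)` form a flow on the open set `O`. -/
structure IsScaleFlow (b : ℝ → ℝ) (a : ℝ) (O : Set Q) : Prop where
  meas : Measurable b
  invariant : ∀ t z, b (Real.exp (-(t * a)) * z) = b z
  isOpen : IsOpen O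
  subset : O ⊆ {q | q.1.2 ≠ 0 ∧ q.2.2 ≠ 0}
  supset : {q : Q | (q.1.2 ≠ 0 ∧ q.2.2 ≠ 0) ∧ q.2.1 + 1 ≠ 0} ⊆ O
  smooth : ContDiffOn ℝ ∞ (fun q : Q => b q.2.1) O
  mapsTo : ∀ t, MapsTo (fun q : Q => (Real.exp (-(t * b q.2.1)) • q.1, Real.exp (-(t * a)) • q.2)) O O

lemma isScale_exp {b : ℝ → ℝ} (hb : Measurable b) (t : ℝ) :
    IsScale fun z => Real.exp (-(t * b z)) where
  meas := by fun_prop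
  ne_zero := Eventually.of_forall fun _ => Real.exp_ne_zero _

/-- The unitaries `ψ ↦ ψ(exp(-t b(z₂)) x₁, exp(-t a) x₂)`. -/
def scaleGroup {b : ℝ → ℝ} (hb : Measurable b) (a t : ℝ) : H₂ →L[ℂ] H₂ :=
  scaleOp (isScale_exp hb t) (Real.exp_ne_zero (-(t * a)))

/-- The derivative of `F(exp(-t b(z₂)) x₁, exp(-t a) x₂)` at `t = 0`. -/
def scaleDeriv (b : ℝ → ℝ) (a : ℝ) (F : Q → ℂ) (q : Q) : ℂ :=
  fderiv ℝ F q (-(b q.2.1 • q.1), -(a • q.2))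

variable {b : ℝ → ℝ} {a : ℝ} {O : Set Q}

lemma IsTestU.tsupport_subset {F : Q → ℂ} (hF : IsTestU F) :
    tsupport F ⊆ {q : Q | (q.1.2 ≠ 0 ∧ q.2.2 ≠ 0) ∧ q.2.1 + 1 ≠ 0} :=
  fun _ hq => ⟨hF.1.2.2 hq, hF.2 hq⟩

namespace IsScaleFlow

lemma exists_isSmoothFamily (h : IsScaleFlow b a O) {F : Q → ℂ} (hF : IsTest₂ F)
    (hFO : tsupport F ⊆ O) : ∃ K, K ⊆ O ∧ IsSmoothFamily
      (fun t q => F (Real.exp (-(t * b q.2.1)) • q.1, Real.exp (-(t * a)) • q.2))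
      (scaleDeriv b a F) K := by
  have hb : ContDiffOn ℝ ∞ (fun p : ℝ × Q => b p.2.2.1) (univ ×ˢ O) :=
    h.smooth.comp contDiffOn_snd fun p hp => hp.2
  -- The values c = 1 and c = -1 give the flow and its inverse.
  have hsm : ∀ c : ℝ, ContDiffOn ℝ ∞ (fun p : ℝ × Q => (Real.exp (-(c * p.1 * b p.2.2.1)) • p.2.1,
      Real.exp (-(c * p.1 * a)) • p.2.2)) (univ ×ˢ O) := by
    intro c
    refine ContDiffOn.prodMk ?_ ?_
    · exact (((contDiffOn_const.mul contDiffOn_fst).mul hb).neg.exp).smul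
        contDiff_snd.fst.contDiffOn
    · have : ContDiff ℝ ∞ fun p : ℝ × Q => Real.exp (-(c * p.1 * a)) • p.2.2 := by fun_prop
      exact this.contDiffOn
  refine isSmoothFamily_pullback
    (G := fun t q => (Real.exp (-(t * b q.2.1)) • q.1, Real.exp (-(t * a)) • q.2))
    (G' := fun t q => (Real.exp (-(-t * b q.2.1)) • q.1, Real.exp (-(-t * a)) • q.2))
    (v := fun q => (-(b q.2.1 • q.1), -(a • q.2)))
    hF.1 hF.2.1 h.isOpen hFO ?_ ?_ (fun t => h.mapsTo (-t)) ?_ ?_ ?_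
  · simpa [Function.uncurry_def] using hsm 1
  · simpa [Function.uncurry_def] using (hsm (-1)).continuousOn
  · intro t q _
    ext1
    · simp only [Prod.smul_fst, smul_eq_mul, h.invariant, smul_smul, ← Real.exp_add]
      simp
    · simp only [smul_smul, ← Real.exp_add]
      simp
  · intro q; simp
  · intro q _
    have h1 : ∀ y : ℝ, HasDerivAt (fun t : ℝ => Real.exp (-(t * y))) (-y) 0 := fun y => by
      simpa using ((hasDerivAt_id (0 : ℝ)).mul_const y).neg.exp
    simpa using ((h1 (b q.2.1)).smul_const q.1).prodMk ((h1 a).smul_const q.2)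

lemma isTest₂_scaleDeriv (h : IsScaleFlow b a O) {F : Q → ℂ} (hF : IsTest₂ F)
    (hFO : tsupport F ⊆ O) : IsTest₂ (scaleDeriv b a F) := by
  obtain ⟨K, hK, hfam⟩ := h.exists_isSmoothFamily hF hFO
  exact hfam.isTest₂_deriv (hK.trans h.subset)

lemma isTestU_scaleDeriv (h : IsScaleFlow b a O) {F : Q → ℂ} (hF : IsTestU F) :
    IsTestU (scaleDeriv b a F) := by
  refine ⟨h.isTest₂_scaleDeriv hF.1 (hF.tsupport_subset.trans h.supset), ?_⟩
  refine (closure_minimal (fun q hq => ?_) (isClosed_tsupport F)).trans hF.2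
  by_contra hne
  exact hq (by rw [scaleDeriv, fderiv_of_notMem_tsupport ℝ hne]; rfl)

lemma hasDerivAt (h : IsScaleFlow b a O) {F : Q → ℂ} (hF : IsTest₂ F) (hFO : tsupport F ⊆ O)
    {ψ η : H₂} (hψ : ψ =ᵐ[mu.prod mu] F) (hη : η =ᵐ[mu.prod mu] scaleDeriv b a F) :
    HasDerivAt (fun t => scaleGroup h.meas a t ψ) η 0 := by
  obtain ⟨K, hK, hfam⟩ := h.exists_isSmoothFamily hF hFO
  exact hfam.hasDerivAt_toLp (mu_prod_lt_top hfam.isCompact (hK.trans h.subset))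
    (fun t => scaleOp_ae _ _ hψ) hη

lemma hasDerivAt_rep₂ (h : IsScaleFlow b a O) {F : Q → ℂ} (hF : IsTest₂ F) (hFO : tsupport F ⊆ O)
    (Φ : H₂) : HasDerivAt (fun t => scaleGroup h.meas a t (rep₂ F Φ)) (rep₂ (scaleDeriv b a F) Φ) 0 := by
  obtain ⟨K, hK, hfam⟩ := h.exists_isSmoothFamily hF hFO
  exact hasDerivAt_apply_of_mul (hfam.hasDerivAt_rep₂ (hK.trans h.subset)) (fun t ht =>
    scaleOp_mul_rep₂ (isScale_exp h.meas t) (Real.exp_ne_zero (-(t * a))) hF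
      (hfam.isTest₂ (hK.trans h.subset) ht) fun q => rfl) Φ

lemma isUnitaryGroup (h : IsScaleFlow b a O) : IsUnitaryGroup (scaleGroup h.meas a) := by
  have key : ∀ s t : ℝ, ∀ᵐ x ∂mu, Real.exp (-(t * b (Real.exp (-(s * a)) * x.1))) *
      Real.exp (-(s * b x.1)) = Real.exp (-((s + t) * b x.1)) := fun s t => by
    refine Eventually.of_forall fun x => ?_
    rw [h.invariant, ← Real.exp_add]
    congr 1
    ring
  refine isUnitaryGroup_of_dense (D := {ψ | ∃ F, IsTestU F ∧ ψ =ᵐ[mu.prod mu] F}) (fun t => ?_) ?_ ?_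
    (fun Φ hΦ => eq_zero_of_orthogonal_isTestU fun g hg ψ hψ => hΦ ψ ⟨g, hg, hψ⟩) ?_
  · refine scaleOp_mem_unitary (isScale_exp h.meas t) (isScale_exp h.meas (-t)) _
      (Real.exp_ne_zero (-(-t * a))) ?_ ?_ ?_
    · exact (key t (-t)).mono fun x hx => hx.trans (by simp)
    · exact (key (-t) t).mono fun x hx => hx.trans (by simp)
    · rw [← Real.exp_add]; simp
  · exact scaleOp_one _ _ (by simp) (by simp)
  · intro s t
    have hk : Real.exp (-(s * a)) * Real.exp (-(t * a)) = Real.exp (-((s + t) * a)) := by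
      rw [← Real.exp_add]
      congr 1
      ring
    exact (scaleOp_mul (isScale_exp h.meas s) (isScale_exp h.meas t) (isScale_exp h.meas (s + t))
      (Real.exp_ne_zero (-(s * a))) (Real.exp_ne_zero (-(t * a))) (Real.exp_ne_zero (-((s + t) * a)))
      (key s t) hk).symm
  · rintro ψ ⟨F, hF, hψ⟩
    exact (h.hasDerivAt hF.1 (hF.tsupport_subset.trans h.supset) hψ
      (h.isTestU_scaleDeriv hF).1.memLp.coeFn_toLp).continuousAt

lemma mem_graph (h : IsScaleFlow b a O) {F : Q → ℂ} (hF : IsTest₂ F) (hFO : tsupport F ⊆ O)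
    {ψ η : H₂} (hψ : ψ =ᵐ[mu.prod mu] F) (hη : η =ᵐ[mu.prod mu] scaleDeriv b a F) :
    (ψ, -Complex.I • η) ∈ (generator (scaleGroup h.meas a)).graph := by
  exact mem_graph_of_hasDerivAt (h.hasDerivAt hF hFO hψ hη)

lemma mem_graph_rep₂ (h : IsScaleFlow b a O) {F : Q → ℂ} (hF : IsTest₂ F) (hFO : tsupport F ⊆ O)
    (Φ : H₂) : (rep₂ F Φ, -Complex.I • rep₂ (scaleDeriv b a F) Φ) ∈
      (generator (scaleGroup h.meas a)).graph := by
  exact mem_graph_of_hasDerivAt (h.hasDerivAt_rep₂ hF hFO Φ)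

end IsScaleFlow

lemma isScaleFlow_const (b a : ℝ) :
    IsScaleFlow (fun _ => b) a {q | q.1.2 ≠ 0 ∧ q.2.2 ≠ 0} where
  meas := measurable_const
  invariant _ _ := rfl
  isOpen := isOpen_gamma₂
  subset := subset_rfl
  supset := fun _ hq => hq.1
  smooth := contDiffOn_const
  mapsTo _ _ hq := ⟨mul_ne_zero (Real.exp_ne_zero _) hq.1, mul_ne_zero (Real.exp_ne_zero _) hq.2⟩

lemma isScaleFlow_of_contDiffOn {b : ℝ → ℝ} (hm : Measurable b)
    (hb : ContDiffOn ℝ ∞ b {z | z + 1 ≠ 0}) :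
    IsScaleFlow b 0 {q | (q.1.2 ≠ 0 ∧ q.2.2 ≠ 0) ∧ q.2.1 + 1 ≠ 0} where
  meas := hm
  invariant _ _ := by simp
  isOpen := isOpen_gammaU
  subset := fun _ hq => hq.1
  supset := subset_rfl
  smooth := hb.comp contDiff_snd.fst.contDiffOn fun q hq => hq.2
  mapsTo t q hq := by
    refine ⟨⟨mul_ne_zero (Real.exp_ne_zero _) hq.1.1, ?_⟩, ?_⟩
    · simpa using hq.1.2
    · simpa using hq.2

end ScalingGroups

/-! ### Elementary tensors in L²(Γ × Γ) -/

section TensorProduct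

instance : SigmaFinite mu := by
  rw [mu]
  exact SigmaFinite.withDensity_of_ne_top (Eventually.of_forall fun _ => ENNReal.ofReal_ne_top)

lemma aestronglyMeasurable_tensor {f g : P → ℂ} (hf : AEStronglyMeasurable f mu)
    (hg : AEStronglyMeasurable g mu) :
    AEStronglyMeasurable (fun q : Q => f q.1 * g q.2) (mu.prod mu) :=
  (hf.comp_quasiMeasurePreserving Measure.quasiMeasurePreserving_fst).mul
    (hg.comp_quasiMeasurePreserving Measure.quasiMeasurePreserving_snd)

lemma memLp_tensor {f g : P → ℂ} (hf : MemLp f 2 mu) (hg : MemLp g 2 mu) :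
    MemLp (fun q : Q => f q.1 * g q.2) 2 (mu.prod mu) := by
  rw [memLp_two_iff_integrable_sq_norm (aestronglyMeasurable_tensor hf.1 hg.1)]
  refine (((memLp_two_iff_integrable_sq_norm hf.1).1 hf).mul_prod
    ((memLp_two_iff_integrable_sq_norm hg.1).1 hg)).congr (Eventually.of_forall fun q => ?_)
  simp only [norm_mul, mul_pow]

lemma tensor_ae_congr {f f' g g' : P → ℂ} (hf : f =ᵐ[mu] f') (hg : g =ᵐ[mu] g') :
    (fun q : Q => f q.1 * g q.2) =ᵐ[mu.prod mu] fun q => f' q.1 * g' q.2 := by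
  filter_upwards [ae_mu_mu_fst hf, ae_mu_mu_snd hg] with q h1 h2
  rw [h1, h2]

/-- The class of `ψ(x₁) φ(x₂)`. -/
def tmul (ψ φ : H) : H₂ := (memLp_tensor (Lp.memLp ψ) (Lp.memLp φ)).toLp

lemma tmul_ae_coe (ψ φ : H) : tmul ψ φ =ᵐ[mu.prod mu] fun q => ψ q.1 * φ q.2 := MemLp.coeFn_toLp _

lemma tmul_ae {ψ φ : H} {f g : P → ℂ} (hf : ψ =ᵐ[mu] f) (hg : φ =ᵐ[mu] g) :
    tmul ψ φ =ᵐ[mu.prod mu] fun q => f q.1 * g q.2 :=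
  (tmul_ae_coe ψ φ).trans (tensor_ae_congr hf hg)

lemma isTensor_iff {Ψ : H₂} {ψ φ : H} : IsTensor Ψ ψ φ ↔ Ψ = tmul ψ φ :=
  ⟨fun h => Lp.ext (h.trans (tmul_ae_coe ψ φ).symm), fun h => h ▸ tmul_ae_coe ψ φ⟩

lemma tmul_add_left (ψ ψ' φ : H) : tmul (ψ + ψ') φ = tmul ψ φ + tmul ψ' φ := by
  refine Lp.ext ?_
  filter_upwards [tmul_ae (Lp.coeFn_add ψ ψ') (ae_eq_refl φ), tmul_ae_coe ψ φ, tmul_ae_coe ψ' φ,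
    Lp.coeFn_add (tmul ψ φ) (tmul ψ' φ)] with q h1 h2 h3 h4
  rw [h1, h4, Pi.add_apply, Pi.add_apply, h2, h3, add_mul]

lemma tmul_add_right (ψ φ φ' : H) : tmul ψ (φ + φ') = tmul ψ φ + tmul ψ φ' := by
  refine Lp.ext ?_
  filter_upwards [tmul_ae (ae_eq_refl ψ) (Lp.coeFn_add φ φ'), tmul_ae_coe ψ φ, tmul_ae_coe ψ φ',
    Lp.coeFn_add (tmul ψ φ) (tmul ψ φ')] with q h1 h2 h3 h4
  rw [h1, h4, Pi.add_apply, Pi.add_apply, h2, h3, mul_add]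

lemma tmul_smul_left (c : ℂ) (ψ φ : H) : tmul (c • ψ) φ = c • tmul ψ φ := by
  refine Lp.ext ?_
  filter_upwards [tmul_ae (Lp.coeFn_smul c ψ) (ae_eq_refl φ), tmul_ae_coe ψ φ,
    Lp.coeFn_smul c (tmul ψ φ)] with q h1 h2 h3
  rw [h1, h3, Pi.smul_apply, Pi.smul_apply, h2, smul_eq_mul, smul_eq_mul, mul_assoc]

lemma tmul_smul_right (c : ℂ) (ψ φ : H) : tmul ψ (c • φ) = c • tmul ψ φ := by
  refine Lp.ext ?_
  filter_upwards [tmul_ae (ae_eq_refl ψ) (Lp.coeFn_smul c φ), tmul_ae_coe ψ φ,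
    Lp.coeFn_smul c (tmul ψ φ)] with q h1 h2 h3
  rw [h1, h3, Pi.smul_apply, Pi.smul_apply, h2, smul_eq_mul, smul_eq_mul, mul_left_comm]

lemma inner_tmul (ψ φ ψ' φ' : H) :
    ⟪tmul ψ φ, tmul ψ' φ'⟫_ℂ = ⟪ψ, ψ'⟫_ℂ * ⟪φ, φ'⟫_ℂ := by
  rw [L2.inner_def, L2.inner_def, L2.inner_def, ← integral_prod_mul]
  refine integral_congr_ae ?_
  filter_upwards [tmul_ae_coe ψ φ, tmul_ae_coe ψ' φ'] with q h1 h2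
  simp only [h1, h2, RCLike.inner_apply, map_mul]
  ring

lemma norm_tmul (ψ φ : H) : ‖tmul ψ φ‖ = ‖ψ‖ * ‖φ‖ := by
  have h1 := inner_tmul ψ φ ψ φ
  rw [inner_self_eq_norm_sq_to_K, inner_self_eq_norm_sq_to_K, inner_self_eq_norm_sq_to_K, ← mul_pow] at h1
  have h2 : ‖tmul ψ φ‖ ^ 2 = (‖ψ‖ * ‖φ‖) ^ 2 := by exact_mod_cast h1
  exact (sq_eq_sq₀ (norm_nonneg _) (by positivity)).1 h2

/-- `tmul` as a bounded bilinear map. -/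
def tmulL : H →L[ℂ] H →L[ℂ] H₂ :=
  LinearMap.mkContinuous₂ (LinearMap.mk₂ ℂ tmul tmul_add_left tmul_smul_left tmul_add_right
    tmul_smul_right) 1 fun ψ φ => by
      rw [one_mul]
      exact (norm_tmul ψ φ).le

/-- Rectangles form a π-system generating the product σ-algebra, and the sets over which F
integrates to 0 are stable under complements and disjoint unions. Integrability on A × B is what
permits these operations. -/
lemma setIntegral_eq_zero_of_rect {F : Q → ℂ} {A B : Set P} (hF : IntegrableOn F (A ×ˢ B) (mu.prod mu))
    (h : ∀ s t, MeasurableSet s → MeasurableSet t → s ⊆ A → t ⊆ B →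
      ∫ q in s ×ˢ t, F q ∂(mu.prod mu) = 0) (hA : MeasurableSet A) (hB : MeasurableSet B)
    (E : Set Q) (hE : MeasurableSet E) : ∫ q in E, F q ∂((mu.prod mu).restrict (A ×ˢ B)) = 0 := by
  have huniv : ∫ q, F q ∂((mu.prod mu).restrict (A ×ˢ B)) = 0 := h A B hA hB subset_rfl subset_rfl
  induction E, hE using MeasurableSpace.induction_on_inter generateFrom_prod.symm isPiSystem_prod with
  | empty => simp
  | basic E hE =>
    obtain ⟨s, hs, t, ht, rfl⟩ := hE
    have hs : MeasurableSet s := hs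
    have ht : MeasurableSet t := ht
    rw [Measure.restrict_restrict (MeasurableSet.prod hs ht), prod_inter_prod]
    exact h _ _ (hs.inter hA) (ht.inter hB) inter_subset_right inter_subset_right
  | compl E hE ih => rw [setIntegral_compl hE hF, ih, huniv, sub_zero]
  | iUnion f hd hm ih =>
    rw [integral_iUnion hm hd hF.integrableOn]
    simp [ih]

/-- On a square of finite measure Φ is integrable, and tensors of indicator functions show that its
integrals over rectangles vanish. Such squares exhaust the space by σ-finiteness. -/
lemma eq_zero_of_orthogonal_tmul {Φ : H₂} (h : ∀ ψ φ, ⟪Φ, tmul ψ φ⟫_ℂ = 0) : Φ = 0 := by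
  have hcover : ∀ n : ℕ, ∀ᵐ q ∂((mu.prod mu).restrict (spanningSets mu n ×ˢ spanningSets mu n)),
      Φ q = 0 := by
    intro n
    set A := spanningSets mu n
    have hA : MeasurableSet A := measurableSet_spanningSets mu n
    have hμA : mu A < ⊤ := measure_spanningSets_lt_top mu n
    have hAA : (mu.prod mu) (A ×ˢ A) < ⊤ := by
      rw [Measure.prod_prod]
      exact ENNReal.mul_lt_top hμA hμA
    have hint : IntegrableOn Φ (A ×ˢ A) (mu.prod mu) := by
      have : IsFiniteMeasure ((mu.prod mu).restrict (A ×ˢ A)) := isFiniteMeasure_restrict.2 hAA.ne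
      exact ((Lp.memLp Φ).restrict (A ×ˢ A)).integrable (by norm_num)
    refine Integrable.ae_eq_zero_of_forall_setIntegral_eq_zero hint fun E hE _ =>
      setIntegral_eq_zero_of_rect hint (fun s t hs ht hsA htA => ?_) hA hA E hE
    have hs' : mu s ≠ ⊤ := ((measure_mono hsA).trans_lt hμA).ne
    have ht' : mu t ≠ ⊤ := ((measure_mono htA).trans_lt hμA).ne
    have h1 := h (indicatorConstLp 2 hs hs' 1) (indicatorConstLp 2 ht ht' 1)
    rw [L2.inner_def] at h1
    have h2 : ∫ q in s ×ˢ t, (starRingEnd ℂ) (Φ q) ∂(mu.prod mu) = 0 := by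
      rw [← integral_indicator (hs.prod ht), ← h1]
      refine integral_congr_ae ?_
      filter_upwards [tmul_ae (indicatorConstLp_coeFn (p := 2) (hs := hs) (hμs := hs') (c := (1 : ℂ)))
        (indicatorConstLp_coeFn (p := 2) (hs := ht) (hμs := ht') (c := (1 : ℂ)))] with q hq
      rw [hq, RCLike.inner_apply]
      by_cases h3 : q.1 ∈ s <;> by_cases h4 : q.2 ∈ t <;> simp [indicator, h3, h4]
    rw [integral_conj] at h2
    simpa using h2
  refine (Lp.eq_zero_iff_ae_eq_zero).2 ?_
  have hun : (⋃ n, spanningSets mu n ×ˢ spanningSets mu n) = univ := by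
    refine eq_univ_of_forall fun q => ?_
    obtain ⟨n, hn⟩ := mem_iUnion.1 ((iUnion_spanningSets mu).symm ▸ mem_univ q.1)
    obtain ⟨k, hk⟩ := mem_iUnion.1 ((iUnion_spanningSets mu).symm ▸ mem_univ q.2)
    exact mem_iUnion.2 ⟨max n k, monotone_spanningSets mu (le_max_left _ _) hn,
      monotone_spanningSets mu (le_max_right _ _) hk⟩
  have h1 := (ae_restrict_iUnion_iff (μ := mu.prod mu) _ (fun q => Φ q = 0)).2 hcover
  rw [hun, Measure.restrict_univ] at h1
  exact h1

lemma eq_zero_of_orthogonal_tmul_of_dense {D₁ D₂ : Set H}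
    (h₁ : ∀ Φ : H, (∀ ψ ∈ D₁, ⟪Φ, ψ⟫_ℂ = 0) → Φ = 0) (h₂ : ∀ Φ : H, (∀ ψ ∈ D₂, ⟪Φ, ψ⟫_ℂ = 0) → Φ = 0)
    {Φ : H₂} (h : ∀ ψ ∈ D₁, ∀ φ ∈ D₂, ⟪Φ, tmul ψ φ⟫_ℂ = 0) : Φ = 0 := by
  have key : ∀ φ ∈ D₂, ∀ ψ, ⟪Φ, tmul ψ φ⟫_ℂ = 0 := by
    intro φ hφ ψ
    have : (innerSL ℂ Φ).comp (tmulL.flip φ) = 0 := ext_of_inner_dense h₁ fun ψ hψ => h ψ hψ φ hφ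
    exact congrArg (fun a : H →L[ℂ] ℂ => a ψ) this
  refine eq_zero_of_orthogonal_tmul fun ψ φ => ?_
  have : (innerSL ℂ Φ).comp (tmulL ψ) = 0 := ext_of_inner_dense h₂ fun φ hφ => key φ hφ ψ
  exact congrArg (fun a : H →L[ℂ] ℂ => a φ) this

end TensorProduct

/-! ### Graphs of sums and tensor products -/

section Graphs

variable {E : Type*} [NormedAddCommGroup E] [InnerProductSpace ℂ E]

lemma mem_graph_add {A B : E →ₗ.[ℂ] E} {ψ η : E} :
    (ψ, η) ∈ (A + B).graph ↔ ∃ η₁ η₂, (ψ, η₁) ∈ A.graph ∧ (ψ, η₂) ∈ B.graph ∧ η = η₁ + η₂ := by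
  constructor
  · intro h
    obtain ⟨hd, rfl⟩ := mem_graph_iff_exists.1 h
    exact ⟨A ⟨ψ, hd.1⟩, B ⟨ψ, hd.2⟩, A.mem_graph ⟨ψ, hd.1⟩, B.mem_graph ⟨ψ, hd.2⟩, rfl⟩
  · rintro ⟨η₁, η₂, h1, h2, rfl⟩
    obtain ⟨hA, rfl⟩ := mem_graph_iff_exists.1 h1
    obtain ⟨hB, rfl⟩ := mem_graph_iff_exists.1 h2
    exact mem_graph_iff_exists.2 ⟨⟨hA, hB⟩, rfl⟩

lemma eq_of_mem_graph_iff {A B : E →ₗ.[ℂ] E} (h : ∀ ψ η, (ψ, η) ∈ A.graph ↔ (ψ, η) ∈ B.graph) :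
    A = B :=
  LinearPMap.eq_of_eq_graph (Submodule.ext fun p => h p.1 p.2)

lemma closedOp_tensor_set {A B : H →ₗ.[ℂ] H} :
    {p : H₂ × H₂ | ∃ (ψ : A.domain) (φ : B.domain), IsTensor p.1 ψ φ ∧ IsTensor p.2 (A ψ) (B φ)} =
      {p | ∃ ψ η φ ξ, (ψ, η) ∈ A.graph ∧ (φ, ξ) ∈ B.graph ∧ p.1 = tmul ψ φ ∧ p.2 = tmul η ξ} := by
  ext p
  constructor
  · rintro ⟨ψ, φ, h1, h2⟩
    exact ⟨_, _, _, _, A.mem_graph ψ, B.mem_graph φ, isTensor_iff.1 h1, isTensor_iff.1 h2⟩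
  · rintro ⟨ψ, η, φ, ξ, h1, h2, h3, h4⟩
    obtain ⟨hA, rfl⟩ := mem_graph_iff_exists.1 h1
    obtain ⟨hB, rfl⟩ := mem_graph_iff_exists.1 h2
    exact ⟨⟨ψ, hA⟩, ⟨φ, hB⟩, isTensor_iff.2 h3, isTensor_iff.2 h4⟩

end Graphs

/-! ### Ŷ as a multiplication operator -/

section Multiplication

lemma ofBdd_one_eq_mulMax {X : Type*} [MeasurableSpace X] {m : Measure X} :
    ofBdd (1 : Lp ℂ 2 m →L[ℂ] Lp ℂ 2 m) = mulMax m fun _ => 1 := by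
  refine eq_of_mem_graph_iff fun ψ η => ?_
  rw [mem_graph_ofBdd, mem_graph_mulMax, one_apply_eq_self]
  simp only [Complex.ofReal_one, one_mul]
  exact ⟨fun h => h ▸ ae_eq_refl _, fun h => Lp.ext h⟩

lemma mulMax_add_ofBdd_one {X : Type*} [MeasurableSpace X] {m : Measure X} (b : X → ℝ) :
    mulMax m b + ofBdd 1 = mulMax m fun x => b x + 1 := by
  refine eq_of_mem_graph_iff fun ψ η => ?_
  rw [mem_graph_add, mem_graph_mulMax]
  constructor
  · rintro ⟨η₁, η₂, h1, h2, rfl⟩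
    rw [mem_graph_mulMax] at h1
    rw [mem_graph_ofBdd, one_apply_eq_self] at h2
    subst h2
    filter_upwards [h1, Lp.coeFn_add η₁ η₂] with x h3 h4
    rw [h4, Pi.add_apply, h3]
    push_cast
    ring
  · intro h
    refine ⟨η - ψ, ψ, ?_, ?_, (sub_add_cancel _ _).symm⟩
    · rw [mem_graph_mulMax]
      filter_upwards [h, Lp.coeFn_sub η ψ] with x h3 h4
      rw [h4, Pi.sub_apply, h3]
      push_cast
      ring
    · rw [mem_graph_ofBdd, one_apply_eq_self]

lemma inverse_mulMax {X : Type*} [MeasurableSpace X] {m : Measure X} {b : X → ℝ}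
    (hb : ∀ᵐ x ∂m, b x ≠ 0) : (mulMax m b).inverse = mulMax m fun x => (b x)⁻¹ := by
  have hker : LinearMap.ker (mulMax m b).toFun = ⊥ := by
    rw [LinearMap.ker_eq_bot']
    intro ψ hψ
    have h1 : ((ψ : Lp ℂ 2 m), (0 : Lp ℂ 2 m)) ∈ (mulMax m b).graph := by
      rw [← hψ]
      exact (mulMax m b).mem_graph ψ
    rw [mem_graph_mulMax] at h1
    refine Subtype.ext (Lp.ext ?_)
    filter_upwards [h1, Lp.coeFn_zero ℂ 2 m, hb] with x h2 h3 h4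
    rw [h3] at h2
    have h5 := (mul_eq_zero.1 h2.symm).resolve_left (by exact_mod_cast h4)
    rw [h5, ZeroMemClass.coe_zero, h3]
    rfl
  refine eq_of_mem_graph_iff fun ψ η => ?_
  rw [LinearPMap.inverse_graph hker, mem_graph_mulMax]
  simp only [Submodule.mem_map, Prod.exists, LinearEquiv.coe_coe, LinearEquiv.prodComm_apply,
    Prod.swap_prod_mk, Prod.mk.injEq]
  constructor
  · rintro ⟨φ, ξ, h, rfl, rfl⟩
    rw [mem_graph_mulMax] at h
    filter_upwards [h, hb] with x h2 h3
    have h4 : (b x : ℂ) ≠ 0 := by exact_mod_cast h3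
    rw [h2]
    push_cast
    field_simp
  · intro h
    refine ⟨η, ψ, ?_, rfl, rfl⟩
    rw [mem_graph_mulMax]
    filter_upwards [h, hb] with x h2 h3
    have h4 : (b x : ℂ) ≠ 0 := by exact_mod_cast h3
    rw [h2]
    push_cast
    field_simp

lemma isTest_phase {f : P → ℂ} (hf : IsTest f) {b : ℝ → ℝ} (hb : ContDiff ℝ ∞ b) (t : ℝ) :
    IsTest fun x => Complex.exp (Complex.I * t * b x.1) * f x := by
  refine hf.mul ?_
  have h1 : ContDiff ℝ ∞ fun x : P => ((b x.1 : ℝ) : ℂ) :=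
    Complex.ofRealCLM.contDiff.comp (hb.comp contDiff_fst)
  exact (contDiff_const.mul h1).cexp

lemma isTest_coord_mul {f : P → ℂ} (hf : IsTest f) : IsTest fun x => (x.1 : ℂ) * f x :=
  hf.mul (Complex.ofRealCLM.contDiff.comp contDiff_fst)

/-- Multiplication by exp(itz) preserves test functions, so they are a core for the maximal
multiplication by z. -/
lemma Yhat_eq_mulMax : Yhat = mulMax mu fun x => x.1 := by
  rw [← generator_phase measurable_fst]
  refine (isUnitaryGroup_phase measurable_fst).closedOp_eq_of_invariant
    (D := {ψ | ∃ f, IsTest f ∧ ψ =ᵐ[mu] f}) ?_ ?_ ?_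
    fun Φ hΦ => eq_zero_of_orthogonal_isTest fun g hg ψ hψ => hΦ ψ ⟨g, hg, hψ⟩
  · rintro ⟨ψ, η⟩ ⟨f, hf, h1, h2⟩
    rw [generator_phase, SetLike.mem_coe, mem_graph_mulMax]
    filter_upwards [h1, h2] with x h3 h4
    rw [h3, h4]
  · rintro ψ ⟨f, hf, hψ⟩
    exact ⟨_, f, hf, hψ, (isTest_coord_mul hf).memLp.coeFn_toLp⟩
  · rintro t ψ ⟨f, hf, hψ⟩
    refine ⟨_, isTest_phase hf contDiff_id t, ?_⟩
    filter_upwards [phase_ae measurable_fst t ψ, hψ] with x h1 h2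
    rw [h1, h2, id]

lemma Yinv_eq_mulMax : Yinv = mulMax mu fun x => (x.1 + 1)⁻¹ := by
  rw [Yinv, Yhat_eq_mulMax, mulMax_add_ofBdd_one, inverse_mulMax ae_add_one_ne_zero]

/-- Test functions with support in `U`. -/
def IsTestV (f : P → ℂ) : Prop := IsTest f ∧ tsupport f ⊆ {p | p.1 + 1 ≠ 0}

lemma eq_zero_of_orthogonal_isTestV {Φ : H} (h : ∀ g, IsTestV g → ∀ ψ : H, ψ =ᵐ[mu] g →
    ⟪Φ, ψ⟫_ℂ = 0) : Φ = 0 := by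
  refine eq_zero_of_orthogonal_test (Ω := {p : P | p.2 ≠ 0 ∧ p.1 + 1 ≠ 0}) ?_ ?_ ?_ ?_
  · exact isOpen_gamma.inter (isOpen_ne_fun (by fun_prop) continuous_const)
  · filter_upwards [ae_mu_snd_ne_zero, ae_add_one_ne_zero] with p h1 h2
    exact ⟨h1, h2⟩
  · exact fun K hK hKΩ => mu_lt_top hK fun p hp => (hKΩ hp).1
  · exact fun g h1 h2 h3 ψ hψ => h g ⟨⟨h1, h2, fun p hp => (h3 hp).1⟩, fun p hp => (h3 hp).2⟩ ψ hψ

lemma IsTestV.mul {f : P → ℂ} (hf : IsTestV f) {b : P → ℂ}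
    (hb : ContDiffOn ℝ ∞ b {p | p.1 + 1 ≠ 0}) : IsTestV fun x => b x * f x := by
  have h0 : ∀ x, x ∉ tsupport f → b x * f x = 0 := fun x hx => by
    rw [image_eq_zero_of_notMem_tsupport hx, mul_zero]
  have hO : IsOpen {p : P | p.1 + 1 ≠ 0} := isOpen_ne_fun (by fun_prop) continuous_const
  refine ⟨isTest_of (contDiff_of_vanish hO (hb.mul hf.1.1.contDiffOn) (isClosed_tsupport f) hf.2 h0)
    hf.1.2.1.isCompact hf.1.2.2 h0, (closure_minimal (fun x hx => ?_) (isClosed_tsupport f)).trans hf.2⟩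
  by_contra hne
  exact hx (h0 x hne)

lemma contDiffOn_coord {b : ℝ → ℝ} (hb : ContDiffOn ℝ ∞ b {z | z + 1 ≠ 0}) :
    ContDiffOn ℝ ∞ (fun x : P => ((b x.1 : ℝ) : ℂ)) {p | p.1 + 1 ≠ 0} :=
  Complex.ofRealCLM.contDiff.comp_contDiffOn (hb.comp contDiffOn_fst fun _ hp => hp)

/-- Since b may be singular at z = -1, the core consists of test functions supported away from
there. They are still total and are preserved by exp(itb). -/
lemma closure_graph_mulMax {b : ℝ → ℝ} (hm : Measurable b)
    (hb : ContDiffOn ℝ ∞ b {z | z + 1 ≠ 0}) :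
    (Submodule.span ℂ {p : H × H | ∃ f, IsTestV f ∧ p.1 =ᵐ[mu] f ∧
      p ∈ (mulMax mu fun x => b x.1).graph}).topologicalClosure = (mulMax mu fun x => b x.1).graph := by
  have hm' : Measurable fun x : P => b x.1 := hm.comp measurable_fst
  have hU := isUnitaryGroup_phase (m := mu) hm'
  have hbC := contDiffOn_coord hb
  rw [← generator_phase hm']
  refine hU.closure_eq_graph (fun p hp => hp.choose_spec.2.2)
    (hU.dense_range_of_invariant (D := {ψ | ∃ f, IsTestV f ∧ ψ =ᵐ[mu] f})
      (fun p hp => hp.choose_spec.2.2) ?_ ?_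
      fun Φ hΦ => eq_zero_of_orthogonal_isTestV fun g hg ψ hψ => hΦ ψ ⟨g, hg, hψ⟩)
  · rintro ψ ⟨f, hf, hψ⟩
    refine ⟨(hf.mul hbC).1.memLp.toLp, f, hf, hψ, ?_⟩
    · rw [generator_phase, mem_graph_mulMax]
      filter_upwards [hψ, (hf.mul hbC).1.memLp.coeFn_toLp] with x h1 h2
      rw [h2, h1]
  · rintro t ψ ⟨f, hf, hψ⟩
    refine ⟨_, hf.mul ((contDiffOn_const (c := Complex.I * t)).mul hbC).cexp, ?_⟩
    · filter_upwards [phase_ae hm' t ψ, hψ] with x h1 h2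
      rw [h1, h2]

end Multiplication

/-! ### A core for the tensor product of a generator and a multiplication -/

section AbstractBilinear

variable {E F : Type*} [NormedAddCommGroup E] [InnerProductSpace ℂ E] [NormedAddCommGroup F]
  [InnerProductSpace ℂ F]

lemma hasDerivAt_bilin {B : E →L[ℂ] F →L[ℂ] ℂ} {u : ℝ → E} {v : ℝ → F} {u' : E} {v' : F}
    (hu : HasDerivAt u u' 0) (hv : HasDerivAt v v' 0) :
    HasDerivAt (fun t => B (u t) (v t)) (B u' (v 0) + B (u 0) v') 0 := by
  have h1 : HasDerivAt (fun t => B (u t)) (B u') 0 :=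
    (B.restrictScalars ℝ).hasFDerivAt.comp_hasDerivAt (0 : ℝ) hu
  have h2 := (ContinuousLinearMap.restrictScalarsL ℂ F ℂ ℝ ℝ).hasFDerivAt.comp_hasDerivAt (0 : ℝ) h1
  exact h2.clm_apply hv

/-- The group laws move the derivative at s to a derivative at 0 taken at the vectors U s ψ and M s
φ, where it is 0 by hypothesis. -/
lemma bilin_eq_of_hasDerivAt {B : E →L[ℂ] F →L[ℂ] ℂ} {U : ℝ → E →L[ℂ] E} {M : ℝ → F →L[ℂ] F}
    (hU0 : U 0 = 1) (hU : ∀ s t, U (s + t) = U t * U s) (hM0 : M 0 = 1)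
    (hM : ∀ s t, M (s + t) = M t * M s) {ψ : E} {φ : F}
    (h : ∀ s, ∃ η ξ, HasDerivAt (fun t => U t (U s ψ)) η 0 ∧ HasDerivAt (fun t => M t (M s φ)) ξ 0 ∧
      B η (M s φ) + B (U s ψ) ξ = 0) (s : ℝ) : B ψ φ = B (U s ψ) (M s φ) := by
  have h1 : ∀ s, HasDerivAt (fun t => B (U t ψ) (M t φ)) 0 s := by
    intro s
    obtain ⟨η, ξ, h1, h2, h3⟩ := h s
    have h4 := hasDerivAt_bilin (B := B) h1 h2
    simp only [hU0, hM0, one_apply_eq_self, h3] at h4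
    have h5 := HasDerivAt.comp_add_const s (-s) (f := fun t => B (U t (U s ψ)) (M t (M s φ)))
      (f' := 0) (by rwa [add_neg_cancel])
    refine h5.congr_of_eventuallyEq (Eventually.of_forall fun t => ?_)
    simp only [← mul_apply_eq_comp, ← hU, ← hM, add_neg_cancel_comm_assoc]
  have h2 := is_const_of_deriv_eq_zero (fun s => (h1 s).differentiableAt) (fun s => (h1 s).deriv) 0 s
  simpa [hU0, hM0] using h2

end AbstractBilinear

section TensorGenerator

lemma mulOp_exp_add {c : P → ℝ} (hc : Measurable c) {C : ℝ} (hC : ∀ x, |c x| ≤ C) (s t : ℝ) :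
    mulOp mu (isBddMeas_exp hc hC (s + t)) =
      mulOp mu (isBddMeas_exp hc hC t) * mulOp mu (isBddMeas_exp hc hC s) := by
  refine (mulOp_mul _ _ _ (Eventually.of_forall fun x => ?_)).symm
  rw [← Complex.ofReal_mul, ← Real.exp_add]
  congr 2
  ring

lemma mulOp_exp_zero {c : P → ℝ} (hc : Measurable c) {C : ℝ} (hC : ∀ x, |c x| ≤ C) :
    mulOp mu (isBddMeas_exp hc hC 0) = 1 :=
  mulOp_one _ (Eventually.of_forall fun x => by simp)

/-- Here c is an inverse of b on the support of φ. The function s ↦ ⟨Φ, U s ψ ⊗ exp(s c) φ⟩ is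
constant: at s = 0 its derivative is i ⟨Φ, η ⊗ φ - i ψ ⊗ c φ⟩, and as b (c φ) = φ this is the
pairing of Φ with (A ⊗ b - i)(ψ ⊗ c φ), up to the factor i. Since c has a fixed sign there and is
bounded away from 0, the function decays in one direction, so it is 0. -/
lemma inner_tmul_eq_zero {U : ℝ → H →L[ℂ] H} (hU : IsUnitaryGroup U) {b : P → ℝ} {Φ : H₂}
    (hΦ : ∀ ψ η φ ξ, (ψ, η) ∈ (generator U).graph → (φ, ξ) ∈ (mulMax mu b).graph →
      ⟪Φ, tmul η ξ - Complex.I • tmul ψ φ⟫_ℂ = 0) {ψ η : H} (hψ : (ψ, η) ∈ (generator U).graph)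
    {φ : H} {c : P → ℝ} (hc : Measurable c) {C δ σ : ℝ} (hC : ∀ x, |c x| ≤ C) (hδ : 0 < δ)
    (hbc : ∀ᵐ x ∂mu, (b x : ℂ) * (c x * φ x) = φ x)
    (hφ : ∀ᵐ x ∂mu, φ x ≠ 0 → δ ≤ σ * c x) : ⟪Φ, tmul ψ φ⟫_ℂ = 0 := by
  set M := fun s => mulOp mu (isBddMeas_exp hc hC s) with hM
  set N := mulOp mu (isBddMeas_ofReal hc hC) with hN
  set B : H →L[ℂ] H →L[ℂ] ℂ := (ContinuousLinearMap.compL ℂ H H₂ ℂ (innerSL ℂ Φ)).comp tmulL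
  have hB : ∀ ψ φ, B ψ φ = ⟪Φ, tmul ψ φ⟫_ℂ := fun _ _ => rfl
  have hconst : ∀ s, ⟪Φ, tmul ψ φ⟫_ℂ = ⟪Φ, tmul (U s ψ) (M s φ)⟫_ℂ := by
    refine bilin_eq_of_hasDerivAt (B := B) hU.zero (fun s t => by rw [add_comm, hU.add])
      (mulOp_exp_zero hc hC) (mulOp_exp_add hc hC) fun s => ?_
    refine ⟨Complex.I • U s η, N (M s φ), mem_graph_generator.1 (hU.apply_mem_graph hψ s),
      hasDerivAt_mulOp_exp hc hC (M s φ), ?_⟩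
    have h1 : (N (M s φ), M s φ) ∈ (mulMax mu b).graph := by
      rw [mem_graph_mulMax]
      filter_upwards [mulOp_ae (isBddMeas_ofReal hc hC) (M s φ), mulOp_ae (isBddMeas_exp hc hC s) φ,
        hbc] with x h1 h2 h3
      rw [h1, h2]
      nth_rewrite 1 [← h3]
      ring
    have h2 := hΦ _ _ _ _ (hU.apply_mem_graph hψ s) h1
    rw [hB, hB, tmul_smul_left, ← inner_add_right]
    have h3 : Complex.I • tmul (U s η) (M s φ) + tmul (U s ψ) (N (M s φ)) =
        Complex.I • (tmul (U s η) (M s φ) - Complex.I • tmul (U s ψ) (N (M s φ))) := by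
      rw [smul_sub, smul_smul, Complex.I_mul_I, neg_one_smul, sub_neg_eq_add]
    rw [h3, inner_smul_right, h2, mul_zero]
  have hbound : ∀ r : ℝ, 0 ≤ r → ‖⟪Φ, tmul ψ φ⟫_ℂ‖ ≤ ‖Φ‖ * (‖ψ‖ * (Real.exp (-(r * δ)) * ‖φ‖)) := by
    intro r hr
    -- The choice s = -σ r gives exp(s c) ≤ exp(-r δ) wherever φ ≠ 0.
    rw [hconst (-(σ * r))]
    refine (norm_inner_le_norm _ _).trans ?_
    rw [norm_tmul, hU.norm_apply]
    gcongr
    refine norm_le_mul_of_ae ?_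
    filter_upwards [mulOp_ae (isBddMeas_exp hc hC (-(σ * r))) φ, hφ] with x h1 h2
    rw [h1, norm_mul, Complex.norm_real, Real.norm_of_nonneg (Real.exp_pos _).le]
    by_cases h3 : φ x = 0
    · simp [h3]
    · gcongr
      have h4 := mul_le_mul_of_nonneg_left (h2 h3) hr
      linarith
  have hlim : Tendsto (fun r : ℝ => ‖Φ‖ * (‖ψ‖ * (Real.exp (-(r * δ)) * ‖φ‖))) atTop
      (𝓝 (‖Φ‖ * (‖ψ‖ * (0 * ‖φ‖)))) := by
    refine ((Tendsto.mul_const _ ?_).const_mul _).const_mul _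
    exact Real.tendsto_exp_neg_atTop_nhds_zero.comp (tendsto_id.atTop_mul_const hδ)
  rw [zero_mul, mul_zero, mul_zero] at hlim
  exact norm_le_zero_iff.1 (ge_of_tendsto hlim ((eventually_ge_atTop 0).mono hbound))

-- Cut Ψ down to the set where 1 / (n + 1) ≤ σ b ≤ n + 1, with c = 1/b there. The lower bound makes
-- c bounded and the upper bound keeps σ c away from 0. For σ = ±1 and all n these sets exhaust {b ≠
-- 0}.
open Classical in
lemma eq_zero_of_orthogonal_cutoff {b : P → ℝ} (hb : Measurable b) (hb0 : ∀ᵐ x ∂mu, b x ≠ 0) {Ψ : H}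
    (h : ∀ φ : H, (∃ c : P → ℝ, Measurable c ∧ ∃ C δ σ : ℝ, (∀ x, |c x| ≤ C) ∧ 0 < δ ∧ σ * σ = 1 ∧
      (∀ᵐ x ∂mu, (b x : ℂ) * (c x * φ x) = φ x) ∧ ∀ᵐ x ∂mu, φ x ≠ 0 → δ ≤ σ * c x) →
      ⟪Ψ, φ⟫_ℂ = 0) : Ψ = 0 := by
  have key : ∀ (n : ℕ) (σ : ℝ), σ * σ = 1 →
      ∀ᵐ x ∂mu, 1 / ((n : ℝ) + 1) ≤ σ * b x ∧ σ * b x ≤ n + 1 → Ψ x = 0 := by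
    intro n σ hσ
    set S : Set P := {x | 1 / ((n : ℝ) + 1) ≤ σ * b x ∧ σ * b x ≤ n + 1} with hSdef
    have hS : MeasurableSet S :=
      (measurableSet_le measurable_const (hb.const_mul σ)).inter
        (measurableSet_le (hb.const_mul σ) measurable_const)
    have hSb : IsBddMeas (S.indicator fun _ => (1 : ℂ)) :=
      ⟨measurable_const.indicator hS, 1, fun x => by
        by_cases hx : x ∈ S <;> simp [hx]⟩
    have hn : (0 : ℝ) < 1 / ((n : ℝ) + 1) := by positivity
    have h0 := h (mulOp mu hSb Ψ) ⟨S.indicator fun x => (b x)⁻¹, hb.inv.indicator hS,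
      n + 1, 1 / ((n : ℝ) + 1), σ, ?_, hn, hσ, ?_, ?_⟩
    · have h1 : mulOp mu hSb * mulOp mu hSb = mulOp mu hSb := by
        refine mulOp_mul _ _ _ (Eventually.of_forall fun x => ?_)
        by_cases hx : x ∈ S <;> simp [hx]
      have h2 : ⟪mulOp mu hSb Ψ, mulOp mu hSb Ψ⟫_ℂ = 0 := by
        rw [inner_mulOp hSb hSb (fun x => by by_cases hx : x ∈ S <;> simp [hx]),
          ← mul_apply_eq_comp, h1, h0]
      rw [inner_self_eq_zero] at h2
      have h3 := mulOp_ae hSb Ψ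
      rw [h2] at h3
      filter_upwards [h3, Lp.coeFn_zero ℂ 2 mu] with x h4 h5 hx
      have hx' : x ∈ S := hx
      rw [h5, indicator_of_mem hx', one_mul] at h4
      exact h4.symm
    · intro x
      by_cases hx : x ∈ S
      · rw [indicator_of_mem hx, abs_inv]
        have hσ1 : |σ| = 1 := by
          have : |σ| * |σ| = 1 := by rw [← abs_mul, hσ, abs_one]
          nlinarith [abs_nonneg σ]
        have h1 : 1 / ((n : ℝ) + 1) ≤ |b x| := by
          have := hx.1.trans (le_abs_self _)
          rwa [abs_mul, hσ1, one_mul] at this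
        rw [inv_le_comm₀ (hn.trans_le h1) (by positivity), ← one_div]
        exact h1
      · rw [indicator_of_notMem hx, abs_zero]
        positivity
    · filter_upwards [mulOp_ae hSb Ψ] with x hx
      rw [hx]
      by_cases hxS : x ∈ S
      · have hbx : (b x : ℂ) ≠ 0 := by
          intro h0
          have h1 : b x = 0 := by exact_mod_cast h0
          have h2 := hxS.1
          rw [h1, mul_zero] at h2
          linarith
        rw [indicator_of_mem hxS, indicator_of_mem hxS]
        push_cast
        field_simp
      · rw [indicator_of_notMem hxS, indicator_of_notMem hxS]
        simp
    · filter_upwards [mulOp_ae hSb Ψ] with x hx hne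
      by_cases hxS : x ∈ S
      · rw [indicator_of_mem hxS]
        have h1 : 0 < σ * b x := hn.trans_le hxS.1
        have h2 : σ * (b x)⁻¹ = (σ * b x)⁻¹ := by
          have hσ0 : σ ≠ 0 := fun h => by simp [h] at hσ
          have hb0 : b x ≠ 0 := fun h => by simp [h] at h1
          field_simp
          nlinarith
        rw [h2, one_div]
        exact (inv_le_inv₀ (by positivity) h1).2 hxS.2
      · rw [hx, indicator_of_notMem hxS, zero_mul] at hne
        exact absurd rfl hne
  have h1 : ∀ᵐ x ∂mu, ∀ n : ℕ, (1 / ((n : ℝ) + 1) ≤ 1 * b x ∧ 1 * b x ≤ n + 1 → Ψ x = 0) ∧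
      (1 / ((n : ℝ) + 1) ≤ -1 * b x ∧ -1 * b x ≤ n + 1 → Ψ x = 0) :=
    ae_all_iff.2 fun n => (key n 1 (by norm_num)).and (key n (-1) (by norm_num))
  refine Lp.eq_zero_iff_ae_eq_zero.2 ?_
  filter_upwards [h1, hb0] with x h2 h3
  have h4 : 0 < |b x| := abs_pos.2 h3
  obtain ⟨n₁, hn₁⟩ := exists_nat_one_div_lt h4
  obtain ⟨n₂, hn₂⟩ := exists_nat_ge |b x|
  have h5 : 1 / (((max n₁ n₂ : ℕ) : ℝ) + 1) ≤ |b x| := by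
    refine le_trans (one_div_le_one_div_of_le (by positivity) ?_) hn₁.le
    have : (n₁ : ℝ) ≤ ((max n₁ n₂ : ℕ) : ℝ) := by exact_mod_cast le_max_left _ _
    linarith
  have h6 : |b x| ≤ ((max n₁ n₂ : ℕ) : ℝ) + 1 := by
    have : (n₂ : ℝ) ≤ ((max n₁ n₂ : ℕ) : ℝ) := by exact_mod_cast le_max_right _ _
    linarith
  rcases abs_choice (b x) with h7 | h7
  · rw [h7] at h5 h6
    exact (h2 _).1 ⟨by rwa [one_mul], by rwa [one_mul]⟩
  · rw [h7] at h5 h6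
    exact (h2 _).2 ⟨by rwa [neg_one_mul], by rwa [neg_one_mul]⟩

/-- W mixes the two variables, so elementary tensors need not be invariant under it and
`closedOp_eq_of_invariant` is not available. Density of the range of S - i is obtained instead from
`inner_tmul_eq_zero`, for φ supported where |b| lies between positive bounds. -/
lemma tensor_generator_mulMax {U : ℝ → H →L[ℂ] H} (hU : IsUnitaryGroup U) {b : P → ℝ}
    (hb : Measurable b) (hb0 : ∀ᵐ x ∂mu, b x ≠ 0) {W : ℝ → H₂ →L[ℂ] H₂} (hW : IsUnitaryGroup W)
    (hG : ∀ ψ η φ ξ, (ψ, η) ∈ (generator U).graph → (φ, ξ) ∈ (mulMax mu b).graph →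
      (tmul ψ φ, tmul η ξ) ∈ (generator W).graph)
    (hd : ∀ Φ : H, (∀ ψ ∈ {ψ | ∃ η, (ψ, η) ∈ (generator U).graph}, ⟪Φ, ψ⟫_ℂ = 0) → Φ = 0) :
    tensor (generator U) (mulMax mu b) = generator W := by
  rw [tensor, closedOp_tensor_set]
  refine hW.closedOp_eq ?_ fun Φ hΦ => ?_
  · rintro ⟨_, _⟩ ⟨ψ, η, φ, ξ, h1, h2, rfl, rfl⟩
    exact hG ψ η φ ξ h1 h2
  · refine eq_zero_of_orthogonal_tmul_of_dense hd
      (fun Ψ hΨ => eq_zero_of_orthogonal_cutoff hb hb0 hΨ) ?_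
    rintro ψ ⟨η, hψ⟩ φ ⟨c, hc, C, δ, σ, hC, hδ, -, h1, h2⟩
    exact inner_tmul_eq_zero hU (fun ψ η φ ξ h3 h4 =>
      hΦ (tmul ψ φ, tmul η ξ) ⟨ψ, η, φ, ξ, h3, h4, rfl, rfl⟩) hψ hc hC hδ h1 h2

end TensorGenerator

/-! ### The tensor product operators of the statement -/

section Tensors

lemma mem_graph_of_intertwine {E F : Type*} [NormedAddCommGroup E] [InnerProductSpace ℂ E]
    [NormedAddCommGroup F] [InnerProductSpace ℂ F] {U : ℝ → E →L[ℂ] E} {W : ℝ → F →L[ℂ] F}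
    {L : E →L[ℂ] F} {φ ξ : E} (hL : ∀ t, W t (L φ) = L (U t φ)) (h : (φ, ξ) ∈ (generator U).graph) :
    (L φ, L ξ) ∈ (generator W).graph := by
  rw [mem_graph_generator] at h ⊢
  simp only [hL]
  have h1 := (L.restrictScalars ℝ).hasFDerivAt.comp_hasDerivAt (0 : ℝ) h
  exact h1.congr_deriv (by simp)

/-- Membership in a closed graph need be checked only on pairs spanning a dense subspace. Applied to
each tensor factor in turn, this reduces general domain vectors to test functions. -/
lemma graph_le_of_closure {E F : Type*} [NormedAddCommGroup E] [InnerProductSpace ℂ E]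
    [NormedAddCommGroup F] [InnerProductSpace ℂ F] {A : Submodule ℂ (E × E)} {G : Set (E × E)}
    (hA : (Submodule.span ℂ G).topologicalClosure = A) {B : Submodule ℂ (F × F)}
    (hB : IsClosed (B : Set (F × F))) (L : E →L[ℂ] F) (L' : E →L[ℂ] F)
    (h : ∀ p ∈ G, (L p.1, L' p.2) ∈ B) {p : E × E} (hp : p ∈ A) : (L p.1, L' p.2) ∈ B := by
  have h1 : A ≤ B.comap ((L.prodMap L' : E × E →L[ℂ] F × F) : E × E →ₗ[ℂ] F × F) := by
    rw [← hA]
    refine Submodule.topologicalClosure_minimal _ (Submodule.span_le.2 fun p hp => h p hp) ?_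
    exact hB.preimage (L.prodMap L').continuous
  exact h1 hp

lemma isTestU_tensor {f g : P → ℂ} (hf : IsTest f) (hg : IsTestV g) :
    IsTestU fun q => f q.1 * g q.2 := by
  refine isTestU_of (K := tsupport f ×ˢ tsupport g) ((hf.1.comp contDiff_fst).mul (hg.1.1.comp contDiff_snd))
    (hf.2.1.isCompact.prod hg.1.2.1.isCompact) (fun q hq => ⟨hf.2.2 hq.1, hg.1.2.2 hq.2⟩)
    (fun q hq => hg.2 hq.2) fun q hq => ?_
  by_contra! hne
  rw [ne_eq, mul_eq_zero, not_or] at hne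
  exact hq ⟨subset_tsupport _ hne.1, subset_tsupport _ hne.2⟩

lemma fderiv_tensor {f g : P → ℂ} (hf : IsTest f) (hg : IsTest g) (q v : Q) :
    fderiv ℝ (fun q : Q => f q.1 * g q.2) q v =
      fderiv ℝ f q.1 v.1 * g q.2 + f q.1 * fderiv ℝ g q.2 v.2 := by
  have h1 : HasFDerivAt (fun q : Q => f q.1) ((fderiv ℝ f q.1).comp (ContinuousLinearMap.fst ℝ P P)) q :=
    (hf.1.differentiable (by norm_num) q.1).hasFDerivAt.comp q hasFDerivAt_fst
  have h2 : HasFDerivAt (fun q : Q => g q.2) ((fderiv ℝ g q.2).comp (ContinuousLinearMap.snd ℝ P P)) q :=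
    (hg.1.differentiable (by norm_num) q.2).hasFDerivAt.comp q hasFDerivAt_snd
  have h3 : HasFDerivAt (fun q : Q => f q.1 * g q.2) _ q := h1.mul h2
  rw [h3.fderiv]
  simp
  ring

lemma scaleDeriv_tensor {f g : P → ℂ} (hf : IsTest f) (hg : IsTest g) (b : ℝ → ℝ) (q : Q) :
    scaleDeriv b 0 (fun q => f q.1 * g q.2) q = eulerNeg f q.1 * (b q.2.1 * g q.2) := by
  rw [scaleDeriv, fderiv_tensor hf hg, eulerNeg]
  simp only [zero_smul, neg_zero, map_zero, mul_zero, add_zero, ← smul_neg, map_smul,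
    Complex.real_smul]
  ring

/-- For test functions f and g, with g supported away from z = -1, the product f ⊗ g lies in 𝒜(Γ ×
U) and the derivative along the flow is the Euler derivative of f times b g. Closedness extends this
first in φ, then in ψ. -/
lemma tmul_mem_graph_scaleGroup {b : ℝ → ℝ} (hm : Measurable b)
    (hb : ContDiffOn ℝ ∞ b {z | z + 1 ≠ 0}) {ψ η φ ξ : H} (h₁ : (ψ, η) ∈ Xhat.graph)
    (h₂ : (φ, ξ) ∈ (mulMax mu fun x => b x.1).graph) :
    (tmul ψ φ, tmul η ξ) ∈ (generator (scaleGroup hm 0)).graph := by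
  have hflow := isScaleFlow_of_contDiffOn hm hb
  have hcl := hflow.isUnitaryGroup.isClosed_graph
  refine graph_le_of_closure (closure_graph_mulMax hm hb) hcl (tmulL ψ) (tmulL η) ?_ h₂
  rintro ⟨φ, ξ⟩ ⟨g, hg, hφ, hξ⟩
  refine graph_le_of_closure closure_graph_Xhat hcl (tmulL.flip φ) (tmulL.flip ξ) ?_ h₁
  rintro ⟨ψ, η⟩ ⟨f, hf, hψ, hη⟩
  have hf' := isTest_eulerNeg hf
  have hη' : η = -Complex.I • hf'.memLp.toLp :=
    LinearPMap.mem_graph_snd_inj _ hη (mem_graph_Xhat hf hψ hf'.memLp.coeFn_toLp) rfl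
  rw [mem_graph_mulMax] at hξ
  have hξ' : ξ =ᵐ[mu] fun x => (b x.1 : ℂ) * g x := by
    filter_upwards [hξ, hφ] with x h1 h2
    rw [h1, h2]
  have hU := isTestU_tensor hf hg
  have h3 := hflow.mem_graph hU.1 (hU.tsupport_subset) (tmul_ae hψ hφ)
    (η := tmul hf'.memLp.toLp ξ) ?_
  · rw [← tmul_smul_left, ← hη'] at h3
    exact h3
  · exact (tmul_ae hf'.memLp.coeFn_toLp hξ').trans
      (Eventually.of_forall fun q => (scaleDeriv_tensor hf hg.1 b q).symm)

lemma dense_domain_Xhat (Φ : H)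
    (h : ∀ ψ ∈ {ψ | ∃ η, (ψ, η) ∈ Xhat.graph}, ⟪Φ, ψ⟫_ℂ = 0) : Φ = 0 :=
  eq_zero_of_orthogonal_isTest fun _ hg ψ hψ => h ψ
    ⟨_, mem_graph_Xhat hg hψ (isTest_eulerNeg hg).memLp.coeFn_toLp⟩

lemma tensor_Xhat_mulMax {b : ℝ → ℝ} (hm : Measurable b) (hb : ContDiffOn ℝ ∞ b {z | z + 1 ≠ 0})
    (hb0 : ∀ᵐ x ∂mu, b x.1 ≠ 0) :
    tensor Xhat (mulMax mu fun x => b x.1) = generator (scaleGroup hm 0) :=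
  tensor_generator_mulMax isUnitaryGroup_Bhat (hm.comp measurable_fst) hb0
    (isScaleFlow_of_contDiffOn hm hb).isUnitaryGroup
    (fun _ _ _ _ h₁ h₂ => tmul_mem_graph_scaleGroup hm hb h₁ h₂) dense_domain_Xhat

lemma measurable_log_abs : Measurable fun z : ℝ => Real.log |z + 1| := by fun_prop

lemma contDiffOn_log_abs : ContDiffOn ℝ ∞ (fun z : ℝ => Real.log |z + 1|) {z | z + 1 ≠ 0} := by
  simp only [Real.log_abs]
  exact ContDiffOn.log (by fun_prop) fun z hz => hz

lemma tensor_Xhat_log : tensor Xhat (mulMax mu fun x => Real.log |x.1 + 1|) =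
    generator (scaleGroup measurable_log_abs 0) := by
  refine tensor_Xhat_mulMax measurable_log_abs contDiffOn_log_abs ?_
  filter_upwards [ae_add_one_ne_zero, ae_mu_fst_ne 0, ae_mu_fst_ne (-2)] with x h1 h2 h3 h4
  rw [Real.log_abs, Real.log_eq_zero] at h4
  -- The zeros of the logarithm are 0 (by convention), 1 and -1, so z is -1, 0 or -2, all excluded
  -- almost everywhere.
  rcases h4 with h4 | h4 | h4
  · exact h1 h4
  · exact h2 (by linarith)
  · exact h3 (by linarith)

lemma measurable_inv_add : Measurable fun z : ℝ => (z + 1)⁻¹ := by fun_prop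

lemma contDiffOn_inv_add : ContDiffOn ℝ ∞ (fun z : ℝ => (z + 1)⁻¹) {z | z + 1 ≠ 0} :=
  ContDiffOn.inv (by fun_prop) fun z hz => hz

lemma tensor_Xhat_Yinv : tensor Xhat Yinv = generator (scaleGroup measurable_inv_add 0) := by
  rw [Yinv_eq_mulMax]
  refine tensor_Xhat_mulMax measurable_inv_add contDiffOn_inv_add ?_
  filter_upwards [ae_add_one_ne_zero] with x h1
  exact inv_ne_zero h1

/-- The range of the resolvent (b - i)⁻¹ lies in the domain. Orthogonality to it means that the
conjugate resolvent, which has no zeros, annihilates Φ. -/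
lemma dense_domain_mulMax {X : Type*} [MeasurableSpace X] {m : Measure X} {b : X → ℝ}
    (hb : Measurable b) (Φ : Lp ℂ 2 m)
    (h : ∀ ψ ∈ {ψ | ∃ η, (ψ, η) ∈ (mulMax m b).graph}, ⟪Φ, ψ⟫_ℂ = 0) : Φ = 0 := by
  have hr := isBddMeas_resolvent hb
  have hr' : IsBddMeas fun x => (starRingEnd ℂ) ((b x : ℂ) - Complex.I)⁻¹ :=
    ⟨Complex.continuous_conj.measurable.comp hr.1, hr.2.imp fun C hC x => by
      rw [RCLike.norm_conj]
      exact hC x⟩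
  have h1 : mulOp m hr' Φ = 0 := by
    refine ext_inner_right ℂ fun φ => ?_
    rw [inner_mulOp hr hr' (fun _ => rfl), inner_zero_left]
    refine h _ ⟨mulOp m (isBddMeas_mul_resolvent hb) φ, ?_⟩
    rw [mem_graph_mulMax]
    filter_upwards [mulOp_ae hr φ, mulOp_ae (isBddMeas_mul_resolvent hb) φ] with x h1 h2
    rw [h1, h2, mul_assoc]
  rw [Lp.eq_zero_iff_ae_eq_zero] at h1 ⊢
  filter_upwards [h1, mulOp_ae hr' Φ] with x h2 h3
  rw [h2] at h3
  have h4 := (mul_eq_zero.1 h3.symm).resolve_left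
    ((map_ne_zero _).2 (inv_ne_zero (sub_I_ne_zero (b x))))
  simpa using h4

lemma tensor_mulMax_mulMax {b₁ b₂ : P → ℝ} (h₁ : Measurable b₁) (h₂ : Measurable b₂)
    (h0 : ∀ᵐ x ∂mu, b₂ x ≠ 0) :
    tensor (mulMax mu b₁) (mulMax mu b₂) = mulMax (mu.prod mu) fun q => b₁ q.1 * b₂ q.2 := by
  have hm : Measurable fun q : Q => b₁ q.1 * b₂ q.2 := by fun_prop
  rw [← generator_phase h₁, ← generator_phase hm]
  refine tensor_generator_mulMax (isUnitaryGroup_phase h₁) h₂ h0 (isUnitaryGroup_phase hm) ?_ ?_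
  · intro ψ η φ ξ h3 h4
    rw [generator_phase, mem_graph_mulMax] at *
    filter_upwards [tmul_ae h3 h4, tmul_ae_coe ψ φ] with q h5 h6
    rw [h5, h6]
    push_cast
    ring
  · rw [generator_phase]
    exact dense_domain_mulMax h₁

lemma tensor_Yhat_Yhat : tensor Yhat Yhat = mulMax (mu.prod mu) fun q => q.1.1 * q.2.1 := by
  rw [Yhat_eq_mulMax]
  exact tensor_mulMax_mulMax measurable_fst measurable_fst (ae_mu_fst_ne 0)

lemma tensor_Yhat_one : tensor Yhat (ofBdd 1) = mulMax (mu.prod mu) fun q => q.1.1 := by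
  rw [Yhat_eq_mulMax, ofBdd_one_eq_mulMax]
  simpa using tensor_mulMax_mulMax (b₂ := fun _ => 1) measurable_fst measurable_const
    (Eventually.of_forall fun _ => one_ne_zero)

lemma tensor_one_Yhat : tensor (ofBdd 1) Yhat = mulMax (mu.prod mu) fun q => q.2.1 := by
  rw [Yhat_eq_mulMax, ofBdd_one_eq_mulMax]
  simpa using tensor_mulMax_mulMax (b₁ := fun _ => 1) measurable_const measurable_fst
    (ae_mu_fst_ne 0)

lemma tensor_ofBdd {a b : H →L[ℂ] H} {A : H₂ →L[ℂ] H₂}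
    (h : ∀ ψ φ, A (tmul ψ φ) = tmul (a ψ) (b φ)) : tensor (ofBdd a) (ofBdd b) = ofBdd A := by
  rw [tensor, closedOp_tensor_set]
  refine closedOp_eq_ofBdd ?_ fun Φ hΦ => eq_zero_of_orthogonal_tmul fun ψ φ => ?_
  · rintro ⟨Ψ, Ψ'⟩ ⟨ψ, η, φ, ξ, h₁, h₂, h₃, h₄⟩
    rw [mem_graph_ofBdd] at h₁ h₂
    simp only at h₃ h₄
    rw [h₃, h₄, h, h₁, h₂]
  · exact hΦ (tmul ψ φ, tmul (a ψ) (b φ))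
      ⟨ψ, _, φ, _, mem_graph_ofBdd.2 rfl, mem_graph_ofBdd.2 rfl, rfl, rfl⟩

lemma scaleGroup_tmul (ψ φ : H) (t : ℝ) :
    scaleGroup (measurable_const (a := (0 : ℝ))) 1 t (tmul ψ φ) = tmul ψ (Bhat t φ) := by
  rw [Bhat_eq]
  refine Lp.ext ?_
  refine (scaleOp_ae _ _ (tmul_ae_coe ψ φ)).trans ?_
  refine Filter.EventuallyEq.trans ?_ (tmul_ae (EventuallyEq.refl _ _)
    (dil_ae _ (EventuallyEq.refl _ φ))).symm
  exact Eventually.of_forall fun q => by simp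

/-- In this case the group I ⊗ B̂ maps elementary tensors to elementary tensors, so invariance alone
gives a core. -/
lemma tensor_one_Xhat :
    tensor (ofBdd 1) Xhat = generator (scaleGroup (measurable_const (a := (0 : ℝ))) 1) := by
  rw [tensor, closedOp_tensor_set]
  refine (isScaleFlow_const 0 1).isUnitaryGroup.closedOp_eq_of_invariant
    (D := {Ψ | ∃ ψ φ ξ, (φ, ξ) ∈ Xhat.graph ∧ Ψ = tmul ψ φ}) ?_ ?_ ?_ ?_
  · rintro ⟨Ψ, Ψ'⟩ ⟨ψ, η, φ, ξ, h₁, h₂, h₃, h₄⟩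
    rw [mem_graph_ofBdd] at h₁
    simp only at h₃ h₄
    rw [h₃, h₄, h₁]
    exact mem_graph_of_intertwine (L := tmulL ψ) (fun t => scaleGroup_tmul ψ φ t) h₂
  · rintro Ψ ⟨ψ, φ, ξ, h, rfl⟩
    exact ⟨tmul ψ ξ, ψ, ψ, φ, ξ, mem_graph_ofBdd.2 rfl, h, rfl, rfl⟩
  · rintro t Ψ ⟨ψ, φ, ξ, h, rfl⟩
    exact ⟨ψ, Bhat t φ, Bhat t ξ, isUnitaryGroup_Bhat.apply_mem_graph h t, scaleGroup_tmul ψ φ t⟩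
  · intro Φ hΦ
    refine eq_zero_of_orthogonal_tmul_of_dense (D₁ := univ)
      (fun Φ h => inner_self_eq_zero.1 (h Φ (mem_univ _))) dense_domain_Xhat fun ψ _ φ hφ => ?_
    obtain ⟨ξ, hξ⟩ := hφ
    exact hΦ _ ⟨ψ, φ, ξ, hξ, rfl⟩

end Tensors

/-! ### The spectral measure of a multiplication operator -/

section SpectralMeasure

variable {X : Type*} [MeasurableSpace X] {m : Measure X} {b : X → ℝ}

lemma isBddMeas_indicator (hb : Measurable b) {s : Set ℝ} (hs : MeasurableSet s) :
    IsBddMeas fun x => s.indicator (1 : ℝ → ℂ) (b x) where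
  measurable := (measurable_one.indicator hs).comp hb
  bdd := ⟨1, fun x => by by_cases h : b x ∈ s <;> simp [h]⟩

variable (m) in
open Classical in
/-- The multiplication by the indicator function of `b ∈ s`. -/
def mulProj (hb : Measurable b) (s : Set ℝ) : Lp ℂ 2 m →L[ℂ] Lp ℂ 2 m :=
  if hs : MeasurableSet s then mulOp m (isBddMeas_indicator hb hs) else 0

lemma mulProj_eq (hb : Measurable b) {s : Set ℝ} (hs : MeasurableSet s) :
    mulProj m hb s = mulOp m (isBddMeas_indicator hb hs) := dif_pos hs

lemma mulProj_ae (hb : Measurable b) {s : Set ℝ} (hs : MeasurableSet s) (ψ : Lp ℂ 2 m) :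
    mulProj m hb s ψ =ᵐ[m] fun x => s.indicator (1 : ℝ → ℂ) (b x) * ψ x := by
  rw [mulProj_eq hb hs]
  exact mulOp_ae _ ψ

lemma sum_indicator {s : ℕ → Set ℝ} (hd : Pairwise (Function.onFun Disjoint s)) (F : Finset ℕ)
    (y : ℝ) : ∑ n ∈ F, (s n).indicator (1 : ℝ → ℂ) y = (⋃ n ∈ F, s n).indicator 1 y :=
  (Finset.indicator_biUnion_apply F s (fun _ _ _ _ hij => hd hij) y).symm

lemma sum_mulProj_ae (hb : Measurable b) {s : ℕ → Set ℝ} (hs : ∀ n, MeasurableSet (s n))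
    (F : Finset ℕ) (ψ : Lp ℂ 2 m) : (∑ n ∈ F, mulProj m hb (s n) ψ : Lp ℂ 2 m) =ᵐ[m]
      fun x => (∑ n ∈ F, (s n).indicator (1 : ℝ → ℂ) (b x)) * ψ x := by
  classical
  induction F using Finset.induction_on with
  | empty =>
    filter_upwards [Lp.coeFn_zero ℂ 2 m] with x h
    rw [Finset.sum_empty, h, Finset.sum_empty, zero_mul, Pi.zero_apply]
  | insert n F hn ih =>
    rw [Finset.sum_insert hn]
    filter_upwards [Lp.coeFn_add (mulProj m hb (s n) ψ) (∑ n ∈ F, mulProj m hb (s n) ψ), ih,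
      mulProj_ae hb (hs n) ψ] with x h1 h2 h3
    rw [h1, Pi.add_apply, h2, h3, Finset.sum_insert hn]
    ring

lemma norm_indicator_sub_le (s t : Set ℝ) (h : s ⊆ t) (y : ℝ) :
    ‖s.indicator (1 : ℝ → ℂ) y - t.indicator 1 y‖ ≤ 1 := by
  by_cases hs : y ∈ s
  · simp [hs, h hs]
  · by_cases ht : y ∈ t <;> simp [hs, ht]

/-- At each point the indicators of the finite unions are eventually constant, and everything is
dominated by |ψ|. -/
lemma hasSum_mulProj (hb : Measurable b) {s : ℕ → Set ℝ} (hs : ∀ n, MeasurableSet (s n))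
    (hd : Pairwise (Function.onFun Disjoint s)) (ψ : Lp ℂ 2 m) :
    HasSum (fun n => mulProj m hb (s n) ψ) (mulProj m hb (⋃ n, s n) ψ) := by
  refine tendsto_of_dominated (fun F => sum_mulProj_ae hb hs F ψ)
    (mulProj_ae hb (MeasurableSet.iUnion hs) ψ) (Lp.memLp ψ).norm ?_ ?_
  · refine Eventually.of_forall fun F => Eventually.of_forall fun x => ?_
    rw [sum_indicator hd, ← sub_mul, norm_mul]
    refine mul_le_of_le_one_left (norm_nonneg _) (norm_indicator_sub_le _ _ ?_ _)
    exact iUnion₂_subset fun n _ => subset_iUnion s n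
  · refine Eventually.of_forall fun x => Tendsto.mul_const _ ?_
    refine tendsto_const_nhds.congr' ?_
    by_cases h : b x ∈ ⋃ n, s n
    · obtain ⟨n, hn⟩ := mem_iUnion.1 h
      filter_upwards [eventually_ge_atTop {n}] with F hF
      have h2 : b x ∈ ⋃ n ∈ F, s n :=
        mem_iUnion₂.2 ⟨n, hF (Finset.mem_singleton_self n), hn⟩
      rw [sum_indicator hd, indicator_of_mem h, indicator_of_mem h2]
    · refine Eventually.of_forall fun F => ?_
      have h2 : b x ∉ ⋃ n ∈ F, s n := fun h3 =>
        h (iUnion₂_subset (fun n _ => subset_iUnion s n) h3)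
      simp only
      rw [sum_indicator hd, indicator_of_notMem h, indicator_of_notMem h2]

variable (m) in
/-- The spectral measure of the multiplication by `b`. -/
def mulPVM (hb : Measurable b) : PVM (Lp ℂ 2 m) where
  proj := mulProj m hb
  isStarProjection s hs := by
    rw [mulProj_eq hb hs]
    refine ⟨mulOp_mul _ _ _ (Eventually.of_forall fun x => ?_), star_mulOp _ _ fun x => ?_⟩ <;>
    by_cases h : b x ∈ s <;> simp [h]
  univ := by
    rw [mulProj_eq hb MeasurableSet.univ]
    exact mulOp_one _ (Eventually.of_forall fun x => by simp)
  empty := by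
    ext1 ψ
    refine Lp.ext ?_
    filter_upwards [mulProj_ae hb MeasurableSet.empty ψ, Lp.coeFn_zero ℂ 2 m] with x h1 h2
    rw [h1, zero_apply, h2]
    simp
  iUnion s hs hd ψ := hasSum_mulProj hb hs hd ψ

lemma measurable_norm_sq (ψ : Lp ℂ 2 m) : Measurable fun x => ENNReal.ofReal (‖ψ x‖ ^ 2) :=
  ((Lp.stronglyMeasurable ψ).measurable.norm.pow_const 2).ennreal_ofReal

lemma scalar_mulPVM (hb : Measurable b) (ψ : Lp ℂ 2 m) : (mulPVM m hb).scalar ψ =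
    Measure.map b (m.withDensity fun x => ENNReal.ofReal (‖ψ x‖ ^ 2)) := by
  ext s hs
  rw [PVM.scalar, Measure.ofMeasurable_apply _ hs, Measure.map_apply hb hs,
    withDensity_apply _ (hb hs), norm_sq_eq_integral, ofReal_integral_eq_lintegral_ofReal
      (integrable_norm_sq _) (Eventually.of_forall fun x => by positivity),
    ← lintegral_indicator (hb hs)]
  refine lintegral_congr_ae ?_
  filter_upwards [mulProj_ae hb hs ψ] with x h
  rw [show (mulPVM m hb).proj s ψ = mulProj m hb s ψ from rfl, h]
  by_cases hx : b x ∈ s <;> simp [hx, indicator]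

lemma isIntegral_mulMax (hb : Measurable b) {f : ℝ → ℝ} (hf : Measurable f) :
    (mulPVM m hb).IsIntegral f (mulMax m fun x => f (b x)) := by
  have hψm (ψ : Lp ℂ 2 m) := measurable_norm_sq ψ
  refine ⟨fun ψ => ?_, fun ψ => ?_⟩
  · rw [scalar_mulPVM, lintegral_map (by fun_prop) hb,
      lintegral_withDensity_eq_lintegral_mul _ (hψm ψ) (by fun_prop)]
    change MemLp (fun x => (f (b x) : ℂ) * ψ x) 2 m ↔ _
    have hsm : AEStronglyMeasurable (fun x => (f (b x) : ℂ) * ψ x) m :=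
      (Complex.measurable_ofReal.comp (hf.comp hb)).aestronglyMeasurable.mul (Lp.aestronglyMeasurable ψ)
    rw [memLp_two_iff_integrable_sq_norm hsm, Integrable,
      and_iff_right (show AEStronglyMeasurable (fun x => ‖(f (b x) : ℂ) * ψ x‖ ^ 2) m from hsm.norm.pow 2),
      hasFiniteIntegral_iff_ofReal (Eventually.of_forall fun x => by positivity)]
    refine Eq.to_iff (congrArg (· < ⊤) (lintegral_congr fun x => ?_))
    rw [Pi.mul_apply, ← ENNReal.ofReal_mul (by positivity), norm_mul, mul_pow, Complex.norm_real,
      Real.norm_eq_abs, sq_abs, mul_comm]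
  · rw [scalar_mulPVM, integral_map hb.aemeasurable hf.aestronglyMeasurable,
      integral_withDensity_eq_integral_toReal_smul (hψm ψ)
        (Eventually.of_forall fun x => ENNReal.ofReal_lt_top), L2.inner_def, ← integral_complex_ofReal]
    refine integral_congr_ae ?_
    have h1 : ((ψ : Lp ℂ 2 m), mulMax m (fun x => f (b x)) ψ) ∈
        (mulMax m fun x => f (b x)).graph := LinearPMap.mem_graph _ ψ
    filter_upwards [mem_graph_mulMax.1 h1] with x hx
    rw [hx, ENNReal.toReal_ofReal (by positivity), RCLike.inner_apply, smul_eq_mul, mul_assoc,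
      RCLike.mul_conj]
    push_cast
    exact mul_comm _ _

end SpectralMeasure

/-! ### Uniqueness in the functional calculus -/

section FunctionalCalculus

variable {H : Type*} [NormedAddCommGroup H] [InnerProductSpace ℂ H]

/-- Polarization over ℂ, using ψ + φ and ψ + i φ. -/
lemma inner_eq_zero_of_quadratic {D : Submodule ℂ H} {C : D →ₗ[ℂ] H}
    (h : ∀ ψ : D, ⟪(ψ : H), C ψ⟫_ℂ = 0) (ψ φ : D) : ⟪(ψ : H), C φ⟫_ℂ = 0 := by
  have h1 := h (ψ + φ)
  have h2 := h (ψ + Complex.I • φ)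
  simp only [map_add, map_smul, Submodule.coe_add, Submodule.coe_smul, inner_add_left,
    inner_add_right, inner_smul_left, inner_smul_right, h, Complex.conj_I] at h1 h2
  linear_combination (1 / 2 : ℂ) * h1 - Complex.I / 2 * h2 + (1 / 2 : ℂ) *
    (⟪(ψ : H), C φ⟫_ℂ - ⟪(φ : H), C ψ⟫_ℂ) * Complex.I_sq

/-- Being an integral of f prescribes the domain and the quadratic form. By polarization these
determine the operator when the domain is dense, so the choice made in `PVM.fn` is harmless. -/
lemma PVM.IsIntegral.eq [CompleteSpace H] {E : PVM H} {f : ℝ → ℝ} {A B : H →ₗ.[ℂ] H} (hA : E.IsIntegral f A)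
    (hB : E.IsIntegral f B) (hd : ∀ Φ : H, (∀ ψ ∈ A.domain, ⟪Φ, ψ⟫_ℂ = 0) → Φ = 0) : A = B := by
  have hdom : A.domain = B.domain := Submodule.ext fun ψ => (hA.1 ψ).trans (hB.1 ψ).symm
  obtain ⟨D, A⟩ := A
  obtain ⟨D', B⟩ := B
  simp only at hdom
  subst hdom
  congr 1
  have h1 : ∀ ψ : D, ⟪(ψ : H), (A - B) ψ⟫_ℂ = 0 := fun ψ => by
    have h2 : ⟪(ψ : H), A ψ⟫_ℂ = _ := hA.2 ψ
    have h3 : ⟪(ψ : H), B ψ⟫_ℂ = _ := hB.2 ψ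
    rw [LinearMap.sub_apply, inner_sub_right, h2, h3, sub_self]
  ext φ
  rw [← sub_eq_zero, ← LinearMap.sub_apply]
  refine hd _ fun ψ hψ => ?_
  rw [← inner_conj_symm, inner_eq_zero_of_quadratic h1 ⟨ψ, hψ⟩ φ, map_zero]

lemma fn_mulPVM {X : Type*} [MeasurableSpace X] {m : Measure X} {b : X → ℝ} (hb : Measurable b)
    {f : ℝ → ℝ} (hf : Measurable f) : (mulPVM m hb).fn f = mulMax m fun x => f (b x) := by
  have h : ∃ B, (mulPVM m hb).IsIntegral f B := ⟨_, isIntegral_mulMax hb hf⟩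
  rw [PVM.fn, dif_pos h]
  refine ((isIntegral_mulMax hb hf).eq h.choose_spec fun Φ hΦ => ?_).symm
  refine dense_domain_mulMax (hf.comp hb) Φ ?_
  rintro ψ ⟨η, hη⟩
  exact hΦ ψ (mem_graph_iff_exists.1 hη).1

end FunctionalCalculus

/-! ### The operator V is the twist -/

section Twist

lemma isSpectralMeasure_Yhat : (mulPVM mu measurable_fst).IsSpectralMeasure Yhat := by
  rw [PVM.IsSpectralMeasure, Yhat_eq_mulMax]
  exact isIntegral_mulMax measurable_fst measurable_id

lemma isScale_abs_add : IsScale fun z => |z + 1| where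
  meas := by fun_prop
  ne_zero := by
    filter_upwards [ae_add_one_ne_zero] with x hx
    exact abs_ne_zero.2 hx

/-- The minus sign reverses time in the scaling group, so its value at 1 scales x₁ by exp(log|1 +
z₂|) = |1 + z₂|. -/
lemma expI_tensor_Xhat_log : expI (-(tensor Xhat (mulMax mu fun x => Real.log |x.1 + 1|))) =
    scaleOp isScale_abs_add one_ne_zero := by
  have hflow := isScaleFlow_of_contDiffOn measurable_log_abs contDiffOn_log_abs
  rw [tensor_Xhat_log, ← generator_neg]
  refine (expI_generator hflow.isUnitaryGroup.neg
    (D := {ψ | ∃ F, IsTestU F ∧ ψ =ᵐ[mu.prod mu] F}) ?_ ?_).trans ?_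
  · rintro ψ ⟨F, hF, hψ⟩
    rw [generator_neg]
    have h := hflow.mem_graph hF.1 hF.tsupport_subset hψ
      (hflow.isTest₂_scaleDeriv hF.1 hF.tsupport_subset).memLp.coeFn_toLp
    obtain ⟨h1, h2⟩ := mem_graph_iff_exists.1 h
    exact ⟨_, mem_graph_iff_exists.2 ⟨h1, rfl⟩⟩
  · exact fun Φ hΦ => eq_zero_of_orthogonal_isTestU fun F hF ψ hψ => hΦ ψ ⟨F, hF, hψ⟩
  · refine ContinuousLinearMap.ext fun ψ => Lp.ext ?_
    refine (scaleOp_ae _ _ (EventuallyEq.refl _ ψ)).trans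
      (EventuallyEq.trans ?_ (scaleOp_ae _ _ (EventuallyEq.refl _ ψ)).symm)
    filter_upwards [ae_mu_mu_snd ae_add_one_ne_zero] with q hq
    have h : Real.exp (Real.log |q.2.1 + 1|) = |q.2.1 + 1| := Real.exp_log (abs_pos.2 hq)
    simp only [neg_mul, one_mul, neg_neg, mul_zero, neg_zero, Real.exp_zero, h]

lemma measurable_sign : Measurable fun z : ℝ => Real.sign (z + 1) := by
  unfold Real.sign
  exact Measurable.ite (measurableSet_lt (by fun_prop) (by fun_prop)) (by fun_prop)
    (Measurable.ite (measurableSet_lt (by fun_prop) (by fun_prop)) (by fun_prop) (by fun_prop))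

lemma abs_sign_le (z : ℝ) : |Real.sign z| ≤ 1 := by
  rcases Real.sign_apply_eq z with h | h | h <;> simp [h]

lemma isBddMeas_sign : IsBddMeas fun x : P => (Real.sign (x.1 + 1) : ℂ) :=
  isBddMeas_ofReal (measurable_sign.comp measurable_fst) fun _ => abs_sign_le _

lemma isBddMeas_sign_snd : IsBddMeas fun q : Q => (Real.sign (q.2.1 + 1) : ℂ) :=
  isBddMeas_ofReal (measurable_sign.comp (measurable_fst.comp measurable_snd))
    fun _ => abs_sign_le _

lemma tensor_one_sign : tensor (ofBdd 1) (mulMax mu fun x => Real.sign (x.1 + 1)) =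
    ofBdd (mulOp (mu.prod mu) isBddMeas_sign_snd) := by
  rw [mulMax_eq_ofBdd isBddMeas_sign]
  refine tensor_ofBdd fun ψ φ => Lp.ext ?_
  filter_upwards [mulOp_ae isBddMeas_sign_snd (tmul ψ φ), tmul_ae_coe ψ φ,
    tmul_ae (EventuallyEq.refl _ _) (mulOp_ae isBddMeas_sign φ)] with q h1 h2 h3
  rw [h1, h2, one_apply_eq_self, h3]
  ring

lemma isScale_neg_one : IsScale fun _ => -1 := ⟨measurable_const, Eventually.of_forall fun _ => by norm_num⟩

lemma tensor_Jhat_one : tensor (ofBdd Jhat) (ofBdd 1) =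
    ofBdd (scaleOp isScale_neg_one one_ne_zero) := by
  refine tensor_ofBdd fun ψ φ => Lp.ext ?_
  rw [Jhat_eq]
  refine (scaleOp_ae _ _ (tmul_ae_coe ψ φ)).trans (EventuallyEq.trans ?_
    (tmul_ae (dil_ae _ (EventuallyEq.refl _ ψ)) (EventuallyEq.refl _ _)).symm)
  exact Eventually.of_forall fun q => by simp

/-- `I ⊗ sgn(Ŷ + I)`. -/
def signOp : H₂ →L[ℂ] H₂ := mulOp (mu.prod mu) isBddMeas_sign_snd

lemma signOp_ae (ψ : H₂) :
    signOp ψ =ᵐ[mu.prod mu] fun q => (Real.sign (q.2.1 + 1) : ℂ) * ψ q :=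
  mulOp_ae _ ψ

lemma signOp_mul_signOp : signOp * signOp = 1 := by
  refine (mulOp_mul _ _ (c := fun _ => 1) ⟨measurable_const, 1, fun _ => by simp⟩ ?_).trans
    (mulOp_one _ (Eventually.of_forall fun _ => rfl))
  filter_upwards [ae_mu_mu_snd ae_add_one_ne_zero] with q hq
  rcases Real.sign_apply_eq_of_ne_zero _ hq with h | h <;> simp [h]

lemma isSelfAdjoint_signOp : IsSelfAdjoint signOp :=
  star_mulOp _ _ fun _ => (Complex.conj_ofReal _).symm

/-- `Ĵ ⊗ I`. -/
def negOp : H₂ →L[ℂ] H₂ := scaleOp isScale_neg_one one_ne_zero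

lemma negOp_ae (ψ : H₂) :
    negOp ψ =ᵐ[mu.prod mu] fun q => ψ ((-1 : ℝ) • q.1, (1 : ℝ) • q.2) :=
  scaleOp_ae isScale_neg_one one_ne_zero (EventuallyEq.refl _ ψ)

lemma isScale_one : IsScale fun _ => 1 :=
  ⟨measurable_const, Eventually.of_forall fun _ => one_ne_zero⟩

lemma negOp_mul_negOp : negOp * negOp = 1 :=
  (scaleOp_mul (l := fun _ => -1) (l' := fun _ => -1) (l'' := fun _ => 1) (k := 1) (k' := 1)
    (k'' := 1) isScale_neg_one isScale_neg_one isScale_one one_ne_zero one_ne_zero one_ne_zero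
    (Eventually.of_forall fun _ => by norm_num) (by norm_num)).trans
    (scaleOp_one _ _ (Eventually.of_forall fun _ => rfl) rfl)

lemma isSelfAdjoint_negOp : IsSelfAdjoint negOp :=
  star_scaleOp (l := fun _ => -1) (l' := fun _ => -1) (k := 1) (k' := 1) isScale_neg_one
    isScale_neg_one one_ne_zero one_ne_zero (Eventually.of_forall fun _ => by norm_num)
    (by norm_num)

lemma chOp_signOp_negOp_ae (ψ : H₂) : chOp signOp negOp ψ =ᵐ[mu.prod mu] fun q =>
    (2⁻¹ : ℂ) * ((ψ q + (Real.sign (q.2.1 + 1) : ℂ) * ψ q) +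
      (ψ ((-1 : ℝ) • q.1, (1 : ℝ) • q.2) -
        (Real.sign (q.2.1 + 1) : ℂ) * ψ ((-1 : ℝ) • q.1, (1 : ℝ) • q.2))) := by
  have h0 : chOp signOp negOp ψ =
      (2⁻¹ : ℂ) • ((ψ + signOp ψ) + (negOp ψ - signOp (negOp ψ))) := by
    rw [chOp_eq isSelfAdjoint_signOp signOp_mul_signOp isSelfAdjoint_negOp negOp_mul_negOp]
    rfl
  rw [h0]
  filter_upwards [Lp.coeFn_smul (2⁻¹ : ℂ) ((ψ + signOp ψ) + (negOp ψ - signOp (negOp ψ))),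
    Lp.coeFn_add (ψ + signOp ψ) (negOp ψ - signOp (negOp ψ)), Lp.coeFn_add ψ (signOp ψ),
    Lp.coeFn_sub (negOp ψ) (signOp (negOp ψ)), signOp_ae ψ, signOp_ae (negOp ψ), negOp_ae ψ]
    with q h1 h2 h3 h4 h5 h6 h7
  rw [h1, Pi.smul_apply, smul_eq_mul, h2, Pi.add_apply, h3, h4, Pi.add_apply, Pi.sub_apply, h5, h6,
    h7]

/-- Ch acts as I where 1 + z₂ > 0 and as Ĵ ⊗ I where 1 + z₂ < 0. There x₁ ↦ -x₁ turns |1 + z₂| into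
1 + z₂. -/
lemma scaleOp_abs_mul_chOp :
    scaleOp isScale_abs_add one_ne_zero * chOp signOp negOp = twist := by
  refine ContinuousLinearMap.ext fun ψ => Lp.ext ?_
  refine (scaleOp_ae isScale_abs_add one_ne_zero (chOp_signOp_negOp_ae ψ)).trans
    (EventuallyEq.trans (Eventually.of_forall fun q => ?_)
      (scaleOp_ae isScale_add one_ne_zero (EventuallyEq.refl _ ψ)).symm)
  simp only [one_smul]
  rcases lt_trichotomy (q.2.1 + 1) 0 with h | h | h
  · rw [Real.sign_of_neg h, abs_of_neg h, smul_smul]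
    push_cast
    rw [show -1 * -(q.2.1 + 1) = 1 + q.2.1 by ring]
    ring
  -- Here the sign is 0 and Ch averages two values, but both are taken at 0 · x₁.
  · rw [h, abs_zero, Real.sign_zero, show 1 + q.2.1 = 0 by linarith]
    simp only [zero_smul, smul_zero, Complex.ofReal_zero]
    ring
  · rw [Real.sign_of_pos h, abs_of_pos h, add_comm q.2.1 1]
    push_cast
    ring

lemma V_mulPVM : V (mulPVM mu measurable_fst) = twist := by
  have h1 : (mulPVM mu measurable_fst).fn (fun x => Real.log |x + 1|) = mulMax mu _ :=
    fn_mulPVM measurable_fst measurable_log_abs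
  have h2 : (mulPVM mu measurable_fst).fn (fun x => Real.sign (x + 1)) = mulMax mu _ :=
    fn_mulPVM measurable_fst measurable_sign
  rw [V, h1, h2, expI_tensor_Xhat_log, tensor_one_sign, tensor_Jhat_one, asBdd_ofBdd, asBdd_ofBdd]
  exact scaleOp_abs_mul_chOp

lemma isBicharacter_chi : IsBicharacter chi := by
  have hCh : ∀ ε ε' δ : ℤˣ, Ch (ε * ε') δ = Ch ε δ * Ch ε' δ := by
    intro ε ε' δ
    rcases Int.units_eq_one_or ε with rfl | rfl <;> rcases Int.units_eq_one_or ε' with rfl | rfl <;>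
      rcases Int.units_eq_one_or δ with rfl | rfl <;> norm_num [Ch]
  have hCh' : ∀ ε δ δ' : ℤˣ, Ch ε (δ * δ') = Ch ε δ * Ch ε δ' := by
    intro ε δ δ'
    have h : ∀ a b : ℤˣ, Ch a b = Ch b a := fun a b => by simp [Ch, and_comm]
    rw [h, hCh, h δ, h δ']
  refine ⟨fun x ε y δ => ?_, fun x x' ε ε' y δ => ?_, fun x ε y y' δ δ' => ?_⟩
  · have h1 : ‖Complex.exp (-(Complex.I * x * y))‖ = 1 := by
      rw [show -(Complex.I * x * y) = ((-(x * y) : ℝ) : ℂ) * Complex.I by push_cast; ring]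
      exact Complex.norm_exp_ofReal_mul_I _
    rw [chi, norm_mul, h1, Complex.norm_real, one_mul, Ch]
    split_ifs <;> simp
  · rw [chi, chi, chi, hCh, mul_mul_mul_comm, ← Complex.exp_add]
    push_cast
    ring_nf
  · rw [chi, chi, chi, hCh', mul_mul_mul_comm, ← Complex.exp_add]
    push_cast
    ring_nf

end Twist

/-! ### Amplification and the diagonal action -/

section Amplification

open scoped TensorProduct

lemma ext_tmul {A B : H₂ →L[ℂ] H₂} (h : ∀ ψ φ, A (tmul ψ φ) = B (tmul ψ φ)) : A = B := by
  refine ext_of_inner_dense (D := {Ψ | ∃ ψ φ, Ψ = tmul ψ φ})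
    (fun Φ hΦ => eq_zero_of_orthogonal_tmul fun ψ φ => hΦ _ ⟨ψ, φ, rfl⟩) ?_
  rintro Ψ ⟨ψ, φ, rfl⟩
  exact h ψ φ

/-- The isometry of the algebraic tensor product into `L²(Γ × Γ)`. -/
def tensorIsometry : H ⊗[ℂ] H →ₗᵢ[ℂ] H₂ :=
  (TensorProduct.lift tmulL.toLinearMap₁₂).isometryOfInner fun x y => by
    induction x using TensorProduct.induction_on with
    | zero => simp
    | add x x' hx hx' => rw [map_add, inner_add_left, inner_add_left, hx, hx']
    | tmul ψ φ =>
      induction y using TensorProduct.induction_on with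
      | zero => simp
      | add y y' hy hy' => rw [map_add, inner_add_right, inner_add_right, hy, hy']
      | tmul ψ' φ' => exact inner_tmul ψ φ ψ' φ'

lemma denseRange_tensorIsometry : DenseRange tensorIsometry := by
  have h : (LinearMap.range tensorIsometry.toLinearMap).topologicalClosure = ⊤ := by
    rw [Submodule.topologicalClosure_eq_top_iff, Submodule.eq_bot_iff]
    intro Φ hΦ
    refine eq_zero_of_orthogonal_tmul fun ψ φ => ?_
    rw [Submodule.mem_orthogonal'] at hΦ
    exact hΦ _ ⟨ψ ⊗ₜ φ, rfl⟩
  exact (Submodule.dense_iff_topologicalClosure_eq_top.2 h)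

/-- For an isometry u, the map I ⊗ u is isometric on the algebraic tensor product and extends by
continuity. Every bounded operator is a linear combination of unitaries. -/
lemma exists_amp (a : H →L[ℂ] H) : ∃ A : H₂ →L[ℂ] H₂, ∀ ψ φ, A (tmul ψ φ) = tmul ψ (a φ) := by
  have ha : a ∈ Submodule.span ℂ (unitary (H →L[ℂ] H) : Set (H →L[ℂ] H)) := by
    rw [CStarAlgebra.span_unitary]
    trivial
  induction ha using Submodule.span_induction with
  | zero => exact ⟨0, fun ψ φ => by
      rw [zero_apply, zero_apply, ← zero_smul ℂ (0 : H), tmul_smul_right, zero_smul]⟩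
  | add a b _ _ ha hb =>
    obtain ⟨A, hA⟩ := ha
    obtain ⟨B, hB⟩ := hb
    exact ⟨A + B, fun ψ φ => by rw [add_apply, hA, hB, add_apply, tmul_add_right]⟩
  | smul c a _ ha =>
    obtain ⟨A, hA⟩ := ha
    exact ⟨c • A, fun ψ φ => by rw [smul_apply, hA, smul_apply, tmul_smul_right]⟩
  | mem u hu =>
    let u' : H →ₗᵢ[ℂ] H := ⟨u, norm_apply_of_mem_unitary hu⟩
    refine ⟨(tensorIsometry.comp (u'.lTensor H)).toContinuousLinearMap.extend
      tensorIsometry.toContinuousLinearMap, fun ψ φ => ?_⟩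
    exact ContinuousLinearMap.extend_eq (e := tensorIsometry.toContinuousLinearMap) _
      denseRange_tensorIsometry tensorIsometry.isometry.isUniformInducing (ψ ⊗ₜ φ)

/-- `I ⊗ a`. -/
def amp (a : H →L[ℂ] H) : H₂ →L[ℂ] H₂ := (exists_amp a).choose

lemma amp_tmul (a : H →L[ℂ] H) (ψ φ : H) : amp a (tmul ψ φ) = tmul ψ (a φ) :=
  (exists_amp a).choose_spec ψ φ

lemma amp_star (a : H →L[ℂ] H) : amp (star a) = star (amp a) := by
  refine ext_tmul fun ψ φ => ?_
  rw [amp_tmul, ← sub_eq_zero]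
  refine eq_zero_of_orthogonal_tmul fun ψ' φ' => ?_
  rw [inner_sub_left, inner_tmul, ContinuousLinearMap.star_eq_adjoint,
    ContinuousLinearMap.star_eq_adjoint, ContinuousLinearMap.adjoint_inner_left,
    ContinuousLinearMap.adjoint_inner_left, amp_tmul, inner_tmul, sub_self]

/-- The unitary on `L²(Γ × Γ)` that transforms `I ⊗ a` into `Δ₀(a)`. -/
def diagOp : H₂ →L[ℂ] H₂ := compOp measurePreserving_diagCoordInv

lemma ae_snd_snd_ne_zero : ∀ᵐ q ∂(mu.prod mu), (q : Q).2.2 ≠ 0 := by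
  filter_upwards [ae_mem_gamma₂] with q hq
  exact hq.2

lemma diagOp_mem_unitary : diagOp ∈ unitary (H₂ →L[ℂ] H₂) :=
  compOp_mem_unitary _ measurePreserving_diagCoord
    (ae_snd_snd_ne_zero.mono fun _ h => diagCoord_inv h)
    (ae_snd_snd_ne_zero.mono fun _ h => diagCoordInv_diagCoord h)

/-- The conjugation of `I ⊗ a` by `diagOp`. -/
def diagHom : (H →L[ℂ] H) →⋆ₙₐ[ℂ] (H₂ →L[ℂ] H₂) where
  toFun a := diagOp * amp a * star diagOp
  map_smul' c a := by
    have h : amp (c • a) = c • amp a := ext_tmul fun ψ φ => by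
      rw [smul_apply, amp_tmul, amp_tmul, smul_apply, tmul_smul_right]
    rw [h, mul_smul_comm, smul_mul_assoc]
    rfl
  map_zero' := by
    have h : amp 0 = 0 := ext_tmul fun ψ φ => by
      rw [amp_tmul, zero_apply, zero_apply, ← zero_smul ℂ (0 : H), tmul_smul_right, zero_smul]
    rw [h, mul_zero, zero_mul]
  map_add' a b := by
    have h : amp (a + b) = amp a + amp b := ext_tmul fun ψ φ => by
      rw [add_apply, amp_tmul, amp_tmul, amp_tmul, add_apply, tmul_add_right]
    rw [h, mul_add, add_mul]
  map_mul' a b := by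
    have h : amp (a * b) = amp a * amp b := ext_tmul fun ψ φ => by
      rw [mul_apply_eq_comp, amp_tmul, amp_tmul, amp_tmul, mul_apply_eq_comp]
    have h2 : star diagOp * diagOp = 1 := diagOp_mem_unitary.1
    rw [h, show diagOp * amp a * star diagOp * (diagOp * amp b * star diagOp) =
      diagOp * amp a * (star diagOp * diagOp) * (amp b * star diagOp) by simp only [mul_assoc], h2,
      mul_one]
    simp only [mul_assoc]
  map_star' a := by
    rw [amp_star, star_mul, star_mul, star_star, mul_assoc]

/-- The quotient x₁ / c₂ is unchanged when both variables are divided by h, so the factor g leaves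
the integral. The remaining variable (z₁ + z₂, c₂) is divided by h, which leaves the convolution of
f with φ. -/
lemma delta₀_tmul (f g : P → ℂ) (φ : P → ℂ) (q : Q) :
    delta₀ f (fun q => g (diagCoordInv q).1 * φ (diagCoordInv q).2) q =
      g (diagCoordInv q).1 * conv f φ (diagCoordInv q).2 := by
  rw [delta₀, conv, ← integral_const_mul]
  refine integral_congr_ae (Eventually.of_forall fun h => ?_)
  rcases eq_or_ne h 0 with rfl | hh
  · simp
  · simp only [diagCoordInv, Prod.smul_mk, smul_eq_mul]
    have h1 : (q.2.2 / h)⁻¹ * (q.1.1 / h) = q.2.2⁻¹ * q.1.1 := by field_simp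
    have h2 : (q.2.2 / h)⁻¹ * (q.1.2 / h) = q.2.2⁻¹ * q.1.2 := by field_simp
    have h3 : q.2.1 / h + q.1.1 / h = (q.2.1 + q.1.1) / h := by ring
    have h4 : q.2.2⁻¹ • q.1 = (q.2.2⁻¹ * q.1.1, q.2.2⁻¹ * q.1.2) := rfl
    rw [h1, h2, h3, h4, add_comm q.1.1]
    ring

lemma diagHom_rep {f : P → ℂ} (hf : IsTest f) : diagHom (rep f) = deltaOp f := by
  have h : diagOp * amp (rep f) = deltaOp f * diagOp := by
    refine ext_tmul fun ψ φ => Lp.ext ?_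
    rw [mul_apply_eq_comp, mul_apply_eq_comp, amp_tmul]
    refine (compOp_toLp_ae _ (tmul_ae (EventuallyEq.refl _ ψ)
      (rep_ae hf (EventuallyEq.refl _ φ)))).trans (EventuallyEq.trans ?_
        (deltaOp_ae hf (compOp_toLp_ae _ (tmul_ae_coe ψ φ))).symm)
    exact Eventually.of_forall fun q => (delta₀_tmul f ψ φ q).symm
  change diagOp * amp (rep f) * star diagOp = _
  rw [h, mul_assoc, diagOp_mem_unitary.2, mul_one]

end Amplification

/-! ### Existence and uniqueness of Δ₀ -/

section Comultiplication

/-- The comultiplication `Δ₀`. -/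
def delta₀Hom : Cr →⋆ₙₐ[ℂ] (H₂ →L[ℂ] H₂) :=
  diagHom.comp (NonUnitalStarSubalgebraClass.subtype Cr)

lemma delta₀Hom_apply (a : Cr) : delta₀Hom a = diagHom (a : H →L[ℂ] H) := rfl

/-- The algebra is a closed *-subalgebra, hence a C*-algebra, and *-homomorphisms between
C*-algebras do not increase norms. In uniqueness no continuity of Δ₀ has to be assumed. -/
lemma norm_apply_le_of_Cr (Φ : Cr →⋆ₙₐ[ℂ] (H₂ →L[ℂ] H₂)) (a : Cr) :
    ‖Φ a‖ ≤ ‖(a : H →L[ℂ] H)‖ := by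
  have : IsClosed (Cr : Set (H →L[ℂ] H)) := isClosed_Cr
  exact NonUnitalStarAlgHom.norm_apply_le Φ a

lemma continuous_of_Cr (Φ : Cr →⋆ₙₐ[ℂ] (H₂ →L[ℂ] H₂)) : Continuous Φ :=
  AddMonoidHomClass.continuous_of_bound Φ 1 fun a => by
    rw [one_mul]
    exact norm_apply_le_of_Cr Φ a

lemma delta₀Hom_mul_mem (a : Cr) {b : H₂ →L[ℂ] H₂} (hb : b ∈ Cr₂) : delta₀Hom a * b ∈ Cr₂ := by
  revert b
  refine Cr_induction (p := fun a => ∀ {b : H₂ →L[ℂ] H₂}, b ∈ Cr₂ → delta₀Hom a * b ∈ Cr₂)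
    ?_ ?_ ?_ ?_ ?_ ?_ a
  · have h1 : {a : Cr | ∀ {b : H₂ →L[ℂ] H₂}, b ∈ Cr₂ → delta₀Hom a * b ∈ Cr₂} =
        ⋂ b ∈ Cr₂, {a | delta₀Hom a * b ∈ Cr₂} := by
      ext a
      simp only [mem_ofPred_eq, mem_iInter]
    rw [h1]
    exact isClosed_biInter fun b _ =>
      isClosed_Cr₂.preimage ((continuous_of_Cr delta₀Hom).mul continuous_const)
  · intro f hf b hb
    rw [delta₀Hom_apply, diagHom_rep hf]
    refine mul_mem_Cr₂ (fun F hF => ?_) hb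
    rw [deltaOp_mul_rep₂ hf hF]
    exact rep₂_mem_Cr₂ (isTest₂_delta₀ hf hF)
  · intro b _
    rw [map_zero, zero_mul]
    exact zero_mem _
  · intro a a' ha ha' b hb
    rw [map_add, add_mul]
    exact add_mem (ha hb) (ha' hb)
  · intro c a ha b hb
    rw [map_smul, smul_mul_assoc]
    exact SMulMemClass.smul_mem c (ha hb)
  · intro a a' ha ha' b hb
    rw [map_mul, mul_assoc]
    exact ha (ha' hb)

lemma isComult₀_delta₀Hom : IsComult₀ delta₀Hom := by
  refine ⟨fun a b hb => ⟨delta₀Hom_mul_mem a hb, ?_⟩, fun f hf a ha F hF =>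
    ⟨isTest₂_delta₀ hf hF, ?_⟩⟩
  · have h := star_mem (delta₀Hom_mul_mem (star a) (star_mem hb))
    rwa [map_star, star_mul, star_star, star_star] at h
  · rw [delta₀Hom_apply, ha, diagHom_rep hf, deltaOp_mul_rep₂ hf hF]

lemma ext_mul_rep₂ {m m' : H₂ →L[ℂ] H₂} (h : ∀ F, IsTest₂ F → m * rep₂ F = m' * rep₂ F) :
    m = m' :=
  eq_of_mul_rep₂U fun F hF => h F hF.1

/-- The definition prescribes Δ₀ only on products with `rep₂ F`; by totality of their ranges this
fixes the operator itself. -/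
lemma IsComult₀.apply_rep {Δ₀ : Cr →⋆ₙₐ[ℂ] (H₂ →L[ℂ] H₂)} (h : IsComult₀ Δ₀) {f : P → ℂ}
    (hf : IsTest f) : Δ₀ ⟨rep f, rep_mem_Cr hf⟩ = deltaOp f :=
  ext_mul_rep₂ fun F hF =>
    (h.2 f hf ⟨rep f, rep_mem_Cr hf⟩ rfl F hF).2.trans (deltaOp_mul_rep₂ hf hF).symm

lemma IsComult₀.eq {Δ₀ Δ₀' : Cr →⋆ₙₐ[ℂ] (H₂ →L[ℂ] H₂)} (h : IsComult₀ Δ₀)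
    (h' : IsComult₀ Δ₀') : Δ₀ = Δ₀' := by
  refine DFunLike.ext _ _ fun a => ?_
  refine Cr_induction (p := fun a => Δ₀ a = Δ₀' a) ?_ ?_ ?_ ?_ ?_ ?_ a
  · exact isClosed_eq (continuous_of_Cr Δ₀) (continuous_of_Cr Δ₀')
  · exact fun f hf => by rw [h.apply_rep hf, h'.apply_rep hf]
  · rw [map_zero, map_zero]
  · exact fun a b ha hb =>
      (map_add Δ₀ a b).trans ((congrArg₂ (· + ·) ha hb).trans (map_add Δ₀' a b).symm)
  · exact fun c a ha =>
      (map_smul Δ₀ c a).trans ((congrArg (c • ·) ha).trans (map_smul Δ₀' c a).symm)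
  · exact fun a b ha hb =>
      (map_mul Δ₀ a b).trans ((congrArg₂ (· * ·) ha hb).trans (map_mul Δ₀' a b).symm)

end Comultiplication

/-! ### The images of the generators under Δ -/

section Image

lemma continuous_mul_of_continuousAt {E : Type*} [NormedAddCommGroup E] [InnerProductSpace ℂ E]
    [CompleteSpace E] {U : ℝ → E →L[ℂ] E} (hU : IsUnitaryGroup U) {a : E →L[ℂ] E}
    (h : ContinuousAt (fun t => U t * a) 0) : Continuous fun t => U t * a := by
  rw [continuous_iff_continuousAt]
  intro s
  have h1 : (fun t => U t * a) = fun t => U s * (U (t - s) * a) := by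
    funext t
    rw [← mul_assoc, ← hU.add, add_sub_cancel]
  rw [h1]
  refine continuousAt_const.mul ?_
  have h2 : ContinuousAt (fun t : ℝ => t - s) s := by fun_prop
  exact ContinuousAt.comp_of_eq (g := fun t => U t * a) h h2 (sub_self s)

lemma norm_mul_of_mem_unitary_le {E : Type*} [NormedAddCommGroup E] [InnerProductSpace ℂ E]
    [CompleteSpace E] {u : E →L[ℂ] E} (hu : u ∈ unitary (E →L[ℂ] E)) (a : E →L[ℂ] E) :
    ‖u * a‖ ≤ ‖a‖ :=
  (CStarRing.norm_mem_unitary_mul a hu).le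

/-- Since the U t are isometric, norm convergence of a gives convergence of U t a uniformly in t, so
the set of good a is closed. It is also stable under multiplication from the right. -/
lemma continuous_mul_of_mem_Cr {U : ℝ → H →L[ℂ] H} (hU : IsUnitaryGroup U)
    (h : ∀ f, IsTest f → ContinuousAt (fun t => U t * rep f) 0) (a : Cr) :
    Continuous fun t => U t * (a : H →L[ℂ] H) := by
  refine Cr_induction (p := fun a => Continuous fun t => U t * (a : H →L[ℂ] H))
    ?_ ?_ ?_ ?_ ?_ ?_ a
  · rw [← isSeqClosed_iff_isClosed]
    intro x y hx hy
    refine continuous_of_uniform_approx_of_continuous fun u hu => ?_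
    obtain ⟨ε, hε, hεu⟩ := Metric.mem_uniformity_dist.1 hu
    obtain ⟨n, hn⟩ := (Metric.tendsto_nhds.1 hy ε hε).exists
    refine ⟨fun t => U t * (x n : H →L[ℂ] H), hx n, fun t => hεu ?_⟩
    rw [dist_eq_norm, ← mul_sub]
    refine (norm_mul_of_mem_unitary_le (hU.unitary t) _).trans_lt ?_
    rw [dist_comm] at hn
    exact (dist_eq_norm (y : H →L[ℂ] H) (x n)).symm.trans_lt hn
  · exact fun f hf => continuous_mul_of_continuousAt hU (h f hf)
  · simpa using continuous_const
  · intro a b ha hb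
    have h1 : Continuous fun t => U t * (a : H →L[ℂ] H) + U t * b := ha.add hb
    simpa only [NonUnitalStarSubalgebra.coe_add, mul_add] using h1
  · intro c a ha
    have h1 : Continuous fun t => c • (U t * (a : H →L[ℂ] H)) := ha.const_smul c
    simpa only [NonUnitalStarSubalgebra.coe_smul, mul_smul_comm] using h1
  · intro a b ha _
    have h1 : Continuous fun t => U t * (a : H →L[ℂ] H) * b := ha.mul continuous_const
    simpa only [NonUnitalStarSubalgebra.coe_mul, ← mul_assoc] using h1

/-- `a ↦ T̂ Δ₀(a) T̂⁻¹`. -/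
def comultL : Cr →ₗ[ℂ] (H₂ →L[ℂ] H₂) where
  toFun := comult twist delta₀Hom
  map_add' a b := by
    rw [comult, map_add, mul_add, add_mul]
    rfl
  map_smul' c a := by
    rw [comult, map_smul, mul_smul_comm, smul_mul_assoc]
    rfl

lemma comultL_apply (a : Cr) : comultL a = twist * diagHom (a : H →L[ℂ] H) * star twist := rfl

lemma star_twist_mul_twist : star twist * twist = 1 := twist_mem_unitary.1

lemma twist_mul_star_twist : twist * star twist = 1 := twist_mem_unitary.2

lemma norm_comultL_le (a : Cr) : ‖comultL a‖ ≤ ‖(a : H →L[ℂ] H)‖ := by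
  rw [comultL_apply, CStarRing.norm_mul_mem_unitary _ (Unitary.star_mem twist_mem_unitary)]
  exact (norm_mul_of_mem_unitary_le twist_mem_unitary _).trans (norm_apply_le_of_Cr delta₀Hom a)

lemma eq_zero_of_orthogonal_comultL {X : H₂}
    (h : ∀ f (hf : IsTest f), ∀ Ψ, ⟪X, comultL ⟨rep f, rep_mem_Cr hf⟩ Ψ⟫_ℂ = 0) : X = 0 := by
  have h1 : star twist X = 0 := by
    refine eq_zero_of_orthogonal_deltaOp fun f hf Ψ => ?_
    have h2 := h f hf (twist Ψ)
    rw [comultL_apply, mul_apply_eq_comp, mul_apply_eq_comp, ← mul_apply_eq_comp (star twist),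
      star_twist_mul_twist, one_apply_eq_self, diagHom_rep hf] at h2
    rw [ContinuousLinearMap.star_eq_adjoint, ContinuousLinearMap.adjoint_inner_left, h2]
  have h2 : twist (star twist X) = X := by
    rw [← mul_apply_eq_comp, twist_mul_star_twist, one_apply_eq_self]
  rw [← h2, h1, map_zero]

/-- Δ carries U t a to T̂ W t T̂⁻¹ Δ(a), so the abstract principle `closedOp_image_generator`
applies. The hypotheses concern only the operators `rep f`, from which they extend to the whole
algebra. -/
lemma image_comult_generator {U : ℝ → H →L[ℂ] H} (hU : IsUnitaryGroup U)
    (hmem : ∀ t f, IsTest f → U t * rep f ∈ Cr)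
    (hc : ∀ f, IsTest f → ContinuousAt (fun t => U t * rep f) 0)
    (hD : ∀ f, IsTest f → ∃ b ∈ Cr, ∀ ψ, (rep f ψ, b ψ) ∈ (generator U).graph)
    {W : ℝ → H₂ →L[ℂ] H₂} (hW : IsUnitaryGroup W)
    (hUW : ∀ t f, IsTest f → W t * deltaOp f = diagHom (U t * rep f)) :
    image (comult twist delta₀Hom) (generator U) =
      generator fun t => twist * W t * star twist := by
  -- `diagHom` is defined on all bounded operators and so can be evaluated at U t itself. The ranges
  -- of the `deltaOp f` are total.
  have hUW' : ∀ t, diagHom (U t) = W t := fun t => by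
    refine ext_of_inner_dense (D := {Φ | ∃ f Ψ, IsTest f ∧ Φ = deltaOp f Ψ})
      (fun Φ hΦ => eq_zero_of_orthogonal_deltaOp fun f hf Ψ => hΦ _ ⟨f, Ψ, hf, rfl⟩) ?_
    rintro Φ ⟨f, Ψ, hf, rfl⟩
    rw [← mul_apply_eq_comp, ← mul_apply_eq_comp, hUW t f hf, map_mul, diagHom_rep hf]
  have hmem' : ∀ t, ∀ a : Cr, U t * a ∈ Cr := fun t a => mul_mem_Cr (hmem t) a.2
  refine closedOp_image_generator hU (hW.conj twist_mem_unitary) comultL norm_comultL_le hmem'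
    (fun t a => ?_) (continuous_mul_of_mem_Cr hU hc) (D := {a | ∃ f, ∃ hf : IsTest f,
      a = ⟨rep f, rep_mem_Cr hf⟩}) ?_ ?_
  · rw [comultL_apply, comultL_apply, map_mul, hUW']
    rw [show twist * W t * star twist * (twist * diagHom (a : H →L[ℂ] H) * star twist) =
      twist * W t * (star twist * twist) * (diagHom (a : H →L[ℂ] H) * star twist) by
        simp only [mul_assoc], star_twist_mul_twist, mul_one]
    simp only [mul_assoc]
  · rintro a ⟨f, hf, rfl⟩
    obtain ⟨b, hb, h⟩ := hD f hf
    exact ⟨⟨b, hb⟩, h⟩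
  · exact fun X hX => eq_zero_of_orthogonal_comultL fun f hf Ψ => hX _ ⟨f, hf, rfl⟩ Ψ

/-- The diagonal action sends the dilation B̂ t to the simultaneous dilation of x₁ and x₂, the
scaling group with both rates equal to 1. -/
lemma image_comult_Xhat : image (comult twist delta₀Hom) Xhat = generator fun t =>
    twist * scaleGroup (measurable_const (a := (1 : ℝ))) 1 t * star twist := by
  refine image_comult_generator isUnitaryGroup_Bhat (fun t f hf => ?_)
    (fun f hf => (hasDerivAt_Bhat_mul_rep hf).continuousAt) (fun f hf => ?_)
    (isScaleFlow_const 1 1).isUnitaryGroup fun t f hf => ?_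
  · rw [Bhat_mul_rep hf]
    exact rep_mem_Cr (isTest_dil hf (Real.exp_ne_zero _))
  · refine ⟨-Complex.I • rep (eulerNeg f), SMulMemClass.smul_mem _ (rep_mem_Cr (isTest_eulerNeg hf)),
      fun ψ => mem_graph_of_hasDerivAt ?_⟩
    exact hasDerivAt_clm_apply (hasDerivAt_Bhat_mul_rep hf) ψ
  · have hf' := isTest_dil hf (Real.exp_ne_zero (-t))
    rw [Bhat_mul_rep hf, diagHom_rep hf']
    exact scaleOp_mul_deltaOp (Real.exp_ne_zero (-(t * 1))) (isScale_exp measurable_const t)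
      (fun _ => rfl) hf hf' fun x => by rw [mul_one]

lemma rep_coord_mul_ae {f : P → ℂ} (hf : IsTest f) (ψ : H) :
    rep (fun x => (x.1 : ℂ) * f x) ψ =ᵐ[mu] fun x => (x.1 : ℂ) * rep f ψ x := by
  filter_upwards [rep_ae hf (EventuallyEq.refl _ ψ),
    rep_ae (isTest_coord_mul hf) (EventuallyEq.refl _ ψ)] with x h1 h2
  rw [h1, h2, conv_eq_kerFun, conv_eq_kerFun, kerFun, kerFun, ← integral_const_mul]
  simp only [mul_assoc]

lemma norm_phase_sub_one_le (t y : ℝ) : ‖Complex.exp (Complex.I * t * y) - 1‖ ≤ |t| * |y| := by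
  have h := Real.norm_exp_I_mul_ofReal_sub_one_le (x := t * y)
  rw [Real.norm_eq_abs, abs_mul] at h
  refine le_trans (le_of_eq ?_) h
  push_cast
  rw [mul_assoc]

/-- From |exp(itz) - 1| ≤ |t| |z|, the norm of the difference is at most |t| times that of the
convolution by z f, which is again a test function. -/
lemma continuousAt_phase_mul_rep {f : P → ℂ} (hf : IsTest f) :
    ContinuousAt (fun t => phase mu measurable_fst t * rep f) 0 := by
  have h0 : ∀ t, ‖phase mu measurable_fst t * rep f - rep f‖ ≤
      |t| * ‖rep fun x => (x.1 : ℂ) * f x‖ := fun t => by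
    refine ContinuousLinearMap.opNorm_le_bound _ (by positivity) fun ψ => ?_
    have h1 : ‖(phase mu measurable_fst t * rep f - rep f) ψ‖ ≤
        |t| * ‖rep (fun x => (x.1 : ℂ) * f x) ψ‖ := by
      refine norm_le_mul_of_ae ?_
      rw [sub_apply, mul_apply_eq_comp]
      filter_upwards [Lp.coeFn_sub (phase mu measurable_fst t (rep f ψ)) (rep f ψ),
        phase_ae measurable_fst t (rep f ψ), rep_coord_mul_ae hf ψ] with x h1 h2 h3
      rw [h1, Pi.sub_apply, h2, h3, ← sub_one_mul, norm_mul, norm_mul, ← mul_assoc,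
        Complex.norm_real, Real.norm_eq_abs]
      exact mul_le_mul_of_nonneg_right (norm_phase_sub_one_le t x.1) (norm_nonneg _)
    refine h1.trans ?_
    rw [mul_assoc]
    exact mul_le_mul_of_nonneg_left (ContinuousLinearMap.le_opNorm _ _) (abs_nonneg t)
  have h1 : phase mu measurable_fst 0 * rep f = rep f := by
    rw [(isUnitaryGroup_phase measurable_fst).zero, one_mul]
  rw [ContinuousAt, h1, tendsto_iff_norm_sub_tendsto_zero]
  refine squeeze_zero (fun _ => norm_nonneg _) h0 ?_
  have h2 : Continuous fun t : ℝ => |t| * ‖rep fun x => (x.1 : ℂ) * f x‖ := by fun_prop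
  simpa using h2.tendsto 0

lemma measurable_sum_coord : Measurable fun q : Q => q.1.1 + q.2.1 := by fun_prop

lemma measurable_twisted_coord : Measurable fun q : Q => (1 + q.2.1) * q.1.1 + q.2.1 := by fun_prop

lemma twist_mul_phase_mul_star_twist (t : ℝ) :
    twist * phase (mu.prod mu) measurable_sum_coord t * star twist =
      phase (mu.prod mu) measurable_twisted_coord t := by
  have h : twist * phase (mu.prod mu) measurable_sum_coord t =
      phase (mu.prod mu) measurable_twisted_coord t * twist := by
    refine ContinuousLinearMap.ext fun ψ => Lp.ext ?_
    rw [mul_apply_eq_comp, mul_apply_eq_comp]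
    filter_upwards [scaleOp_ae isScale_add one_ne_zero (phase_ae measurable_sum_coord t ψ),
      phase_ae measurable_twisted_coord t (twist ψ),
      scaleOp_ae isScale_add one_ne_zero (EventuallyEq.refl _ ψ)] with q h1 h2 h3
    rw [h2]
    refine h1.trans ?_
    rw [show twist ψ q = _ from h3]
    simp
  rw [h, mul_assoc, twist_mul_star_twist, mul_one]

/-- Under Δ₀ the phase exp(itŶ) becomes multiplication by exp(it(z₁ + z₂)). The twist replaces z₁ by
(1 + z₂) z₁. -/
lemma image_comult_Yhat : image (comult twist delta₀Hom) Yhat =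
    mulMax (mu.prod mu) fun q => (1 + q.2.1) * q.1.1 + q.2.1 := by
  rw [Yhat_eq_mulMax, ← generator_phase measurable_fst, ← generator_phase measurable_twisted_coord]
  have h1 (t : ℝ) {f : P → ℂ} (hf : IsTest f) : phase mu measurable_fst t * rep f =
      rep fun x => Complex.exp (Complex.I * t * (x.1 : ℝ)) * f x :=
    mulOp_mul_rep (isBddMeas_phase measurable_fst t) (fun _ _ _ => rfl) hf
      (isTest_phase hf contDiff_id t)
  rw [image_comult_generator (isUnitaryGroup_phase measurable_fst) (fun t f hf => ?_)
    (fun f hf => continuousAt_phase_mul_rep hf) (fun f hf => ?_)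
    (isUnitaryGroup_phase measurable_sum_coord) fun t f hf => ?_]
  · simp only [twist_mul_phase_mul_star_twist]
  · rw [h1 t hf]
    exact rep_mem_Cr (isTest_phase hf contDiff_id t)
  · refine ⟨_, rep_mem_Cr (isTest_coord_mul hf), fun ψ => ?_⟩
    rw [generator_phase, mem_graph_mulMax]
    exact rep_coord_mul_ae hf ψ
  · have h2 : IsTest fun x => Complex.exp (Complex.I * t * (x.1 : ℝ)) * f x :=
      isTest_phase hf contDiff_id t
    rw [h1 t hf, diagHom_rep h2]
    exact mulOp_mul_deltaOp (isBddMeas_phase measurable_sum_coord t)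
      (b₀ := fun x => Complex.exp (Complex.I * t * (x.1 : ℝ))) (fun _ _ => rfl) hf h2

end Image

/-! ### The formulas for Δ(X̂) and Δ(Ŷ) on 𝒜(Γ × U) -/

section Restriction

lemma IsTestU.eq_zero {F : Q → ℂ} (hF : IsTestU F) {q : Q} (hq : q.2.1 + 1 = 0) : F q = 0 :=
  image_eq_zero_of_notMem_tsupport (f := F) fun h => by
    have h1 := hF.2 h
    exact h1 hq

lemma eqOnU_of_mem_graph {A B : H₂ →ₗ.[ℂ] H₂}
    (h : ∀ F, IsTestU F → ∀ Ψ : H₂, (Ψ =ᵐ[mu.prod mu] F ∨ ∃ Φ : H₂, Ψ = rep₂ F Φ) →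
      ∃ η, (Ψ, η) ∈ A.graph ∧ (Ψ, η) ∈ B.graph) : EqOnU A B := by
  intro F hF Ψ hΨ
  obtain ⟨η, hA, hB⟩ := h F hF Ψ hΨ
  obtain ⟨hA, hA'⟩ := mem_graph_iff_exists.1 hA
  obtain ⟨hB, hB'⟩ := mem_graph_iff_exists.1 hB
  exact ⟨hA, hB, hA'.trans hB'.symm⟩

lemma exists_coord_mul {b : Q → ℝ} (hb : ContDiff ℝ ∞ b)
    (hbz : ∀ q q' : Q, q.1.1 = q'.1.1 → q.2.1 = q'.2.1 → b q = b q') {F : Q → ℂ} (hF : IsTest₂ F)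
    {Ψ : H₂} (h : Ψ =ᵐ[mu.prod mu] F ∨ ∃ Φ : H₂, Ψ = rep₂ F Φ) :
    ∃ η, (Ψ, η) ∈ (mulMax (mu.prod mu) b).graph := by
  have hF' : IsTest₂ fun q => (b q : ℂ) * F q := hF.mul (Complex.ofRealCLM.contDiff.comp hb)
  rcases h with h | ⟨Φ, rfl⟩
  · refine ⟨hF'.memLp.toLp, mem_graph_mulMax.2 ?_⟩
    filter_upwards [hF'.memLp.coeFn_toLp, h] with q h1 h2
    rw [h1, h2]
  · refine ⟨rep₂ (fun q => (b q : ℂ) * F q) Φ, mem_graph_mulMax.2 ?_⟩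
    filter_upwards [rep₂_ae hF (EventuallyEq.refl _ Φ), rep₂_ae hF' (EventuallyEq.refl _ Φ)]
      with q h1 h2
    rw [h1, h2, conv₂_eq_kerFun, conv₂_eq_kerFun, kerFun, kerFun, ← integral_const_mul]
    congr 1
    funext h
    rw [hbz ((q.1.1, h.1), (q.2.1, h.2)) q rfl rfl, mul_assoc]

/-- The multiplier expands as (1 + z₂) z₁ + z₂ = z₁ z₂ + z₁ + z₂. The sum of operators has the
intersection of three domains, so each product with F must be seen to be a test function separately.
-/
lemma eqOnU_Yhat : EqOnU (image (comult twist delta₀Hom) Yhat)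
    (tensor Yhat Yhat + tensor Yhat (ofBdd 1) + tensor (ofBdd 1) Yhat) := by
  rw [image_comult_Yhat, tensor_Yhat_Yhat, tensor_Yhat_one, tensor_one_Yhat]
  refine eqOnU_of_mem_graph fun F hF Ψ hΨ => ?_
  obtain ⟨η₁, h₁⟩ := exists_coord_mul (b := fun q => q.1.1 * q.2.1) (by fun_prop)
    (fun q q' h h' => by rw [h, h']) hF.1 hΨ
  obtain ⟨η₂, h₂⟩ := exists_coord_mul (b := fun q => q.1.1) (by fun_prop)
    (fun q q' h _ => h) hF.1 hΨ
  obtain ⟨η₃, h₃⟩ := exists_coord_mul (b := fun q => q.2.1) (by fun_prop)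
    (fun q q' _ h => h) hF.1 hΨ
  refine ⟨η₁ + η₂ + η₃, mem_graph_mulMax.2 ?_, mem_graph_add.2 ⟨_, _, mem_graph_add.2
    ⟨_, _, h₁, h₂, rfl⟩, h₃, rfl⟩⟩
  filter_upwards [mem_graph_mulMax.1 h₁, mem_graph_mulMax.1 h₂, mem_graph_mulMax.1 h₃,
    Lp.coeFn_add η₁ η₂, Lp.coeFn_add (η₁ + η₂) η₃] with q h1 h2 h3 h4 h5
  rw [h5, Pi.add_apply, h4, Pi.add_apply, h1, h2, h3]
  push_cast
  ring

/-- The function `F((1 + z₂)⁻¹ x₁, x₂)`. -/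
def untwist (F : Q → ℂ) (q : Q) : ℂ := F ((1 + q.2.1)⁻¹ • q.1, q.2)

/-- The conjugated flow scales x₁ by exp(-t) (1 + z₂) / (1 + exp(-t) z₂) and x₂ by exp(-t). The
derivative of the first factor at t = 0 is -(1 + z₂)⁻¹. -/
lemma scaleDeriv_untwist {F : Q → ℂ} (hF : IsTestU F) {q : Q} (hq : q.2.1 + 1 ≠ 0) :
    scaleDeriv (fun _ => 1) 1 (untwist F) ((1 + q.2.1) • q.1, q.2) =
      scaleDeriv (fun z => (z + 1)⁻¹) 0 F q + scaleDeriv (fun _ => 0) 1 F q := by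
  have hq' : 1 + q.2.1 ≠ 0 := by rwa [add_comm]
  set p : Q := ((1 + q.2.1) • q.1, q.2) with hp
  have h1 : HasFDerivAt (fun x : Q => 1 + x.2.1)
      ((ContinuousLinearMap.fst ℝ ℝ ℝ).comp (ContinuousLinearMap.snd ℝ P P)) p :=
    ((ContinuousLinearMap.fst ℝ ℝ ℝ).comp (ContinuousLinearMap.snd ℝ P P)).hasFDerivAt.const_add 1
  have h2 : HasFDerivAt (fun x : Q => (1 + x.2.1)⁻¹) _ p :=
    (hasDerivAt_inv hq').comp_hasFDerivAt p h1
  have h3 : HasFDerivAt (fun x : Q => ((1 + x.2.1)⁻¹ • x.1, x.2)) _ p :=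
    (h2.smul (hasFDerivAt_fst (p := p))).prodMk hasFDerivAt_snd
  have hpq : ((1 + p.2.1)⁻¹ • p.1, p.2) = q := by
    rw [hp]
    simp only [smul_smul, inv_mul_cancel₀ hq', one_smul]
  have h4 : HasFDerivAt F (fderiv ℝ F q) ((1 + p.2.1)⁻¹ • p.1, p.2) := by
    rw [hpq]
    exact (hF.1.1.differentiable (by norm_num) q).hasFDerivAt
  have h5 : HasFDerivAt (untwist F) _ p := h4.comp p h3
  rw [scaleDeriv, h5.fderiv, scaleDeriv, scaleDeriv, ← map_add, ContinuousLinearMap.comp_apply]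
  congr 1
  have h6 : (1 + q.2.1)⁻¹ * (1 + q.2.1) = 1 := inv_mul_cancel₀ hq'
  ext
  all_goals
    simp [hp]
    try field_simp
    try ring

lemma isTestU_untwist {F : Q → ℂ} (hF : IsTestU F) : IsTestU (untwist F) := isTestU_twist_inv hF

lemma isScaleFlow_inv_add : IsScaleFlow (fun z => (z + 1)⁻¹) 0
    {q | (q.1.2 ≠ 0 ∧ q.2.2 ≠ 0) ∧ q.2.1 + 1 ≠ 0} :=
  isScaleFlow_of_contDiffOn measurable_inv_add contDiffOn_inv_add

lemma mem_graph_conj {E : Type*} [NormedAddCommGroup E] [InnerProductSpace ℂ E] [CompleteSpace E]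
    {W : ℝ → E →L[ℂ] E} {v : E →L[ℂ] E} (hv : v ∈ unitary (E →L[ℂ] E)) {ψ η : E}
    (h : (ψ, η) ∈ (generator W).graph) :
    (v ψ, v η) ∈ (generator fun t => v * W t * star v).graph := by
  refine mem_graph_of_intertwine (fun t => ?_) h
  have h1 : star v * v = 1 := hv.1
  rw [mul_apply_eq_comp, mul_apply_eq_comp, ← mul_apply_eq_comp (star v), h1, one_apply_eq_self]

/-- The untwisted function again lies in 𝒜(Γ × U), hence in the domain of the generator of the
diagonal dilations. Twisting back and applying the chain rule gives the two terms, once for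
functions as vectors and once for vectors in the range of `rep₂ F`. -/
lemma eqOnU_Xhat : EqOnU (image (comult twist delta₀Hom) Xhat)
    (tensor Xhat Yinv + tensor (ofBdd 1) Xhat) := by
  rw [image_comult_Xhat, tensor_Xhat_Yinv, tensor_one_Xhat]
  refine eqOnU_of_mem_graph fun F hF Ψ hΨ => ?_
  have hF₁ := isTestU_untwist hF
  have hG := (isScaleFlow_const 1 1).isTestU_scaleDeriv hF₁
  set G := scaleDeriv (fun _ => 1) 1 (untwist F)
  have hA := isScaleFlow_inv_add.isTestU_scaleDeriv hF
  have hB := (isScaleFlow_const 0 1).isTestU_scaleDeriv hF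
  have hGt := isTestU_twist hG
  have heq : ∀ q : Q, G ((1 + q.2.1) • q.1, q.2) =
      scaleDeriv (fun z => (z + 1)⁻¹) 0 F q + scaleDeriv (fun _ => 0) 1 F q := fun q => by
    -- At z₂ = -1 the chain rule is not available, but both sides vanish because of their supports.
    by_cases hq : q.2.1 + 1 = 0
    · rw [hA.eq_zero hq, hB.eq_zero hq, add_zero]
      exact hGt.eq_zero hq
    · exact scaleDeriv_untwist hF hq
  have hst : twist (star twist Ψ) = Ψ := by
    rw [← mul_apply_eq_comp, twist_mul_star_twist, one_apply_eq_self]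
  rcases hΨ with hΨ | ⟨Φ, rfl⟩
  · have h1 : star twist Ψ =ᵐ[mu.prod mu] untwist F := by
      rw [star_twist]
      refine (scaleOp_ae _ _ hΨ).trans (Eventually.of_forall fun q => ?_)
      simp only [one_smul, untwist]
    have h2 := mem_graph_conj twist_mem_unitary ((isScaleFlow_const 1 1).mem_graph hF₁.1 hF₁.1.2.2 h1
      hG.1.memLp.coeFn_toLp)
    rw [hst] at h2
    refine ⟨_, h2, mem_graph_add.2 ⟨_, _, isScaleFlow_inv_add.mem_graph hF.1 hF.tsupport_subset hΨ
      hA.1.memLp.coeFn_toLp, (isScaleFlow_const 0 1).mem_graph hF.1 hF.1.2.2 hΨ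
      hB.1.memLp.coeFn_toLp, ?_⟩⟩
    rw [← smul_add, map_smul]
    congr 1
    refine Lp.ext ?_
    filter_upwards [Lp.coeFn_add hA.1.memLp.toLp hB.1.memLp.toLp, hA.1.memLp.coeFn_toLp,
      hB.1.memLp.coeFn_toLp, scaleOp_ae isScale_add one_ne_zero hG.1.memLp.coeFn_toLp]
      with q h3 h4 h5 h6
    rw [h3, Pi.add_apply, h4, h5, ← heq]
    refine Eq.trans h6 ?_
    simp only [one_smul]
  · have h1 : star twist (rep₂ F Φ) = rep₂ (untwist F) Φ := by
      rw [← mul_apply_eq_comp, star_twist_mul_rep₂ hF]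
      rfl
    have h2 := mem_graph_conj twist_mem_unitary
      ((isScaleFlow_const 1 1).mem_graph_rep₂ hF₁.1 hF₁.1.2.2 Φ)
    rw [← h1, hst] at h2
    refine ⟨_, h2, mem_graph_add.2 ⟨_, _, isScaleFlow_inv_add.mem_graph_rep₂ hF.1
      hF.tsupport_subset Φ, (isScaleFlow_const 0 1).mem_graph_rep₂ hF.1 hF.1.2.2 Φ, ?_⟩⟩
    rw [← smul_add, map_smul]
    congr 1
    have h3 := rep₂_sub hGt.1 hA.1
    rw [show (fun q : Q => G ((1 + q.2.1) • q.1, q.2) - scaleDeriv (fun z => (z + 1)⁻¹) 0 F q) =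
      scaleDeriv (fun _ => 0) 1 F from funext fun q => by rw [heq, add_sub_cancel_left]] at h3
    have h4 : twist * rep₂ G = rep₂ _ := twist_mul_rep₂ hG
    rw [← mul_apply_eq_comp, h4, h3, sub_apply, add_sub_cancel]

end Restriction

end AxB

end

open AxB in
theorem lemma5p6 :
    -- the twist is a bicharacter applied to the generators
    (IsBicharacter chi ∧
      ∃ E : PVM H, E.IsSpectralMeasure Yhat ∧ ∀ That : H₂ →L[ℂ] H₂, IsTwist That ↔ That = V E) ∧
    -- the action of the comultiplication on the generators
    (∃! Δ₀ : Cr →⋆ₙₐ[ℂ] (H₂ →L[ℂ] H₂), IsComult₀ Δ₀) ∧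
    ∀ (That : H₂ →L[ℂ] H₂) (Δ₀ : Cr →⋆ₙₐ[ℂ] (H₂ →L[ℂ] H₂)), IsTwist That → IsComult₀ Δ₀ →
      EqOnU (image (comult That Δ₀) Xhat) (tensor Xhat Yinv + tensor (ofBdd 1) Xhat) ∧
      EqOnU (image (comult That Δ₀) Yhat)
        (tensor Yhat Yhat + tensor Yhat (ofBdd 1) + tensor (ofBdd 1) Yhat) := by
  refine ⟨⟨isBicharacter_chi, mulPVM mu measurable_fst, isSpectralMeasure_Yhat, fun That => ?_⟩,
    ⟨delta₀Hom, isComult₀_delta₀Hom, fun Δ₀ h => h.eq isComult₀_delta₀Hom⟩, fun That Δ₀ hT hΔ => ?_⟩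
  · rw [V_mulPVM, isTwist_iff]
  · rw [isTwist_iff.1 hT, hΔ.eq isComult₀_delta₀Hom]
    exact ⟨eqOnU_Xhat, eqOnU_Yhat⟩
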